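/- **Theorem 3.7.** Let $X$ be a compact complex manifold of dimension $m$, $E\to X$ a holomorphic vector bundle of rank $r\ge 1$, $d\ge 1$ an integer, $\nu_0$ a fixed Kähler form on $X$ and $h_0$ a fixed (smooth) hermitian metric on $E$. *Notation.* A hermitian metric $h$ on $E$ induces the metric $\langle v_1\cdots v_d,w_1\cdots w_d\rangle_{\mathrm{Sym}^d h}=\frac1{d!}\sum_{\sigma\in S_d}\prod_i\langle v_i,w_{\sigma(i)}\rangle_h$ on $\mathrm{Sym}^dE$. An element $s\in \mathrm{Sym}^dE_x$ defines the section $\hat s$ of $\mathcal O_{\mathbb PE^*}(d)$ over $\mathbb PE_x^*$ whose value on $v^{\otimes d}$, $v\in E_x^*$, is $v^{\otimes d}(s)$, and a hermitian metric $H$ on $\mathrm{Sym}^dE$ defines the metric $\hat H$ on $\mathcal O_{\mathbb PE^*}(d)$, $$\langle\hat s,\hat t\rangle_{\hat H}([v])=\frac{v^{\otimes d}(s)\,\overline{v^{\otimes d}(t)}}{|v^{\otimes d}|_H^2},$$ where $|\cdot|_H$ in the denominator is the dual norm. For a metric $g$ on $\mathcal O_{\mathbb PE^*}(d)$ put $\omega_g=i\bar\partial\partial\log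 g$, and let $\pi:\mathbb PE^*\to X$ be the projection. Given a Kähler form $\omega$ on $X$, a hermitian metric $h$ on $E$, a smooth endomorphism $\Phi$ of $\mathrm{Sym}^dE$ that is hermitian with respect to $\mathrm{Sym}^dh$, and a positive integer $k$ that is so large that $I+k^{-1}\Phi$ is positive, let $g=\widehat{\mathrm{Sym}^dh}$, $g_k(\Phi)$ the metric $\hat H$ for $H=\mathrm{Sym}^dh\,(I+k^{-1}\Phi)$, $$d\mu_g=\frac{\omega_g^{r-1}}{(r-1)!}\wedge\frac{\pi^*\omega^m}{m!},\qquad d\mu_{g,k,\Phi}=k^{-m}\frac{(\omega_{g_k(\Phi)}+k\,\pi^*\omega)^{m+r-1}}{(m+r-1)!},$$ and let $h(k,\Phi)$ be the form on $\mathrm{Sym}^dE$ given by $$\langle s,t\rangle_{h(k,\Phi)}=C_{r,d}^{-1}\int_{\mathbb PE_x^*}\langle\hat s,\hat t\rangle_{g_k(\Phi)}\,\frac{d\mu_{g,k,\Phi}}{d\mu_g}\,\frac{\omega_g^{r-1}}{(r-1)!}\qquad(s,t\in\mathrm{Sym}^dE_x),$$ with $C_{r,d}=\int_{\mathbb C^{r-1}}(1+\sum_j|\xi_j|^2)^{-(r+d)}\prod_j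 i\,d\xi_j\wedge d\bar\xi_j$. For a tensor $T$ with values in a bundle built from $TX$, $E$ and $\mathrm{Sym}^dE$, $\|T\|_{C^p}=\max_{j\le p}\sup_X|\nabla^jT|$, where $\nabla$ and the pointwise (operator) norms are those of the background metrics $\nu_0$, $h_0$, $\mathrm{Sym}^dh_0$ (Levi-Civita connection of $\nu_0$ and Chern connections of $h_0$, $\mathrm{Sym}^dh_0$). *Statement.* For all positive numbers $l,l'$ and every positive integer $p$ there are a positive number $C$ and an integer $k_0$, depending only on $X,E,d,\nu_0,h_0,l,l',p$, such that for all $\omega$, $h$, $\Phi$ as above with $$\|\omega\|_{C^p}\le l,\quad \|h\|_{C^{p+2}}\le l,\quad \|\Phi\|_{C^{p+2}}\le l,$$ $$h\ge l'h_0\ \text{ on } X\qquad\text{and}\qquad \frac{\omega^m}{\nu_0^m}\ge l'\ \text{ on } X,$$ and for all $k\ge k_0$, the integral defining $h(k,\Phi)$ converges absolutely, $h(k,\Phi)$ is smooth, and $\|h(k,\Phi)\|_{C^p}\le C$. -/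

import Mathlib

open scoped Manifold ContDiff ENNReal TensorProduct ComplexConjugate
open MeasureTheory Bundle

noncomputable section

namespace PushMetric

/-! ### Symmetric powers of a complex vector space -/

section Sym

variable {V W : Type*} [AddCommGroup V] [Module ℂ V] [AddCommGroup W] [Module ℂ W] {d : ℕ}

/-- The linear map on `Sym^d V` induced by a symmetric multilinear map. -/
def symLift (f : MultilinearMap ℂ (fun _ : Fin d => V) W)
    (hf : ∀ (σ : Equiv.Perm (Fin d)) (v : Fin d → V), f (fun i => v (σ i)) = f v) :
    Sym[ℂ]^d V →ₗ[ℂ] W where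
  __ := AddCon.lift (addConGen (SymmetricPower.Rel ℂ (Fin d) V))
    (PiTensorProduct.lift f).toAddMonoidHom (AddCon.addConGen_le.2 (by
      rintro _ _ ⟨σ, v⟩
      simp [hf σ v]))
  map_smul' c s := AddCon.induction_on s fun t => (PiTensorProduct.lift f).map_smul c t

theorem symLift_tprod (f : MultilinearMap ℂ (fun _ : Fin d => V) W)
    (hf : ∀ (σ : Equiv.Perm (Fin d)) (v : Fin d → V), f (fun i => v (σ i)) = f v)
    (v : Fin d → V) : symLift f hf (SymmetricPower.tprod ℂ v) = f v :=
  PiTensorProduct.lift.tprod (φ := f) v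

/-- `v₁ ⊗ ⋯ ⊗ v_d ↦ (1 / d!) ∑_σ ∏ᵢ a_{σ i}(vᵢ)`. -/
def dualProd (a : Fin d → Module.Dual ℂ V) : MultilinearMap ℂ (fun _ : Fin d => V) ℂ :=
  ((d.factorial : ℂ)⁻¹) • ∑ σ : Equiv.Perm (Fin d),
    (MultilinearMap.mkPiAlgebra ℂ (Fin d) ℂ).compLinearMap (fun i => a (σ i))

theorem dualProd_apply (a : Fin d → Module.Dual ℂ V) (v : Fin d → V) :
    dualProd a v = (d.factorial : ℂ)⁻¹ * ∑ σ : Equiv.Perm (Fin d), ∏ i, a (σ i) (v i) := by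
  simp [dualProd]

theorem dualProd_perm (a : Fin d → Module.Dual ℂ V) (τ : Equiv.Perm (Fin d)) (v : Fin d → V) :
    dualProd a (fun i => v (τ i)) = dualProd a v := by
  rw [dualProd_apply, dualProd_apply]
  congr 1
  refine Fintype.sum_equiv (Equiv.mulRight τ⁻¹) _ _ fun σ => ?_
  refine Fintype.prod_equiv τ _ _ fun i => ?_
  simp

/-- The complex conjugate of a conjugate-linear functional. -/
def conjFun (f : V →ₛₗ[starRingEnd ℂ] ℂ) : Module.Dual ℂ V where
  toFun v := conj (f v)
  map_add' := by simp
  map_smul' := by simp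

/-- The complex conjugate of a linear functional. -/
def conjDual (f : Module.Dual ℂ V) : V →ₛₗ[starRingEnd ℂ] ℂ where
  toFun v := conj (f v)
  map_add' := by simp
  map_smul' := by simp

theorem conjDual_tprod (h : V →ₗ[ℂ] V →ₛₗ[starRingEnd ℂ] ℂ) (v w : Fin d → V) :
    conjDual (symLift (dualProd fun i => conjFun (h (v i))) (dualProd_perm _))
      (SymmetricPower.tprod ℂ w) = dualProd (fun i => h.flip (w i)) v := by
  change conj (symLift _ _ _) = _
  rw [symLift_tprod, dualProd_apply, dualProd_apply]
  simp only [map_mul, map_inv₀, map_natCast, map_sum, map_prod]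
  congr 1
  refine Fintype.sum_equiv (Equiv.inv _) _ _ fun σ => ?_
  refine Fintype.prod_equiv σ _ _ fun i => ?_
  simp [conjFun]

theorem sym_ext {f g : Sym[ℂ]^d V →ₛₗ[starRingEnd ℂ] ℂ}
    (hfg : ∀ w, f (SymmetricPower.tprod ℂ w) = g (SymmetricPower.tprod ℂ w)) : f = g :=
  LinearMap.ext_on (SymmetricPower.span_tprod_eq_top ℂ (Fin d) V)
    (by rintro _ ⟨w, rfl⟩; exact hfg w)

/-- The form `Sym^d h` on `Sym^d V` induced by a sesquilinear form `h` on `V` (linear in the first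
variable, conjugate-linear in the second); `symForm_tprod` is its defining formula. -/
def symForm (h : V →ₗ[ℂ] V →ₛₗ[starRingEnd ℂ] ℂ) :
    Sym[ℂ]^d V →ₗ[ℂ] Sym[ℂ]^d V →ₛₗ[starRingEnd ℂ] ℂ :=
  symLift
    { toFun := fun v =>
        conjDual (symLift (dualProd fun i => conjFun (h (v i))) (dualProd_perm _))
      map_update_add' := by
        intro _ v i x y
        refine sym_ext fun w => ?_
        rw [LinearMap.add_apply, conjDual_tprod, conjDual_tprod, conjDual_tprod]
        convert (dualProd fun i => h.flip (w i)).map_update_add v i x y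
      map_update_smul' := by
        intro _ v i c x
        refine sym_ext fun w => ?_
        rw [LinearMap.smul_apply, conjDual_tprod, conjDual_tprod]
        convert (dualProd fun i => h.flip (w i)).map_update_smul v i c x }
    (fun σ v => sym_ext fun w => by
      change conjDual _ _ = conjDual _ _
      rw [conjDual_tprod h (fun i => v (σ i)) w, conjDual_tprod h v w, dualProd_perm])

theorem symForm_tprod (h : V →ₗ[ℂ] V →ₛₗ[starRingEnd ℂ] ℂ) (v w : Fin d → V) :
    symForm h (SymmetricPower.tprod ℂ v) (SymmetricPower.tprod ℂ w) =
      (d.factorial : ℂ)⁻¹ * ∑ σ : Equiv.Perm (Fin d), ∏ i, h (v i) (w (σ i)) := by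
  rw [symForm, symLift_tprod]
  change conjDual _ _ = _
  rw [conjDual_tprod, dualProd_apply]
  rfl

/-- The functional `v^{⊗d}` on `Sym^d V`, `w₁ ⋯ w_d ↦ v(w₁) ⋯ v(w_d)`, for `v ∈ V*`. It is the
value at the point `v` over `[v]` of the section of `𝒪(d)` on `ℙ(V*)` defined by an element
of `Sym^d V`. -/
def powDual (d : ℕ) (v : Module.Dual ℂ V) : Module.Dual ℂ (Sym[ℂ]^d V) :=
  symLift ((MultilinearMap.mkPiAlgebra ℂ (Fin d) ℂ).compLinearMap (fun _ => v))
    (fun σ w => by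
      simpa using Fintype.prod_equiv σ (fun i => v (w (σ i))) (fun i => v (w i)) fun _ => rfl)

theorem powDual_tprod (v : Module.Dual ℂ V) (w : Fin d → V) :
    powDual d v (SymmetricPower.tprod ℂ w) = ∏ i, v (w i) := by
  rw [powDual, symLift_tprod]
  simp

/-- The squared norm on the dual space induced by a hermitian inner product `H`. -/
def dualNormSq (H : V → V → ℂ) (f : Module.Dual ℂ V) : ℝ :=
  sSup {c : ℝ | ∃ s : V, (H s s).re ≤ 1 ∧ c = ‖f s‖ ^ 2}

end Sym

/-! ### Complex calculus in coordinates -/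

section Calculus

variable {ι κ : Type*} [Fintype ι] [Fintype κ] [DecidableEq ι] [DecidableEq κ]

/-- `(∂f)(v)`, the complex-linear part of the differential of `f`. -/
def del (f : (κ → ℂ) → ℂ) (y v : κ → ℂ) : ℂ :=
  (1 / 2) * (fderiv ℝ f y v - Complex.I * fderiv ℝ f y (Complex.I • v))

/-- `(∂̄f)(v)`, the conjugate-linear part of the differential of `f`. -/
def delBar (f : (κ → ℂ) → ℂ) (y v : κ → ℂ) : ℂ :=
  (1 / 2) * (fderiv ℝ f y v + Complex.I * fderiv ℝ f y (Complex.I • v))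

/-- The matrix `∂²u / ∂w_a ∂w̄_b`, that is, the coefficients of the `(1,1)`-form
`i∂∂̄u = i ∑ u_{ab̄} dw_a ∧ dw̄_b`. -/
def complexHessian (u : (κ → ℂ) → ℝ) (w : κ → ℂ) : Matrix κ κ ℂ :=
  Matrix.of fun a b =>
    del (fun w' => delBar (fun w'' => (u w'' : ℂ)) w' (Pi.single b 1)) w (Pi.single a 1)

/-- The Chern connection form `θ = ∂H · H⁻¹` of the metric with Gram matrix
`H_{ij} = ⟨e_i, e_j⟩` in a holomorphic frame: `∇_v e_i = ∑ⱼ θ(v)_{ij} e_j`. -/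
def chernForm (H : (κ → ℂ) → Matrix ι ι ℂ) (y v : κ → ℂ) : Matrix ι ι ℂ :=
  (Matrix.of fun i j => del (fun y' => H y' i j) y v) * (H y)⁻¹

/-- The iterated covariant derivative `(∇^j T)(v₀, …, v_{j-1})` of a field of sesquilinear forms
with components `T_{ij} = T(e_i, e_j)`, for the Chern connection of `H` on the bundle and the
Chern (for a Kähler metric: Levi-Civita) connection of `N` on the tangent bundle. The `v`'s are
real tangent vectors, identified with elements of `ℂ^m`; they are extended as constant fields:
`(∇^{j+1}T)(v₀, v₁, …) = v₀((∇^jT)(v₁, …)) - θ(v₀)(∇^jT) - (∇^jT)θ(v₀)^*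
  - ∑ᵢ (∇^jT)(v₁, …, ∇_{v₀}vᵢ, …)`. -/
def iterCov (N : (κ → ℂ) → Matrix κ κ ℂ) (H T : (κ → ℂ) → Matrix ι ι ℂ) :
    (j : ℕ) → (κ → ℂ) → (Fin j → κ → ℂ) → Matrix ι ι ℂ
  | 0, y, _ => T y
  | j + 1, y, v =>
      (Matrix.of fun a b => fderiv ℝ (fun y' => iterCov N H T j y' (Fin.tail v) a b) y (v 0))
        - chernForm H y (v 0) * iterCov N H T j y (Fin.tail v)
        - iterCov N H T j y (Fin.tail v) * (chernForm H y (v 0)).conjTranspose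
        - ∑ i : Fin j, iterCov N H T j y
            (Function.update (Fin.tail v) i
              (Matrix.vecMul (Fin.tail v i) (chernForm N y (v 0))))

/-- The value `∑ a_i M_{ij} b̄_j` of a sesquilinear form with matrix `M`. -/
def pairing (M : Matrix ι ι ℂ) (a b : ι → ℂ) : ℂ := ∑ i, ∑ j, a i * M i j * conj (b j)

end Calculus

/-! ### Bundles over a complex manifold

`X` is a manifold modelled on `ℂ^m`. Every point `x₀` of `X` labels a holomorphic chart
`chartAt _ x₀`, and, for a holomorphic vector bundle, a holomorphic frame near `x₀`. -/

section Geometry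

variable {m : ℕ} {X : Type*} [TopologicalSpace X] [ChartedSpace (Fin m → ℂ) X]

/-- A family of local frames `vec x₀`, one for each `x₀ : X`, over the part of the chart at `x₀`
given (in coordinates) by `dom x₀`. -/
structure Frames (m : ℕ) (X : Type*) (V : X → Type*) (ι : Type*) where
  dom : X → Set (Fin m → ℂ)
  vec : X → ∀ x, ι → V x

section

variable {V : X → Type*} {ι : Type*}

/-- The components `T(e_i, e_j)` of a field of forms, in the chart and the frame labelled by
`x₀`. -/
def comps (fr : Frames m X V ι) (T : ∀ x, V x → V x → ℂ) (x₀ : X) (y : Fin m → ℂ) :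
    Matrix ι ι ℂ :=
  Matrix.of fun i j => T ((chartAt (Fin m → ℂ) x₀).symm y)
    (fr.vec x₀ ((chartAt (Fin m → ℂ) x₀).symm y) i)
    (fr.vec x₀ ((chartAt (Fin m → ℂ) x₀).symm y) j)

/-- Smoothness (in the real sense) of a field of forms. -/
def IsSmoothForm (fr : Frames m X V ι) (T : ∀ x, V x → V x → ℂ) : Prop :=
  ∀ x₀ i j, ContDiffOn ℝ ∞ (fun y => comps fr T x₀ y i j) (fr.dom x₀)

/-- Smoothness (in the real sense) of a field of endomorphisms: `Φ e_i = ∑ⱼ A_{ij} e_j` with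
smooth `A_{ij}`. -/
def IsSmoothEnd [Fintype ι] [∀ x, AddCommGroup (V x)] [∀ x, Module ℂ (V x)]
    (fr : Frames m X V ι) (Φ : ∀ x, Module.End ℂ (V x)) : Prop :=
  ∀ x₀, ∃ A : ι → ι → (Fin m → ℂ) → ℂ,
    (∀ i j, ContDiffOn ℝ ∞ (A i j) (fr.dom x₀)) ∧
    ∀ y ∈ fr.dom x₀, ∀ i, Φ _ (fr.vec x₀ ((chartAt (Fin m → ℂ) x₀).symm y) i) =
      ∑ j, A i j y • fr.vec x₀ ((chartAt (Fin m → ℂ) x₀).symm y) j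

end

section

variable (E : X → Type*) [∀ x, AddCommGroup (E x)] [∀ x, Module ℂ (E x)]
  [∀ x, TopologicalSpace (E x)]

/-- The frames of a rank `r` bundle defined by its trivializations. -/
def bundleFrames (m r : ℕ) [ChartedSpace (Fin m → ℂ) X]
    [TopologicalSpace (TotalSpace (Fin r → ℂ) E)] [FiberBundle (Fin r → ℂ) E]
    [VectorBundle ℂ (Fin r → ℂ) E] : Frames m X E (Fin r) where
  dom x₀ := (chartAt (Fin m → ℂ) x₀).target ∩
    (chartAt (Fin m → ℂ) x₀).symm ⁻¹' (trivializationAt (Fin r → ℂ) E x₀).baseSet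
  vec x₀ x i := (trivializationAt (Fin r → ℂ) E x₀).localFrame (Pi.basisFun ℂ (Fin r)) i x

/-- The indices of the monomials `e_{f 0} ⋯ e_{f (d-1)}`, `f 0 ≤ ⋯ ≤ f (d-1)`, of degree `d` in
`r` variables. -/
abbrev Monomials (d r : ℕ) : Type := {f : Fin d → Fin r // Monotone f}

/-- The induced frames of monomials of the bundle `Sym^d E`. -/
def symFrames (m r d : ℕ) [ChartedSpace (Fin m → ℂ) X]
    [TopologicalSpace (TotalSpace (Fin r → ℂ) E)] [FiberBundle (Fin r → ℂ) E]
    [VectorBundle ℂ (Fin r → ℂ) E] :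
    Frames m X (fun x => Sym[ℂ]^d (E x)) (Monomials d r) where
  dom := (bundleFrames E m r).dom
  vec x₀ x f := SymmetricPower.tprod ℂ fun i => (bundleFrames E m r).vec x₀ x (f.1 i)

/-- A smooth hermitian metric on a rank `r` bundle, linear in the first variable. -/
structure HermitianMetric (m r : ℕ) [ChartedSpace (Fin m → ℂ) X]
    [TopologicalSpace (TotalSpace (Fin r → ℂ) E)] [FiberBundle (Fin r → ℂ) E]
    [VectorBundle ℂ (Fin r → ℂ) E] where
  form : ∀ x, E x →ₗ[ℂ] E x →ₛₗ[starRingEnd ℂ] ℂ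
  conj_symm : ∀ x s t, form x s t = conj (form x t s)
  pos : ∀ x s, s ≠ 0 → 0 < (form x s s).re
  smooth : IsSmoothForm (bundleFrames E m r) (fun x s t => form x s t)

end

variable (m X) in
/-- A Kähler form `i ∑ g_{ab̄} dz_a ∧ dz̄_b`, given by the hermitian metric `g_{ab̄}` on the
holomorphic tangent bundle; `closed` says that the form is closed. -/
structure KahlerForm [IsManifold 𝓘(ℂ, Fin m → ℂ) ω X] extends
    HermitianMetric (fun x : X => TangentSpace 𝓘(ℂ, Fin m → ℂ) x) m m where
  closed : ∀ x₀, ∀ y ∈ (bundleFrames (fun x : X => TangentSpace 𝓘(ℂ, Fin m → ℂ) x) m m).dom x₀,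
    ∀ a b c : Fin m,
    del (fun y' => comps (bundleFrames (fun x : X => TangentSpace 𝓘(ℂ, Fin m → ℂ) x) m m)
        (fun x s t => form x s t) x₀ y' a b) y (Pi.single c 1) =
      del (fun y' => comps (bundleFrames (fun x : X => TangentSpace 𝓘(ℂ, Fin m → ℂ) x) m m)
        (fun x s t => form x s t) x₀ y' c b) y (Pi.single a 1)

section

variable [IsManifold 𝓘(ℂ, Fin m → ℂ) ω X]

/-- The matrix `g_{ab̄}` of a Kähler form in the chart labelled by `x₀`. -/
def KahlerForm.matrix (κ : KahlerForm m X) (x₀ : X) (y : Fin m → ℂ) : Matrix (Fin m) (Fin m) ℂ :=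
  comps (bundleFrames (fun x : X => TangentSpace 𝓘(ℂ, Fin m → ℂ) x) m m)
    (fun x s t => κ.form x s t) x₀ y

/-- The function `κ^m / ν^m`, the pointwise size of the top form `κ^m` measured by `ν`. -/
def volRatio (κ ν : KahlerForm m X) (x : X) : ℝ :=
  ‖(κ.matrix x (chartAt (Fin m → ℂ) x x)).det‖ / ‖(ν.matrix x (chartAt (Fin m → ℂ) x x)).det‖

/-- The norm `max_{j ≤ p} sup_x |∇^j T|` of a field of sesquilinear forms, where `∇` and `|·|` are
those of the Kähler form `ν` on `X` and of the metric `H` on the bundle. The pointwise norm of the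
tensor `∇^j T` is its supremum over arguments of length at most `1`. It does not depend on the
chart and on the frame; the supremum runs over all of those labelled by points of `X`. -/
def cpNorm {V : X → Type*} {ι : Type*} [Fintype ι] [DecidableEq ι] (fr : Frames m X V ι)
    (ν : KahlerForm m X) (H : ∀ x, V x → V x → ℂ) (p : ℕ) (T : ∀ x, V x → V x → ℂ) : ℝ≥0∞ :=
  ⨆ (j : ℕ) (_ : j ≤ p) (x₀ : X) (y : Fin m → ℂ) (_ : y ∈ fr.dom x₀)
    (v : Fin j → Fin m → ℂ) (_ : ∀ i, (pairing (ν.matrix x₀ y) (v i) (v i)).re ≤ 1)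
    (a : ι → ℂ) (_ : (pairing (comps fr H x₀ y) a a).re ≤ 1)
    (b : ι → ℂ) (_ : (pairing (comps fr H x₀ y) b b).re ≤ 1),
    ENNReal.ofReal
      ‖pairing (iterCov (ν.matrix x₀) (comps fr H x₀) (comps fr T x₀) j y v) a b‖

end

/-! ### The projective bundle `ℙE^*` and the push-forward

`E` has rank `n + 1`. Near `x₀`, the open dense subset of `ℙE^*` where the first homogeneous
coordinate does not vanish has the holomorphic coordinates `w = (y, ξ) ∈ ℂ^m × ℂ^n`, where
`(y, ξ)` stands for the class of `e₀^* + ∑ ξ_j e_j^*` over the point with coordinates `y`. Its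
complement meets every fibre in a null set. -/

section

variable {n d : ℕ} {E : X → Type*} [∀ x, AddCommGroup (E x)] [∀ x, Module ℂ (E x)]
  [∀ x, TopologicalSpace (E x)] [TopologicalSpace (TotalSpace (Fin (n + 1) → ℂ) E)]
  [FiberBundle (Fin (n + 1) → ℂ) E] [VectorBundle ℂ (Fin (n + 1) → ℂ) E]

variable (n E) in
/-- The element `e₀^* + ∑ ξ_j e_j^*` of `E_x^*`, in the dual of the frame labelled by `x₀`. -/
def affinePoint (x₀ x : X) (ξ : Fin n → ℂ) : Module.Dual ℂ (E x) :=
  ∑ i, (Fin.cons 1 ξ : Fin (n + 1) → ℂ) i •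
    (LinearMap.proj i ∘ₗ (trivializationAt (Fin (n + 1) → ℂ) E x₀).linearMapAt ℂ x)

/-- `ω_g` for `g = Ĥ`, where `H` is a metric on `Sym^d E` and
`⟨ŝ, t̂⟩_Ĥ [v] = v^d(s) \overline{v^d(t)} / |v^d|²_H`: the form `i∂̄∂ log g` is `i∂∂̄ log |v^d|²_H`.
This is its coefficient matrix in the coordinates `w = (y, ξ)`. -/
def fsForm (H : ∀ x, Sym[ℂ]^d (E x) → Sym[ℂ]^d (E x) → ℂ) (x₀ : X) (w : Fin m ⊕ Fin n → ℂ) :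
    Matrix (Fin m ⊕ Fin n) (Fin m ⊕ Fin n) ℂ :=
  complexHessian (fun w' => Real.log (dualNormSq
    (H ((chartAt (Fin m → ℂ) x₀).symm (w' ∘ Sum.inl)))
    (powDual d (affinePoint n E x₀ ((chartAt (Fin m → ℂ) x₀).symm (w' ∘ Sum.inl))
      (w' ∘ Sum.inr))))) w

/-- `Sym^d h`, as a field of forms on `Sym^d E`. -/
def symMetric (d : ℕ) (h : HermitianMetric E m (n + 1)) :
    ∀ x, Sym[ℂ]^d (E x) → Sym[ℂ]^d (E x) → ℂ :=
  fun x s t => symForm (h.form x) s t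

/-- The form `Sym^d h (Φ ·, ·)`. -/
def symMetricEnd (h : HermitianMetric E m (n + 1)) (Φ : ∀ x, Module.End ℂ (Sym[ℂ]^d (E x))) :
    ∀ x, Sym[ℂ]^d (E x) → Sym[ℂ]^d (E x) → ℂ :=
  fun x s t => symMetric d h x (Φ x s) t

/-- `Sym^d h (I + k⁻¹ Φ)`. -/
def twistedMetric (h : HermitianMetric E m (n + 1)) (Φ : ∀ x, Module.End ℂ (Sym[ℂ]^d (E x)))
    (k : ℕ) : ∀ x, Sym[ℂ]^d (E x) → Sym[ℂ]^d (E x) → ℂ :=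
  symMetricEnd h fun x => 1 + (k : ℂ)⁻¹ • Φ x

/-- `C_{r,d} = ∫_{ℂ^{r-1}} dξ ∧ dξ̄ / (1 + ∑ |ξ_j|²)^{r+d}` with `r = n + 1`, where `dξ ∧ dξ̄` is the
product of the forms `i dξ_j ∧ dξ̄_j`, that is, `2^n` times the Lebesgue measure. -/
def fibreConst (n d : ℕ) : ℝ :=
  ∫ ξ : Fin n → ℂ, 2 ^ n / (1 + ∑ j, ‖ξ j‖ ^ 2) ^ (n + 1 + d)

variable [IsManifold 𝓘(ℂ, Fin m → ℂ) ω X]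

/-- The density of the volume form `k^{-m} (ω_{g_k(Φ)} + k π^*κ)^{m+n} / (m+n)!` with respect to
`∏_a i dw_a ∧ dw̄_a`: for a `(1,1)`-form `α = i ∑ α_{ab̄} dw_a ∧ dw̄_b` in dimension `N`, the density
of `α^N / N!` is `det (α_{ab̄})`. -/
def densityK (κ : KahlerForm m X) (h : HermitianMetric E m (n + 1))
    (Φ : ∀ x, Module.End ℂ (Sym[ℂ]^d (E x))) (k : ℕ) (x₀ : X) (w : Fin m ⊕ Fin n → ℂ) : ℂ :=
  ((k : ℂ) ^ m)⁻¹ * (fsForm (twistedMetric h Φ k) x₀ w +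
    (k : ℂ) • Matrix.fromBlocks (κ.matrix x₀ (w ∘ Sum.inl)) 0 0 0).det

/-- The density on the fibres of `ω_g^n / n!`, `g` the metric defined by `Sym^d h`, with respect to
`∏_j i dξ_j ∧ dξ̄_j`. -/
def fibreDensity (d : ℕ) (h : HermitianMetric E m (n + 1)) (x₀ : X) (w : Fin m ⊕ Fin n → ℂ) : ℂ :=
  (fsForm (symMetric d h) x₀ w).toBlocks₂₂.det

/-- The density of the volume form `ω_g^n / n! ∧ π^*κ^m / m!`, `g` the metric defined by `Sym^d h`:
as `π^*κ^m` is a multiple of the top form in the `y`-directions, only the restriction of `ω_g` to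
the fibres contributes. -/
def densityG (d : ℕ) (κ : KahlerForm m X) (h : HermitianMetric E m (n + 1)) (x₀ : X)
    (w : Fin m ⊕ Fin n → ℂ) : ℂ :=
  fibreDensity d h x₀ w * (κ.matrix x₀ (w ∘ Sum.inl)).det

/-- The integrand `⟨ŝ, t̂⟩_{g_k(Φ)} (dμ_{g,k,Φ} / dμ_g) ω_g^n / n!` over the fibre at `x`, in the
coordinates `ξ` and with respect to the Lebesgue measure. -/
def pushIntegrand (κ : KahlerForm m X) (h : HermitianMetric E m (n + 1))
    (Φ : ∀ x, Module.End ℂ (Sym[ℂ]^d (E x))) (k : ℕ) (x₀ x : X) (s t : Sym[ℂ]^d (E x))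
    (ξ : Fin n → ℂ) : ℂ :=
  powDual d (affinePoint n E x₀ x ξ) s * conj (powDual d (affinePoint n E x₀ x ξ) t) /
      dualNormSq (twistedMetric h Φ k x) (powDual d (affinePoint n E x₀ x ξ)) *
    (densityK κ h Φ k x₀ (Sum.elim (chartAt (Fin m → ℂ) x₀ x) ξ) /
      densityG d κ h x₀ (Sum.elim (chartAt (Fin m → ℂ) x₀ x) ξ)) *
    (2 ^ n * fibreDensity d h x₀ (Sum.elim (chartAt (Fin m → ℂ) x₀ x) ξ))

/-- The metric `h(k, Φ)` on `Sym^d E`. The fibre integral does not depend on the chart and on the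
frame; at the point `x` we use those labelled by `x`. -/
def pushMetric (κ : KahlerForm m X) (h : HermitianMetric E m (n + 1))
    (Φ : ∀ x, Module.End ℂ (Sym[ℂ]^d (E x))) (k : ℕ) :
    ∀ x, Sym[ℂ]^d (E x) → Sym[ℂ]^d (E x) → ℂ :=
  fun x s t => (fibreConst n d : ℂ)⁻¹ * ∫ ξ : Fin n → ℂ, pushIntegrand κ h Φ k x x s t ξ

end

end Geometry

end PushMetric

end

open PushMetric

/-! In a chart and a frame, write the points of E_x^* as v in ℂ^{n+1}, and put N(y, v) = |v^d|²_H =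
∑ Q_{fg}(y) v^f conj(v^g), where Q is the transposed inverse Gram matrix of H = Sym^d h (I + Φ/k) on
monomials. The form ω_{g_k(Φ)} is i∂∂̄ log N at v = (1, ξ). Since N is homogeneous of bidegree (d,
d) in v, a Schur complement (`det_cHess_homogeneous`) expresses det(∂∂̄ log N + kK), K the matrix of
the Kähler form, as d⁻² times the value at (1, ξ) of det(N⁻¹∂∂̄N + kK), taken on the cone in all n +
1 fibre coordinates. The fibre density of ω_g is nonzero and cancels. So the integrand is, up to a
constant, the restriction to v = (1, ξ) of a function F, continuous off v = 0, with |c|^{2(n+1)}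
F(cv) = F(v) there. For such F the integral over ξ is a constant multiple of the integral of F
against a cut-off supported in a compact shell around 0 (`integral_affine_eq`). Convergence follows,
and the integration now takes place over a compact set avoiding the singularity.

The function F depends on y only through finitely many numbers: the values at y of Q, ∂Q, ∂̄Q, ∂∂̄Q
and K, and t = 1/k. The factor k^{-m} is absorbed by multiplying the m base rows of the matrix by t,
after which nothing is singular at t = 0 (`det_jetMat`). Hence the components of h(k, Φ) are a
constant times one fixed smooth function `jetIntegral`, defined on the open set `goodJets`, composed
with the jet of the data (`comps_pushMetric`). This gives smoothness at once. The jet contains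
second derivatives of Q, which is why h and Φ must be bounded in C^{p+2} and ω only in C^p.

For uniform bounds the jets must stay in a compact subset of `goodJets`. At t = 0 the twisted metric
is Sym^d h, and the bounds on h and Φ with h ≥ l'h₀ confine the data to a compact set on which it is
positive; by openness positivity persists for 0 ≤ t ≤ ε (`LocalData.exists_compact`). In particular
the positivity of I + Φ/k for large k is a consequence of the hypotheses. The lower bound on
ω^m/ν₀^m keeps det K away from 0. Two applications of the chain rule, with bounds on derivatives
over compact sets, then bound the derivatives of h(k, Φ) up to order p (`exists_local_bound`).

It remains to pass between ordinary and covariant derivatives. On a compact part of a chart, ∇^j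
differs from the j-th derivative by a linear operator of lower order with smooth coefficients
(`iterCov_structure`), so bounds of either kind imply those of the other. As the norms run over all
charts and frames, one needs that ∇^j is a tensor (`iterCov_transform`) and that the fibre integral
does not depend on chart and frame (`integral_pushIntegrand_change`). Compactness of X then makes
the local constants global. -/

noncomputable section

set_option linter.unusedSectionVars false

namespace PushMetric

/-! ### Wirtinger derivatives -/

section Wirtinger

variable {κ κ' : Type*} [Fintype κ] [Fintype κ'] {f g : (κ → ℂ) → ℂ} {y : κ → ℂ}

theorem del_eq_of_hasFDerivAt {f' : (κ → ℂ) →L[ℝ] ℂ} (hf : HasFDerivAt f f' y) (v : κ → ℂ) :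
    del f y v = (1 / 2) * (f' v - Complex.I * f' (Complex.I • v)) := by
  rw [del, hf.fderiv]

theorem delBar_eq_of_hasFDerivAt {f' : (κ → ℂ) →L[ℝ] ℂ} (hf : HasFDerivAt f f' y) (v : κ → ℂ) :
    delBar f y v = (1 / 2) * (f' v + Complex.I * f' (Complex.I • v)) := by
  rw [delBar, hf.fderiv]

theorem del_congr (h : f =ᶠ[nhds y] g) (v : κ → ℂ) : del f y v = del g y v := by
  rw [del, del, h.fderiv_eq]

theorem delBar_congr (h : f =ᶠ[nhds y] g) (v : κ → ℂ) : delBar f y v = delBar g y v := by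
  rw [delBar, delBar, h.fderiv_eq]

theorem del_const (c : ℂ) (v : κ → ℂ) : del (fun _ => c) y v = 0 := by
  simp [del]

theorem del_mul (hf : DifferentiableAt ℝ f y) (hg : DifferentiableAt ℝ g y) (v : κ → ℂ) :
    del (fun z => f z * g z) y v = f y * del g y v + g y * del f y v := by
  rw [del_eq_of_hasFDerivAt (hf.hasFDerivAt.fun_mul hg.hasFDerivAt), del, del]
  simp only [add_apply, smul_apply, smul_eq_mul]
  ring

theorem delBar_mul (hf : DifferentiableAt ℝ f y) (hg : DifferentiableAt ℝ g y) (v : κ → ℂ) :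
    delBar (fun z => f z * g z) y v = f y * delBar g y v + g y * delBar f y v := by
  rw [delBar_eq_of_hasFDerivAt (hf.hasFDerivAt.fun_mul hg.hasFDerivAt), delBar, delBar]
  simp only [add_apply, smul_apply, smul_eq_mul]
  ring

theorem del_sum {ι : Type*} (s : Finset ι) {F : ι → (κ → ℂ) → ℂ}
    (hF : ∀ i ∈ s, DifferentiableAt ℝ (F i) y) (v : κ → ℂ) :
    del (fun z => ∑ i ∈ s, F i z) y v = ∑ i ∈ s, del (F i) y v := by
  rw [del_eq_of_hasFDerivAt (HasFDerivAt.fun_sum fun i hi => (hF i hi).hasFDerivAt)]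
  simp only [del, sum_apply, Finset.mul_sum, ← Finset.sum_sub_distrib]

theorem delBar_sum {ι : Type*} (s : Finset ι) {F : ι → (κ → ℂ) → ℂ}
    (hF : ∀ i ∈ s, DifferentiableAt ℝ (F i) y) (v : κ → ℂ) :
    delBar (fun z => ∑ i ∈ s, F i z) y v = ∑ i ∈ s, delBar (F i) y v := by
  rw [delBar_eq_of_hasFDerivAt (HasFDerivAt.fun_sum fun i hi => (hF i hi).hasFDerivAt)]
  simp only [delBar, sum_apply, Finset.mul_sum, ← Finset.sum_add_distrib]

/-- The differential is only real linear, so c is split as Re c + i Im c; the combination defining ∂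
turns the rotation v ↦ iv into multiplication by i. -/
theorem del_smul (c : ℂ) (v : κ → ℂ) : del f y (c • v) = c * del f y v := by
  have h : c • v = c.re • v + c.im • (Complex.I • v) := by
    ext a; simp only [Pi.smul_apply, Pi.add_apply, smul_eq_mul, Complex.real_smul]
    conv_lhs => rw [← Complex.re_add_im c]
    ring
  have h' : Complex.I • c • v = c.re • (Complex.I • v) - c.im • v := by
    ext a; simp only [Pi.smul_apply, Pi.sub_apply, smul_eq_mul, Complex.real_smul]
    conv_lhs => rw [← Complex.re_add_im c]
    linear_combination (c.im : ℂ) * v a * Complex.I_sq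
  rw [del, del, h', h]
  simp only [map_add, map_sub, map_smul, Complex.real_smul]
  conv_rhs => rw [← Complex.re_add_im c]
  linear_combination (1 / 2 : ℂ) * c.im * fderiv ℝ f y (Complex.I • v) * Complex.I_sq

theorem delBar_smul (c : ℂ) (v : κ → ℂ) : delBar f y (c • v) = conj c * delBar f y v := by
  have h : c • v = c.re • v + c.im • (Complex.I • v) := by
    ext a; simp only [Pi.smul_apply, Pi.add_apply, smul_eq_mul, Complex.real_smul]
    conv_lhs => rw [← Complex.re_add_im c]
    ring
  have h' : Complex.I • c • v = c.re • (Complex.I • v) - c.im • v := by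
    ext a; simp only [Pi.smul_apply, Pi.sub_apply, smul_eq_mul, Complex.real_smul]
    conv_lhs => rw [← Complex.re_add_im c]
    linear_combination (c.im : ℂ) * v a * Complex.I_sq
  have hc : conj c = c.re - c.im * Complex.I := by
    apply Complex.ext <;> simp
  rw [delBar, delBar, h', h, hc]
  simp only [map_add, map_sub, map_smul, Complex.real_smul]
  linear_combination (1 / 2 : ℂ) * c.im * fderiv ℝ f y (Complex.I • v) * Complex.I_sq

theorem del_add_vec (v w : κ → ℂ) : del f y (v + w) = del f y v + del f y w := by
  simp only [del, smul_add, map_add]; ring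

theorem delBar_add_vec (v w : κ → ℂ) : delBar f y (v + w) = delBar f y v + delBar f y w := by
  simp only [delBar, smul_add, map_add]; ring

variable [DecidableEq κ] in
theorem eq_sum_smul_single (v : κ → ℂ) : v = ∑ a, v a • (Pi.single a 1 : κ → ℂ) := by
  ext b; simp [Finset.sum_apply, Pi.single_apply]

variable [DecidableEq κ] in
theorem del_eq_sum (v : κ → ℂ) : del f y v = ∑ a, v a * del f y (Pi.single a 1) := by
  let L : (κ → ℂ) →ₗ[ℂ] ℂ :=
    { toFun := del f y, map_add' := del_add_vec, map_smul' := del_smul }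
  change L v = _
  conv_lhs => rw [eq_sum_smul_single v]
  simp [L]

variable [DecidableEq κ] in
theorem delBar_eq_sum (v : κ → ℂ) :
    delBar f y v = ∑ a, conj (v a) * delBar f y (Pi.single a 1) := by
  let L : (κ → ℂ) →ₛₗ[starRingEnd ℂ] ℂ :=
    { toFun := delBar f y, map_add' := delBar_add_vec, map_smul' := delBar_smul }
  change L v = _
  conv_lhs => rw [eq_sum_smul_single v]
  simp [L]

/-- Wirtinger derivatives of a function composed with a holomorphic map. -/
theorem del_comp {Ψ : (κ' → ℂ) → κ → ℂ} {z : κ' → ℂ} (hf : DifferentiableAt ℝ f (Ψ z))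
    (hΨ : DifferentiableAt ℂ Ψ z) (v : κ' → ℂ) :
    del (fun z => f (Ψ z)) z v = del f (Ψ z) (fderiv ℂ Ψ z v) := by
  rw [del_eq_of_hasFDerivAt (f := fun z => f (Ψ z))
    (hf.hasFDerivAt.comp z (hΨ.hasFDerivAt.restrictScalars ℝ)), del]
  simp

theorem delBar_comp {Ψ : (κ' → ℂ) → κ → ℂ} {z : κ' → ℂ} (hf : DifferentiableAt ℝ f (Ψ z))
    (hΨ : DifferentiableAt ℂ Ψ z) (v : κ' → ℂ) :
    delBar (fun z => f (Ψ z)) z v = delBar f (Ψ z) (fderiv ℂ Ψ z v) := by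
  rw [delBar_eq_of_hasFDerivAt (f := fun z => f (Ψ z))
    (hf.hasFDerivAt.comp z (hΨ.hasFDerivAt.restrictScalars ℝ)), delBar]
  simp

theorem del_of_holo (hf : DifferentiableAt ℂ f y) (v : κ → ℂ) : del f y v = fderiv ℂ f y v := by
  rw [del_eq_of_hasFDerivAt (hf.hasFDerivAt.restrictScalars ℝ)]
  simp only [ContinuousLinearMap.coe_restrictScalars', map_smul, smul_eq_mul]
  linear_combination (-(1 / 2) : ℂ) * fderiv ℂ f y v * Complex.I_sq

theorem delBar_of_holo (hf : DifferentiableAt ℂ f y) (v : κ → ℂ) : delBar f y v = 0 := by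
  rw [delBar_eq_of_hasFDerivAt (hf.hasFDerivAt.restrictScalars ℝ)]
  simp only [ContinuousLinearMap.coe_restrictScalars', map_smul, smul_eq_mul]
  linear_combination ((1 / 2) : ℂ) * fderiv ℂ f y v * Complex.I_sq

theorem hasFDerivAt_conj (hf : DifferentiableAt ℝ f y) :
    HasFDerivAt (fun z => conj (f z)) (Complex.conjCLE.toContinuousLinearMap ∘L fderiv ℝ f y) y :=
  Complex.conjCLE.toContinuousLinearMap.hasFDerivAt.comp y hf.hasFDerivAt

theorem del_conj (hf : DifferentiableAt ℝ f y) (v : κ → ℂ) :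
    del (fun z => conj (f z)) y v = conj (delBar f y v) := by
  rw [del_eq_of_hasFDerivAt (hasFDerivAt_conj hf), delBar]
  simp [sub_eq_add_neg, map_ofNat]

theorem delBar_conj (hf : DifferentiableAt ℝ f y) (v : κ → ℂ) :
    delBar (fun z => conj (f z)) y v = conj (del f y v) := by
  rw [delBar_eq_of_hasFDerivAt (hasFDerivAt_conj hf), del]
  simp [sub_eq_add_neg, map_ofNat]

theorem contDiffAt_del {n : WithTop ℕ∞} (hf : ContDiffAt ℝ (n + 1) f y) (v : κ → ℂ) :
    ContDiffAt ℝ n (fun z => del f z v) y := by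
  have h := hf.fderiv_right (m := n) le_rfl
  unfold del
  fun_prop

theorem contDiffAt_delBar {n : WithTop ℕ∞} (hf : ContDiffAt ℝ (n + 1) f y) (v : κ → ℂ) :
    ContDiffAt ℝ n (fun z => delBar f z v) y := by
  have h := hf.fderiv_right (m := n) le_rfl
  unfold delBar
  fun_prop

end Wirtinger

/-! ### Complex Hessians under composition and under the logarithm -/

section Hessian

variable {κ κ' : Type*} [Fintype κ] [Fintype κ'] [DecidableEq κ] [DecidableEq κ']

/-- The matrix `∂²u / ∂w_a ∂w̄_b` of a complex-valued function. -/
def cHess (u : (κ → ℂ) → ℂ) (w : κ → ℂ) : Matrix κ κ ℂ :=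
  Matrix.of fun a b => del (fun w' => delBar u w' (Pi.single b 1)) w (Pi.single a 1)

theorem complexHessian_eq (u : (κ → ℂ) → ℝ) (w : κ → ℂ) :
    complexHessian u w = cHess (fun z => (u z : ℂ)) w := rfl

theorem cHess_congr {u u' : (κ → ℂ) → ℂ} {w : κ → ℂ} (h : u =ᶠ[nhds w] u') :
    cHess u w = cHess u' w := by
  ext a b
  exact del_congr (h.eventuallyEq_nhds.mono fun z hz => delBar_congr hz _) _

/-- The Jacobian matrix `J_{bc} = ∂_b Ψ_c`. -/
def holoJac (Ψ : (κ' → ℂ) → κ → ℂ) (w : κ' → ℂ) : Matrix κ' κ ℂ :=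
  Matrix.of fun b c => fderiv ℂ Ψ w (Pi.single b 1) c

theorem fderiv_eq_vecMul_holoJac (Ψ : (κ' → ℂ) → κ → ℂ) (w v : κ' → ℂ) :
    fderiv ℂ Ψ w v = Matrix.vecMul v (holoJac Ψ w) := by
  conv_lhs => rw [eq_sum_smul_single v]
  ext c
  simp [Matrix.vecMul, dotProduct, Finset.sum_apply, holoJac]

/-- The complex Hessian of a function composed with a holomorphic map. -/
theorem cHess_comp {u : (κ → ℂ) → ℂ} {Ψ : (κ' → ℂ) → κ → ℂ} {w : κ' → ℂ}
    (hu : ContDiffAt ℝ 2 u (Ψ w)) (hΨ : ContDiffAt ℂ 2 Ψ w) :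
    cHess (fun z => u (Ψ z)) w =
      holoJac Ψ w * cHess u (Ψ w) * (holoJac Ψ w).conjTranspose := by
  have hΨd : ∀ᶠ z in nhds w, DifferentiableAt ℂ Ψ z :=
    (hΨ.eventually (by simp)).mono fun z hz => hz.differentiableAt (by simp)
  have hud : ∀ᶠ z in nhds w, DifferentiableAt ℝ u (Ψ z) :=
    hΨ.continuousAt.eventually
      ((hu.eventually (by simp)).mono fun z hz => hz.differentiableAt (by simp))
  ext a b
  have h1 : (fun z => delBar (fun z => u (Ψ z)) z (Pi.single b 1)) =ᶠ[nhds w] fun z =>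
      ∑ c, conj (holoJac Ψ z b c) * delBar u (Ψ z) (Pi.single c 1) := by
    filter_upwards [hΨd, hud] with z h1 h2
    rw [delBar_comp h2 h1, delBar_eq_sum]
    rfl
  have hJ : ∀ c, DifferentiableAt ℂ (fun z => holoJac Ψ z b c) w := by
    intro c
    have h := (hΨ.fderiv_right (m := 1) (by norm_num)).differentiableAt (by simp)
    have h2 : DifferentiableAt ℂ (fun z => fderiv ℂ Ψ z (Pi.single b 1)) w := by fun_prop
    exact (differentiableAt_pi.1 h2 c)
  have hJr : ∀ c, DifferentiableAt ℝ (fun z => conj (holoJac Ψ z b c)) w := fun c =>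
    (hasFDerivAt_conj ((hJ c).restrictScalars ℝ)).differentiableAt
  have hD : ∀ c, DifferentiableAt ℝ (fun z => delBar u z (Pi.single c 1)) (Ψ w) := fun c =>
    (contDiffAt_delBar (n := 1) (by simpa [one_add_one_eq_two] using hu) _).differentiableAt (by simp)
  have hΨw : DifferentiableAt ℂ Ψ w := hΨd.self_of_nhds
  have hD' : ∀ c, DifferentiableAt ℝ (fun z => delBar u (Ψ z) (Pi.single c 1)) w := fun c =>
    (hD c).comp w (hΨw.restrictScalars ℝ)
  change del _ w _ = _
  rw [del_congr h1, del_sum _ fun c _ => (hJr c).fun_mul (hD' c)]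
  simp only [Matrix.mul_apply, Finset.sum_mul, Matrix.conjTranspose_apply, RCLike.star_def]
  refine Finset.sum_congr rfl fun c _ => ?_
  -- The conjugate of the Jacobian is antiholomorphic, so ∂ annihilates it: no second derivative of
  -- Ψ survives, and the Hessian transforms as a sesquilinear form.
  rw [del_mul (hJr c) (hD' c), del_conj ((hJ c).restrictScalars ℝ), delBar_of_holo (hJ c),
    del_comp (f := fun z => delBar u z (Pi.single c 1)) (hD c) hΨw, del_eq_sum, Finset.mul_sum]
  simp only [map_zero, mul_zero, add_zero]
  refine Finset.sum_congr rfl fun e _ => ?_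
  simp only [holoJac, cHess, Matrix.of_apply]
  ring

/-- The complex Hessian of `log M`. -/
theorem cHess_log {M : (κ → ℂ) → ℝ} {w : κ → ℂ} (hM : ContDiffAt ℝ 2 M w) (hpos : M w ≠ 0)
    (a b : κ) :
    cHess (fun z => (Real.log (M z) : ℂ)) w a b =
      cHess (fun z => (M z : ℂ)) w a b / M w -
        del (fun z => (M z : ℂ)) w (Pi.single a 1) * delBar (fun z => (M z : ℂ)) w (Pi.single b 1) /
          (M w) ^ 2 := by
  have hMc : ContDiffAt ℝ 2 (fun z => (M z : ℂ)) w :=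
    Complex.ofRealCLM.contDiff.contDiffAt.comp w hM
  have h1 : (fun z => delBar (fun z => (Real.log (M z) : ℂ)) z (Pi.single b 1)) =ᶠ[nhds w] fun z =>
      delBar (fun z => (M z : ℂ)) z (Pi.single b 1) * (M z : ℂ)⁻¹ := by
    filter_upwards [hM.eventually (by simp), hM.continuousAt.eventually_ne hpos] with z h1 h2
    have h1d := (h1.differentiableAt (by simp)).hasFDerivAt
    rw [delBar_eq_of_hasFDerivAt (f := fun z => (Real.log (M z) : ℂ))
        (Complex.ofRealCLM.hasFDerivAt.comp z (h1d.log h2)),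
      delBar_eq_of_hasFDerivAt (f := fun z => (M z : ℂ)) (Complex.ofRealCLM.hasFDerivAt.comp z h1d)]
    simp
    ring
  have hd : DifferentiableAt ℝ (fun z => delBar (fun z => (M z : ℂ)) z (Pi.single b 1)) w :=
    (contDiffAt_delBar (n := 1) (by simpa [one_add_one_eq_two] using hMc) _).differentiableAt (by simp)
  have hMd := hMc.differentiableAt (by simp)
  have hw : (M w : ℂ) ≠ 0 := by exact_mod_cast hpos
  have hinv : HasFDerivAt (fun z => (M z : ℂ)⁻¹)
      (-((M w : ℂ) ^ 2)⁻¹ • fderiv ℝ (fun z => (M z : ℂ)) w) w := by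
    have h := (((hasDerivAt_inv hw).hasFDerivAt.restrictScalars ℝ).comp w hMd.hasFDerivAt)
    refine h.congr_fderiv ?_
    ext v
    simp [mul_comm]
  change del _ w _ = _
  rw [del_congr h1, del_mul hd hinv.differentiableAt, del_eq_of_hasFDerivAt hinv]
  simp only [cHess, Matrix.of_apply]
  have hdel : del (fun z => (M z : ℂ)) w (Pi.single a 1) = (1 / 2) *
      (fderiv ℝ (fun z => (M z : ℂ)) w (Pi.single a 1) -
        Complex.I * fderiv ℝ (fun z => (M z : ℂ)) w (Complex.I • Pi.single a 1)) := rfl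
  simp only [smul_apply, smul_eq_mul]
  rw [hdel]
  field_simp
  ring

end Hessian

/-! ### Complex Hessians of sums and of products with holomorphic factors -/

section HessianFormulas

variable {κ κ' : Type*} [Fintype κ] [Fintype κ'] [DecidableEq κ] [DecidableEq κ']

theorem cHess_sum {ι : Type*} (s : Finset ι) {F : ι → (κ → ℂ) → ℂ} {w : κ → ℂ}
    (hF : ∀ i ∈ s, ContDiffAt ℝ 2 (F i) w) :
    cHess (fun z => ∑ i ∈ s, F i z) w = ∑ i ∈ s, cHess (F i) w := by
  ext a b
  have h : (fun z => delBar (fun z => ∑ i ∈ s, F i z) z (Pi.single b 1)) =ᶠ[nhds w]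
      fun z => ∑ i ∈ s, delBar (F i) z (Pi.single b 1) := by
    have : ∀ᶠ z in nhds w, ∀ i ∈ s, DifferentiableAt ℝ (F i) z :=
      (Filter.eventually_all_finset s).2 fun i hi =>
        ((hF i hi).eventually (by simp)).mono fun z hz => hz.differentiableAt (by simp)
    filter_upwards [this] with z hz
    exact delBar_sum s hz _
  change del _ w _ = _
  rw [del_congr h, del_sum _ fun i hi => (contDiffAt_delBar (n := 1)
    (by simpa [one_add_one_eq_two] using hF i hi) _).differentiableAt (by simp), Matrix.sum_apply]
  rfl

/-- The complex Hessian of `A B C̄` for holomorphic `B` and `C`. -/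
theorem cHess_mul_holo_conj {A B C : (κ → ℂ) → ℂ} {w : κ → ℂ} (hA : ContDiffAt ℝ 2 A w)
    (hB : ContDiffAt ℂ 2 B w) (hC : ContDiffAt ℂ 2 C w) (a b : κ) :
    cHess (fun z => A z * B z * conj (C z)) w a b =
      cHess A w a b * B w * conj (C w) +
      del A w (Pi.single a 1) * B w * conj (fderiv ℂ C w (Pi.single b 1)) +
      delBar A w (Pi.single b 1) * fderiv ℂ B w (Pi.single a 1) * conj (C w) +
      A w * fderiv ℂ B w (Pi.single a 1) * conj (fderiv ℂ C w (Pi.single b 1)) := by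
  have hBr : ContDiffAt ℝ 2 B w := hB.restrict_scalars ℝ
  have hCr : ContDiffAt ℝ 2 C w := hC.restrict_scalars ℝ
  have h1 : (fun z => delBar (fun z => A z * B z * conj (C z)) z (Pi.single b 1)) =ᶠ[nhds w]
      fun z => B z * (conj (C z) * delBar A z (Pi.single b 1) +
        A z * conj (fderiv ℂ C z (Pi.single b 1))) := by
    filter_upwards [hA.eventually (by simp), hB.eventually (by simp),
      hC.eventually (by simp)] with z hA hB hC
    have hA := hA.differentiableAt (by simp)
    have hB := hB.differentiableAt (by simp)
    have hC := hC.differentiableAt (by simp)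
    have hBr := hB.restrictScalars ℝ
    have hCr := hC.restrictScalars ℝ
    rw [delBar_mul (hA.fun_mul hBr) (hasFDerivAt_conj hCr).differentiableAt, delBar_mul hA hBr,
      delBar_of_holo hB, delBar_conj hCr, del_of_holo hC]
    ring
  have hAd := hA.differentiableAt (by simp)
  have hBd := hB.differentiableAt (by simp)
  have hCd := hC.differentiableAt (by simp)
  have hBrd := hBd.restrictScalars ℝ
  have hCrd := hCd.restrictScalars ℝ
  have hC' : DifferentiableAt ℂ (fun z => fderiv ℂ C z (Pi.single b 1)) w := by
    have h := (hC.fderiv_right (m := 1) (by norm_num)).differentiableAt (by simp)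
    fun_prop
  have hAb := (contDiffAt_delBar (n := 1)
    (by simpa [one_add_one_eq_two] using hA) (Pi.single b 1)).differentiableAt (by simp)
  have hCc := (hasFDerivAt_conj hCrd).differentiableAt
  have hCc' := (hasFDerivAt_conj (hC'.restrictScalars ℝ)).differentiableAt
  have hsum : ∀ v, del (fun z => conj (C z) * delBar A z (Pi.single b 1) +
      A z * conj (fderiv ℂ C z (Pi.single b 1))) w v =
      del (fun z => conj (C z) * delBar A z (Pi.single b 1)) w v +
      del (fun z => A z * conj (fderiv ℂ C z (Pi.single b 1))) w v := fun v => by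
    rw [del_eq_of_hasFDerivAt ((hCc.fun_mul hAb).hasFDerivAt.fun_add (hAd.fun_mul hCc').hasFDerivAt),
      del, del]
    simp only [add_apply]
    ring
  change del _ w _ = _
  rw [del_congr h1, del_mul hBrd ((hCc.fun_mul hAb).fun_add (hAd.fun_mul hCc')), hsum,
    del_mul hCc hAb, del_mul hAd hCc', del_conj hCrd, delBar_of_holo hCd,
    del_conj (hC'.restrictScalars ℝ), delBar_of_holo hC', del_of_holo hBd]
  simp only [cHess, Matrix.of_apply, map_zero]
  ring

/-- Needed for projections with a kernel: the directions killed by L visibly contribute zero. -/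
theorem cHess_comp_linear {u : (κ → ℂ) → ℂ} (L : (κ' → ℂ) →L[ℂ] (κ → ℂ)) {w : κ' → ℂ}
    (hu : ContDiffAt ℝ 2 u (L w)) (a b : κ') :
    cHess (fun z => u (L z)) w a b =
      del (fun z => delBar u z (L (Pi.single b 1))) (L w) (L (Pi.single a 1)) := by
  have hud : ∀ᶠ z in nhds w, DifferentiableAt ℝ u (L z) :=
    L.continuous.continuousAt.eventually
      ((hu.eventually (by simp)).mono fun z hz => hz.differentiableAt (by simp))
  have h1 : (fun z => delBar (fun z => u (L z)) z (Pi.single b 1)) =ᶠ[nhds w] fun z =>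
      delBar u (L z) (L (Pi.single b 1)) := by
    filter_upwards [hud] with z hz
    rw [delBar_comp hz L.differentiableAt, L.fderiv]
  change del _ w _ = _
  rw [del_congr h1, del_comp (f := fun z => delBar u z (L (Pi.single b 1))) _ L.differentiableAt,
    L.fderiv]
  exact (contDiffAt_delBar (n := 1) (by simpa [one_add_one_eq_two] using hu) _).differentiableAt
    (by simp)

theorem holoJac_apply {Ψ : (κ' → ℂ) → κ → ℂ} {w : κ' → ℂ} (hΨ : DifferentiableAt ℂ Ψ w) (b : κ')
    (c : κ) : holoJac Ψ w b c = fderiv ℂ (fun z => Ψ z c) w (Pi.single b 1) := by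
  have h := (hasFDerivAt_pi'.1 hΨ.hasFDerivAt c)
  rw [h.fderiv]
  rfl

end HessianFormulas

/-! ### Homogeneous functions: the cone and the affine chart of projective space -/

section Homogeneous

variable {m n : ℕ}

/-- The affine coordinates of the projective space as a slice of the homogeneous ones. -/
def affineSlice (w : Fin m ⊕ Fin n → ℂ) : Fin m ⊕ Fin (n + 1) → ℂ :=
  Sum.elim (w ∘ Sum.inl) (Fin.cons 1 (w ∘ Sum.inr))

/-- The coordinates `(y, λ, ξ)` of the point `(y, λ(1, ξ))`. -/
def coneMap (w : Fin m ⊕ Fin (n + 1) → ℂ) : Fin m ⊕ Fin (n + 1) → ℂ :=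
  Sum.elim (w ∘ Sum.inl)
    (w (Sum.inr 0) • (Fin.cons 1 (fun i : Fin n => w (Sum.inr i.succ)) : Fin (n + 1) → ℂ))

theorem contDiff_coneMap : ContDiff ℂ 2 (coneMap : (Fin m ⊕ Fin (n + 1) → ℂ) → _) := by
  refine contDiff_pi.2 fun c => ?_
  rcases c with c | c
  · simp only [coneMap, Sum.elim_inl, Function.comp]; fun_prop
  · refine Fin.cases ?_ (fun i => ?_) c
    · simp only [coneMap, Sum.elim_inr, Pi.smul_apply, Fin.cons_zero, smul_eq_mul]; fun_prop
    · simp only [coneMap, Sum.elim_inr, Pi.smul_apply, Fin.cons_succ, smul_eq_mul]; fun_prop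

theorem fderiv_proj {κ : Type*} [Fintype κ] (c : κ) (w v : κ → ℂ) :
    fderiv ℂ (fun z : κ → ℂ => z c) w v = v c := by
  rw [(hasFDerivAt_apply c w).fderiv]; rfl

/-- In the fibre directions the Jacobian of (λ, ξ) ↦ (λ, λξ) is triangular with diagonal (1, λ, …,
λ). The base is untouched, so conjugating by the Jacobian leaves a matrix supported in the base
block unchanged. -/
theorem holoJac_coneMap (w : Fin m ⊕ Fin (n + 1) → ℂ) :
    ∃ T : Matrix (Fin (n + 1)) (Fin (n + 1)) ℂ,
      holoJac coneMap w = Matrix.fromBlocks 1 0 0 T ∧ T.det = w (Sum.inr 0) ^ n := by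
  have hd : DifferentiableAt ℂ coneMap w := contDiff_coneMap.contDiffAt.differentiableAt (by simp)
  have e1 : ∀ c, (fun z : Fin m ⊕ Fin (n + 1) → ℂ => coneMap z (Sum.inl c)) =
    fun z => z (Sum.inl c) := fun c => rfl
  have e2 : (fun z : Fin m ⊕ Fin (n + 1) → ℂ => coneMap z (Sum.inr 0)) =
    fun z => z (Sum.inr 0) := by ext z; simp [coneMap]
  have e3 : ∀ i : Fin n, (fun z : Fin m ⊕ Fin (n + 1) → ℂ => coneMap z (Sum.inr i.succ)) =
    fun z => z (Sum.inr 0) * z (Sum.inr i.succ) := fun i => by ext z; simp [coneMap]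
  have hJ3 : ∀ b (i : Fin n), holoJac coneMap w b (Sum.inr i.succ) =
      w (Sum.inr 0) * (Pi.single b 1 : Fin m ⊕ Fin (n + 1) → ℂ) (Sum.inr i.succ) +
      w (Sum.inr i.succ) * (Pi.single b 1 : Fin m ⊕ Fin (n + 1) → ℂ) (Sum.inr 0) := by
    intro b i
    rw [holoJac_apply hd, e3, ((hasFDerivAt_apply _ w).fun_mul (hasFDerivAt_apply _ w)).fderiv]
    simp
  refine ⟨(holoJac coneMap w).toBlocks₂₂, ?_, ?_⟩
  · conv_lhs => rw [← Matrix.fromBlocks_toBlocks (holoJac coneMap w)]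
    congr 1
    · ext a b
      simp only [Matrix.toBlocks₁₁, Matrix.of_apply]
      rw [holoJac_apply hd, e1, fderiv_proj]
      simp [Matrix.one_apply, Pi.single_apply, eq_comm]
    · ext a b
      simp only [Matrix.toBlocks₁₂, Matrix.of_apply]
      refine Fin.cases ?_ (fun i => ?_) b
      · rw [holoJac_apply hd, e2, fderiv_proj]; simp
      · rw [hJ3]; simp
    · ext a b
      simp only [Matrix.toBlocks₂₁, Matrix.of_apply]
      rw [holoJac_apply hd, e1, fderiv_proj]
      simp
  · rw [Matrix.det_of_isUpperTriangular]
    · rw [Fin.prod_univ_succ]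
      have h0 : (holoJac coneMap w).toBlocks₂₂ 0 0 = 1 := by
        simp only [Matrix.toBlocks₂₂, Matrix.of_apply]
        rw [holoJac_apply hd, e2, fderiv_proj]; simp
      have h1 : ∀ i : Fin n, (holoJac coneMap w).toBlocks₂₂ i.succ i.succ = w (Sum.inr 0) := by
        intro i
        simp only [Matrix.toBlocks₂₂, Matrix.of_apply]
        rw [hJ3]; simp
      simp [h0, h1]
    · intro i j hij
      simp only [id] at hij
      simp only [Matrix.toBlocks₂₂, Matrix.of_apply]
      revert hij
      refine Fin.cases ?_ (fun j' => ?_) j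
      · intro hij
        rw [holoJac_apply hd, e2, fderiv_proj]
        simp [hij.ne]
      · intro hij
        rw [hJ3]
        have h1 : i ≠ 0 := fun h => by simp [h] at hij
        simp [hij.ne, Ne.symm h1]

/-- Splitting off the first homogeneous coordinate. -/
def coneEquiv (m n : ℕ) : (Fin m ⊕ Fin n) ⊕ Unit ≃ Fin m ⊕ Fin (n + 1) where
  toFun := Sum.elim (Sum.map id Fin.succ) (fun _ => Sum.inr 0)
  invFun := Sum.elim (fun a => Sum.inl (Sum.inl a))
    (Fin.cases (Sum.inr ()) (fun i => Sum.inl (Sum.inr i)))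
  left_inv := by rintro ((a | a) | a) <;> simp
  right_inv := by
    rintro (a | a)
    · simp
    · refine Fin.cases ?_ (fun i => ?_) a <;> simp

/-- Forgetting the first homogeneous coordinate. -/
def coneProj (m n : ℕ) : (Fin m ⊕ Fin (n + 1) → ℂ) →L[ℂ] (Fin m ⊕ Fin n → ℂ) :=
  ContinuousLinearMap.pi fun a => ContinuousLinearMap.proj (Sum.map id Fin.succ a)

theorem coneProj_single (a : Fin m ⊕ Fin n) :
    coneProj m n (Pi.single (Sum.map id Fin.succ a) 1) = Pi.single a 1 := by
  have hinj : Function.Injective (Sum.map id Fin.succ : Fin m ⊕ Fin n → Fin m ⊕ Fin (n + 1)) :=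
    Sum.map_injective.2 ⟨Function.injective_id, Fin.succ_injective _⟩
  ext b
  simp [coneProj, Pi.single_apply, hinj.eq_iff]

theorem coneProj_single_zero : coneProj m n (Pi.single (Sum.inr 0) 1) = 0 := by
  ext b
  rcases b with b | b <;> simp [coneProj]

theorem fderiv_pow_proj {κ : Type*} [Fintype κ] (d : ℕ) (c : κ) (w v : κ → ℂ) :
    fderiv ℂ (fun z : κ → ℂ => z c ^ d) w v = d * w c ^ (d - 1) * v c := by
  have h := (hasDerivAt_pow d (w c)).comp_hasFDerivAt w (hasFDerivAt_apply (𝕜 := ℂ) c w)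
  change fderiv ℂ ((fun x => x ^ d) ∘ fun z : κ → ℂ => z c) w v = _
  rw [h.fderiv]
  simp

/-- For a function `N(y, v)` homogeneous of bidegree `(d, d)` in `v`, the determinant of the Hessian
of `log N` in affine coordinates and that of the Hessian of `N` in homogeneous coordinates. -/
theorem det_cHess_homogeneous {d : ℕ} {N : (Fin m ⊕ Fin (n + 1) → ℂ) → ℝ}
    (hhom : ∀ (y : Fin m → ℂ) (v : Fin (n + 1) → ℂ) (c : ℂ),
      N (Sum.elim y (c • v)) = (‖c‖ ^ 2) ^ d * N (Sum.elim y v))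
    {y : Fin m → ℂ} {ξ : Fin n → ℂ} {c : ℂ} (hc : c ≠ 0)
    (hN : ContDiffAt ℝ 2 N (Sum.elim y (c • Fin.cons 1 ξ)))
    (hN1 : ContDiffAt ℝ 2 N (Sum.elim y (Fin.cons 1 ξ)))
    (hpos : N (Sum.elim y (Fin.cons 1 ξ)) ≠ 0) (hd : d ≠ 0) (K : Matrix (Fin m) (Fin m) ℂ) :
    ((‖c‖ : ℂ) ^ 2) ^ (n + 1) *
      (((N (Sum.elim y (c • Fin.cons 1 ξ)) : ℂ))⁻¹ •
        cHess (fun w => (N w : ℂ)) (Sum.elim y (c • Fin.cons 1 ξ)) +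
          Matrix.fromBlocks K 0 0 0).det =
      (d : ℂ) ^ 2 * (complexHessian (fun w => Real.log (N (affineSlice w))) (Sum.elim y ξ) +
        Matrix.fromBlocks K 0 0 0).det := by
  set q : Fin m ⊕ Fin (n + 1) → ℂ := Sum.elim y (Fin.cons c ξ) with hq
  have hcone : coneMap q = Sum.elim y (c • Fin.cons 1 ξ) := by
    ext a; rcases a with a | a
    · rfl
    · refine Fin.cases ?_ (fun i => ?_) a <;> simp [coneMap, hq]
  have hrq : coneProj m n q = Sum.elim y ξ := by
    ext a; rcases a with a | a <;> simp [coneProj, hq]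
  have haff : affineSlice (coneProj m n q) = Sum.elim y (Fin.cons 1 ξ) := by
    rw [hrq]; rfl
  set M : (Fin m ⊕ Fin n → ℂ) → ℝ := fun w => N (affineSlice w) with hM
  have haffs : ContDiff ℝ 2 (affineSlice : (Fin m ⊕ Fin n → ℂ) → _) := by
    refine contDiff_pi.2 fun a => ?_
    rcases a with a | a
    · simp only [affineSlice, Sum.elim_inl, Function.comp]; fun_prop
    · refine Fin.cases ?_ (fun i => ?_) a
      · simp only [affineSlice, Sum.elim_inr, Fin.cons_zero]; fun_prop
      · simp only [affineSlice, Sum.elim_inr, Fin.cons_succ, Function.comp]; fun_prop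
  have hMs : ContDiffAt ℝ 2 M (coneProj m n q) :=
    ContDiffAt.comp _ (by rw [haff]; exact hN1) haffs.contDiffAt
  have hMc : ContDiffAt ℝ 2 (fun w => (M w : ℂ)) (coneProj m n q) :=
    Complex.ofRealCLM.contDiff.contDiffAt.comp _ hMs
  have hM0 : (M (coneProj m n q) : ℂ) ≠ 0 := by
    simp only [hM, haff]; exact_mod_cast hpos
  -- In the coordinates (y, λ, ξ) of the cone, homogeneity factors N as M(y, ξ) λ^d conj(λ^d) with M
  -- its restriction to λ = 1. Its Hessian therefore follows from the product formula with
  -- holomorphic factors.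
  have hfac : (fun w => (N (coneMap w) : ℂ)) = fun w =>
      (M (coneProj m n w) : ℂ) * w (Sum.inr 0) ^ d * conj (w (Sum.inr 0) ^ d) := by
    ext w
    rw [coneMap, hhom, mul_assoc, Complex.mul_conj, Complex.normSq_eq_norm_sq]
    push_cast
    rw [norm_pow]
    push_cast
    rw [← pow_mul, ← pow_mul, mul_comm d 2, mul_comm]
    rfl
  have hNp : (N (Sum.elim y (c • Fin.cons 1 ξ)) : ℂ) =
      M (coneProj m n q) * c ^ d * conj (c ^ d) := by
    have := congrFun hfac q
    rw [hcone] at this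
    rw [this]
    simp [hq]
  have hNpc : ContDiffAt ℝ 2 (fun w => (N w : ℂ)) (coneMap q) := by
    rw [hcone]; exact Complex.ofRealCLM.contDiff.contDiffAt.comp _ hN
  have hchain := cHess_comp hNpc (contDiff_coneMap.contDiffAt (x := q))
  obtain ⟨T, hT, hTdet⟩ := holoJac_coneMap q
  have hq0 : q (Sum.inr 0) = c := by simp [hq]
  rw [hq0] at hTdet
  have hAc : ContDiffAt ℝ 2 (fun w => (M (coneProj m n w) : ℂ)) q :=
    hMc.comp q ((coneProj m n).contDiff.restrict_scalars ℝ).contDiffAt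
  have hBc : ContDiffAt ℂ 2 (fun w : Fin m ⊕ Fin (n + 1) → ℂ => w (Sum.inr 0) ^ d) q := by fun_prop
  have hent : ∀ a b, cHess (fun w => (N (coneMap w) : ℂ)) q a b = _ := fun a b => by
    rw [hfac]; exact cHess_mul_holo_conj hAc hBc hBc a b
  have hcc : conj c ≠ 0 := by simpa using hc
  have hdel : ∀ v, del (fun w => (M (coneProj m n w) : ℂ)) q v =
      del (fun w => (M w : ℂ)) (coneProj m n q) (coneProj m n v) := fun v => by
    rw [del_comp (hMc.differentiableAt (by simp)) (coneProj m n).differentiableAt,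
      (coneProj m n).fderiv]
  have hdelBar : ∀ v, delBar (fun w => (M (coneProj m n w) : ℂ)) q v =
      delBar (fun w => (M w : ℂ)) (coneProj m n q) (coneProj m n v) := fun v => by
    rw [delBar_comp (hMc.differentiableAt (by simp)) (coneProj m n).differentiableAt,
      (coneProj m n).fderiv]
  have hcd : c ^ d ≠ 0 := pow_ne_zero _ hc
  have hccd : conj c ^ d ≠ 0 := pow_ne_zero _ hcc
  have hc1 : c ^ (d - 1) = c ^ d / c := by
    rw [eq_div_iff hc, ← pow_succ, Nat.sub_add_cancel (Nat.pos_of_ne_zero hd)]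
  have hcc1 : conj c ^ (d - 1) = conj c ^ d / conj c := by
    rw [eq_div_iff hcc, ← pow_succ, Nat.sub_add_cancel (Nat.pos_of_ne_zero hd)]
  set S : Matrix (Fin m ⊕ Fin (n + 1)) (Fin m ⊕ Fin (n + 1)) ℂ :=
    (N (Sum.elim y (c • Fin.cons 1 ξ)) : ℂ)⁻¹ • cHess (fun w => (N (coneMap w) : ℂ)) q +
      Matrix.fromBlocks K 0 0 0 with hS
  -- Changing coordinates from (y, v) to (y, λ, ξ) costs |c^n|², the squared modulus of the Jacobian
  -- determinant.
  have hSdet : S.det = (c * conj c) ^ n * (((N (Sum.elim y (c • Fin.cons 1 ξ)) : ℂ))⁻¹ •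
        cHess (fun w => (N w : ℂ)) (Sum.elim y (c • Fin.cons 1 ξ)) +
          Matrix.fromBlocks K 0 0 0).det := by
    have : S = holoJac coneMap q * (((N (Sum.elim y (c • Fin.cons 1 ξ)) : ℂ))⁻¹ •
        cHess (fun w => (N w : ℂ)) (Sum.elim y (c • Fin.cons 1 ξ)) +
          Matrix.fromBlocks K 0 0 0) * (holoJac coneMap q).conjTranspose := by
      rw [Matrix.mul_add, Matrix.add_mul, hS, hchain, hcone]
      congr 1
      · simp
      · rw [hT, Matrix.fromBlocks_conjTranspose, Matrix.fromBlocks_multiply,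
          Matrix.fromBlocks_multiply]
        simp
    rw [this, Matrix.det_mul, Matrix.det_mul, Matrix.det_conjTranspose, hT,
      Matrix.det_fromBlocks_zero₂₁, hTdet]
    simp only [Matrix.det_one, one_mul, RCLike.star_def, map_pow, mul_pow]
    ring
  -- Block form of S with the λ direction split off. The corner D is d²/|c|², and the mixed blocks
  -- u, v are multiples of ∂M/M and ∂̄M/M.
  set u : Matrix (Fin m ⊕ Fin n) Unit ℂ := Matrix.of fun a _ => (d / conj c) *
    (del (fun w => (M w : ℂ)) (coneProj m n q) (Pi.single a 1) / M (coneProj m n q)) with hu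
  set v : Matrix Unit (Fin m ⊕ Fin n) ℂ := Matrix.of fun _ b => (d / c) *
    (delBar (fun w => (M w : ℂ)) (coneProj m n q) (Pi.single b 1) / M (coneProj m n q)) with hv
  set D : Matrix Unit Unit ℂ := Matrix.of fun _ _ => (d : ℂ) ^ 2 / (c * conj c) with hD
  set H : Matrix (Fin m ⊕ Fin n) (Fin m ⊕ Fin n) ℂ :=
    (M (coneProj m n q) : ℂ)⁻¹ • cHess (fun w => (M w : ℂ)) (coneProj m n q) +
      Matrix.fromBlocks K 0 0 0 with hH
  have hKe : ∀ a b, (Matrix.fromBlocks K 0 0 0 : Matrix (Fin m ⊕ Fin (n + 1)) (Fin m ⊕ Fin (n + 1)) ℂ)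
      (Sum.map id Fin.succ a) (Sum.map id Fin.succ b) =
      (Matrix.fromBlocks K 0 0 0 : Matrix (Fin m ⊕ Fin n) (Fin m ⊕ Fin n) ℂ) a b := by
    rintro (a | a) (b | b) <;> simp
  have hsub : S.submatrix (coneEquiv m n) (coneEquiv m n) = Matrix.fromBlocks H u v D := by
    have hs0 : ∀ a : Fin m ⊕ Fin n,
        (Pi.single (Sum.map id Fin.succ a) 1 : Fin m ⊕ Fin (n + 1) → ℂ) (Sum.inr 0) = 0 := by
      rintro (a | a) <;> simp
    ext a b
    rcases a with a | a <;> rcases b with b | b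
    · simp only [hS, coneEquiv, Equiv.coe_fn_mk, Matrix.submatrix_apply, Sum.elim_inl,
        Matrix.fromBlocks_apply₁₁, Matrix.add_apply, Matrix.smul_apply, smul_eq_mul, hH, hKe]
      rw [hent, fderiv_pow_proj, fderiv_pow_proj, hs0, hs0, cHess_comp_linear _ hMc,
        coneProj_single, coneProj_single, hNp, hq0]
      simp only [mul_zero, map_zero, zero_mul, add_zero, map_pow]
      congr 1
      simp only [cHess, Matrix.of_apply]
      field_simp
    · simp only [hS, coneEquiv, Equiv.coe_fn_mk, Matrix.submatrix_apply, Sum.elim_inl,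
        Sum.elim_inr, Matrix.fromBlocks_apply₁₂, Matrix.add_apply, Matrix.smul_apply, smul_eq_mul]
      rw [hent, fderiv_pow_proj, fderiv_pow_proj, hs0, cHess_comp_linear _ hMc,
        coneProj_single, coneProj_single_zero, hNp, hq0, hdel, hdelBar, coneProj_single,
        coneProj_single_zero]
      have z1 : ∀ z, delBar (fun w => (M w : ℂ)) z 0 = 0 := fun z => by simp [delBar]
      simp only [z1, del_const, Pi.single_eq_same, mul_one, mul_zero, zero_mul, zero_add, add_zero,
        map_mul, map_pow, map_natCast, hcc1, hu, Matrix.of_apply]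
      have z2 : (Matrix.fromBlocks K 0 0 0 : Matrix (Fin m ⊕ Fin (n + 1)) (Fin m ⊕ Fin (n + 1)) ℂ)
        (Sum.map id Fin.succ a) (Sum.inr 0) = 0 := by rcases a with a | a <;> simp
      rw [z2]
      field_simp
      simp
    · simp only [hS, coneEquiv, Equiv.coe_fn_mk, Matrix.submatrix_apply, Sum.elim_inl,
        Sum.elim_inr, Matrix.fromBlocks_apply₂₁, Matrix.add_apply, Matrix.smul_apply, smul_eq_mul]
      rw [hent, fderiv_pow_proj, fderiv_pow_proj, hs0, cHess_comp_linear _ hMc,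
        coneProj_single, coneProj_single_zero, hNp, hq0, hdel, hdelBar, coneProj_single,
        coneProj_single_zero]
      have z1 : ∀ (g : (Fin m ⊕ Fin n → ℂ) → ℂ) z, del g z 0 = 0 := fun g z => by simp [del]
      simp only [z1, Pi.single_eq_same, mul_one, mul_zero, zero_mul, zero_add, add_zero,
        map_pow, map_zero, hc1, hv, Matrix.of_apply]
      have z2 : (Matrix.fromBlocks K 0 0 0 : Matrix (Fin m ⊕ Fin (n + 1)) (Fin m ⊕ Fin (n + 1)) ℂ)
        (Sum.inr 0) (Sum.map id Fin.succ b) = 0 := by rcases b with b | b <;> simp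
      rw [z2]
      field_simp
      simp
    · simp only [hS, coneEquiv, Equiv.coe_fn_mk, Matrix.submatrix_apply,
        Sum.elim_inr, Matrix.fromBlocks_apply₂₂, Matrix.add_apply, Matrix.smul_apply, smul_eq_mul]
      rw [hent, fderiv_pow_proj, cHess_comp_linear _ hMc,
        coneProj_single_zero, hNp, hq0, hdel, hdelBar, coneProj_single_zero]
      have z1 : ∀ (g : (Fin m ⊕ Fin n → ℂ) → ℂ) z, del g z 0 = 0 := fun g z => by simp [del]
      have z2 : ∀ z, delBar (fun w => (M w : ℂ)) z 0 = 0 := fun z => by simp [delBar]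
      simp only [z1, z2, Pi.single_eq_same, mul_one, zero_mul, zero_add, map_mul, map_pow,
        map_natCast, hc1, map_div₀, hD, Matrix.of_apply, Matrix.zero_apply, add_zero]
      field_simp
  have hdc : (d : ℂ) ^ 2 / (c * conj c) ≠ 0 :=
    div_ne_zero (pow_ne_zero _ (by exact_mod_cast hd)) (mul_ne_zero hc hcc)
  let D' : Matrix Unit Unit ℂ := Matrix.of fun _ _ => ((d : ℂ) ^ 2 / (c * conj c))⁻¹
  have hDD : D' * D = 1 := by
    ext i j; simp only [D', hD, Matrix.mul_apply, Finset.univ_unique, Finset.sum_singleton,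
      Matrix.of_apply, inv_mul_cancel₀ hdc, Matrix.one_apply_eq]
  let : Invertible D := ⟨D', hDD, mul_eq_one_comm.1 hDD⟩
  have hDinv : ⅟D = D' := rfl
  -- Eliminating λ subtracts (∂M/M)(∂̄M/M) from M⁻¹∂∂̄M, since the powers of d and c cancel. This is
  -- exactly the term by which the Hessian of log M differs from M⁻¹∂∂̄M.
  have hschur : H - u * ⅟D * v =
      complexHessian (fun w => Real.log (N (affineSlice w))) (Sum.elim y ξ) +
        Matrix.fromBlocks K 0 0 0 := by
    ext a b
    have hlog := cHess_log hMs (by exact_mod_cast hM0) a b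
    rw [← hrq, complexHessian_eq, Matrix.add_apply, hlog, hDinv]
    simp only [D', hH, hu, hv, Matrix.sub_apply, Matrix.add_apply, Matrix.smul_apply, smul_eq_mul,
      Matrix.mul_apply, Finset.univ_unique, Finset.sum_singleton, Matrix.of_apply]
    have hd0 : (d : ℂ) ≠ 0 := by exact_mod_cast hd
    field_simp
    ring
  have hfin : S.det = (d : ℂ) ^ 2 / (c * conj c) *
      (complexHessian (fun w => Real.log (N (affineSlice w))) (Sum.elim y ξ) +
        Matrix.fromBlocks K 0 0 0).det := by
    rw [← Matrix.det_submatrix_equiv_self (coneEquiv m n), hsub, Matrix.det_fromBlocks₂₂, hschur]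
    congr 1
    simp [hD]
  have hnorm : ((‖c‖ : ℂ) ^ 2) = c * conj c := by
    rw [Complex.mul_conj, Complex.normSq_eq_norm_sq]; push_cast; rfl
  -- The exponent n + 1 consists of n from the Jacobian of the cone coordinates and one from the
  -- corner D.
  rw [hnorm, pow_succ', mul_assoc, ← hSdet, hfin]
  field_simp

end Homogeneous

/-! ### Linear differential operators with smooth coefficients -/

section DifferentialOperators

variable {ι κ : Type*} [Fintype ι] [Fintype κ]

/-- A field of matrices with smooth entries on `U`. -/
def SmoothMat (T : (κ → ℂ) → Matrix ι ι ℂ) (U : Set (κ → ℂ)) : Prop :=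
  ∀ a b, ContDiffOn ℝ ∞ (fun y => T y a b) U

/-- Linear differential operators of order less than `N`, with smooth coefficients on `U`, acting on
fields of matrices. -/
inductive DiffOp (U : Set (κ → ℂ)) : ℕ → (((κ → ℂ) → Matrix ι ι ℂ) → (κ → ℂ) → ℂ) → Prop
  | basic {N i : ℕ} (hi : i < N) (v : Fin i → κ → ℂ) (a b : ι) :
      DiffOp U N fun T y => iteratedFDeriv ℝ i (fun z => T z a b) y v
  | zero {N : ℕ} : DiffOp U N fun _ _ => 0
  | add {N : ℕ} {P Q} : DiffOp U N P → DiffOp U N Q → DiffOp U N fun T y => P T y + Q T y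
  | smul {N : ℕ} {P} (c : (κ → ℂ) → ℂ) (hc : ContDiffOn ℝ ∞ c U) :
      DiffOp U N P → DiffOp U N fun T y => c y * P T y
  | congr {N : ℕ} {P Q} : DiffOp U N P →
      (∀ T, SmoothMat T U → ∀ y ∈ U, P T y = Q T y) → DiffOp U N Q

namespace DiffOp

variable {U : Set (κ → ℂ)} {N : ℕ} {P Q : ((κ → ℂ) → Matrix ι ι ℂ) → (κ → ℂ) → ℂ}

theorem mono {N' : ℕ} (h : DiffOp U N P) (hN : N ≤ N') : DiffOp U N' P := by
  induction h with
  | basic hi v a b => exact basic (hi.trans_le hN) v a b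
  | zero => exact zero
  | add _ _ h1 h2 => exact add h1 h2
  | smul c hc _ h1 => exact smul c hc h1
  | congr _ h2 h1 => exact congr h1 h2

theorem sum {α : Type*} (s : Finset α) {F : α → ((κ → ℂ) → Matrix ι ι ℂ) → (κ → ℂ) → ℂ}
    (h : ∀ i ∈ s, DiffOp U N (F i)) : DiffOp U N fun T y => ∑ i ∈ s, F i T y := by
  classical
  induction s using Finset.induction_on with
  | empty => simpa using zero
  | insert a s ha ih =>
    simp only [Finset.sum_insert ha]
    exact add (h a (by simp)) (ih fun i hi => h i (by simp [hi]))

theorem sub (h : DiffOp U N P) (h' : DiffOp U N Q) : DiffOp U N fun T y => P T y - Q T y :=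
  (h.add (h'.smul (fun _ => -1) contDiffOn_const)).congr fun T _ y _ => by ring

theorem contDiffOn (hU : IsOpen U) (h : DiffOp U N P) {T : (κ → ℂ) → Matrix ι ι ℂ}
    (hT : SmoothMat T U) : ContDiffOn ℝ ∞ (P T) U := by
  induction h with
  | @basic i hi v a b =>
    intro y hy
    have h1 : ContDiffAt ℝ ∞ (fun z => T z a b) y := (hT a b).contDiffAt (hU.mem_nhds hy)
    have h2 := h1.iteratedFDeriv_right (m := ∞) (i := i) (by exact_mod_cast le_rfl)
    exact ((ContinuousMultilinearMap.apply ℝ (fun _ => κ → ℂ) ℂ v).contDiff.contDiffAt.comp y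
      h2).contDiffWithinAt
  | zero => exact contDiffOn_const
  | add _ _ h1 h2 => exact h1.add h2
  | smul c hc _ h1 => exact hc.mul h1
  | congr _ h2 h1 => exact h1.congr fun y hy => (h2 T hT y hy).symm

theorem differentiableAt (hU : IsOpen U) (h : DiffOp U N P) {T : (κ → ℂ) → Matrix ι ι ℂ}
    (hT : SmoothMat T U) {y : κ → ℂ} (hy : y ∈ U) : DifferentiableAt ℝ (P T) y :=
  ((h.contDiffOn hU hT).contDiffAt (hU.mem_nhds hy)).differentiableAt (by simp)

theorem iteratedFDeriv_succ_eq_fderiv {f : (κ → ℂ) → ℂ} {y : κ → ℂ} {i : ℕ}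
    (hf : ContDiffAt ℝ ∞ f y) (v : Fin (i + 1) → κ → ℂ) :
    iteratedFDeriv ℝ (i + 1) f y v =
      fderiv ℝ (fun z => iteratedFDeriv ℝ i f z (Fin.tail v)) y (v 0) := by
  rw [iteratedFDeriv_succ_apply_left]
  have h2 : DifferentiableAt ℝ (iteratedFDeriv ℝ i f) y :=
    hf.differentiableAt_iteratedFDeriv (WithTop.coe_lt_coe.2 (ENat.natCast_lt_top i))
  have := ((ContinuousMultilinearMap.apply ℝ (fun _ => κ → ℂ) ℂ (Fin.tail v)).hasFDerivAt.comp y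
    h2.hasFDerivAt).fderiv
  exact (DFunLike.congr_fun this (v 0)).symm

/-- By the product rule the derivative of c · P is c · ∂P plus ∂c · P, and the second term has lower
order. Constant directions suffice: variable arguments are expanded in a basis where they occur. -/
theorem fderiv (hU : IsOpen U) (h : DiffOp U N P) (u : κ → ℂ) :
    DiffOp U (N + 1) fun T y => fderiv ℝ (P T) y u := by
  induction h with
  | @basic i hi v a b =>
    refine congr (basic (Nat.succ_lt_succ hi) (Fin.cons u v : Fin (i + 1) → κ → ℂ) a b) ?_
    intro T hT y hy
    rw [iteratedFDeriv_succ_eq_fderiv ((hT a b).contDiffAt (hU.mem_nhds hy))]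
    simp
  | zero => simpa using zero
  | add hP hQ h1 h2 =>
    refine congr (add h1 h2) fun T hT y hy => ?_
    rw [fderiv_fun_add (hP.differentiableAt hU hT hy) (hQ.differentiableAt hU hT hy)]
    rfl
  | smul c hc hP h1 =>
    have hc' : ContDiffOn ℝ ∞ (fun y => _root_.fderiv ℝ c y u) U :=
      (hc.fderiv_of_isOpen hU (m := ∞) (by simp)).clm_apply contDiffOn_const
    refine congr (add (smul c hc h1) (smul _ hc' (hP.mono (Nat.le_succ _)))) fun T hT y hy => ?_
    rw [fderiv_fun_mul ((hc.contDiffAt (hU.mem_nhds hy)).differentiableAt (by simp))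
      (hP.differentiableAt hU hT hy)]
    simp [mul_comm]
  | congr _ h2 h1 =>
    refine congr h1 fun T hT y hy => ?_
    have : _ =ᶠ[nhds y] _ := Filter.eventuallyEq_of_mem (hU.mem_nhds hy) fun z hz => h2 T hT z hz
    rw [this.fderiv_eq]

/-- The coefficients are bounded on the compact set K. What matters is that the constant depends on
the operator and on K alone, not on the field T. -/
theorem bound (h : DiffOp U N P) {K : Set (κ → ℂ)} (hK : IsCompact K) (hKU : K ⊆ U) :
    ∃ C : ℝ, 0 ≤ C ∧ ∀ T, SmoothMat T U → ∀ y ∈ K, ∀ B : ℝ, 0 ≤ B →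
      (∀ i < N, ∀ a b, ‖iteratedFDeriv ℝ i (fun z => T z a b) y‖ ≤ B) → ‖P T y‖ ≤ C * B := by
  induction h with
  | basic hi v a b =>
    refine ⟨∏ i, ‖v i‖, by positivity, fun T _ y _ B _ hB => ?_⟩
    rw [mul_comm]
    exact (ContinuousMultilinearMap.le_opNorm _ _).trans
      (mul_le_mul_of_nonneg_right (hB _ hi a b) (by positivity))
  | zero => exact ⟨0, le_rfl, by simp⟩
  | add _ _ h1 h2 =>
    obtain ⟨C, hC, h⟩ := h1
    obtain ⟨C', hC', h'⟩ := h2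
    refine ⟨C + C', by positivity, fun T hT y hy B hB hb => ?_⟩
    rw [add_mul]
    exact (norm_add_le _ _).trans (add_le_add (h T hT y hy B hB hb) (h' T hT y hy B hB hb))
  | smul c hc _ h1 =>
    obtain ⟨C, hC, h⟩ := h1
    obtain ⟨D, hD⟩ := hK.exists_bound_of_continuousOn (hc.continuousOn.mono hKU)
    refine ⟨|D| * C, by positivity, fun T hT y hy B hB hb => ?_⟩
    rw [norm_mul, mul_assoc]
    exact mul_le_mul ((hD y hy).trans (le_abs_self D)) (h T hT y hy B hB hb) (norm_nonneg _)
      (abs_nonneg _)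
  | congr _ h2 h1 =>
    obtain ⟨C, hC, h⟩ := h1
    exact ⟨C, hC, fun T hT y hy B hB hb => h2 T hT y (hKU hy) ▸ h T hT y hy B hB hb⟩

end DiffOp

end DifferentialOperators

/-! ### Iterated covariant derivatives compared with iterated derivatives -/

section CovariantDerivatives

variable {ι κ : Type*} [Fintype ι] [Fintype κ] [DecidableEq ι] [DecidableEq κ]

/-- Real multilinearity. -/
structure IsRealMultilinear {j : ℕ} (f : (Fin j → κ → ℂ) → Matrix ι ι ℂ) : Prop where
  map_add : ∀ v i x x',
    f (Function.update v i (x + x')) = f (Function.update v i x) + f (Function.update v i x')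
  map_smul : ∀ v i (c : ℝ) x, f (Function.update v i (c • x)) = (c : ℂ) • f (Function.update v i x)

theorem chernForm_add_vec (H : (κ → ℂ) → Matrix ι ι ℂ) (y v w : κ → ℂ) :
    chernForm H y (v + w) = chernForm H y v + chernForm H y w := by
  rw [chernForm, chernForm, chernForm, ← Matrix.add_mul]
  congr 1; ext i j; simp [del_add_vec]

theorem chernForm_smul_vec (H : (κ → ℂ) → Matrix ι ι ℂ) (c : ℂ) (y v : κ → ℂ) :
    chernForm H y (c • v) = c • chernForm H y v := by
  rw [chernForm, chernForm, ← Matrix.smul_mul]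
  congr 1; ext i j; simp [del_smul]

theorem real_smul_vec (c : ℝ) (v : κ → ℂ) : c • v = (c : ℂ) • v := by
  ext a; simp

theorem IsRealMultilinear.map_expand {j : ℕ} {f : (Fin j → κ → ℂ) → Matrix ι ι ℂ}
    (hf : IsRealMultilinear f) (v : Fin j → κ → ℂ) (i : Fin j) (u : κ → ℂ) :
    f (Function.update v i u) = ∑ e, ((u e).re : ℂ) • f (Function.update v i (Pi.single e 1)) +
      ∑ e, ((u e).im : ℂ) • f (Function.update v i (Complex.I • Pi.single e 1)) := by
  have hu : u = ∑ e, (u e).re • (Pi.single e 1 : κ → ℂ) +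
      ∑ e, (u e).im • (Complex.I • (Pi.single e 1 : κ → ℂ)) := by
    ext a
    simp [Finset.sum_apply, Pi.single_apply]
  let L : (κ → ℂ) →ₗ[ℝ] Matrix ι ι ℂ :=
    { toFun := fun x => f (Function.update v i x)
      map_add' := hf.map_add v i
      map_smul' := fun c x => by
        rw [hf.map_smul]; ext a b; simp }
  change L u = _
  conv_lhs => rw [hu]
  simp only [_root_.map_add, map_sum, _root_.map_smul]
  congr 1

variable {N : (κ → ℂ) → Matrix κ κ ℂ} {H : (κ → ℂ) → Matrix ι ι ℂ} {U : Set (κ → ℂ)}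

theorem iterCov_succ_apply (T : (κ → ℂ) → Matrix ι ι ℂ) (j : ℕ) (y : κ → ℂ)
    (v : Fin (j + 1) → κ → ℂ) (a b : ι) :
    iterCov N H T (j + 1) y v a b =
      fderiv ℝ (fun y' => iterCov N H T j y' (Fin.tail v) a b) y (v 0)
        - ∑ c, chernForm H y (v 0) a c * iterCov N H T j y (Fin.tail v) c b
        - ∑ c, iterCov N H T j y (Fin.tail v) a c * conj (chernForm H y (v 0) b c)
        - ∑ i : Fin j, iterCov N H T j y (Function.update (Fin.tail v) i
            (Matrix.vecMul (Fin.tail v i) (chernForm N y (v 0)))) a b := by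
  simp only [iterCov, Matrix.sub_apply, Matrix.mul_apply, Matrix.of_apply, Matrix.sum_apply,
    Matrix.conjTranspose_apply, RCLike.star_def]

/-- The iterated covariant derivative is multilinear, and agrees with the iterated derivative up to
an operator of lower order. -/
theorem iterCov_structure (hU : IsOpen U)
    (hN : ∀ v, SmoothMat (fun y => chernForm N y v) U)
    (hH : ∀ v, SmoothMat (fun y => chernForm H y v) U) (j : ℕ) :
    (∀ v a b, DiffOp U j fun T y =>
      iterCov N H T j y v a b - iteratedFDeriv ℝ j (fun z => T z a b) y v) ∧
    ∀ T, SmoothMat T U → ∀ y ∈ U, IsRealMultilinear (iterCov N H T j y) := by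
  induction j with
  | zero =>
    refine ⟨fun v a b => ?_, fun T _ y _ => ⟨fun v i => i.elim0, fun v i => i.elim0⟩⟩
    simpa [iterCov] using DiffOp.zero
  | succ j ih =>
    obtain ⟨ih1, ih2⟩ := ih
    have hop : ∀ v a b, DiffOp U (j + 1) fun T y => iterCov N H T j y v a b := fun v a b =>
      (((ih1 v a b).mono (Nat.le_succ j)).add (.basic (Nat.lt_succ_self j) v a b)).congr
        fun T _ y _ => by ring
    refine ⟨fun v a b => ?_, fun T hT y hy => ?_⟩
    · have h1 := (ih1 (Fin.tail v) a b).fderiv hU (v 0)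
      have h2 : DiffOp U (j + 1) fun T y =>
          ∑ c, chernForm H y (v 0) a c * iterCov N H T j y (Fin.tail v) c b :=
        DiffOp.sum _ fun c _ => (hop _ _ _).smul _ (hH (v 0) a c)
      have h3 : DiffOp U (j + 1) fun T y =>
          ∑ c, iterCov N H T j y (Fin.tail v) a c * conj (chernForm H y (v 0) b c) := by
        refine DiffOp.sum _ fun c _ => ((hop (Fin.tail v) a c).smul
          (fun y => conj (chernForm H y (v 0) b c)) ?_).congr fun T _ y _ => mul_comm _ _
        exact Complex.conjCLE.contDiff.comp_contDiffOn (hH (v 0) b c)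
      -- Here the argument ∇_{v₀} v_i depends on the point. Expanding it in the real basis e, ie
      -- with smooth real coefficients reduces it to constant arguments. This uses multilinearity at
      -- stage j, which is why both assertions are proved in one induction.
      have h4 : DiffOp U (j + 1) fun T y =>
          ∑ i : Fin j, iterCov N H T j y (Function.update (Fin.tail v) i
            (Matrix.vecMul (Fin.tail v i) (chernForm N y (v 0)))) a b := by
        refine DiffOp.sum _ fun i _ => ?_
        have hv : ∀ e, ContDiffOn ℝ ∞
            (fun y => Matrix.vecMul (Fin.tail v i) (chernForm N y (v 0)) e) U := fun e => by
          simp only [Matrix.vecMul, dotProduct]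
          exact ContDiffOn.sum fun c _ => contDiffOn_const.mul (hN (v 0) c e)
        have hre : ∀ e, ContDiffOn ℝ ∞ (fun y =>
            ((Matrix.vecMul (Fin.tail v i) (chernForm N y (v 0)) e).re : ℂ)) U := fun e =>
          (Complex.ofRealCLM.contDiff.comp Complex.reCLM.contDiff).comp_contDiffOn (hv e)
        have him : ∀ e, ContDiffOn ℝ ∞ (fun y =>
            ((Matrix.vecMul (Fin.tail v i) (chernForm N y (v 0)) e).im : ℂ)) U := fun e =>
          (Complex.ofRealCLM.contDiff.comp Complex.imCLM.contDiff).comp_contDiffOn (hv e)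
        refine ((DiffOp.sum Finset.univ fun e _ => (hop (Function.update (Fin.tail v) i
          (Pi.single e 1)) a b).smul _ (hre e)).add (DiffOp.sum Finset.univ fun e _ =>
          (hop (Function.update (Fin.tail v) i (Complex.I • Pi.single e 1)) a b).smul _
            (him e))).congr fun T hT y hy => ?_
        rw [(ih2 T hT y hy).map_expand]
        simp only [Matrix.add_apply, Matrix.sum_apply, Matrix.smul_apply, smul_eq_mul]
      refine (((h1.sub h2).sub h3).sub h4).congr fun T hT y hy => ?_
      rw [iterCov_succ_apply, DiffOp.iteratedFDeriv_succ_eq_fderiv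
        ((hT a b).contDiffAt (hU.mem_nhds hy)),
        fderiv_fun_sub ((hop _ a b).differentiableAt hU hT hy)
          ((DiffOp.basic (Nat.lt_succ_self j) (Fin.tail v) a b).differentiableAt hU hT hy)]
      simp only [sub_apply]
      ring
    · have hd : ∀ v a b, DifferentiableAt ℝ (fun y => iterCov N H T j y v a b) y := fun v a b =>
        (hop v a b).differentiableAt hU hT hy
      have hml := ih2 T hT y hy
      have hmul : ∀ (x : κ → ℂ) (c : ℝ) (A : Matrix κ κ ℂ),
          Matrix.vecMul (c • x) A = c • Matrix.vecMul x A := fun x c A => by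
        rw [real_smul_vec, Matrix.smul_vecMul, real_smul_vec]
      constructor
      · intro v i x x'
        refine Fin.cases ?_ (fun i => ?_) i
        · ext a b
          rw [Matrix.add_apply, iterCov_succ_apply, iterCov_succ_apply, iterCov_succ_apply]
          simp only [Fin.tail_update_zero, Function.update_self, _root_.map_add,
            chernForm_add_vec, Matrix.add_apply, add_mul, mul_add, Finset.sum_add_distrib,
            Matrix.vecMul_add, hml.map_add]
          ring
        · ext a b
          rw [Matrix.add_apply, iterCov_succ_apply, iterCov_succ_apply, iterCov_succ_apply]
          have h0 : ∀ z, (Function.update v i.succ z) 0 = v 0 := fun z => by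
            simp [Function.update_of_ne (Fin.succ_ne_zero i).symm]
          have hder : fderiv ℝ (fun y' => iterCov N H T j y'
              (Function.update (Fin.tail v) i (x + x')) a b) y (v 0) =
              fderiv ℝ (fun y' => iterCov N H T j y' (Function.update (Fin.tail v) i x) a b) y
                (v 0) +
              fderiv ℝ (fun y' => iterCov N H T j y' (Function.update (Fin.tail v) i x') a b) y
                (v 0) := by
            have : (fun y' => iterCov N H T j y' (Function.update (Fin.tail v) i (x + x')) a b)
                =ᶠ[nhds y] fun y' => iterCov N H T j y' (Function.update (Fin.tail v) i x) a b +
                  iterCov N H T j y' (Function.update (Fin.tail v) i x') a b :=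
              Filter.eventuallyEq_of_mem (hU.mem_nhds hy) fun z hz => by
                simp only [(ih2 T hT z hz).map_add, Matrix.add_apply]
            rw [this.fderiv_eq, fderiv_fun_add (hd _ _ _) (hd _ _ _)]
            rfl
          -- Either the connection acts on the slot i in which additivity is tested, and its
          -- linearity is used, or it acts on another slot, and the two updates commute.
          have hlast : ∀ i' : Fin j, iterCov N H T j y
              (Function.update (Function.update (Fin.tail v) i (x + x')) i' (Matrix.vecMul
                (Function.update (Fin.tail v) i (x + x') i') (chernForm N y (v 0)))) =
              iterCov N H T j y (Function.update (Function.update (Fin.tail v) i x) i'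
                (Matrix.vecMul (Function.update (Fin.tail v) i x i') (chernForm N y (v 0)))) +
              iterCov N H T j y (Function.update (Function.update (Fin.tail v) i x') i'
                (Matrix.vecMul (Function.update (Fin.tail v) i x' i') (chernForm N y (v 0)))) := by
            intro i'
            rcases eq_or_ne i' i with rfl | hne
            · simp only [Function.update_self, Function.update_idem, Matrix.add_vecMul,
                hml.map_add]
            · simp only [Function.update_of_ne hne]
              rw [Function.update_comm hne.symm, hml.map_add, Function.update_comm hne.symm,
                Function.update_comm hne.symm]
          simp only [Fin.tail_update_succ, h0, hder, hlast, hml.map_add, Matrix.add_apply, add_mul,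
            mul_add, Finset.sum_add_distrib]
          ring
      · intro v i c x
        refine Fin.cases ?_ (fun i => ?_) i
        · ext a b
          rw [Matrix.smul_apply, iterCov_succ_apply, iterCov_succ_apply]
          simp only [Fin.tail_update_zero, Function.update_self, _root_.map_smul]
          rw [real_smul_vec, chernForm_smul_vec, chernForm_smul_vec]
          simp only [Matrix.vecMul_smul, ← real_smul_vec, hml.map_smul, Matrix.smul_apply,
            smul_eq_mul, Complex.real_smul, map_mul, Complex.conj_ofReal, mul_sub, Finset.mul_sum]
          congr 2
          · congr 1
            exact Finset.sum_congr rfl fun e _ => by ring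
          · exact Finset.sum_congr rfl fun e _ => by ring
        · ext a b
          rw [Matrix.smul_apply, iterCov_succ_apply, iterCov_succ_apply]
          have h0 : ∀ z, (Function.update v i.succ z) 0 = v 0 := fun z => by
            simp [Function.update_of_ne (Fin.succ_ne_zero i).symm]
          have hder : fderiv ℝ (fun y' => iterCov N H T j y'
              (Function.update (Fin.tail v) i (c • x)) a b) y (v 0) = c *
              fderiv ℝ (fun y' => iterCov N H T j y' (Function.update (Fin.tail v) i x) a b) y
                (v 0) := by
            have : (fun y' => iterCov N H T j y' (Function.update (Fin.tail v) i (c • x)) a b)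
                =ᶠ[nhds y] fun y' => c *
                  iterCov N H T j y' (Function.update (Fin.tail v) i x) a b :=
              Filter.eventuallyEq_of_mem (hU.mem_nhds hy) fun z hz => by
                simp only [(ih2 T hT z hz).map_smul, Matrix.smul_apply, smul_eq_mul]
            rw [this.fderiv_eq, fderiv_const_mul (hd _ _ _)]
            rfl
          -- The same two cases for real scalars.
          have hlast : ∀ i' : Fin j, iterCov N H T j y
              (Function.update (Function.update (Fin.tail v) i (c • x)) i' (Matrix.vecMul
                (Function.update (Fin.tail v) i (c • x) i') (chernForm N y (v 0)))) = (c : ℂ) •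
              iterCov N H T j y (Function.update (Function.update (Fin.tail v) i x) i'
                (Matrix.vecMul (Function.update (Fin.tail v) i x i') (chernForm N y (v 0)))) := by
            intro i'
            rcases eq_or_ne i' i with rfl | hne
            · simp only [Function.update_self, Function.update_idem, hmul, hml.map_smul]
            · simp only [Function.update_of_ne hne]
              rw [Function.update_comm hne.symm, hml.map_smul, Function.update_comm hne.symm]
          simp only [Fin.tail_update_succ, h0, hder, hlast, hml.map_smul, Matrix.smul_apply,
            smul_eq_mul, mul_sub, Finset.mul_sum]
          congr 2
          · congr 1
            exact Finset.sum_congr rfl fun e _ => by ring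
          · exact Finset.sum_congr rfl fun e _ => by ring

/-- A real multilinear map, bundled. -/
def IsRealMultilinear.toMultilinearMap {j : ℕ} {f : (Fin j → κ → ℂ) → Matrix ι ι ℂ}
    (hf : IsRealMultilinear f) (a b : ι) : MultilinearMap ℝ (fun _ : Fin j => κ → ℂ) ℂ where
  toFun v := f v a b
  map_update_add' := by
    intro inst v i x x'
    have := congrFun (congrFun (hf.map_add v i x x') a) b
    rw [Matrix.add_apply] at this
    convert this
  map_update_smul' := by
    intro inst v i c x
    have := congrFun (congrFun (hf.map_smul v i c x) a) b
    rw [Matrix.smul_apply, smul_eq_mul, ← Complex.real_smul] at this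
    convert this

/-- The standard real basis of `ℂ^κ`. -/
def realBasis (s : κ × Bool) : κ → ℂ := bif s.2 then Pi.single s.1 1 else Complex.I • Pi.single s.1 1

/-- The coordinates in the basis `realBasis`. -/
def realCoord (s : κ × Bool) : (κ → ℂ) →L[ℝ] ℝ :=
  (bif s.2 then Complex.reCLM else Complex.imCLM) ∘L
    (ContinuousLinearMap.proj (R := ℝ) (φ := fun _ : κ => ℂ) s.1)

theorem sum_realCoord_smul (u : κ → ℂ) : ∑ s, realCoord s u • realBasis s = u := by
  rw [Fintype.sum_prod_type]
  ext a
  simp [Finset.sum_apply, Pi.single_apply, realCoord, realBasis, ite_add_ite]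

theorem abs_realCoord_le (s : κ × Bool) (u : κ → ℂ) : |realCoord s u| ≤ ‖u‖ := by
  rcases s with ⟨e, (_ | _)⟩
  · exact (Complex.abs_im_le_norm _).trans (norm_le_pi_norm u e)
  · exact (Complex.abs_re_le_norm _).trans (norm_le_pi_norm u e)

theorem multilinear_expand {j : ℕ} (M : MultilinearMap ℝ (fun _ : Fin j => κ → ℂ) ℂ)
    (v : Fin j → κ → ℂ) :
    M v = ∑ r : Fin j → κ × Bool, (∏ i, realCoord (r i) (v i)) • M fun i => realBasis (r i) := by
  conv_lhs => rw [show v = fun i => ∑ s, realCoord s (v i) • realBasis s from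
    funext fun i => (sum_realCoord_smul (v i)).symm]
  rw [MultilinearMap.map_sum]
  exact Finset.sum_congr rfl fun r _ => M.map_smul_univ _ _

theorem multilinear_bound {j : ℕ} (M : MultilinearMap ℝ (fun _ : Fin j => κ → ℂ) ℂ) {B : ℝ}
    (hB : ∀ r : Fin j → κ × Bool, ‖M fun i => realBasis (r i)‖ ≤ B) (v : Fin j → κ → ℂ) :
    ‖M v‖ ≤ Fintype.card (Fin j → κ × Bool) * B * ∏ i, ‖v i‖ := by
  rw [multilinear_expand M v]
  refine (norm_sum_le _ _).trans ?_
  have h : ∀ r ∈ (Finset.univ : Finset (Fin j → κ × Bool)),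
      ‖(∏ i, realCoord (r i) (v i)) • M fun i => realBasis (r i)‖ ≤ (∏ i, ‖v i‖) * B := by
    intro r _
    rw [norm_smul, Real.norm_eq_abs, Finset.abs_prod]
    refine mul_le_mul ?_ (hB r) (norm_nonneg _) (by positivity)
    exact Finset.prod_le_prod (fun i _ => abs_nonneg _) fun i _ => abs_realCoord_le _ _
  refine (Finset.sum_le_card_nsmul _ _ _ h).trans (le_of_eq ?_)
  rw [nsmul_eq_mul, Finset.card_univ]
  ring

theorem diffOp_iterCov (hU : IsOpen U) (hN : ∀ v, SmoothMat (fun y => chernForm N y v) U)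
    (hH : ∀ v, SmoothMat (fun y => chernForm H y v) U) (j : ℕ) (v : Fin j → κ → ℂ) (a b : ι) :
    DiffOp U (j + 1) fun T y => iterCov N H T j y v a b :=
  ((((iterCov_structure hU hN hH j).1 v a b).mono (Nat.le_succ j)).add
    (.basic (Nat.lt_succ_self j) v a b)).congr fun T _ y _ => by ring

/-- Bounds on covariant derivatives follow from bounds on derivatives. -/
theorem iterCov_bound (hU : IsOpen U) (hN : ∀ v, SmoothMat (fun y => chernForm N y v) U)
    (hH : ∀ v, SmoothMat (fun y => chernForm H y v) U) {K : Set (κ → ℂ)} (hK : IsCompact K)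
    (hKU : K ⊆ U) (p : ℕ) :
    ∃ C : ℝ, 0 ≤ C ∧ ∀ T, SmoothMat T U → ∀ y ∈ K, ∀ B : ℝ, 0 ≤ B →
      (∀ i ≤ p, ∀ a b, ‖iteratedFDeriv ℝ i (fun z => T z a b) y‖ ≤ B) →
      ∀ j ≤ p, ∀ v a b, ‖iterCov N H T j y v a b‖ ≤ C * B * ∏ i, ‖v i‖ := by
  have h1 : ∀ j (r : Fin j → κ × Bool) a b, ∃ C : ℝ, 0 ≤ C ∧ ∀ T, SmoothMat T U → ∀ y ∈ K,
      ∀ B : ℝ, 0 ≤ B → (∀ i < j + 1, ∀ a b, ‖iteratedFDeriv ℝ i (fun z => T z a b) y‖ ≤ B) →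
      ‖iterCov N H T j y (fun i => realBasis (r i)) a b‖ ≤ C * B := fun j r a b =>
    (diffOp_iterCov hU hN hH j _ a b).bound hK hKU
  choose C hC0 hC using h1
  let D : ℕ → ℝ := fun j => Fintype.card (Fin j → κ × Bool) * ∑ r, ∑ a, ∑ b, C j r a b
  have hD0 : ∀ j, 0 ≤ D j := fun j => mul_nonneg (by positivity) (Finset.sum_nonneg fun r _ =>
    Finset.sum_nonneg fun a _ => Finset.sum_nonneg fun b _ => hC0 j r a b)
  refine ⟨∑ j ∈ Finset.range (p + 1), D j, Finset.sum_nonneg fun j _ => hD0 j,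
    fun T hT y hy B hB hb j hj v a b => ?_⟩
  have hml := (iterCov_structure hU hN hH j).2 T hT y (hKU hy)
  have hle : ∀ r, C j r a b ≤ ∑ r, ∑ a, ∑ b, C j r a b := fun r =>
    (Finset.single_le_sum (f := fun b => C j r a b) (fun b _ => hC0 j r a b)
      (Finset.mem_univ b)).trans <|
    (Finset.single_le_sum (f := fun a => ∑ b, C j r a b)
      (fun a _ => Finset.sum_nonneg fun b _ => hC0 j r a b) (Finset.mem_univ a)).trans <|
    Finset.single_le_sum (f := fun r => ∑ a, ∑ b, C j r a b) (fun r _ => Finset.sum_nonneg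
      fun a _ => Finset.sum_nonneg fun b _ => hC0 j r a b) (Finset.mem_univ r)
  have h2 := multilinear_bound (hml.toMultilinearMap a b)
    (B := (∑ r, ∑ a, ∑ b, C j r a b) * B) (fun r =>
      (hC j r a b T hT y hy B hB fun i hi => hb i (by omega)).trans
        (mul_le_mul_of_nonneg_right (hle r) hB)) v
  refine h2.trans ?_
  rw [← mul_assoc]
  refine mul_le_mul_of_nonneg_right (mul_le_mul_of_nonneg_right ?_ hB) (by positivity)
  exact Finset.single_le_sum (f := D) (fun j _ => hD0 j) (Finset.mem_range.2 (by omega))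

/-- Bounds on derivatives follow from bounds on covariant derivatives. -/
theorem iteratedFDeriv_bound (hU : IsOpen U) (hN : ∀ v, SmoothMat (fun y => chernForm N y v) U)
    (hH : ∀ v, SmoothMat (fun y => chernForm H y v) U) {K : Set (κ → ℂ)} (hK : IsCompact K)
    (hKU : K ⊆ U) (p : ℕ) :
    ∃ C : ℝ, 0 ≤ C ∧ ∀ T, SmoothMat T U → ∀ y ∈ K, ∀ B : ℝ, 0 ≤ B →
      (∀ j ≤ p, ∀ (r : Fin j → κ × Bool) a b,
        ‖iterCov N H T j y (fun i => realBasis (r i)) a b‖ ≤ B) →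
      ∀ i ≤ p, ∀ a b, ‖iteratedFDeriv ℝ i (fun z => T z a b) y‖ ≤ C * B := by
  induction p with
  | zero =>
    refine ⟨1, zero_le_one, fun T _ y _ B _ hb i hi a b => ?_⟩
    obtain rfl : i = 0 := by omega
    rw [norm_iteratedFDeriv_zero, one_mul]
    exact hb 0 le_rfl Fin.elim0 a b
  | succ p ih =>
    obtain ⟨C, hC0, hC⟩ := ih
    have h1 := fun (r : Fin (p + 1) → κ × Bool) a b =>
      ((iterCov_structure hU hN hH (p + 1)).1 (fun i => realBasis (r i)) a b).bound hK hKU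
    choose D hD0 hD using h1
    set S := ∑ r, ∑ a, ∑ b, D r a b with hS
    have hS0 : 0 ≤ S := Finset.sum_nonneg fun r _ =>
      Finset.sum_nonneg fun a _ => Finset.sum_nonneg fun b _ => hD0 r a b
    have hle : ∀ r a b, D r a b ≤ S := fun r a b =>
      (Finset.single_le_sum (f := fun b => D r a b) (fun b _ => hD0 r a b)
        (Finset.mem_univ b)).trans <|
      (Finset.single_le_sum (f := fun a => ∑ b, D r a b)
        (fun a _ => Finset.sum_nonneg fun b _ => hD0 r a b) (Finset.mem_univ a)).trans <|
      Finset.single_le_sum (f := fun r => ∑ a, ∑ b, D r a b) (fun r _ => Finset.sum_nonneg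
        fun a _ => Finset.sum_nonneg fun b _ => hD0 r a b) (Finset.mem_univ r)
    -- The derivative of top order equals ∇^{p+1}T, bounded by B, minus an operator of lower order,
    -- bounded by S · (C B) by induction. The cardinality comes from expanding arbitrary arguments
    -- in the real basis.
    refine ⟨C + Fintype.card (Fin (p + 1) → κ × Bool) * (1 + S * C), by positivity,
      fun T hT y hy B hB hb i hi a b => ?_⟩
    have hlow := hC T hT y hy B hB fun j hj => hb j (by omega)
    rcases Nat.lt_or_ge i (p + 1) with h | h
    · refine (hlow i (by omega) a b).trans (mul_le_mul_of_nonneg_right ?_ hB)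
      exact le_add_of_nonneg_right (by positivity)
    · obtain rfl : i = p + 1 := by omega
      have hbasis : ∀ r : Fin (p + 1) → κ × Bool,
          ‖iteratedFDeriv ℝ (p + 1) (fun z => T z a b) y fun i => realBasis (r i)‖ ≤
            (1 + S * C) * B := by
        intro r
        have e1 := hD r a b T hT y hy (C * B) (by positivity) fun i hi => hlow i (by omega)
        have e2 := hb (p + 1) le_rfl r a b
        have e3 : D r a b * (C * B) ≤ S * (C * B) :=
          mul_le_mul_of_nonneg_right (hle r a b) (by positivity)
        calc _ = ‖iterCov N H T (p + 1) y (fun i => realBasis (r i)) a b -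
              (iterCov N H T (p + 1) y (fun i => realBasis (r i)) a b -
                iteratedFDeriv ℝ (p + 1) (fun z => T z a b) y fun i => realBasis (r i))‖ := by
              congr 1; ring
          _ ≤ B + S * (C * B) := (norm_sub_le _ _).trans (add_le_add e2 (e1.trans e3))
          _ = _ := by ring
      refine ContinuousMultilinearMap.opNorm_le_bound (by positivity) fun v => ?_
      refine (multilinear_bound (iteratedFDeriv ℝ (p + 1) (fun z => T z a b) y).toMultilinearMap
        hbasis v).trans (mul_le_mul_of_nonneg_right ?_ (by positivity))
      nlinarith [mul_nonneg hC0 hB]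

end CovariantDerivatives

/-! ### Covariant derivatives are compatible with holomorphic changes of chart and frame -/

section Tensoriality

variable {ι κ : Type*} [Fintype ι] [Fintype κ] [DecidableEq ι] [DecidableEq κ]

/-- The entrywise derivative of a field of matrices. -/
def matDeriv {α β : Type*} (F : (κ → ℂ) → Matrix α β ℂ) (y v : κ → ℂ) : Matrix α β ℂ :=
  Matrix.of fun a b => fderiv ℝ (fun z => F z a b) y v

/-- A field of matrices with differentiable entries. -/
def MatDiffAt {α β : Type*} (F : (κ → ℂ) → Matrix α β ℂ) (y : κ → ℂ) : Prop :=
  ∀ a b, DifferentiableAt ℝ (fun z => F z a b) y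

theorem MatDiffAt.mul {α β γ : Type*} [Fintype β] {F : (κ → ℂ) → Matrix α β ℂ}
    {G : (κ → ℂ) → Matrix β γ ℂ} {y : κ → ℂ} (hF : MatDiffAt F y) (hG : MatDiffAt G y) :
    MatDiffAt (fun z => F z * G z) y := by
  intro a b
  simp only [Matrix.mul_apply]
  exact DifferentiableAt.fun_sum fun c _ => (hF a c).fun_mul (hG c b)

theorem MatDiffAt.conjTranspose {α β : Type*} {F : (κ → ℂ) → Matrix α β ℂ} {y : κ → ℂ}
    (hF : MatDiffAt F y) : MatDiffAt (fun z => (F z).conjTranspose) y :=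
  fun a b => (hasFDerivAt_conj (hF b a)).differentiableAt

theorem matDeriv_mul {α β γ : Type*} [Fintype β] {F : (κ → ℂ) → Matrix α β ℂ}
    {G : (κ → ℂ) → Matrix β γ ℂ} {y : κ → ℂ} (hF : MatDiffAt F y) (hG : MatDiffAt G y)
    (v : κ → ℂ) :
    matDeriv (fun z => F z * G z) y v = matDeriv F y v * G y + F y * matDeriv G y v := by
  ext a b
  simp only [matDeriv, Matrix.of_apply, Matrix.add_apply, Matrix.mul_apply]
  rw [fderiv_fun_sum fun c _ => (hF a c).fun_mul (hG c b), sum_apply, ← Finset.sum_add_distrib]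
  refine Finset.sum_congr rfl fun c _ => ?_
  rw [fderiv_fun_mul (hF a c) (hG c b)]
  simp only [add_apply, smul_apply, smul_eq_mul]
  ring

theorem matDeriv_conjTranspose {α β : Type*} {F : (κ → ℂ) → Matrix α β ℂ} {y : κ → ℂ}
    (hF : MatDiffAt F y) (v : κ → ℂ) :
    matDeriv (fun z => (F z).conjTranspose) y v = (matDeriv F y v).conjTranspose := by
  ext a b
  simp only [matDeriv, Matrix.of_apply, Matrix.conjTranspose_apply]
  exact DFunLike.congr_fun (hasFDerivAt_conj (hF b a)).fderiv v

theorem matDeriv_congr {α β : Type*} {F G : (κ → ℂ) → Matrix α β ℂ} {y : κ → ℂ}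
    (h : F =ᶠ[nhds y] G) (v : κ → ℂ) : matDeriv F y v = matDeriv G y v := by
  ext a b
  simp only [matDeriv, Matrix.of_apply]
  rw [Filter.EventuallyEq.fderiv_eq (h.mono fun z hz => by rw [hz])]

theorem iterCov_succ (N : (κ → ℂ) → Matrix κ κ ℂ) (H T : (κ → ℂ) → Matrix ι ι ℂ) (j : ℕ)
    (y : κ → ℂ) (v : Fin (j + 1) → κ → ℂ) :
    iterCov N H T (j + 1) y v = matDeriv (fun y' => iterCov N H T j y' (Fin.tail v)) y (v 0)
        - chernForm H y (v 0) * iterCov N H T j y (Fin.tail v)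
        - iterCov N H T j y (Fin.tail v) * (chernForm H y (v 0)).conjTranspose
        - ∑ i : Fin j, iterCov N H T j y
            (Function.update (Fin.tail v) i
              (Matrix.vecMul (Fin.tail v i) (chernForm N y (v 0)))) := rfl

/-- The Chern connection form under a holomorphic change of coordinates and frame. -/
theorem chernForm_transform {g H H' : (κ → ℂ) → Matrix ι ι ℂ} {φ : (κ → ℂ) → κ → ℂ} {y : κ → ℂ}
    (hH' : ∀ᶠ z in nhds y, H' z = g z * H (φ z) * (g z).conjTranspose)
    (hg : ∀ a b, DifferentiableAt ℂ (fun z => g z a b) y) (hφ : DifferentiableAt ℂ φ y)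
    (hH : MatDiffAt H (φ y)) (hgu : IsUnit (g y).det) (hHu : IsUnit (H (φ y)).det) (v : κ → ℂ) :
    chernForm H' y v * g y = matDeriv g y v + g y * chernForm H (φ y) (fderiv ℂ φ y v) := by
  have hgr : ∀ a b, DifferentiableAt ℝ (fun z => g z a b) y := fun a b =>
    (hg a b).restrictScalars ℝ
  have hHφ : ∀ a b, DifferentiableAt ℝ (fun z => H (φ z) a b) y := fun a b =>
    (hH a b).comp y (hφ.restrictScalars ℝ)
  -- Since g is holomorphic, ∂ annihilates the entries of its conjugate transpose, which therefore
  -- stays outside as a factor and cancels against the inverse of H'.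
  have hdel : (Matrix.of fun i j => del (fun y' => H' y' i j) y v) =
      (matDeriv g y v * H (φ y) + g y * Matrix.of fun i j =>
        del (fun y' => H y' i j) (φ y) (fderiv ℂ φ y v)) * (g y).conjTranspose := by
    ext a b
    have e1 : (fun z => H' z a b) =ᶠ[nhds y] fun z =>
        ∑ c, (∑ e, g z a e * H (φ z) e c) * conj (g z b c) := by
      filter_upwards [hH'] with z hz
      rw [hz]
      simp [Matrix.mul_apply]
    simp only [Matrix.of_apply]
    rw [del_congr e1, del_sum _ fun c _ => DifferentiableAt.fun_mul
      (DifferentiableAt.fun_sum fun e _ => (hgr a e).fun_mul (hHφ e c))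
      (hasFDerivAt_conj (hgr b c)).differentiableAt, Matrix.mul_apply]
    refine Finset.sum_congr rfl fun c _ => ?_
    rw [del_mul (DifferentiableAt.fun_sum fun e _ => (hgr a e).fun_mul (hHφ e c))
      (hasFDerivAt_conj (hgr b c)).differentiableAt, del_conj (hgr b c), delBar_of_holo (hg b c),
      del_sum _ fun e _ => (hgr a e).fun_mul (hHφ e c)]
    simp only [map_zero, mul_zero, zero_add, Matrix.conjTranspose_apply, RCLike.star_def]
    rw [mul_comm]
    congr 1
    simp only [Matrix.add_apply, Matrix.mul_apply, ← Finset.sum_add_distrib, Matrix.of_apply,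
      matDeriv]
    refine Finset.sum_congr rfl fun e _ => ?_
    rw [del_mul (hgr a e) (hHφ e c), del_of_holo (hg a e),
      del_comp (f := fun z => H z e c) (hH e c) hφ,
      ((hg a e).hasFDerivAt.restrictScalars ℝ).fderiv]
    simp only [ContinuousLinearMap.coe_restrictScalars']
    ring
  have hgu' : IsUnit (g y).conjTranspose.det := by
    rw [Matrix.det_conjTranspose]; exact hgu.star
  rw [chernForm, hdel, chernForm, hH'.self_of_nhds, Matrix.mul_inv_rev, Matrix.mul_inv_rev]
  simp only [Matrix.mul_assoc]
  rw [Matrix.nonsing_inv_mul _ hgu, Matrix.mul_one, ← Matrix.mul_assoc (g y).conjTranspose,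
    Matrix.mul_nonsing_inv _ hgu', Matrix.one_mul, Matrix.add_mul, Matrix.mul_assoc,
    Matrix.mul_nonsing_inv _ hHu, Matrix.mul_one, Matrix.mul_assoc]

variable {N : (κ → ℂ) → Matrix κ κ ℂ} {H T : (κ → ℂ) → Matrix ι ι ℂ} {U : Set (κ → ℂ)}

/-- Differentiating an iterated covariant derivative along a map, with variable arguments. -/
theorem fderiv_iterCov_comp (hU : IsOpen U) (hN : ∀ v, SmoothMat (fun y => chernForm N y v) U)
    (hH : ∀ v, SmoothMat (fun y => chernForm H y v) U) (hT : SmoothMat T U) (j : ℕ)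
    {φ : (κ → ℂ) → κ → ℂ} {w : (κ → ℂ) → Fin j → κ → ℂ} {y : κ → ℂ} (hφ : DifferentiableAt ℝ φ y)
    (hφy : φ y ∈ U) (hw : DifferentiableAt ℝ w y) (a b : ι) :
    DifferentiableAt ℝ (fun z => iterCov N H T j (φ z) (w z) a b) y ∧ ∀ u,
    fderiv ℝ (fun z => iterCov N H T j (φ z) (w z) a b) y u =
      fderiv ℝ (fun z => iterCov N H T j z (w y) a b) (φ y) (fderiv ℝ φ y u) +
      ∑ i, iterCov N H T j (φ y) (Function.update (w y) i (fderiv ℝ w y u i)) a b := by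
  have hml : ∀ z ∈ U, IsRealMultilinear (iterCov N H T j z) :=
    (iterCov_structure hU hN hH j).2 T hT
  have hd : ∀ v, DifferentiableAt ℝ (fun z => iterCov N H T j z v a b) (φ y) := fun v =>
    (diffOp_iterCov hU hN hH j v a b).differentiableAt hU hT hφy
  let F : (κ → ℂ) × (Fin j → κ → ℂ) → ℂ := fun q => iterCov N H T j q.1 q.2 a b
  -- Joint differentiability in point and arguments: in the real basis F is a finite sum of products
  -- of coordinates of the arguments with functions of the point alone.
  have hF : DifferentiableAt ℝ F (φ y, w y) := by
    have he : F =ᶠ[nhds (φ y, w y)] fun q => ∑ r : Fin j → κ × Bool,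
        (∏ i, realCoord (r i) (q.2 i)) • iterCov N H T j q.1 (fun i => realBasis (r i)) a b := by
      filter_upwards [continuousAt_fst.eventually (hU.mem_nhds hφy)] with q hq
      exact multilinear_expand ((hml q.1 hq).toMultilinearMap a b) q.2
    refine DifferentiableAt.congr_of_eventuallyEq (DifferentiableAt.fun_sum fun r _ => ?_) he
    refine DifferentiableAt.fun_smul ?_ ?_
    · fun_prop
    · exact DifferentiableAt.comp (𝕜 := ℝ) (f := Prod.fst) (φ y, w y)
        (hd fun i => realBasis (r i)) differentiableAt_fst
  have hF' := hF.hasFDerivAt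
  have hcomp := hF'.comp y (hφ.hasFDerivAt.prodMk hw.hasFDerivAt)
  refine ⟨hcomp.differentiableAt, fun u => ?_⟩
  have h0 : fderiv ℝ (fun z => iterCov N H T j (φ z) (w z) a b) y u =
      fderiv ℝ F (φ y, w y) (fderiv ℝ φ y u, fderiv ℝ w y u) :=
    DFunLike.congr_fun hcomp.fderiv u
  have h1 : fderiv ℝ (fun z => iterCov N H T j z (w y) a b) (φ y) (fderiv ℝ φ y u) =
      fderiv ℝ F (φ y, w y) (fderiv ℝ φ y u, 0) := by
    have := HasFDerivAt.comp (f := fun x => (x, w y)) (φ y) hF'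
      ((hasFDerivAt_id (𝕜 := ℝ) (φ y)).prodMk (hasFDerivAt_const (w y) (φ y)))
    have := DFunLike.congr_fun this.fderiv (fderiv ℝ φ y u)
    have e : fderiv ℝ (F ∘ fun x => (x, w y)) (φ y) (fderiv ℝ φ y u) =
      fderiv ℝ F (φ y, w y) (fderiv ℝ φ y u, 0) := by simpa using this
    exact e
  -- At a fixed point the map is multilinear in the arguments, and the derivative of a multilinear
  -- map is the sum over its slots.
  have h2 : ∑ i, iterCov N H T j (φ y) (Function.update (w y) i (fderiv ℝ w y u i)) a b =
      fderiv ℝ F (φ y, w y) (0, fderiv ℝ w y u) := by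
    have e1 := HasFDerivAt.comp (f := fun x => (φ y, x)) (w y) hF'
      ((hasFDerivAt_const (φ y) (w y)).prodMk (hasFDerivAt_id (𝕜 := ℝ) (w y)))
    have e2 := DFunLike.congr_fun e1.fderiv (fderiv ℝ w y u)
    let M := ((hml _ hφy).toMultilinearMap a b).mkContinuous
      (Fintype.card (Fin j → κ × Bool) * ∑ r : Fin j → κ × Bool,
        ‖(hml _ hφy).toMultilinearMap a b fun i => realBasis (r i)‖)
      (multilinear_bound _ fun r => Finset.single_le_sum
        (f := fun r : Fin j → κ × Bool =>
          ‖(hml _ hφy).toMultilinearMap a b fun i => realBasis (r i)‖)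
        (fun _ _ => norm_nonneg _) (Finset.mem_univ r))
    have e3 := DFunLike.congr_fun (M.hasFDerivAt (w y)).fderiv (fderiv ℝ w y u)
    rw [ContinuousMultilinearMap.linearDeriv_apply] at e3
    have e4 : fderiv ℝ (F ∘ fun x => (φ y, x)) (w y) (fderiv ℝ w y u) =
      fderiv ℝ F (φ y, w y) (0, fderiv ℝ w y u) := by simpa using e2
    rw [← e4]
    exact e3.symm
  rw [h0, h1, h2, ← map_add]
  simp

theorem matDeriv_eq_of_differentiableAt_complex {α β : Type*} {g : (κ → ℂ) → Matrix α β ℂ}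
    {y : κ → ℂ} (hg : ∀ a b, DifferentiableAt ℂ (fun z => g z a b) y) : MatDiffAt g y :=
  fun a b => (hg a b).restrictScalars ℝ

/-- Iterated covariant derivatives are tensors: they are compatible with holomorphic changes of
coordinates and frames. -/
theorem iterCov_transform {N' : (κ → ℂ) → Matrix κ κ ℂ} {g H' T' : (κ → ℂ) → Matrix ι ι ℂ}
    {φ : (κ → ℂ) → κ → ℂ} {U' : Set (κ → ℂ)} (hU : IsOpen U) (hU' : IsOpen U')
    (hmaps : Set.MapsTo φ U' U) (hφ : ContDiffOn ℂ 2 φ U')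
    (hg : ∀ a b, DifferentiableOn ℂ (fun z => g z a b) U')
    (hgu : ∀ z ∈ U', IsUnit (g z).det) (hJu : ∀ z ∈ U', IsUnit (holoJac φ z).det)
    (hNs : SmoothMat N U) (hHs : SmoothMat H U)
    (hNu : ∀ z ∈ U, IsUnit (N z).det) (hHu : ∀ z ∈ U, IsUnit (H z).det)
    (hN : ∀ v, SmoothMat (fun y => chernForm N y v) U)
    (hH : ∀ v, SmoothMat (fun y => chernForm H y v) U) (hT : SmoothMat T U)
    (hN' : ∀ z ∈ U', N' z = holoJac φ z * N (φ z) * (holoJac φ z).conjTranspose)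
    (hH' : ∀ z ∈ U', H' z = g z * H (φ z) * (g z).conjTranspose)
    (hT' : ∀ z ∈ U', T' z = g z * T (φ z) * (g z).conjTranspose) (j : ℕ) :
    ∀ y ∈ U', ∀ v, iterCov N' H' T' j y v = g y *
      iterCov N H T j (φ y) (fun i => Matrix.vecMul (v i) (holoJac φ y)) *
        (g y).conjTranspose := by
  induction j with
  | zero => exact fun y hy v => hT' y hy
  | succ j ih =>
    intro y hy v
    have hU'n := hU'.mem_nhds hy
    have hφc : ContDiffAt ℂ 2 φ y := hφ.contDiffAt hU'n
    have hφd : DifferentiableAt ℂ φ y := hφc.differentiableAt (by simp)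
    have hφr : DifferentiableAt ℝ φ y := hφd.restrictScalars ℝ
    have hφf : ∀ u, fderiv ℝ φ y u = Matrix.vecMul u (holoJac φ y) := fun u => by
      rw [← fderiv_eq_vecMul_holoJac, (hφd.hasFDerivAt.restrictScalars ℝ).fderiv]; rfl
    have hgd : ∀ a b, DifferentiableAt ℂ (fun z => g z a b) y := fun a b =>
      (hg a b).differentiableAt hU'n
    have hgm := matDeriv_eq_of_differentiableAt_complex hgd
    have hJd : ∀ a b, DifferentiableAt ℂ (fun z => holoJac φ z a b) y := by
      intro a b
      have h := (hφc.fderiv_right (m := 1) (by norm_num)).differentiableAt (by simp)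
      have h2 : DifferentiableAt ℂ (fun z => fderiv ℂ φ z (Pi.single a 1)) y := by fun_prop
      exact differentiableAt_pi.1 h2 b
    have hJm := matDeriv_eq_of_differentiableAt_complex hJd
    have hUn := hU.mem_nhds (hmaps hy)
    have hHd : MatDiffAt H (φ y) := fun a b =>
      ((hHs a b).contDiffAt hUn).differentiableAt (by simp)
    have hNd : MatDiffAt N (φ y) := fun a b =>
      ((hNs a b).contDiffAt hUn).differentiableAt (by simp)
    have hχH := chernForm_transform (Filter.eventually_of_mem hU'n hH') hgd hφd hHd
      (hgu y hy) (hHu _ (hmaps hy)) (v 0)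
    have hχN := chernForm_transform (Filter.eventually_of_mem hU'n hN') hJd hφd hNd
      (hJu y hy) (hNu _ (hmaps hy)) (v 0)
    set w : (κ → ℂ) → Fin j → κ → ℂ := fun z i => Matrix.vecMul (Fin.tail v i) (holoJac φ z)
      with hw
    have hwd' : ∀ i c, DifferentiableAt ℝ (fun z => w z i c) y := fun i c => by
      simp only [hw, Matrix.vecMul, dotProduct]
      exact DifferentiableAt.fun_sum fun e _ => (differentiableAt_const _).fun_mul (hJm e c)
    have hwd : DifferentiableAt ℝ w y :=
      differentiableAt_pi.2 fun i => differentiableAt_pi.2 fun c => hwd' i c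
    have hwf : ∀ i, fderiv ℝ w y (v 0) i =
        Matrix.vecMul (Fin.tail v i) (matDeriv (fun z => holoJac φ z) y (v 0)) := fun i => by
      ext c
      have e1 : fderiv ℝ w y (v 0) i c = fderiv ℝ (fun z => w z i c) y (v 0) := by
        have := hasFDerivAt_pi'.1 (hasFDerivAt_pi'.1 hwd.hasFDerivAt i) c
        rw [this.fderiv]; rfl
      rw [e1]
      simp only [hw, Matrix.vecMul, dotProduct, matDeriv, Matrix.of_apply]
      rw [fderiv_fun_sum fun e _ => (differentiableAt_const _).fun_mul (hJm e c), sum_apply]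
      refine Finset.sum_congr rfl fun e _ => ?_
      rw [fderiv_const_mul (hJm e c)]
      rfl
    have hcomp := fun a b => fderiv_iterCov_comp hU hN hH hT j hφr (hmaps hy) hwd a b
    set I : (κ → ℂ) → Matrix ι ι ℂ := fun z => iterCov N H T j (φ z) (w z) with hI
    have hId : MatDiffAt I y := fun a b => (hcomp a b).1
    have hIder : matDeriv I y (v 0) =
        matDeriv (fun z => iterCov N H T j z (w y)) (φ y) (Matrix.vecMul (v 0) (holoJac φ y)) +
        ∑ i, iterCov N H T j (φ y) (Function.update (w y) i
          (Matrix.vecMul (Fin.tail v i) (matDeriv (fun z => holoJac φ z) y (v 0)))) := by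
      ext a b
      have := (hcomp a b).2 (v 0)
      simp only [matDeriv, Matrix.of_apply, Matrix.add_apply, Matrix.sum_apply, hI]
      rw [this, hφf]
      congr 1
      refine Finset.sum_congr rfl fun i _ => ?_
      rw [hwf]; rfl
    have hder : matDeriv (fun y' => iterCov N' H' T' j y' (Fin.tail v)) y (v 0) =
        matDeriv g y (v 0) * I y * (g y).conjTranspose + g y * matDeriv I y (v 0) *
          (g y).conjTranspose + g y * I y * (matDeriv g y (v 0)).conjTranspose := by
      have : (fun y' => iterCov N' H' T' j y' (Fin.tail v)) =ᶠ[nhds y]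
          fun z => g z * I z * (g z).conjTranspose :=
        Filter.eventuallyEq_of_mem hU'n fun z hz => ih z hz _
      rw [matDeriv_congr this, matDeriv_mul (hgm.mul hId) hgm.conjTranspose, matDeriv_mul hgm hId,
        matDeriv_conjTranspose hgm, Matrix.add_mul]
    have hml := (iterCov_structure hU hN hH j).2 T hT (φ y) (hmaps hy)
    -- Slot by slot, the transformation law of the tangent connection form produces the derivative
    -- of the Jacobian, which also arises from differentiating the transformed arguments in `hIder`.
    have hlast : ∀ i : Fin j, iterCov N' H' T' j y (Function.update (Fin.tail v) i
        (Matrix.vecMul (Fin.tail v i) (chernForm N' y (v 0)))) =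
        g y * (iterCov N H T j (φ y) (Function.update (w y) i
          (Matrix.vecMul (Fin.tail v i) (matDeriv (fun z => holoJac φ z) y (v 0)))) +
          iterCov N H T j (φ y) (Function.update (w y) i
          (Matrix.vecMul (w y i) (chernForm N (φ y) (Matrix.vecMul (v 0) (holoJac φ y)))))) *
          (g y).conjTranspose := by
      intro i
      rw [ih y hy]
      congr 2
      rw [← hml.map_add]
      congr 1
      ext i' : 1
      rcases eq_or_ne i' i with rfl | hne
      · simp only [Function.update_self]
        rw [Matrix.vecMul_vecMul, hχN, Matrix.vecMul_add, fderiv_eq_vecMul_holoJac, hw,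
          Matrix.vecMul_vecMul]
      · simp only [Function.update_of_ne hne, hw]
    have htail : (Fin.tail fun i => Matrix.vecMul (v i) (holoJac φ y)) = w y := rfl
    have hχH' : (g y).conjTranspose * (chernForm H' y (v 0)).conjTranspose =
        (matDeriv g y (v 0)).conjTranspose +
          (chernForm H (φ y) (fderiv ℂ φ y (v 0))).conjTranspose * (g y).conjTranspose := by
      rw [← Matrix.conjTranspose_mul, hχH, Matrix.conjTranspose_add, Matrix.conjTranspose_mul]
    -- The inhomogeneous terms now cancel: dg and its conjugate transpose against those in the
    -- bundle connection form, the derivative of the Jacobian against that in the tangent connection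
    -- form.
    rw [iterCov_succ, iterCov_succ, hder, hIder, htail, ih y hy]
    simp only [hlast]
    rw [← Finset.sum_mul, ← Finset.mul_sum, Finset.sum_add_distrib]
    change _ - chernForm H' y (v 0) * (g y * I y * (g y).conjTranspose) -
      g y * I y * (g y).conjTranspose * (chernForm H' y (v 0)).conjTranspose - _ = _
    have r1 : chernForm H' y (v 0) * (g y * I y * (g y).conjTranspose) =
        (matDeriv g y (v 0) + g y * chernForm H (φ y) (fderiv ℂ φ y (v 0))) * I y *
          (g y).conjTranspose := by
      rw [← hχH]; simp only [Matrix.mul_assoc]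
    have r2 : g y * I y * (g y).conjTranspose * (chernForm H' y (v 0)).conjTranspose =
        g y * I y * ((matDeriv g y (v 0)).conjTranspose +
          (chernForm H (φ y) (fderiv ℂ φ y (v 0))).conjTranspose * (g y).conjTranspose) := by
      rw [← hχH', Matrix.mul_assoc]
    rw [r1, r2, fderiv_eq_vecMul_holoJac]
    simp only [Matrix.mul_add, Matrix.add_mul, Matrix.mul_sub, Matrix.sub_mul, Matrix.mul_assoc, hI]
    abel

end Tensoriality

/-! ### Hermitian inner products and dual norms -/

section Sesquilinear

variable {V : Type*} [AddCommGroup V] [Module ℂ V]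

/-- A positive definite hermitian form, linear in the first variable. -/
structure IsHermInner (h : V →ₗ[ℂ] V →ₛₗ[starRingEnd ℂ] ℂ) : Prop where
  symm : ∀ s t, h s t = conj (h t s)
  pos : ∀ s, s ≠ 0 → 0 < (h s s).re

namespace IsHermInner

variable {h : V →ₗ[ℂ] V →ₛₗ[starRingEnd ℂ] ℂ}

theorem self_nonneg (hh : IsHermInner h) (s : V) : 0 ≤ (h s s).re := by
  rcases eq_or_ne s 0 with rfl | hs
  · simp
  · exact (hh.pos s hs).le

theorem self_eq_re (hh : IsHermInner h) (s : V) : h s s = ((h s s).re : ℂ) :=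
  (Complex.conj_eq_iff_re.1 (hh.symm s s).symm).symm

/-- Evaluate the form on h(t,t) s − h(s,t) t: the result is h(t,t) times the difference of the two
sides, and h(t,t) > 0 for t ≠ 0. -/
theorem cauchySchwarz (hh : IsHermInner h) (s t : V) :
    ‖h s t‖ ^ 2 ≤ (h s s).re * (h t t).re := by
  rcases eq_or_ne t 0 with rfl | ht
  · simp
  have hp := hh.pos t ht
  have h0 := hh.self_nonneg (h t t • s - h s t • t)
  have e : h (h t t • s - h s t • t) (h t t • s - h s t • t) =
      ((h t t).re * ((h s s).re * (h t t).re - ‖h s t‖ ^ 2) : ℝ) := by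
    have hn : h s t * conj (h s t) = (‖h s t‖ ^ 2 : ℝ) := by
      rw [Complex.mul_conj, Complex.normSq_eq_norm_sq]
    simp only [map_sub, map_smul, LinearMap.sub_apply, LinearMap.smul_apply, LinearMap.map_smulₛₗ,
      smul_eq_mul, hh.symm t s]
    push_cast at hn ⊢
    rw [← hh.self_eq_re, ← hh.self_eq_re, ← hn, ← hh.symm t t]
    ring
  rw [e, Complex.ofReal_re] at h0
  have := nonneg_of_mul_nonneg_right h0 hp
  linarith

theorem exists_orthonormal_basis [FiniteDimensional ℂ V] (hh : IsHermInner h) :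
    ∃ b : Module.Basis (Fin (Module.finrank ℂ V)) ℂ V,
      ∀ i j, h (b i) (b j) = if i = j then 1 else 0 := by
  let core : InnerProductSpace.Core ℂ V :=
    -- The arguments are exchanged because `inner` is conjugate-linear in its first variable, while
    -- h is linear there.
    { inner := fun x y => h y x
      conj_inner_symm := fun x y => (hh.symm y x).symm
      re_inner_nonneg := fun x => hh.self_nonneg x
      add_left := fun x y z => by simp
      smul_left := fun x y r => by simp
      definite := fun x hx => by
        by_contra hne
        have := hh.pos x hne
        rw [show h x x = 0 from hx] at this
        simp at this }
  let : NormedAddCommGroup V := core.toNormedAddCommGroup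
  let : InnerProductSpace ℂ V := InnerProductSpace.ofCore core.toCore
  let b := stdOrthonormalBasis ℂ V
  refine ⟨b.toBasis, fun i j => ?_⟩
  have := (orthonormal_iff_ite.1 b.orthonormal) j i
  simp only [OrthonormalBasis.coe_toBasis]
  rw [show h (b i) (b j) = inner ℂ (b j) (b i) from rfl, this]
  simp [eq_comm]

/-- The dual norm of a functional that is represented by the vector `t`. -/
theorem dualNormSq_eq (hh : IsHermInner h) {f : Module.Dual ℂ V} {t : V}
    (ht : ∀ s, f s = h s t) : dualNormSq (fun s t => h s t) f = (h t t).re := by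
  have hub : ∀ c ∈ {c : ℝ | ∃ s : V, (h s s).re ≤ 1 ∧ c = ‖f s‖ ^ 2}, c ≤ (h t t).re := by
    rintro c ⟨s, hs, rfl⟩
    rw [ht]
    refine (hh.cauchySchwarz s t).trans ?_
    nlinarith [hh.self_nonneg t]
  refine le_antisymm (csSup_le ⟨‖f 0‖ ^ 2, 0, by simp, rfl⟩ hub) ?_
  refine le_csSup ⟨_, hub⟩ ?_
  rcases eq_or_ne t 0 with rfl | hne
  · exact ⟨0, by simp, by simp⟩
  have hp := hh.pos t hne
  -- The supremum is attained at the unit vector t / r.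
  set r : ℝ := Real.sqrt (h t t).re with hr
  have hr2 : r ^ 2 = (h t t).re := Real.sq_sqrt hp.le
  have hr0 : 0 < r := Real.sqrt_pos.2 hp
  have hrc : (r : ℂ) ≠ 0 := by exact_mod_cast hr0.ne'
  have htt : h t t = (r : ℂ) ^ 2 := by rw [hh.self_eq_re, ← hr2]; push_cast; rfl
  refine ⟨(r : ℂ)⁻¹ • t, ?_, ?_⟩
  · simp only [map_smul, LinearMap.smul_apply, LinearMap.map_smulₛₗ, smul_eq_mul, map_inv₀,
      Complex.conj_ofReal, htt]
    field_simp
    simp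
  · rw [map_smul, ht, htt, smul_eq_mul]
    rw [show (r : ℂ)⁻¹ * (r : ℂ) ^ 2 = r by field_simp, Complex.norm_real, Real.norm_eq_abs,
      sq_abs, ← Complex.ofReal_pow, Complex.ofReal_re]

variable {ι : Type*} [Fintype ι] [DecidableEq ι]

/-- The dual norm in a basis. -/
theorem dualNormSq_eq_gram (hh : IsHermInner h) (B : Module.Basis ι ℂ V) {G : Matrix ι ι ℂ}
    (hG : ∀ i j, G i j = h (B i) (B j)) (hGu : IsUnit G.det) (f : Module.Dual ℂ V) :
    (dualNormSq (fun s t => h s t) f : ℂ) =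
      ∑ i, ∑ j, G⁻¹.transpose i j * f (B i) * conj (f (B j)) := by
  -- Coordinates of the vector representing f: f(B_i) = ∑ G_{ij} conj(τ_j) is solved by conj τ = G⁻¹
  -- f(B).
  set τ : ι → ℂ := fun j => conj (G⁻¹.mulVec (fun i => f (B i)) j) with hτ
  set t : V := ∑ j, τ j • B j with ht
  have hrep : ∀ s, f s = h s t := by
    intro s
    have : f = h.flip t := by
      refine B.ext fun i => ?_
      rw [LinearMap.flip_apply, ht, map_sum]
      have e : ∀ j, h (B i) (τ j • B j) = G i j * G⁻¹.mulVec (fun i => f (B i)) j := fun j => by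
        rw [LinearMap.map_smulₛₗ, smul_eq_mul, hG, hτ]; simp [mul_comm]
      simp only [e]
      change _ = (G.mulVec (G⁻¹.mulVec (fun i => f (B i)))) i
      rw [Matrix.mulVec_mulVec, Matrix.mul_nonsing_inv _ hGu, Matrix.one_mulVec]
    exact DFunLike.congr_fun this s
  have hherm : G.conjTranspose = G := by
    ext i j
    rw [Matrix.conjTranspose_apply, hG, hG, hh.symm (B i)]; rfl
  have hinv : ∀ i j, conj (G⁻¹ i j) = G⁻¹ j i := fun i j => by
    have : (G⁻¹).conjTranspose = G⁻¹ := by rw [Matrix.conjTranspose_nonsing_inv, hherm]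
    exact congrFun (congrFun this j) i
  rw [hh.dualNormSq_eq hrep, ← hh.self_eq_re, ← hrep, ht, map_sum]
  simp only [map_smul, smul_eq_mul, hτ, Matrix.mulVec, dotProduct, map_sum, map_mul, hinv,
    Finset.sum_mul]
  exact Finset.sum_congr rfl fun i _ => Finset.sum_congr rfl fun j _ => by
    rw [Matrix.transpose_apply]; ring

end IsHermInner

end Sesquilinear

/-! ### The symmetric power: monomial basis and induced inner product -/

section SymPower

variable {V : Type*} [AddCommGroup V] [Module ℂ V] {d r : ℕ}

/-- The Gram matrix of `Sym^d h` on monomials, in terms of that of `h`. -/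
def symGram (d : ℕ) {r : ℕ} (A : Matrix (Fin r) (Fin r) ℂ) :
    Matrix (Monomials d r) (Monomials d r) ℂ :=
  Matrix.of fun f g => (d.factorial : ℂ)⁻¹ * ∑ σ : Equiv.Perm (Fin d), ∏ i, A (f.1 i) (g.1 (σ i))

theorem symForm_monomials (h : V →ₗ[ℂ] V →ₛₗ[starRingEnd ℂ] ℂ) (b : Fin r → V)
    (f g : Monomials d r) :
    symForm h (SymmetricPower.tprod ℂ fun i => b (f.1 i))
      (SymmetricPower.tprod ℂ fun i => b (g.1 i)) =
      symGram d (Matrix.of fun i j => h (b i) (b j)) f g := by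
  rw [symForm_tprod]; rfl

/-- A monomial is the monotone enumeration of a multiset, and that enumeration is unique. -/
theorem monomials_eq_of_perm (f g : Monomials d r) (σ : Equiv.Perm (Fin d))
    (h : ∀ i, f.1 i = g.1 (σ i)) : f = g := by
  have h1 : f.1 = g.1 ∘ σ := funext h
  have := Tuple.unique_monotone (f := g.1) (σ := σ) (τ := 1) (by rw [← h1]; exact f.2) g.2
  exact Subtype.ext (h1.trans this)

theorem span_monomials (b : Module.Basis (Fin r) ℂ V) :
    ⊤ ≤ Submodule.span ℂ (Set.range fun f : Monomials d r =>
      SymmetricPower.tprod ℂ fun i => b (f.1 i)) := by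
  rw [← SymmetricPower.span_tprod_eq_top ℂ (Fin d) V, Submodule.span_le]
  rintro _ ⟨w, rfl⟩
  have hw : w = fun i => ∑ a, b.repr (w i) a • b a := funext fun i => (b.sum_repr (w i)).symm
  rw [hw, MultilinearMap.map_sum]
  refine Submodule.sum_mem _ fun c _ => ?_
  rw [MultilinearMap.map_smul_univ]
  refine Submodule.smul_mem _ _ (Submodule.subset_span ⟨⟨c ∘ Tuple.sort c,
    Tuple.monotone_sort c⟩, ?_⟩)
  exact SymmetricPower.tprod_equiv (Tuple.sort c) fun i => b (c i)

theorem symForm_conj_symm {h : V →ₗ[ℂ] V →ₛₗ[starRingEnd ℂ] ℂ}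
    (hh : ∀ s t, h s t = conj (h t s)) (s t : Sym[ℂ]^d V) :
    symForm h s t = conj (symForm h t s) := by
  have hspan := SymmetricPower.span_tprod_eq_top ℂ (Fin d) V
  have h1 : ∀ v w : Fin d → V, symForm h (SymmetricPower.tprod ℂ v) (SymmetricPower.tprod ℂ w) =
      conj (symForm h (SymmetricPower.tprod ℂ w) (SymmetricPower.tprod ℂ v)) := by
    intro v w
    rw [symForm_tprod, symForm_tprod]
    simp only [map_mul, map_inv₀, map_natCast, map_sum, map_prod]
    congr 1
    refine Fintype.sum_equiv (Equiv.inv _) _ _ fun σ => ?_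
    refine Fintype.prod_equiv σ _ _ fun i => ?_
    simp [← hh]
  have hs : s ∈ Submodule.span ℂ (Set.range (SymmetricPower.tprod ℂ (ι := Fin d) (M := V))) := by
    rw [hspan]; trivial
  have ht : t ∈ Submodule.span ℂ (Set.range (SymmetricPower.tprod ℂ (ι := Fin d) (M := V))) := by
    rw [hspan]; trivial
  induction hs using Submodule.span_induction with
  | zero => simp
  | add x y _ _ hx hy => simp [hx, hy]
  | smul c x _ hx => simp [hx]
  | mem x hx =>
    obtain ⟨v, rfl⟩ := hx
    induction ht using Submodule.span_induction with
    | zero => simp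
    | add x y _ _ hx hy => simp [hx, hy]
    | smul c x _ hx => simp [hx]
    | mem x hx => obtain ⟨w, rfl⟩ := hx; exact h1 v w

/-- A product of Kronecker deltas survives only for a permutation carrying g to f, and monotone
tuples related by a permutation coincide. So the monomials of an orthonormal basis are orthogonal,
which gives both the positivity of Sym^d h and the linear independence of monomials. -/
theorem symGram_one (f g : Monomials d r) : symGram d (1 : Matrix (Fin r) (Fin r) ℂ) f g =
    if f = g then (d.factorial : ℂ)⁻¹ *
      (Finset.univ.filter fun σ : Equiv.Perm (Fin d) => ∀ i, f.1 i = f.1 (σ i)).card else 0 := by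
  have hprod : ∀ σ : Equiv.Perm (Fin d), (∏ i, (1 : Matrix (Fin r) (Fin r) ℂ) (f.1 i) (g.1 (σ i))) =
      if ∀ i, f.1 i = g.1 (σ i) then 1 else 0 := fun σ => by
    simp only [Matrix.one_apply]
    rw [Finset.prod_ite_zero]
    simp
  simp only [symGram, Matrix.of_apply, hprod]
  split_ifs with hfg
  · subst hfg
    rw [Finset.sum_boole]
  · rw [Finset.sum_eq_zero, mul_zero]
    intro σ _
    rw [if_neg fun hσ => hfg (monomials_eq_of_perm f g σ hσ)]

theorem symGram_one_self_pos (f : Monomials d r) :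
    ∃ c : ℝ, 0 < c ∧ symGram d (1 : Matrix (Fin r) (Fin r) ℂ) f f = c := by
  rw [symGram_one, if_pos rfl]
  refine ⟨(d.factorial : ℝ)⁻¹ * (Finset.univ.filter fun σ : Equiv.Perm (Fin d) =>
    ∀ i, f.1 i = f.1 (σ i)).card, mul_pos (by positivity) ?_, by push_cast; rfl⟩
  exact_mod_cast Finset.card_pos.2 ⟨1, by simp⟩

theorem symForm_orthonormal {h : V →ₗ[ℂ] V →ₛₗ[starRingEnd ℂ] ℂ} (b : Fin r → V)
    (hb : ∀ i j, h (b i) (b j) = if i = j then 1 else 0) (a : Monomials d r → ℂ)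
    (g : Monomials d r) :
    symForm h (∑ f, a f • SymmetricPower.tprod ℂ fun i => b (f.1 i))
      (SymmetricPower.tprod ℂ fun i => b (g.1 i)) = a g * symGram d 1 g g := by
  have h1 : (Matrix.of fun i j => h (b i) (b j)) = (1 : Matrix (Fin r) (Fin r) ℂ) := by
    ext i j; simp [hb, Matrix.one_apply]
  rw [map_sum, LinearMap.sum_apply, Finset.sum_eq_single g]
  · simp [symForm_monomials, h1]
  · intro f _ hfg
    simp [symForm_monomials, h1, symGram_one, hfg]
  · simp

/-- The form induced on `Sym^d V` by a hermitian inner product is a hermitian inner product. -/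
theorem isHermInner_symForm [FiniteDimensional ℂ V] {h : V →ₗ[ℂ] V →ₛₗ[starRingEnd ℂ] ℂ}
    (hh : IsHermInner h) : IsHermInner (symForm (d := d) h) where
  symm := symForm_conj_symm hh.symm
  pos s hs := by
    obtain ⟨b, hb⟩ := hh.exists_orthonormal_basis
    have hmem : s ∈ Submodule.span ℂ (Set.range fun f : Monomials d _ =>
      SymmetricPower.tprod ℂ fun i => b (f.1 i)) := span_monomials b trivial
    obtain ⟨a, rfl⟩ := (Submodule.mem_span_range_iff_exists_fun ℂ).1 hmem
    have hval : symForm h (∑ f, a f • SymmetricPower.tprod ℂ fun i => b (f.1 i))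
        (∑ f, a f • SymmetricPower.tprod ℂ fun i => b (f.1 i)) =
        ∑ g, conj (a g) * (a g * symGram d 1 g g) := by
      conv_lhs => rw [map_sum]
      refine Finset.sum_congr rfl fun g _ => ?_
      rw [LinearMap.map_smulₛₗ, symForm_orthonormal _ hb]; rfl
    have hterm : ∀ g, ∃ c : ℝ, 0 < c ∧ conj (a g) * (a g * symGram d 1 g g) =
        (‖a g‖ ^ 2 * c : ℝ) := fun g => by
      obtain ⟨c, hc, h⟩ := symGram_one_self_pos g
      refine ⟨c, hc, ?_⟩
      rw [h, ← mul_assoc, mul_comm (conj _), Complex.mul_conj, Complex.normSq_eq_norm_sq]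
      push_cast; rfl
    choose c hc hterm using hterm
    rw [hval]
    simp only [hterm]
    rw [← Complex.ofReal_sum, Complex.ofReal_re]
    have hne : ∃ g, a g ≠ 0 := by
      by_contra hcon
      push Not at hcon
      exact hs (by simp [hcon])
    obtain ⟨g, hg⟩ := hne
    have hg' : 0 < ‖a g‖ := norm_pos_iff.2 hg
    refine Finset.sum_pos' (fun g _ => mul_nonneg (by positivity) (hc g).le)
      ⟨g, Finset.mem_univ g, mul_pos (by positivity) (hc g)⟩

/-- The hermitian form with Gram matrix `A` in the basis `b`. -/
def matForm {ι : Type*} [Fintype ι] (b : Module.Basis ι ℂ V) (A : Matrix ι ι ℂ) :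
    V →ₗ[ℂ] V →ₛₗ[starRingEnd ℂ] ℂ :=
  LinearMap.mk₂'ₛₗ (RingHom.id ℂ) (starRingEnd ℂ)
    (fun s t => ∑ i, ∑ j, b.repr s i * A i j * conj (b.repr t j))
    (fun s s' t => by simp [add_mul, Finset.sum_add_distrib])
    (fun c s t => by simp [Finset.mul_sum, mul_assoc])
    (fun s t t' => by simp [mul_add, Finset.sum_add_distrib])
    (fun c s t => by
      simp only [map_smul, Finsupp.smul_apply, smul_eq_mul, map_mul, Finset.mul_sum]
      exact Finset.sum_congr rfl fun i _ => Finset.sum_congr rfl fun j _ => by ring)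

theorem matForm_basis {ι : Type*} [Fintype ι] [DecidableEq ι] (b : Module.Basis ι ℂ V)
    (A : Matrix ι ι ℂ) (i j : ι) : matForm b A (b i) (b j) = A i j := by
  simp [matForm, Finsupp.single_apply]

theorem matForm_apply {ι : Type*} [Fintype ι] (b : Module.Basis ι ℂ V)
    (A : Matrix ι ι ℂ) (s t : V) : matForm b A s t = pairing A (b.repr s) (b.repr t) := rfl

/-- Pair a vanishing combination with one monomial, in the inner product for which b is orthonormal:
only one coefficient remains, times a positive number. -/
theorem linearIndependent_monomials (b : Module.Basis (Fin r) ℂ V) :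
    LinearIndependent ℂ (fun f : Monomials d r => SymmetricPower.tprod ℂ fun i => b (f.1 i)) := by
  rw [Fintype.linearIndependent_iff]
  intro a ha g
  have h1 := symForm_orthonormal (h := matForm b 1) b
    (fun i j => by rw [matForm_basis, Matrix.one_apply]) a g
  rw [ha, map_zero, LinearMap.zero_apply] at h1
  obtain ⟨c, hc, h⟩ := symGram_one_self_pos g
  rw [h] at h1
  have hc' : (c : ℂ) ≠ 0 := by exact_mod_cast hc.ne'
  exact (mul_eq_zero.1 h1.symm).resolve_right hc'

/-- The basis of monomials of `Sym^d V`. -/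
def symBasis (d : ℕ) (b : Module.Basis (Fin r) ℂ V) :
    Module.Basis (Monomials d r) ℂ (Sym[ℂ]^d V) :=
  Module.Basis.mk (linearIndependent_monomials b) (span_monomials b)

theorem symBasis_apply (b : Module.Basis (Fin r) ℂ V) (f : Monomials d r) :
    symBasis d b f = SymmetricPower.tprod ℂ fun i => b (f.1 i) := by
  simp [symBasis]

theorem powDual_symBasis (b : Module.Basis (Fin r) ℂ V) (v : Module.Dual ℂ V)
    (f : Monomials d r) : powDual d v (symBasis d b f) = ∏ i, v (b (f.1 i)) := by
  rw [symBasis_apply, powDual_tprod]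

/-- `|v^d|² = |v| ^ (2 * d)` for the norm induced by `Sym^d h`. -/
theorem dualNormSq_symForm [FiniteDimensional ℂ V] {h : V →ₗ[ℂ] V →ₛₗ[starRingEnd ℂ] ℂ}
    (hh : IsHermInner h) {v : Module.Dual ℂ V} {t : V} (ht : ∀ s, v s = h s t) :
    dualNormSq (fun s t => symForm (d := d) h s t) (powDual d v) = (h t t).re ^ d := by
  -- If t represents v, then the power t^d represents v^d: all d! permutations give the same
  -- product, and the normalisation 1/d! cancels their number.
  have hrep : ∀ s, powDual d v s = symForm h s (SymmetricPower.tprod ℂ fun _ => t) := by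
    intro s
    have : powDual d v = (symForm h).flip (SymmetricPower.tprod ℂ fun _ => t) := by
      refine LinearMap.ext_on (SymmetricPower.span_tprod_eq_top ℂ (Fin d) V) ?_
      rintro _ ⟨w, rfl⟩
      rw [powDual_tprod, LinearMap.flip_apply, symForm_tprod]
      simp only [ht]
      rw [Finset.sum_const, Finset.card_univ, Fintype.card_perm, Fintype.card_fin, nsmul_eq_mul,
        inv_mul_cancel_left₀ (by exact_mod_cast d.factorial_ne_zero)]
    exact DFunLike.congr_fun this s
  rw [(isHermInner_symForm hh).dualNormSq_eq hrep, symForm_tprod]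
  simp only [Finset.prod_const, Finset.card_univ, Fintype.card_fin, Finset.sum_const,
    Fintype.card_perm, nsmul_eq_mul]
  rw [inv_mul_cancel_left₀ (by exact_mod_cast d.factorial_ne_zero), hh.self_eq_re,
    ← Complex.ofReal_pow, Complex.ofReal_re]
  simp

end SymPower

/-! ### Fibre integrals as integrals over a compact shell -/

section HomogeneousIntegral

/-- A bump function on `ℝ`, supported in `(1, 3)`. -/
def radialBump : ContDiffBump (2 : ℝ) := ⟨1 / 2, 1, by norm_num, by norm_num⟩

theorem radialBump_eq_zero {x : ℝ} (hx : x ≤ 1 ∨ 3 ≤ x) : radialBump x = 0 := by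
  refine radialBump.zero_of_le_dist ?_
  rw [Real.dist_eq]
  change (1 : ℝ) ≤ _
  rcases hx with hx | hx
  · rw [abs_of_nonpos (by linarith)]; linarith
  · rw [abs_of_nonneg (by linarith)]; linarith

/-- The normalising constant of the radial integrals. -/
def radialConst : ℂ := ∫ z : ℂ, ((radialBump (‖z‖ ^ 2) / ‖z‖ ^ 2 : ℝ) : ℂ)

/-- The integrand is non-negative, has compact support, and is continuous because the bump vanishes
near z = 0. At |z|² = 2, the centre of the bump, it is positive. -/
theorem radialConst_ne_zero : radialConst ≠ 0 := by
  have hcont : Continuous fun z : ℂ => radialBump (‖z‖ ^ 2) / ‖z‖ ^ 2 := by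
    rw [continuous_iff_continuousAt]
    intro z
    rcases eq_or_ne z 0 with rfl | hz
    · have : (fun z : ℂ => radialBump (‖z‖ ^ 2) / ‖z‖ ^ 2) =ᶠ[nhds 0] fun _ => 0 := by
        filter_upwards [Metric.ball_mem_nhds (0 : ℂ) one_pos] with z hz
        rw [radialBump_eq_zero, zero_div]
        left
        have : ‖z‖ < 1 := by simpa using hz
        nlinarith [norm_nonneg z]
      exact continuousAt_const.congr this.symm
    · have : ‖z‖ ^ 2 ≠ 0 := by simpa using hz
      exact ContinuousAt.div (radialBump.continuous.comp (by fun_prop)).continuousAt (by fun_prop)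
        this
  have hsupp : HasCompactSupport fun z : ℂ => radialBump (‖z‖ ^ 2) / ‖z‖ ^ 2 := by
    refine HasCompactSupport.intro (isCompact_closedBall (0 : ℂ) 3) fun z hz => ?_
    rw [radialBump_eq_zero, zero_div]
    right
    have : 3 < ‖z‖ := by simpa using hz
    nlinarith
  have hpos := hcont.integral_pos_of_hasCompactSupport_nonneg_nonzero (μ := volume) hsupp
    (fun z => div_nonneg radialBump.nonneg (by positivity)) (x := (Real.sqrt 2 : ℂ)) (by
      have h2 : ‖(Real.sqrt 2 : ℂ)‖ ^ 2 = 2 := by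
        rw [Complex.norm_real, Real.norm_eq_abs, sq_abs]; exact Real.sq_sqrt (by norm_num)
      simp only [h2]
      rw [radialBump.one_of_mem_closedBall (by simpa using radialBump.rIn_pos.le)]
      norm_num)
  rw [radialConst, integral_complex_ofReal]
  exact_mod_cast hpos.ne'

/-- Complex-linear change of variables. -/
theorem integral_comp_complexLinear {r : ℕ} (L : (Fin r → ℂ) →ₗ[ℂ] (Fin r → ℂ))
    (hL : LinearMap.det L ≠ 0) (F : (Fin r → ℂ) → ℂ) :
    ((‖LinearMap.det L‖ ^ 2 : ℝ) : ℂ) * ∫ v, F (L v) = ∫ v, F v := by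
  set L' : (Fin r → ℂ) →ₗ[ℝ] (Fin r → ℂ) := L.restrictScalars ℝ with hL'
  -- The determinant of a complex linear map viewed as a real one is the squared modulus of the
  -- complex determinant.
  have hdet : LinearMap.det L' = ‖LinearMap.det L‖ ^ 2 := by
    rw [hL', LinearMap.det_restrictScalars, Algebra.norm_complex_apply, Complex.normSq_eq_norm_sq]
  have hpos : 0 < ‖LinearMap.det L‖ ^ 2 := by
    have := norm_pos_iff.2 hL
    positivity
  have hd0 : LinearMap.det L' ≠ 0 := by rw [hdet]; exact hpos.ne'
  have hmap := Measure.map_linearMap_addHaar_eq_smul_addHaar (volume : Measure (Fin r → ℂ)) hd0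
  let e := (LinearMap.equivOfDetNeZero L' hd0).toContinuousLinearEquiv.toHomeomorph
  have he : ∫ v, F (L v) = ∫ v, F v ∂(Measure.map L' volume) :=
    (e.measurableEmbedding.integral_map F).symm
  rw [he, hmap, integral_smul_measure, hdet, abs_of_pos (inv_pos.2 hpos),
    ENNReal.toReal_ofReal (inv_pos.2 hpos).le, Complex.real_smul]
  push_cast
  rw [mul_inv_cancel_left₀]
  exact_mod_cast hpos.ne'

theorem integral_comp_complexSmul {r : ℕ} {c : ℂ} (hc : c ≠ 0) (F : (Fin r → ℂ) → ℂ) :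
    (((‖c‖ ^ 2) ^ r : ℝ) : ℂ) * ∫ v, F (c • v) = ∫ v, F v := by
  have hd : LinearMap.det (c • (LinearMap.id : (Fin r → ℂ) →ₗ[ℂ] (Fin r → ℂ))) = c ^ r := by
    rw [LinearMap.det_smul]; simp
  have := integral_comp_complexLinear (c • LinearMap.id) (by rw [hd]; exact pow_ne_zero _ hc) F
  rw [hd, norm_pow, ← pow_mul, mul_comm r 2, pow_mul] at this
  exact this

variable {n : ℕ}

/-- The data of a homogeneous exhaustion function of `ℂ^{n+1} ∖ 0`. -/
structure IsNormSqLike (ν : (Fin (n + 1) → ℂ) → ℝ) : Prop where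
  cont : Continuous ν
  pos : ∀ v, v ≠ 0 → 0 < ν v
  hom : ∀ (c : ℂ) v, ν (c • v) = ‖c‖ ^ 2 * ν v

/-- Take the minimum over the unit sphere and scale by homogeneity. It follows that the sublevel
sets of ν are bounded. -/
theorem IsNormSqLike.lower_bound {ν : (Fin (n + 1) → ℂ) → ℝ} (hν : IsNormSqLike ν) :
    ∃ δ > 0, ∀ v, δ * ‖v‖ ^ 2 ≤ ν v := by
  have hne : (Metric.sphere (0 : Fin (n + 1) → ℂ) 1).Nonempty :=
    NormedSpace.sphere_nonempty.2 zero_le_one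
  obtain ⟨u, hu, hmin⟩ := (isCompact_sphere (0 : Fin (n + 1) → ℂ) 1).exists_isMinOn hne
    hν.cont.continuousOn
  have hu1 : ‖u‖ = 1 := by simpa using hu
  have hu0 : u ≠ 0 := fun h => by simp [h] at hu1
  refine ⟨ν u, hν.pos u hu0, fun v => ?_⟩
  rcases eq_or_ne v 0 with rfl | hv
  · have := hν.hom 0 0
    simp at this
    simp [this]
  have hvn : 0 < ‖v‖ := norm_pos_iff.2 hv
  have h1 : v = ((‖v‖ : ℂ)) • (((‖v‖ : ℂ))⁻¹ • v) := by
    rw [smul_smul, mul_inv_cancel₀ (by exact_mod_cast hvn.ne'), one_smul]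
  have h2 : ((‖v‖ : ℂ))⁻¹ • v ∈ Metric.sphere (0 : Fin (n + 1) → ℂ) 1 := by
    simp [norm_smul, hvn.ne']
  have h3 := hmin h2
  simp only [Set.mem_ofPred_eq] at h3
  conv_rhs => rw [h1]
  rw [hν.hom, Complex.norm_real, norm_norm, mul_comm]
  exact mul_le_mul_of_nonneg_left h3 (by positivity)

/-- The cut-off vanishes where ν ≤ 1, a neighbourhood of the only point at which f may be singular,
and where ν ≥ 3, which contains the complement of a ball. -/
theorem continuous_bump_mul {ν : (Fin (n + 1) → ℂ) → ℝ} (hν : IsNormSqLike ν)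
    {f : (Fin (n + 1) → ℂ) → ℂ} (hf : ContinuousOn f {0}ᶜ) :
    Continuous (fun v => (radialBump (ν v) : ℂ) * f v) ∧
      HasCompactSupport fun v => (radialBump (ν v) : ℂ) * f v := by
  constructor
  · rw [continuous_iff_continuousAt]
    intro v
    rcases eq_or_ne v 0 with rfl | hv
    · have h0 : ν 0 = 0 := by simpa using hν.hom 0 0
      have : (fun v => (radialBump (ν v) : ℂ) * f v) =ᶠ[nhds 0] fun _ => 0 := by
        filter_upwards [hν.cont.continuousAt.eventually (gt_mem_nhds (h0.trans_lt one_pos))] with v hv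
        rw [radialBump_eq_zero (Or.inl hv.le)]; simp
      exact continuousAt_const.congr this.symm
    · refine ContinuousAt.mul ?_ (hf.continuousAt (isOpen_compl_singleton.mem_nhds hv))
      exact (Complex.continuous_ofReal.comp (radialBump.continuous.comp hν.cont)).continuousAt
  · obtain ⟨δ, hδ, hb⟩ := hν.lower_bound
    refine HasCompactSupport.intro (isCompact_closedBall (0 : Fin (n + 1) → ℂ) (3 / δ + 1))
      fun v hv => ?_
    have h1 : 3 / δ + 1 < ‖v‖ := by simpa using hv
    have h2 : 0 < 3 / δ := by positivity
    have h3 : 3 / δ ≤ ‖v‖ ^ 2 := by nlinarith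
    rw [radialBump_eq_zero, Complex.ofReal_zero, zero_mul]
    right
    calc (3 : ℝ) = δ * (3 / δ) := by field_simp
      _ ≤ δ * ‖v‖ ^ 2 := mul_le_mul_of_nonneg_left h3 hδ.le
      _ ≤ ν v := hb v

/-- Integrals over affine coordinates of projective space as integrals over a spherical shell. -/
theorem integral_affine_eq {ν : (Fin (n + 1) → ℂ) → ℝ} (hν : IsNormSqLike ν)
    {f : (Fin (n + 1) → ℂ) → ℂ} (hf : ContinuousOn f {0}ᶜ)
    (hhom : ∀ c : ℂ, c ≠ 0 → ∀ ξ : Fin n → ℂ,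
      ((‖c‖ : ℂ) ^ 2) ^ (n + 1) * f (c • Fin.cons 1 ξ) = f (Fin.cons 1 ξ)) :
    Integrable (fun ξ : Fin n → ℂ => f (Fin.cons 1 ξ)) ∧
      ∫ v, (radialBump (ν v) : ℂ) * f v = radialConst * ∫ ξ : Fin n → ℂ, f (Fin.cons 1 ξ) := by
  set g : (Fin (n + 1) → ℂ) → ℂ := fun v => (radialBump (ν v) : ℂ) * f v with hg
  obtain ⟨hgc, hgs⟩ := continuous_bump_mul hν hf
  have hgi : Integrable g := hgc.integrable_of_hasCompactSupport hgs
  let e := MeasurableEquiv.piFinSuccAbove (fun _ : Fin (n + 1) => ℂ) 0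
  have hep : MeasurePreserving e := volume_preserving_piFinSuccAbove (fun _ => ℂ) 0
  have hes : ∀ q : ℂ × (Fin n → ℂ), e.symm q = Fin.cons q.1 q.2 := fun q => by
    simp [e, MeasurableEquiv.piFinSuccAbove, Fin.insertNthEquiv]
  have hgi' : Integrable (fun q : ℂ × (Fin n → ℂ) => g (Fin.cons q.1 q.2)) := by
    have := (hep.symm e).integrable_comp_of_integrable hgi
    simpa [Function.comp_def, hes] using this
  have hint : ∫ v, g v = ∫ c : ℂ, ∫ η : Fin n → ℂ, g (Fin.cons c η) := by
    rw [← (hep.symm e).integral_comp' (f := e.symm) g]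
    simp only [hes]
    exact integral_prod _ hgi'
  -- The substitution (c, η) = (c, cξ) in ℂ × ℂⁿ, with real Jacobian |c|^{2n}.
  set G : ℂ × (Fin n → ℂ) → ℂ := fun q => (((‖q.1‖ ^ 2) ^ n : ℝ) : ℂ) *
    g (Fin.cons q.1 (q.1 • q.2)) with hG
  have hGc : Continuous G := by
    have h1 : Continuous fun q : ℂ × (Fin n → ℂ) =>
        (Fin.cons q.1 (q.1 • q.2) : Fin (n + 1) → ℂ) := by
      refine continuous_pi fun i => ?_
      refine Fin.cases ?_ (fun i => ?_) i
      · simpa using continuous_fst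
      · simp only [Fin.cons_succ, Pi.smul_apply, smul_eq_mul]; fun_prop
    exact Continuous.mul (by fun_prop) (hgc.comp h1)
  have hscale : ∀ c : ℂ, c ≠ 0 → ∀ F : (Fin n → ℂ) → ℂ,
      ∫ ξ, (((‖c‖ ^ 2) ^ n : ℝ) : ℂ) * F (c • ξ) = ∫ η, F η := fun c hc F => by
    rw [integral_const_mul, integral_comp_complexSmul hc]
  have hae : ∀ᵐ c : ℂ, c ≠ 0 := by
    rw [ae_iff]; simp
  have hslice : ∀ᵐ c : ℂ, Integrable fun η : Fin n → ℂ => g (Fin.cons c η) :=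
    ((integrable_prod_iff hgi'.aestronglyMeasurable).1 hgi').1
  have hGi : Integrable G := by
    rw [Measure.volume_eq_prod, integrable_prod_iff hGc.aestronglyMeasurable]
    refine ⟨?_, ?_⟩
    · filter_upwards [hae, hslice] with c hc hs
      let L : (Fin n → ℂ) ≃L[ℝ] (Fin n → ℂ) :=
        ((LinearEquiv.smulOfNeZero ℂ (Fin n → ℂ) c hc).restrictScalars ℝ).toContinuousLinearEquiv
      have hd0 : LinearMap.det (L : (Fin n → ℂ) →ₗ[ℝ] (Fin n → ℂ)) ≠ 0 :=
        L.toLinearEquiv.isUnit_det'.ne_zero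
      have hm := Measure.map_linearMap_addHaar_eq_smul_addHaar
          (volume : Measure (Fin n → ℂ)) hd0
      have h1 : Integrable (fun η : Fin n → ℂ => g (Fin.cons c η))
          (Measure.map (L : (Fin n → ℂ) →ₗ[ℝ] (Fin n → ℂ)) volume) := by
        rw [hm]
        exact hs.smul_measure (by simp)
      exact Integrable.const_mul
        ((L.toHomeomorph.measurableEmbedding.integrable_map_iff).1 h1) (((‖c‖ ^ 2) ^ n : ℝ) : ℂ)
    · have h2 := ((integrable_prod_iff hgi'.aestronglyMeasurable).1 hgi').2
      refine h2.congr ?_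
      filter_upwards [hae] with c hc
      have := hscale c hc fun η => (‖g (Fin.cons c η)‖ : ℂ)
      have h3 : ∫ ξ : Fin n → ℂ, ‖G (c, ξ)‖ = ∫ η : Fin n → ℂ, ‖g (Fin.cons c η)‖ := by
        have hn : ∀ ξ : Fin n → ℂ, (((‖c‖ ^ 2) ^ n : ℝ) : ℂ) * (‖g (Fin.cons c (c • ξ))‖ : ℂ) =
            ((‖G (c, ξ)‖ : ℝ) : ℂ) := fun ξ => by
          simp only [hG, norm_mul]
          rw [Complex.norm_real, Real.norm_of_nonneg (by positivity)]
          push_cast; rfl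
        simp only [hn] at this
        rw [integral_complex_ofReal, integral_complex_ofReal] at this
        exact_mod_cast this
      exact h3.symm
  have hGint : ∫ v, g v = ∫ q, G q := by
    rw [hint, Measure.volume_eq_prod, integral_prod _ (by rwa [← Measure.volume_eq_prod])]
    refine integral_congr_ae ?_
    filter_upwards [hae] with c hc
    exact (hscale c hc fun η => g (Fin.cons c η)).symm
  -- By homogeneity |c|^{2n} f(c(1, ξ)) = |c|^{-2} f(1, ξ), so that c and ξ are coupled only through
  -- the argument of the cut-off.
  have hGval : ∀ ξ : Fin n → ℂ, (fun c : ℂ => G (c, ξ)) =ᵐ[volume] fun c =>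
      ((radialBump (‖c‖ ^ 2 * ν (Fin.cons 1 ξ)) / ‖c‖ ^ 2 : ℝ) : ℂ) * f (Fin.cons 1 ξ) := by
    intro ξ
    filter_upwards [hae] with c hc
    have hcons : (Fin.cons c (c • ξ) : Fin (n + 1) → ℂ) = c • Fin.cons 1 ξ := by
      ext i; refine Fin.cases ?_ (fun i => ?_) i <;> simp
    have hcn : (‖c‖ : ℂ) ≠ 0 := by simpa using hc
    simp only [hG, hg, hcons, hν.hom]
    rw [← hhom c hc ξ]
    push_cast
    field_simp
    ring
  -- The measure |c|^{-2} dc is invariant under dilations, hence the c-integral does not depend on a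
  -- = ν(1, ξ), nor on ν.
  have hrad : ∀ a : ℝ, 0 < a →
      ∫ c : ℂ, ((radialBump (‖c‖ ^ 2 * a) / ‖c‖ ^ 2 : ℝ) : ℂ) = radialConst := by
    intro a ha
    have ha' : (Real.sqrt a) ≠ 0 := (Real.sqrt_pos.2 ha).ne'
    have := Measure.integral_comp_smul (volume : Measure ℂ)
      (fun z : ℂ => ((radialBump (‖z‖ ^ 2) / ‖z‖ ^ 2 : ℝ) : ℂ)) (Real.sqrt a)
    rw [Complex.finrank_real_complex] at this
    have hsq : Real.sqrt a ^ 2 = a := Real.sq_sqrt ha.le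
    rw [hsq, abs_of_pos (inv_pos.2 ha)] at this
    have h2 : ∀ z : ℂ, ((radialBump (‖Real.sqrt a • z‖ ^ 2) / ‖Real.sqrt a • z‖ ^ 2 : ℝ) : ℂ) =
        ((a⁻¹ : ℝ) : ℂ) * ((radialBump (‖z‖ ^ 2 * a) / ‖z‖ ^ 2 : ℝ) : ℂ) := fun z => by
      rw [norm_smul, mul_pow, Real.norm_of_nonneg (Real.sqrt_nonneg a), hsq, ← Complex.ofReal_mul,
        mul_comm (‖z‖ ^ 2) a]
      congr 1
      field_simp
    simp only [h2] at this
    rw [integral_const_mul, Complex.real_smul] at this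
    have ha0 : ((a⁻¹ : ℝ) : ℂ) ≠ 0 := by exact_mod_cast (inv_pos.2 ha).ne'
    exact mul_left_cancel₀ ha0 this
  have hinner : ∀ ξ : Fin n → ℂ, ∫ c : ℂ, G (c, ξ) = radialConst * f (Fin.cons 1 ξ) := by
    intro ξ
    rw [integral_congr_ae (hGval ξ), integral_mul_const, hrad]
    refine hν.pos _ fun h => ?_
    have := congrFun h 0
    simp at this
  constructor
  -- Integrability over the affine chart is obtained from Fubini: the partial integral over c is a
  -- nonzero multiple of f(1, ξ).
  · have h1 := hGi.integral_prod_right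
    simp only [hinner] at h1
    have h2 := h1.const_mul radialConst⁻¹
    simpa [inv_mul_cancel_left₀ radialConst_ne_zero] using h2
  · rw [hGint, Measure.volume_eq_prod, integral_prod_symm _ (by rwa [← Measure.volume_eq_prod])]
    simp only [hinner]
    rw [integral_const_mul]

/-- Smooth dependence on parameters of integrals over a spherical shell. -/
theorem contDiffOn_integral_bump {P : Type*} [NormedAddCommGroup P] [NormedSpace ℝ P]
    {s : Set P} (hs : IsOpen s) {ν : (Fin (n + 1) → ℂ) → ℝ} (hν : IsNormSqLike ν)
    (hνs : ContDiff ℝ ∞ ν) {F : P → (Fin (n + 1) → ℂ) → ℂ}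
    (hF : ContDiffOn ℝ ∞ (fun q : P × (Fin (n + 1) → ℂ) => F q.1 q.2) (s ×ˢ {0}ᶜ)) :
    ContDiffOn ℝ ∞ (fun x => ∫ v, (radialBump (ν v) : ℂ) * F x v) s := by
  -- The integral is the value at 0 of the convolution of the constant function 1 with g, whence the
  -- reflection v ↦ −v. Smoothness in the parameter is that of convolutions whose support lies in a
  -- fixed compact set.
  set g : P → (Fin (n + 1) → ℂ) → ℂ := fun x v => (radialBump (ν (-v)) : ℂ) * F x (-v) with hg
  obtain ⟨δ, hδ, hb⟩ := hν.lower_bound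
  have hsupp : ∀ x, ∀ v, x ∈ s → v ∉ Metric.closedBall (0 : Fin (n + 1) → ℂ) (3 / δ + 1) →
      g x v = 0 := by
    intro x v _ hv
    have h1 : 3 / δ + 1 < ‖v‖ := by simpa using hv
    have h2 : 0 < 3 / δ := by positivity
    have h3 : 3 / δ ≤ ‖-v‖ ^ 2 := by rw [norm_neg]; nlinarith
    simp only [hg]
    rw [radialBump_eq_zero, Complex.ofReal_zero, zero_mul]
    right
    calc (3 : ℝ) = δ * (3 / δ) := by field_simp
      _ ≤ δ * ‖-v‖ ^ 2 := mul_le_mul_of_nonneg_left h3 hδ.le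
      _ ≤ ν (-v) := hb _
  have hgs : ContDiffOn ℝ ∞ (Function.uncurry g) (s ×ˢ Set.univ) := by
    rintro ⟨x, v⟩ ⟨hx, -⟩
    refine ContDiffAt.contDiffWithinAt ?_
    rcases eq_or_ne v 0 with rfl | hv
    · have h0 : ν (-0) = 0 := by simpa using hν.hom 0 0
      have : Function.uncurry g =ᶠ[nhds (x, 0)] fun _ => 0 := by
        have hc : ContinuousAt (fun q : P × (Fin (n + 1) → ℂ) => ν (-q.2)) (x, 0) :=
          (hν.cont.comp continuous_snd.neg).continuousAt
        filter_upwards [hc.eventually (gt_mem_nhds (h0.trans_lt one_pos))] with q hq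
        simp only [Function.uncurry, hg]
        rw [radialBump_eq_zero (Or.inl hq.le)]; simp
      exact contDiffAt_const.congr_of_eventuallyEq this
    · have hmem : s ×ˢ ({0}ᶜ : Set (Fin (n + 1) → ℂ)) ∈ nhds (x, -v) :=
        (hs.prod isOpen_compl_singleton).mem_nhds ⟨hx, by simpa using hv⟩
      have h1 : ContDiffAt ℝ ∞ (fun q : P × (Fin (n + 1) → ℂ) => F q.1 (-q.2)) (x, v) :=
        ContDiffAt.comp (g := fun q : P × (Fin (n + 1) → ℂ) => F q.1 q.2)
          (f := fun q : P × (Fin (n + 1) → ℂ) => (q.1, -q.2)) (x, v) (hF.contDiffAt hmem)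
          (by fun_prop)
      have h2 : ContDiff ℝ ∞ fun q : P × (Fin (n + 1) → ℂ) => (radialBump (ν (-q.2)) : ℂ) :=
        Complex.ofRealCLM.contDiff.comp (radialBump.contDiff.comp (hνs.comp (by fun_prop)))
      exact h2.contDiffAt.mul h1
  have hmain := contDiffOn_convolution_right_with_param (μ := volume)
    (f := fun _ : Fin (n + 1) → ℂ => (1 : ℝ)) (n := ⊤) (ContinuousLinearMap.lsmul ℝ ℝ) hs
    (isCompact_closedBall (0 : Fin (n + 1) → ℂ) (3 / δ + 1)) hsupp (locallyIntegrable_const _) hgs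
  have hcomp := hmain.comp (f := fun x : P => (x, (0 : Fin (n + 1) → ℂ)))
    (by fun_prop : ContDiffOn ℝ ∞ (fun x : P => (x, (0 : Fin (n + 1) → ℂ))) s)
    (fun x hx => ⟨hx, trivial⟩)
  refine hcomp.congr fun x _ => ?_
  simp [convolution, hg]

end HomogeneousIntegral

/-! ### The integrand as a function of finitely many jet coordinates -/

section Jets

variable {m n d r : ℕ}

/-- The monomial `∏ v_{f i}`. -/
def mon (f : Monomials d r) (v : Fin r → ℂ) : ℂ := ∏ i, v (f.1 i)

/-- The derivative of a monomial. -/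
def dmon (f : Monomials d r) (v : Fin r → ℂ) (i : Fin r) : ℂ := fderiv ℂ (mon f) v (Pi.single i 1)

theorem contDiff_mon (N : WithTop ℕ∞) (f : Monomials d r) : ContDiff ℂ N (mon f) :=
  contDiff_prod fun i _ => contDiff_apply ℂ ℂ (f.1 i)

theorem contDiff_dmon (N : ℕ∞) (f : Monomials d r) (i : Fin r) :
    ContDiff ℂ N (fun v => dmon f v i) :=
  ((contDiff_mon ∞ f).fderiv_right (m := N) (by exact_mod_cast le_top)).clm_apply contDiff_const

theorem mon_smul (f : Monomials d r) (c : ℂ) (v : Fin r → ℂ) : mon f (c • v) = c ^ d * mon f v := by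
  simp [mon, Finset.prod_mul_distrib]

/-- The function `∑ Q_{fg} v^f \overline{v^g}`. -/
def normVal (q : Monomials d r → Monomials d r → ℂ) (v : Fin r → ℂ) : ℂ :=
  ∑ f, ∑ g, q f g * mon f v * conj (mon g v)

theorem normVal_smul (q : Monomials d r → Monomials d r → ℂ) (c : ℂ) (v : Fin r → ℂ) :
    normVal q (c • v) = ((‖c‖ : ℂ) ^ 2) ^ d * normVal q v := by
  have hn : c ^ d * conj c ^ d = ((‖c‖ : ℂ) ^ 2) ^ d := by
    rw [← mul_pow, Complex.mul_conj, Complex.normSq_eq_norm_sq]; push_cast; rfl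
  simp only [normVal, mon_smul, map_mul, map_pow, ← hn, Finset.mul_sum]
  exact Finset.sum_congr rfl fun f _ => Finset.sum_congr rfl fun g _ => by ring

/-- The same with coefficients depending on `y`, as a function of `(y, v)`. -/
def normFun (Q : (Fin m → ℂ) → Matrix (Monomials d r) (Monomials d r) ℂ)
    (w : Fin m ⊕ Fin r → ℂ) : ℂ :=
  normVal (Q (w ∘ Sum.inl)) (w ∘ Sum.inr)

/-- Projection to the base coordinates. -/
def baseProj (m r : ℕ) : (Fin m ⊕ Fin r → ℂ) →L[ℂ] (Fin m → ℂ) :=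
  ContinuousLinearMap.pi fun a => ContinuousLinearMap.proj (Sum.inl a)

/-- Projection to the fibre coordinates. -/
def fibreProj (m r : ℕ) : (Fin m ⊕ Fin r → ℂ) →L[ℂ] (Fin r → ℂ) :=
  ContinuousLinearMap.pi fun a => ContinuousLinearMap.proj (Sum.inr a)

theorem baseProj_single_inl (a : Fin m) :
    baseProj m r (Pi.single (Sum.inl a) 1) = Pi.single a 1 := by
  ext b; simp [baseProj, Pi.single_apply]

theorem baseProj_single_inr (i : Fin r) : baseProj m r (Pi.single (Sum.inr i) 1) = 0 := by
  ext b; simp [baseProj]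

theorem fibreProj_single_inl (a : Fin m) : fibreProj m r (Pi.single (Sum.inl a) 1) = 0 := by
  ext b; simp [fibreProj]

theorem fibreProj_single_inr (i : Fin r) :
    fibreProj m r (Pi.single (Sum.inr i) 1) = Pi.single i 1 := by
  ext b; simp [fibreProj, Pi.single_apply]

theorem contDiffAt_normFun {N : ℕ∞} {Q : (Fin m → ℂ) → Matrix (Monomials d r) (Monomials d r) ℂ}
    {y : Fin m → ℂ} (hQ : ∀ f g, ContDiffAt ℝ N (fun z => Q z f g) y) (v : Fin r → ℂ) :
    ContDiffAt ℝ N (normFun Q) (Sum.elim y v) := by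
  have hmon : ∀ f : Monomials d r, ContDiffAt ℝ N
      (fun w : Fin m ⊕ Fin r → ℂ => mon f (w ∘ Sum.inr)) (Sum.elim y v) := fun f =>
    (((contDiff_mon _ f).comp (fibreProj m r).contDiff).restrict_scalars ℝ).contDiffAt
  refine ContDiffAt.sum fun f _ => ContDiffAt.sum fun g _ => ContDiffAt.mul (ContDiffAt.mul ?_
    (hmon f)) (Complex.conjCLE.contDiff.contDiffAt.comp _ (hmon g))
  exact ContDiffAt.comp (g := fun z => Q z f g) (f := fun w => w ∘ Sum.inl) (Sum.elim y v)
    (hQ f g) ((baseProj m r).contDiff.restrict_scalars ℝ).contDiffAt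

/-- The complex Hessian of `∑ Q_{fg}(y) v^f \overline{v^g}`. -/
theorem cHess_normFun {Q : (Fin m → ℂ) → Matrix (Monomials d r) (Monomials d r) ℂ}
    {y : Fin m → ℂ} (hQ : ∀ f g, ContDiffAt ℝ 2 (fun z => Q z f g) y) (v : Fin r → ℂ) :
    cHess (normFun Q) (Sum.elim y v) = Matrix.fromBlocks
      (Matrix.of fun a b => ∑ f, ∑ g, cHess (fun z => Q z f g) y a b * mon f v * conj (mon g v))
      (Matrix.of fun a j => ∑ f, ∑ g,
        del (fun z => Q z f g) y (Pi.single a 1) * mon f v * conj (dmon g v j))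
      (Matrix.of fun i b => ∑ f, ∑ g,
        delBar (fun z => Q z f g) y (Pi.single b 1) * dmon f v i * conj (mon g v))
      (Matrix.of fun i j => ∑ f, ∑ g, Q y f g * dmon f v i * conj (dmon g v j)) := by
  set p : Fin m ⊕ Fin r → ℂ := Sum.elim y v with hp
  have hpb : baseProj m r p = y := rfl
  have hpf : fibreProj m r p = v := rfl
  have hA : ∀ f g, ContDiffAt ℝ 2 (fun w => Q (baseProj m r w) f g) p := fun f g =>
    ContDiffAt.comp (g := fun z => Q z f g) (f := fun w => baseProj m r w) p
      (by rw [hpb]; exact hQ f g) ((baseProj m r).contDiff.restrict_scalars ℝ).contDiffAt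
  have hB : ∀ f : Monomials d r, ContDiffAt ℂ 2 (fun w => mon f (fibreProj m r w)) p := fun f =>
    ((contDiff_mon _ f).comp (fibreProj m r).contDiff).contDiffAt
  have hBr : ∀ f : Monomials d r, ContDiffAt ℝ 2 (fun w => mon f (fibreProj m r w)) p := fun f =>
    (hB f).restrict_scalars ℝ
  have hterm : ∀ f g, ContDiffAt ℝ 2 (fun w => Q (baseProj m r w) f g * mon f (fibreProj m r w) *
      conj (mon g (fibreProj m r w))) p := fun f g =>
    ((hA f g).mul (hBr f)).mul (Complex.conjCLE.contDiff.contDiffAt.comp _ (hBr g))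
  have hfd : ∀ (f : Monomials d r) u,
      fderiv ℂ (fun w => mon f (fibreProj m r w)) p u = fderiv ℂ (mon f) v (fibreProj m r u) := by
    intro f u
    have h1 : DifferentiableAt ℂ (mon f) (fibreProj m r p) :=
      (contDiff_mon 1 f).contDiffAt.differentiableAt (by simp)
    have := (h1.hasFDerivAt.comp p (fibreProj m r).hasFDerivAt).fderiv
    rw [hpf] at this
    exact DFunLike.congr_fun this u
  have hdel : ∀ f g u, del (fun w => Q (baseProj m r w) f g) p u =
      del (fun z => Q z f g) y (baseProj m r u) := fun f g u => by
    rw [del_comp (f := fun z => Q z f g) ((hQ f g).differentiableAt (by simp))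
      (baseProj m r).differentiableAt, (baseProj m r).fderiv, hpb]
  have hdelBar : ∀ f g u, delBar (fun w => Q (baseProj m r w) f g) p u =
      delBar (fun z => Q z f g) y (baseProj m r u) := fun f g u => by
    rw [delBar_comp (f := fun z => Q z f g) ((hQ f g).differentiableAt (by simp))
      (baseProj m r).differentiableAt, (baseProj m r).fderiv, hpb]
  have hmain : ∀ a b, cHess (normFun Q) p a b = ∑ f, ∑ g, (
      del (fun z => delBar (fun z => Q z f g) z (baseProj m r (Pi.single b 1))) y
        (baseProj m r (Pi.single a 1)) * mon f v * conj (mon g v) +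
      del (fun z => Q z f g) y (baseProj m r (Pi.single a 1)) * mon f v *
        conj (fderiv ℂ (mon g) v (fibreProj m r (Pi.single b 1))) +
      delBar (fun z => Q z f g) y (baseProj m r (Pi.single b 1)) *
        fderiv ℂ (mon f) v (fibreProj m r (Pi.single a 1)) * conj (mon g v) +
      Q y f g * fderiv ℂ (mon f) v (fibreProj m r (Pi.single a 1)) *
        conj (fderiv ℂ (mon g) v (fibreProj m r (Pi.single b 1)))) := by
    intro a b
    have h1 : cHess (normFun Q) p = ∑ f, ∑ g, cHess (fun w => Q (baseProj m r w) f g *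
        mon f (fibreProj m r w) * conj (mon g (fibreProj m r w))) p := by
      change cHess (fun w => ∑ f, ∑ g, Q (baseProj m r w) f g *
        mon f (fibreProj m r w) * conj (mon g (fibreProj m r w))) p = _
      rw [cHess_sum _ fun f _ => ContDiffAt.sum fun g _ => hterm f g]
      exact Finset.sum_congr rfl fun f _ => cHess_sum _ fun g _ => hterm f g
    rw [h1, Matrix.sum_apply]
    refine Finset.sum_congr rfl fun f _ => ?_
    rw [Matrix.sum_apply]
    refine Finset.sum_congr rfl fun g _ => ?_
    rw [cHess_mul_holo_conj (hA f g) (hB f) (hB g), hfd, hfd, hdel, hdelBar,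
      cHess_comp_linear (u := fun z => Q z f g) (baseProj m r) (by rw [hpb]; exact hQ f g), hpb,
      hpf]
  have hd0 : ∀ (g : (Fin m → ℂ) → ℂ) z, del g z 0 = 0 := fun g z => by simp [del]
  have hb0 : ∀ (g : (Fin m → ℂ) → ℂ) z, delBar g z 0 = 0 := fun g z => by simp [delBar]
  ext a b
  rw [hmain]
  rcases a with a | a <;> rcases b with b | b <;>
    simp [baseProj_single_inl, baseProj_single_inr, fibreProj_single_inl, fibreProj_single_inr,
      hd0, hb0, del_const, cHess, dmon]

/-- The index set of the components of a jet. -/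
def JetIdx (m d r : ℕ) : Type :=
  (Monomials d r × Monomials d r) ⊕ (Fin m × Monomials d r × Monomials d r) ⊕
  (Fin m × Monomials d r × Monomials d r) ⊕ (Fin m × Fin m × Monomials d r × Monomials d r) ⊕
  (Fin m × Fin m) ⊕ Unit

instance (m d r : ℕ) : Fintype (JetIdx m d r) :=
  inferInstanceAs (Fintype ((Monomials d r × Monomials d r) ⊕
    (Fin m × Monomials d r × Monomials d r) ⊕ (Fin m × Monomials d r × Monomials d r) ⊕
    (Fin m × Fin m × Monomials d r × Monomials d r) ⊕ (Fin m × Fin m) ⊕ Unit))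

/-- The space of the jets of the local data: the values of `Q`, `∂Q`, `∂̄Q`, `∂∂̄Q`, of the matrix of
the Kähler form, and `1/k`. -/
abbrev Jet (m d r : ℕ) : Type := JetIdx m d r → ℂ

namespace Jet

/-- The value component. -/
abbrev val (J : Jet m d r) (f g : Monomials d r) : ℂ := J (.inl (f, g))

/-- The `∂` component. -/
abbrev dz (J : Jet m d r) (a : Fin m) (f g : Monomials d r) : ℂ := J (.inr (.inl (a, f, g)))

/-- The `∂̄` component. -/
abbrev dzBar (J : Jet m d r) (a : Fin m) (f g : Monomials d r) : ℂ :=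
  J (.inr (.inr (.inl (a, f, g))))

/-- The `∂∂̄` component. -/
abbrev hess (J : Jet m d r) (a b : Fin m) (f g : Monomials d r) : ℂ :=
  J (.inr (.inr (.inr (.inl (a, b, f, g)))))

/-- The Kähler form component. -/
abbrev kah (J : Jet m d r) (a b : Fin m) : ℂ := J (.inr (.inr (.inr (.inr (.inl (a, b))))))

/-- The parameter component. -/
abbrev par (J : Jet m d r) : ℂ := J (.inr (.inr (.inr (.inr (.inr ())))))

end Jet

/-- The jet of the local data. -/
def jetOf (Q : (Fin m → ℂ) → Matrix (Monomials d r) (Monomials d r) ℂ)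
    (K : (Fin m → ℂ) → Matrix (Fin m) (Fin m) ℂ) (t : ℂ) (y : Fin m → ℂ) : Jet m d r :=
  Sum.elim (fun i => Q y i.1 i.2) <| Sum.elim
    (fun i => del (fun z => Q z i.2.1 i.2.2) y (Pi.single i.1 1)) <| Sum.elim
    (fun i => delBar (fun z => Q z i.2.1 i.2.2) y (Pi.single i.1 1)) <| Sum.elim
    (fun i => cHess (fun z => Q z i.2.2.1 i.2.2.2) y i.1 i.2.1) <| Sum.elim
    (fun i => K y i.1 i.2) fun _ => t

section

variable (Q : (Fin m → ℂ) → Matrix (Monomials d r) (Monomials d r) ℂ)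
  (K : (Fin m → ℂ) → Matrix (Fin m) (Fin m) ℂ) (t : ℂ) (y : Fin m → ℂ)

theorem jetOf_val : (jetOf Q K t y).val = fun f g => Q y f g := rfl

theorem jetOf_dz (a : Fin m) (f g : Monomials d r) :
    (jetOf Q K t y).dz a f g = del (fun z => Q z f g) y (Pi.single a 1) := rfl

theorem jetOf_dzBar (a : Fin m) (f g : Monomials d r) :
    (jetOf Q K t y).dzBar a f g = delBar (fun z => Q z f g) y (Pi.single a 1) := rfl

theorem jetOf_hess (a b : Fin m) (f g : Monomials d r) :
    (jetOf Q K t y).hess a b f g = cHess (fun z => Q z f g) y a b := rfl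

theorem jetOf_par : (jetOf Q K t y).par = t := rfl

end

/-- The matrix of the volume form of the total space, in terms of jets. -/
def jetMat (J : Jet m d r) (v : Fin r → ℂ) : Matrix (Fin m ⊕ Fin r) (Fin m ⊕ Fin r) ℂ :=
  Matrix.fromBlocks
    (Matrix.of fun a b => J.par * ((∑ f, ∑ g, J.hess a b f g * mon f v * conj (mon g v)) /
      normVal J.val v) + J.kah a b)
    (Matrix.of fun a j => J.par * ((∑ f, ∑ g, J.dz a f g * mon f v * conj (dmon g v j)) /
      normVal J.val v))
    (Matrix.of fun i b => (∑ f, ∑ g, J.dzBar b f g * dmon f v i * conj (mon g v)) / normVal J.val v)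
    (Matrix.of fun i j => (∑ f, ∑ g, J.val f g * dmon f v i * conj (dmon g v j)) / normVal J.val v)

/-- The integrand of the push-forward in homogeneous coordinates, in terms of jets. -/
def jetIntegrand (f₀ g₀ : Monomials d r) (J : Jet m d r) (v : Fin r → ℂ) : ℂ :=
  mon f₀ v * conj (mon g₀ v) / normVal J.val v *
    ((jetMat J v).det / (Matrix.of J.kah).det)

/-- The jets for which the integrand is defined. -/
def goodJets (m d r : ℕ) : Set (Jet m d r) :=
  {J | (Matrix.of J.kah).det ≠ 0 ∧ ∀ v : Fin r → ℂ, v ≠ 0 → normVal J.val v ≠ 0}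

/-- Multiplying the m base rows by t costs t^m and turns kK into K, since tk = 1. This absorbs the
factor k^{-m}: in `jetMat` the parameter enters polynomially, so t = 0, the limit of large k, is an
ordinary value. -/
theorem det_jetMat {Q : (Fin m → ℂ) → Matrix (Monomials d r) (Monomials d r) ℂ}
    {y : Fin m → ℂ} (hQ : ∀ f g, ContDiffAt ℝ 2 (fun z => Q z f g) y)
    (K : (Fin m → ℂ) → Matrix (Fin m) (Fin m) ℂ) {t k : ℂ} (htk : t * k = 1) (v : Fin r → ℂ) :
    (jetMat (jetOf Q K t y) v).det = t ^ m * ((normFun Q (Sum.elim y v))⁻¹ •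
      cHess (normFun Q) (Sum.elim y v) + Matrix.fromBlocks (k • K y) 0 0 0).det := by
  have h : jetMat (jetOf Q K t y) v =
      Matrix.diagonal (Sum.elim (fun _ : Fin m => t) (fun _ : Fin r => 1)) *
      ((normFun Q (Sum.elim y v))⁻¹ • cHess (normFun Q) (Sum.elim y v) +
        Matrix.fromBlocks (k • K y) 0 0 0) := by
    rw [cHess_normFun hQ]
    have hN : normFun Q (Sum.elim y v) = normVal (fun f g => Q y f g) v := rfl
    ext a b
    rw [Matrix.diagonal_mul]
    rcases a with a | a <;> rcases b with b | b
    · simp only [jetMat, jetOf_val, jetOf_hess, jetOf_par, hN, Matrix.fromBlocks_apply₁₁, Matrix.of_apply, Matrix.add_apply,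
        Matrix.smul_apply, smul_eq_mul, Sum.elim_inl, mul_add]
      rw [← mul_assoc t k, htk, one_mul, div_eq_inv_mul]
      rfl
    · simp only [jetMat, jetOf_val, jetOf_dz, jetOf_par, hN,
        Matrix.fromBlocks_apply₁₂, Matrix.of_apply, Matrix.add_apply,
        Matrix.smul_apply, smul_eq_mul, Sum.elim_inl, Matrix.zero_apply, add_zero]
      rw [div_eq_inv_mul]
    · simp only [jetMat, jetOf_val, jetOf_dzBar, hN, Matrix.fromBlocks_apply₂₁, Matrix.of_apply, Matrix.add_apply,
        Matrix.smul_apply, smul_eq_mul, Sum.elim_inr, Matrix.zero_apply, add_zero, one_mul]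
      rw [div_eq_inv_mul]
    · simp only [jetMat, jetOf_val, hN, Matrix.fromBlocks_apply₂₂, Matrix.of_apply, Matrix.add_apply,
        Matrix.smul_apply, smul_eq_mul, Sum.elim_inr, Matrix.zero_apply, add_zero, one_mul]
      rw [div_eq_inv_mul]
      rfl
  rw [h, Matrix.det_mul, Matrix.det_diagonal, Fintype.prod_sum_type]
  simp

theorem contDiffOn_det {P ι : Type*} [NormedAddCommGroup P] [NormedSpace ℝ P] [Fintype ι]
    [DecidableEq ι] {N : WithTop ℕ∞} {s : Set P} {M : P → Matrix ι ι ℂ}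
    (hM : ∀ a b, ContDiffOn ℝ N (fun x => M x a b) s) : ContDiffOn ℝ N (fun x => (M x).det) s := by
  simp only [Matrix.det_apply']
  exact ContDiffOn.sum fun σ _ => contDiffOn_const.mul (contDiffOn_prod fun i _ => hM _ _)

theorem contDiff_normVal : ContDiff ℝ ∞
    (fun q : Jet m d r × (Fin r → ℂ) => normVal q.1.val q.2) := by
  have hmon : ∀ f : Monomials d r, ContDiff ℝ ∞ (fun q : Jet m d r × (Fin r → ℂ) => mon f q.2) :=
    fun f => ((contDiff_mon ∞ f).restrict_scalars ℝ).comp contDiff_snd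
  have hc : ∀ f : Monomials d r, ContDiff ℝ ∞
      (fun q : Jet m d r × (Fin r → ℂ) => conj (mon f q.2)) := fun f =>
    Complex.conjCLE.contDiff.comp (hmon f)
  refine ContDiff.sum fun f _ => ContDiff.sum fun g _ => ContDiff.mul (ContDiff.mul ?_ (hmon f))
    (hc g)
  fun_prop

theorem contDiffOn_jetIntegrand (f₀ g₀ : Monomials d r) :
    ContDiffOn ℝ ∞ (fun q : Jet m d r × (Fin r → ℂ) => jetIntegrand f₀ g₀ q.1 q.2)
      (goodJets m d r ×ˢ {0}ᶜ) := by
  have hmon : ∀ f : Monomials d r, ContDiff ℝ ∞ (fun q : Jet m d r × (Fin r → ℂ) => mon f q.2) :=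
    fun f => ((contDiff_mon ∞ f).restrict_scalars ℝ).comp contDiff_snd
  have hcmon : ∀ f : Monomials d r, ContDiff ℝ ∞
      (fun q : Jet m d r × (Fin r → ℂ) => conj (mon f q.2)) := fun f =>
    Complex.conjCLE.contDiff.comp (hmon f)
  have hdmon : ∀ (f : Monomials d r) i, ContDiff ℝ ∞
      (fun q : Jet m d r × (Fin r → ℂ) => dmon f q.2 i) := fun f i =>
    ((contDiff_dmon ⊤ f i).restrict_scalars ℝ).comp contDiff_snd
  have hcdmon : ∀ (f : Monomials d r) i, ContDiff ℝ ∞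
      (fun q : Jet m d r × (Fin r → ℂ) => conj (dmon f q.2 i)) := fun f i =>
    Complex.conjCLE.contDiff.comp (hdmon f i)
  have hN0 : ∀ q ∈ goodJets m d r ×ˢ ({0}ᶜ : Set (Fin r → ℂ)), normVal q.1.val q.2 ≠ 0 :=
    fun q hq => hq.1.2 q.2 hq.2
  have hN := (contDiff_normVal (m := m) (d := d) (r := r)).contDiffOn
    (s := goodJets m d r ×ˢ ({0}ᶜ : Set (Fin r → ℂ)))
  have hinv : ContDiffOn ℝ ∞ (fun q : Jet m d r × (Fin r → ℂ) => (normVal q.1.val q.2)⁻¹)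
      (goodJets m d r ×ˢ {0}ᶜ) := hN.inv hN0
  have ht : ContDiff ℝ ∞ (fun q : Jet m d r × (Fin r → ℂ) => q.1.par) := by fun_prop
  have hquot : ∀ F : Jet m d r × (Fin r → ℂ) → ℂ, ContDiff ℝ ∞ F → ContDiffOn ℝ ∞
      (fun q => F q / normVal q.1.val q.2) (goodJets m d r ×ˢ {0}ᶜ) := fun F hF => by
    simp only [div_eq_mul_inv]
    exact hF.contDiffOn.mul hinv
  have hdet : ContDiffOn ℝ ∞ (fun q : Jet m d r × (Fin r → ℂ) => (jetMat q.1 q.2).det)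
      (goodJets m d r ×ˢ {0}ᶜ) := by
    refine contDiffOn_det fun a b => ?_
    rcases a with a | a <;> rcases b with b | b
    · simp only [jetMat, Matrix.fromBlocks_apply₁₁, Matrix.of_apply]
      refine (ht.contDiffOn.mul (hquot _ ?_)).add (ContDiff.contDiffOn (by fun_prop))
      exact ContDiff.sum fun f _ => ContDiff.sum fun g _ => ContDiff.mul (ContDiff.mul (by fun_prop)
        (hmon f)) (hcmon g)
    · simp only [jetMat, Matrix.fromBlocks_apply₁₂, Matrix.of_apply]
      refine ht.contDiffOn.mul (hquot _ ?_)
      exact ContDiff.sum fun f _ => ContDiff.sum fun g _ => ContDiff.mul (ContDiff.mul (by fun_prop)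
        (hmon f)) (hcdmon g b)
    · simp only [jetMat, Matrix.fromBlocks_apply₂₁, Matrix.of_apply]
      refine hquot _ ?_
      exact ContDiff.sum fun f _ => ContDiff.sum fun g _ => ContDiff.mul (ContDiff.mul (by fun_prop)
        (hdmon f a)) (hcmon g)
    · simp only [jetMat, Matrix.fromBlocks_apply₂₂, Matrix.of_apply]
      refine hquot _ ?_
      exact ContDiff.sum fun f _ => ContDiff.sum fun g _ => ContDiff.mul (ContDiff.mul (by fun_prop)
        (hdmon f a)) (hcdmon g b)
  have hκ : ContDiffOn ℝ ∞ (fun q : Jet m d r × (Fin r → ℂ) => (Matrix.of q.1.kah).det)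
      (goodJets m d r ×ˢ {0}ᶜ) :=
    contDiffOn_det fun a b => ContDiff.contDiffOn (by simp only [Matrix.of_apply]; fun_prop)
  have hκinv := hκ.inv fun q hq => hq.1.1
  unfold jetIntegrand
  refine (hquot _ ((hmon f₀).mul (hcmon g₀))).mul ?_
  simp only [div_eq_mul_inv]
  exact hdet.mul hκinv

/-- By homogeneity, non-vanishing off the origin only has to be tested on the unit sphere, and
non-vanishing on a compact set is an open condition on the coefficients. -/
theorem isOpen_goodJets : IsOpen (goodJets m d (n + 1)) := by
  rw [isOpen_iff_mem_nhds]
  rintro J ⟨h1, h2⟩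
  have hdet : ContinuousAt (fun J : Jet m d (n + 1) => (Matrix.of J.kah).det) J := by
    have : ContDiffOn ℝ 0 (fun J : Jet m d (n + 1) => (Matrix.of J.kah).det) Set.univ :=
      contDiffOn_det fun a b => ContDiff.contDiffOn (by simp only [Matrix.of_apply]; fun_prop)
    exact (contDiffOn_univ.1 this).continuous.continuousAt
  have hsph : ∀ᶠ J' in nhds J, ∀ v ∈ Metric.sphere (0 : Fin (n + 1) → ℂ) 1,
      normVal J'.val v ≠ 0 := by
    refine (isCompact_sphere (0 : Fin (n + 1) → ℂ) 1).eventually_forall_of_forall_eventually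
      fun v hv => ?_
    have hv0 : v ≠ 0 := fun h => by simp [h] at hv
    exact contDiff_normVal.continuous.continuousAt.eventually_ne (h2 v hv0)
  filter_upwards [hdet.eventually_ne h1, hsph] with J' h1' h2'
  refine ⟨h1', fun v hv => ?_⟩
  have hvn : (‖v‖ : ℂ) ≠ 0 := by simpa using hv
  have h3 : v = (‖v‖ : ℂ) • ((‖v‖ : ℂ)⁻¹ • v) := by rw [smul_smul, mul_inv_cancel₀ hvn, one_smul]
  rw [h3, normVal_smul]
  refine mul_ne_zero (pow_ne_zero _ (pow_ne_zero _ (by simpa using hv))) (h2' _ ?_)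
  simp [norm_smul, hv]

/-- The standard squared norm. -/
def stdNormSq (v : Fin r → ℂ) : ℝ := ∑ i, ‖v i‖ ^ 2

theorem isNormSqLike_stdNormSq : IsNormSqLike (stdNormSq : (Fin (n + 1) → ℂ) → ℝ) where
  cont := by unfold stdNormSq; fun_prop
  pos v hv := by
    obtain ⟨i, hi⟩ := Function.ne_iff.1 hv
    have : 0 < ‖v i‖ := norm_pos_iff.2 hi
    exact Finset.sum_pos' (fun i _ => by positivity) ⟨i, Finset.mem_univ i, by positivity⟩
  hom c v := by simp [stdNormSq, mul_pow, Finset.mul_sum]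

theorem contDiff_stdNormSq : ContDiff ℝ ∞ (stdNormSq : (Fin r → ℂ) → ℝ) := by
  refine ContDiff.sum fun i _ => ?_
  exact (contDiff_norm_sq ℝ).comp (contDiff_apply ℝ ℂ i)

/-- The push-forward integral in terms of jets. -/
def jetIntegral (f₀ g₀ : Monomials d (n + 1)) (J : Jet m d (n + 1)) : ℂ :=
  ∫ v, (radialBump (stdNormSq v) : ℂ) * jetIntegrand f₀ g₀ J v

/-- All differentiation under the integral sign is contained here: for each choice of data the
push-forward is this one function composed with the jet. -/
theorem contDiffOn_jetIntegral (f₀ g₀ : Monomials d (n + 1)) :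
    ContDiffOn ℝ ∞ (jetIntegral (m := m) f₀ g₀) (goodJets m d (n + 1)) :=
  contDiffOn_integral_bump isOpen_goodJets isNormSqLike_stdNormSq contDiff_stdNormSq
    (contDiffOn_jetIntegrand f₀ g₀)

end Jets

/-! ### Bounds on derivatives of compositions and of jets -/

section Bounds

variable {V P F : Type*} [NormedAddCommGroup V] [NormedSpace ℝ V] [NormedAddCommGroup P]
  [NormedSpace ℝ P] [NormedAddCommGroup F] [NormedSpace ℝ F]

/-- Derivatives of `g ∘ f` are bounded in terms of those of `f`, when `f` takes values in a compact
set. -/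
theorem exists_bound_iteratedFDeriv_comp {g : P → F} {U K : Set P} (hU : IsOpen U)
    (hg : ContDiffOn ℝ ∞ g U) (hK : IsCompact K) (hKU : K ⊆ U) (p : ℕ) (B : ℝ) :
    ∃ B' : ℝ, 0 ≤ B' ∧ ∀ (f : V → P) (y : V), ContDiffAt ℝ ∞ f y → f y ∈ K →
      (∀ i ≤ p, ‖iteratedFDeriv ℝ i f y‖ ≤ B) →
      ∀ i ≤ p, ‖iteratedFDeriv ℝ i (fun z => g (f z)) y‖ ≤ B' := by
  have h1 : ∀ i : ℕ, ∃ C : ℝ, ∀ q ∈ K, ‖iteratedFDerivWithin ℝ i g U q‖ ≤ C := fun i =>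
    hK.exists_bound_of_continuousOn ((hg.continuousOn_iteratedFDerivWithin
      (by exact_mod_cast le_top) hU.uniqueDiffOn).mono hKU)
  choose C hC using h1
  set C' := ∑ i ∈ Finset.range (p + 1), |C i|
  have hC' : ∀ i ≤ p, ∀ q ∈ K, ‖iteratedFDerivWithin ℝ i g U q‖ ≤ C' := fun i hi q hq =>
    (hC i q hq).trans ((le_abs_self _).trans (Finset.single_le_sum (f := fun i => |C i|)
      (fun _ _ => abs_nonneg _) (Finset.mem_range.2 (Nat.lt_succ_of_le hi))))
  -- The estimate for higher derivatives of a composition wants the j-th derivative of f bounded by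
  -- D^j; with D ≥ 1 the uniform bound B is enough for j ≥ 1.
  set D := max 1 B
  have hD1 : 1 ≤ D := le_max_left _ _
  have hC0 : 0 ≤ C' := Finset.sum_nonneg fun _ _ => abs_nonneg _
  refine ⟨p.factorial * C' * D ^ p, by positivity, fun f y hf hy hB i hi => ?_⟩
  -- The hypotheses on f concern a single point, so f is restricted to an open neighbourhood on
  -- which it is C^p and takes values in U.
  obtain ⟨u, hu, hfu⟩ := hf.contDiffOn (m := (p : WithTop ℕ∞)) (by exact_mod_cast le_top) (by simp)
  have hpre : f ⁻¹' U ∈ nhds y := hf.continuousAt.preimage_mem_nhds (hU.mem_nhds (hKU hy))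
  obtain ⟨s, hs, hso, hys⟩ := mem_nhds_iff.1 (Filter.inter_mem hu hpre)
  have h2 := norm_iteratedFDerivWithin_comp_le (n := i) (N := (p : WithTop ℕ∞))
    (hg.of_le (by exact_mod_cast le_top)) (hfu.mono fun z hz => (hs hz).1)
    (by exact_mod_cast hi) hU.uniqueDiffOn hso.uniqueDiffOn (fun z hz => (hs hz).2) hys
    (fun j hj => hC' j (hj.trans hi) _ hy) (D := D) (fun j hj hj' => by
      rw [iteratedFDerivWithin_of_isOpen j hso hys]
      exact (hB j (hj'.trans hi)).trans ((le_max_right _ _).trans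
        (le_self_pow₀ hD1 (by omega))))
  rw [iteratedFDerivWithin_of_isOpen i hso hys] at h2
  refine h2.trans ?_
  have : (i.factorial : ℝ) ≤ p.factorial := by exact_mod_cast Nat.factorial_le hi
  gcongr

theorem norm_iteratedFDeriv_pi_le {ι : Type*} [Fintype ι] {f : V → ι → F} {y : V} {i : ℕ} {B : ℝ}
    (hB : 0 ≤ B) (hf : ContDiffAt ℝ i f y)
    (h : ∀ a, ‖iteratedFDeriv ℝ i (fun z => f z a) y‖ ≤ B) : ‖iteratedFDeriv ℝ i f y‖ ≤ B := by
  refine ContinuousMultilinearMap.opNorm_le_bound hB fun v => ?_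
  refine (pi_norm_le_iff_of_nonneg (by positivity)).2 fun a => ?_
  have h1 := (ContinuousLinearMap.proj (R := ℝ) (φ := fun _ : ι => F) a).iteratedFDeriv_comp_left
    hf (i := i) le_rfl
  have h2 : iteratedFDeriv ℝ i f y v a = iteratedFDeriv ℝ i (fun z => f z a) y v := by
    change _ = iteratedFDeriv ℝ i ((ContinuousLinearMap.proj (R := ℝ) (φ := fun _ : ι => F) a) ∘ f)
      y v
    rw [h1]; rfl
  rw [h2]
  exact (ContinuousMultilinearMap.le_opNorm _ _).trans
    (mul_le_mul_of_nonneg_right (h a) (by positivity))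

theorem exists_bound_clm_fderiv (L : (V →L[ℝ] F) →L[ℝ] F) : ∃ C : ℝ, 0 ≤ C ∧ ∀ (f : V → F) y i,
    ContDiffAt ℝ ∞ f y →
    ‖iteratedFDeriv ℝ i (fun z => L (fderiv ℝ f z)) y‖ ≤ C * ‖iteratedFDeriv ℝ (i + 1) f y‖ := by
  refine ⟨‖L‖, L.opNorm_nonneg, fun f y i hf => ?_⟩
  have h1 : ContDiffAt ℝ i (fderiv ℝ f) y := hf.fderiv_right (by exact_mod_cast le_top)
  rw [← norm_iteratedFDeriv_fderiv]
  exact L.norm_iteratedFDeriv_comp_left h1 le_rfl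

theorem exists_bound_fderiv_comb (c : ℂ) (v w : V) : ∃ C : ℝ, 0 ≤ C ∧ ∀ (f : V → ℂ) y i,
    ContDiffAt ℝ ∞ f y →
    ‖iteratedFDeriv ℝ i (fun z => (1 / 2 : ℂ) * (fderiv ℝ f z v + c * fderiv ℝ f z w)) y‖ ≤
      C * ‖iteratedFDeriv ℝ (i + 1) f y‖ :=
  exists_bound_clm_fderiv ((1 / 2 : ℂ) • (ContinuousLinearMap.apply ℝ ℂ v + c •
    ContinuousLinearMap.apply ℝ ℂ w))

variable {κ : Type*} [Fintype κ] [DecidableEq κ]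

theorem exists_bound_del (v : κ → ℂ) : ∃ C : ℝ, 0 ≤ C ∧ ∀ (f : (κ → ℂ) → ℂ) y i,
    ContDiffAt ℝ ∞ f y →
    ‖iteratedFDeriv ℝ i (fun z => del f z v) y‖ ≤ C * ‖iteratedFDeriv ℝ (i + 1) f y‖ := by
  obtain ⟨C, hC, h⟩ := exists_bound_fderiv_comb (-Complex.I) v (Complex.I • v)
  refine ⟨C, hC, fun f y i hf => ?_⟩
  have := h f y i hf
  simp only [neg_mul, ← sub_eq_add_neg] at this
  exact this

theorem exists_bound_delBar (v : κ → ℂ) : ∃ C : ℝ, 0 ≤ C ∧ ∀ (f : (κ → ℂ) → ℂ) y i,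
    ContDiffAt ℝ ∞ f y →
    ‖iteratedFDeriv ℝ i (fun z => delBar f z v) y‖ ≤ C * ‖iteratedFDeriv ℝ (i + 1) f y‖ :=
  exists_bound_fderiv_comb Complex.I v (Complex.I • v)

variable {m d r : ℕ}

theorem contDiffAt_jetOf {Q : (Fin m → ℂ) → Matrix (Monomials d r) (Monomials d r) ℂ}
    {K : (Fin m → ℂ) → Matrix (Fin m) (Fin m) ℂ} {y : Fin m → ℂ} (t : ℂ)
    (hQ : ∀ f g, ContDiffAt ℝ ∞ (fun z => Q z f g) y)
    (hK : ∀ a b, ContDiffAt ℝ ∞ (fun z => K z a b) y) : ContDiffAt ℝ ∞ (jetOf Q K t) y := by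
  have h : ∀ {f : (Fin m → ℂ) → ℂ}, ContDiffAt ℝ ∞ f y → ∀ v, ContDiffAt ℝ ∞ (fun z => del f z v) y :=
    fun hf v => contDiffAt_del (by exact hf) v
  have h' : ∀ {f : (Fin m → ℂ) → ℂ}, ContDiffAt ℝ ∞ f y →
      ∀ v, ContDiffAt ℝ ∞ (fun z => delBar f z v) y :=
    fun hf v => contDiffAt_delBar (by exact hf) v
  refine contDiffAt_pi.2 fun i => ?_
  rcases i with ⟨f, g⟩ | ⟨a, f, g⟩ | ⟨a, f, g⟩ | ⟨a, b, f, g⟩ | ⟨a, b⟩ | _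
  · exact hQ f g
  · exact h (hQ f g) _
  · exact h' (hQ f g) _
  · exact h (h' (hQ f g) _) _
  · exact hK a b
  · exact contDiffAt_const

/-- Bounds for the derivatives of the jets of the local data. -/
theorem exists_bound_jetOf (m d r p : ℕ) (B : ℝ) (hB : 0 ≤ B) : ∃ B' : ℝ, 0 ≤ B' ∧
    ∀ (Q : (Fin m → ℂ) → Matrix (Monomials d r) (Monomials d r) ℂ)
    (K : (Fin m → ℂ) → Matrix (Fin m) (Fin m) ℂ) (t : ℂ) (y : Fin m → ℂ), ‖t‖ ≤ 1 →
    (∀ f g, ContDiffAt ℝ ∞ (fun z => Q z f g) y) → (∀ a b, ContDiffAt ℝ ∞ (fun z => K z a b) y) →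
    (∀ i ≤ p + 2, ∀ f g, ‖iteratedFDeriv ℝ i (fun z => Q z f g) y‖ ≤ B) →
    (∀ i ≤ p, ∀ a b, ‖iteratedFDeriv ℝ i (fun z => K z a b) y‖ ≤ B) →
    ∀ i ≤ p, ‖iteratedFDeriv ℝ i (jetOf Q K t) y‖ ≤ B' := by
  choose C₁ hC₁ h₁ using fun a : Fin m => exists_bound_del (Pi.single a (1 : ℂ) : Fin m → ℂ)
  choose C₂ hC₂ h₂ using fun a : Fin m => exists_bound_delBar (Pi.single a (1 : ℂ) : Fin m → ℂ)
  set D₁ := ∑ a, C₁ a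
  set D₂ := ∑ a, C₂ a
  have hD₁ : ∀ a, C₁ a ≤ D₁ := fun a => Finset.single_le_sum (fun a _ => hC₁ a) (Finset.mem_univ a)
  have hD₂ : ∀ a, C₂ a ≤ D₂ := fun a => Finset.single_le_sum (fun a _ => hC₂ a) (Finset.mem_univ a)
  have hD₁0 : 0 ≤ D₁ := Finset.sum_nonneg fun a _ => hC₁ a
  have hD₂0 : 0 ≤ D₂ := Finset.sum_nonneg fun a _ => hC₂ a
  -- In order, the summands serve Q and K, then ∂Q, ∂̄Q and ∂∂̄Q, and finally the parameter t with
  -- |t| ≤ 1.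
  refine ⟨B + D₁ * B + D₂ * B + D₁ * (D₂ * B) + 1, by positivity,
    fun Q K t y ht hQ hK hQB hKB i hi => ?_⟩
  refine norm_iteratedFDeriv_pi_le (by positivity)
    ((contDiffAt_jetOf t hQ hK).of_le (by exact_mod_cast le_top)) fun a => ?_
  have e0 := mul_nonneg hD₁0 hB
  have e1 := mul_nonneg hD₂0 hB
  have e2 := mul_nonneg hD₁0 e1
  have hdel : ∀ a f g i, i ≤ p + 1 →
      ‖iteratedFDeriv ℝ i (fun z => del (fun z => Q z f g) z (Pi.single a 1)) y‖ ≤ D₁ * B :=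
    fun a f g i hi => (h₁ a _ y i (hQ f g)).trans
      (mul_le_mul (hD₁ a) (hQB _ (by omega) f g) (norm_nonneg _) hD₁0)
  have hdelBar : ∀ a f g i, i ≤ p + 1 →
      ‖iteratedFDeriv ℝ i (fun z => delBar (fun z => Q z f g) z (Pi.single a 1)) y‖ ≤ D₂ * B :=
    fun a f g i hi => (h₂ a _ y i (hQ f g)).trans
      (mul_le_mul (hD₂ a) (hQB _ (by omega) f g) (norm_nonneg _) hD₂0)
  rcases a with ⟨f, g⟩ | ⟨a, f, g⟩ | ⟨a, f, g⟩ | ⟨a, b, f, g⟩ | ⟨a, b⟩ | _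
  · exact (hQB i (by omega) f g).trans (by linarith)
  · exact (hdel a f g i (by omega)).trans (by linarith)
  · exact (hdelBar a f g i (by omega)).trans (by linarith)
  · have h3 := h₁ a (fun z => delBar (fun z => Q z f g) z (Pi.single b 1)) y i
      (contDiffAt_delBar (by exact hQ f g) _)
    exact (h3.trans (mul_le_mul (hD₁ a) (hdelBar b f g _ (by omega)) (norm_nonneg _) hD₁0)).trans
      (by linarith)
  · exact (hKB i hi a b).trans (by linarith)
  · change ‖iteratedFDeriv ℝ i (fun _ => t) y‖ ≤ _
    rcases Nat.eq_zero_or_pos i with rfl | h0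
    · simp only [norm_iteratedFDeriv_zero]; linarith
    · rw [iteratedFDeriv_const_of_ne (by omega)]
      simp only [Pi.zero_apply, norm_zero]; positivity

end Bounds

/-! ### Matrices with positive definite hermitian part -/

section Accretive

variable {ι : Type*} [Fintype ι] [DecidableEq ι]

/-- Matrices whose hermitian part is positive definite. -/
def Accretive (G : Matrix ι ι ℂ) : Prop := ∀ a : ι → ℂ, a ≠ 0 → 0 < (pairing G a a).re

theorem pairing_eq_vecMul (G : Matrix ι ι ℂ) (a b : ι → ℂ) :
    pairing G a b = ∑ j, Matrix.vecMul a G j * conj (b j) := by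
  simp only [pairing, Matrix.vecMul, dotProduct, Finset.sum_mul]
  exact Finset.sum_comm

theorem pairing_eq_mulVec (G : Matrix ι ι ℂ) (a b : ι → ℂ) :
    pairing G a b = ∑ i, a i * G.mulVec (fun j => conj (b j)) i := by
  simp only [pairing, Matrix.mulVec, dotProduct, Finset.mul_sum, mul_assoc]

theorem pairing_smul (G : Matrix ι ι ℂ) (c c' : ℂ) (a b : ι → ℂ) :
    pairing G (c • a) (c' • b) = c * conj c' * pairing G a b := by
  simp only [pairing, Finset.mul_sum, Pi.smul_apply, smul_eq_mul, map_mul]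
  exact Finset.sum_congr rfl fun i _ => Finset.sum_congr rfl fun j _ => by ring

theorem pairing_smul_self (G : Matrix ι ι ℂ) (c : ℝ) (a : ι → ℂ) :
    (pairing G ((c : ℂ) • a) ((c : ℂ) • a)).re = c ^ 2 * (pairing G a a).re := by
  rw [pairing_smul, Complex.conj_ofReal, ← Complex.ofReal_mul, Complex.re_ofReal_mul, sq]

theorem Accretive.isUnit_det {G : Matrix ι ι ℂ} (hG : Accretive G) : IsUnit G.det := by
  rw [isUnit_iff_ne_zero]
  intro h
  obtain ⟨v, hv, hv0⟩ := Matrix.exists_vecMul_eq_zero_iff.2 h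
  have := hG v hv
  rw [pairing_eq_vecMul, hv0] at this
  simp at this

theorem continuousOn_re_pairing {Z : Type*} [TopologicalSpace Z] {s : Set Z}
    {G : Z → Matrix ι ι ℂ} {a : Z → ι → ℂ} (hG : ContinuousOn G s) (ha : ContinuousOn a s) :
    ContinuousOn (fun z => (pairing (G z) (a z) (a z)).re) s := by
  unfold pairing
  refine Complex.continuous_re.comp_continuousOn (continuousOn_finsetSum _ fun i _ =>
    continuousOn_finsetSum _ fun j _ => ?_)
  have h1 : ContinuousOn (fun z => G z i j) s := (continuous_apply_apply i j).comp_continuousOn hG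
  have h2 : ∀ i, ContinuousOn (fun z => a z i) s := fun i =>
    (continuous_apply i).comp_continuousOn ha
  exact ((h2 i).mul h1).mul (Complex.continuous_conj.comp_continuousOn (h2 j))

theorem accretive_iff_sphere (G : Matrix ι ι ℂ) :
    Accretive G ↔ ∀ a ∈ Metric.sphere (0 : ι → ℂ) 1, 0 < (pairing G a a).re := by
  refine ⟨fun h a ha => h a fun h0 => by simp [h0] at ha, fun h a ha => ?_⟩
  have hn : 0 < ‖a‖ := norm_pos_iff.2 ha
  have h1 := h (((‖a‖⁻¹ : ℝ) : ℂ) • a) (by simp [norm_smul, hn.ne'])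
  rw [pairing_smul_self] at h1
  exact (pos_iff_pos_of_mul_pos h1).1 (by positivity)

/-- Positivity is tested on the unit sphere, which is compact. Openness among all matrices,
hermitian or not, makes it possible to treat the entries of the data as independent coordinates. -/
theorem isOpen_accretive : IsOpen {G : Matrix ι ι ℂ | Accretive G} := by
  rw [isOpen_iff_mem_nhds]
  intro G hG
  have h : ∀ᶠ G' in nhds G, ∀ a ∈ Metric.sphere (0 : ι → ℂ) 1, 0 < (pairing G' a a).re :=
    (isCompact_sphere (0 : ι → ℂ) 1).eventually_forall_of_forall_eventually fun a ha =>
      (continuousOn_univ.1 (continuousOn_re_pairing (s := Set.univ) continuousOn_fst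
        continuousOn_snd)).continuousAt.eventually
        (lt_mem_nhds ((accretive_iff_sphere G).1 hG a ha))
  filter_upwards [h] with G' hG'
  exact (accretive_iff_sphere G').2 hG'

/-- A uniform lower bound over compact sets of accretive matrices. -/
theorem exists_norm_le_of_accretive {Z : Type*} [TopologicalSpace Z] {K : Set Z} (hK : IsCompact K)
    {G : Z → Matrix ι ι ℂ} (hG : ContinuousOn G K) (hacc : ∀ z ∈ K, Accretive (G z)) :
    ∃ C : ℝ, 0 ≤ C ∧ ∀ z ∈ K, ∀ a, (pairing (G z) a a).re ≤ 1 → ‖a‖ ≤ C := by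
  have hc : ContinuousOn (fun q : Z × (ι → ℂ) => ((pairing (G q.1) q.2 q.2).re)⁻¹)
      (K ×ˢ Metric.sphere 0 1) := by
    refine ContinuousOn.inv₀ ?_ fun q hq => ((accretive_iff_sphere _).1 (hacc _ hq.1) _ hq.2).ne'
    exact continuousOn_re_pairing (hG.comp continuousOn_fst fun q hq => hq.1) continuousOn_snd
  obtain ⟨C, hC⟩ := (hK.prod (isCompact_sphere (0 : ι → ℂ) 1)).exists_bound_of_continuousOn hc
  refine ⟨|C| + 1, by positivity, fun z hz a ha => ?_⟩
  rcases eq_or_ne a 0 with rfl | h0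
  · simp; positivity
  have hn : 0 < ‖a‖ := norm_pos_iff.2 h0
  have hs : ((‖a‖⁻¹ : ℝ) : ℂ) • a ∈ Metric.sphere (0 : ι → ℂ) 1 := by simp [norm_smul, hn.ne']
  have h1 := hC (z, ((‖a‖⁻¹ : ℝ) : ℂ) • a) ⟨hz, hs⟩
  have h2 := hacc z hz a h0
  simp only [pairing_smul_self] at h1
  rw [Real.norm_of_nonneg (by positivity)] at h1
  have h3 : ‖a‖ ^ 2 ≤ C := by
    refine le_trans ?_ h1
    rw [mul_inv, inv_pow, inv_inv]
    exact le_mul_of_one_le_right (by positivity) ((one_le_inv₀ h2).2 ha)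
  nlinarith [le_abs_self C, abs_nonneg C]

/-- Cramer's rule: an entry of the inverse is a quotient of determinants. -/
theorem contDiffOn_inv_entry {P : Type*} [NormedAddCommGroup P] [NormedSpace ℝ P] {N : WithTop ℕ∞}
    {s : Set P} {M : P → Matrix ι ι ℂ} (hM : ∀ a b, ContDiffOn ℝ N (fun x => M x a b) s)
    (hdet : ∀ x ∈ s, (M x).det ≠ 0) (a b : ι) : ContDiffOn ℝ N (fun x => (M x)⁻¹ a b) s := by
  have h1 : ∀ x, (M x)⁻¹ a b = (M x).det⁻¹ * ((M x).updateRow b (Pi.single a 1)).det := fun x => by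
    rw [Matrix.inv_def, Matrix.smul_apply, Matrix.adjugate_apply, Ring.inverse_eq_inv', smul_eq_mul]
  simp only [h1]
  refine ((contDiffOn_det hM).inv hdet).mul (contDiffOn_det fun i j => ?_)
  by_cases h : i = b
  · subst h; simp only [Matrix.updateRow_self]; exact contDiffOn_const
  · simp only [Matrix.updateRow_ne h]; exact hM i j

theorem contDiffOn_mul_entry {P : Type*} [NormedAddCommGroup P] [NormedSpace ℝ P] {N : WithTop ℕ∞}
    {s : Set P} {M M' : P → Matrix ι ι ℂ} (hM : ∀ a b, ContDiffOn ℝ N (fun x => M x a b) s)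
    (hM' : ∀ a b, ContDiffOn ℝ N (fun x => M' x a b) s) (a b : ι) :
    ContDiffOn ℝ N (fun x => (M x * M' x) a b) s := by
  simp only [Matrix.mul_apply]
  exact ContDiffOn.sum fun c _ => (hM a c).mul (hM' c b)

end Accretive

/-! ### Local data at a point and uniform positivity for small t -/

section Data

variable {d r : ℕ}

/-- `symGram d A` is the Gram matrix, on monomials, of Sym^d of the inner product on ℂ^r with matrix
A, and Sym^d of an inner product is positive. -/
theorem accretive_symGram {A : Matrix (Fin r) (Fin r) ℂ} (hA : A.IsHermitian) (hacc : Accretive A) :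
    Accretive (symGram d A) := by
  set b := Pi.basisFun ℂ (Fin r)
  have hh : IsHermInner (matForm b A) := by
    refine ⟨fun s t => ?_, fun s hs => hacc _ fun h => hs ?_⟩
    · rw [matForm_apply, matForm_apply, pairing, pairing, Finset.sum_comm]
      simp only [map_sum, map_mul, Complex.conj_conj]
      refine Finset.sum_congr rfl fun i _ => Finset.sum_congr rfl fun j _ => ?_
      rw [← hA.apply j i]
      simp only [RCLike.star_def]
      ring
    · ext i; simpa [b] using congrFun h i
  intro a ha
  have h1 := (isHermInner_symForm (d := d) hh).pos (∑ f, a f • symBasis d b f) (by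
    intro h0
    refine ha (funext fun f => ?_)
    simpa [Finsupp.single_apply] using congrArg (fun s => (symBasis d b).repr s f) h0)
  have h2 : symForm (d := d) (matForm b A) (∑ f, a f • symBasis d b f)
      (∑ f, a f • symBasis d b f) = pairing (symGram d A) a a := by
    simp only [map_sum, LinearMap.sum_apply, map_smulₛₗ, LinearMap.smul_apply,
      symBasis_apply, pairing]
    rw [Finset.sum_comm]
    refine Finset.sum_congr rfl fun f _ => ?_
    rw [Finset.smul_sum]
    refine Finset.sum_congr rfl fun g _ => ?_
    rw [symForm_monomials]
    have : (Matrix.of fun i j => matForm b A (b i) (b j)) = A := by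
      ext i j; simp [matForm_basis]
    rw [this]
    simp only [smul_eq_mul, RingHom.id_apply]; ring
  rwa [h2] at h1

theorem mon_ne_zero {v : Fin r → ℂ} (hv : v ≠ 0) :
    (fun f : Monomials d r => mon f v) ≠ 0 := by
  obtain ⟨i, hi⟩ := Function.ne_iff.1 hv
  intro h
  have := congrFun h ⟨fun _ => i, fun _ _ _ => le_rfl⟩
  simp only [mon, Finset.prod_const, Pi.zero_apply] at this
  exact pow_ne_zero _ hi this

/-- With u the vector of monomials of v and w = G⁻¹u, the value is the conjugate of the form G at
the conjugate of w. As u ≠ 0 also w ≠ 0, and accretivity makes the real part positive. -/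
theorem normVal_inv_ne_zero {G : Matrix (Monomials d r) (Monomials d r) ℂ} (hG : Accretive G)
    {v : Fin r → ℂ} (hv : v ≠ 0) : normVal (fun f g => G⁻¹.transpose f g) v ≠ 0 := by
  set u : Monomials d r → ℂ := fun f => mon f v
  set w := G⁻¹.mulVec u
  have hu : G.mulVec w = u := by
    rw [Matrix.mulVec_mulVec, Matrix.mul_nonsing_inv _ hG.isUnit_det, Matrix.one_mulVec]
  have hw : w ≠ 0 := fun h => mon_ne_zero (d := d) hv (by
    change u = 0
    rw [← hu, h, Matrix.mulVec_zero])
  have h1 := hG (fun f => conj (w f)) fun h => hw (by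
    ext f; simpa using congrFun h f)
  have h2 : normVal (fun f g => G⁻¹.transpose f g) v =
      conj (pairing G (fun f => conj (w f)) fun f => conj (w f)) := by
    rw [pairing_eq_mulVec]
    simp only [Complex.conj_conj, hu, map_sum, map_mul]
    unfold normVal
    rw [Finset.sum_comm]
    refine Finset.sum_congr rfl fun g _ => ?_
    change _ = G⁻¹.mulVec u g * conj (mon g v)
    simp only [Matrix.mulVec, dotProduct, Finset.sum_mul, Matrix.transpose_apply, u]
  rw [h2]
  intro h0
  have := congrArg Complex.re h0
  rw [Complex.conj_re] at this
  simp only [Complex.zero_re] at this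
  exact h1.ne' this

/-- The index set of the local data. -/
def DataIdx (d r : ℕ) : Type :=
  (Fin r × Fin r) ⊕ (Fin r × Fin r) ⊕ (Monomials d r × Monomials d r) ⊕ Unit

instance (d r : ℕ) : Fintype (DataIdx d r) :=
  inferInstanceAs (Fintype ((Fin r × Fin r) ⊕ (Fin r × Fin r) ⊕ (Monomials d r × Monomials d r) ⊕
    Unit))

instance (d r : ℕ) : DecidableEq (DataIdx d r) :=
  inferInstanceAs (DecidableEq ((Fin r × Fin r) ⊕ (Fin r × Fin r) ⊕
    (Monomials d r × Monomials d r) ⊕ Unit))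

/-- The values at a point of the matrices of the background metric, of the metric, and of the
form defined by the endomorphism, and the parameter `1/k`. -/
abbrev LocalData (d r : ℕ) : Type := DataIdx d r → ℂ

namespace LocalData

/-- The background metric. -/
def bg (D : LocalData d r) : Matrix (Fin r) (Fin r) ℂ := Matrix.of fun i j => D (.inl (i, j))

/-- The metric. -/
def met (D : LocalData d r) : Matrix (Fin r) (Fin r) ℂ := Matrix.of fun i j => D (.inr (.inl (i, j)))

/-- The form defined by the endomorphism. -/
def endo (D : LocalData d r) : Matrix (Monomials d r) (Monomials d r) ℂ :=
  Matrix.of fun f g => D (.inr (.inr (.inl (f, g))))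

/-- The parameter. -/
def par (D : LocalData d r) : ℂ := D (.inr (.inr (.inr ())))

/-- The Gram matrix of the twisted metric. -/
def gram (D : LocalData d r) : Matrix (Monomials d r) (Monomials d r) ℂ :=
  symGram d D.met + D.par • (D.endo * (symGram d D.bg)⁻¹ * symGram d D.met)

/-- The matrix of the dual of the twisted metric. -/
def invGram (D : LocalData d r) : Matrix (Monomials d r) (Monomials d r) ℂ := D.gram⁻¹.transpose

/-- The data for which the twisted metric is positive. -/
def good (d r : ℕ) : Set (LocalData d r) := {D | (symGram d D.bg).det ≠ 0 ∧ Accretive D.gram}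

/-- The collection of given matrices. -/
def mk (A₀ A : Matrix (Fin r) (Fin r) ℂ) (Ψ : Matrix (Monomials d r) (Monomials d r) ℂ) (t : ℂ) :
    LocalData d r :=
  Sum.elim (fun i => A₀ i.1 i.2) <| Sum.elim (fun i => A i.1 i.2) <|
    Sum.elim (fun i => Ψ i.1 i.2) fun _ => t

theorem contDiff_symGram {P : Type*} [NormedAddCommGroup P] [NormedSpace ℝ P] {N : WithTop ℕ∞}
    {s : Set P} {M : P → Matrix (Fin r) (Fin r) ℂ}
    (hM : ∀ a b, ContDiffOn ℝ N (fun x => M x a b) s) (f g : Monomials d r) :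
    ContDiffOn ℝ N (fun x => symGram d (M x) f g) s := by
  simp only [symGram, Matrix.of_apply]
  exact contDiffOn_const.mul (ContDiffOn.sum fun σ _ => contDiffOn_prod fun i _ => hM _ _)

theorem contDiffOn_bg (s : Set (LocalData d r)) (a b : Fin r) :
    ContDiffOn ℝ ∞ (fun D : LocalData d r => D.bg a b) s :=
  (contDiff_apply ℝ ℂ (.inl (a, b) : DataIdx d r)).contDiffOn

theorem contDiffOn_met (s : Set (LocalData d r)) (a b : Fin r) :
    ContDiffOn ℝ ∞ (fun D : LocalData d r => D.met a b) s :=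
  (contDiff_apply ℝ ℂ (.inr (.inl (a, b)) : DataIdx d r)).contDiffOn

theorem contDiffOn_endo (s : Set (LocalData d r)) (a b : Monomials d r) :
    ContDiffOn ℝ ∞ (fun D : LocalData d r => D.endo a b) s :=
  (contDiff_apply ℝ ℂ (.inr (.inr (.inl (a, b))) : DataIdx d r)).contDiffOn

theorem contDiffOn_par (s : Set (LocalData d r)) :
    ContDiffOn ℝ ∞ (fun D : LocalData d r => D.par) s :=
  (contDiff_apply ℝ ℂ (.inr (.inr (.inr ())) : DataIdx d r)).contDiffOn

theorem contDiffOn_gram (f g : Monomials d r) : ContDiffOn ℝ ∞ (fun D : LocalData d r => D.gram f g)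
    {D | (symGram d D.bg).det ≠ 0} := by
  simp only [gram, Matrix.add_apply, Matrix.smul_apply, smul_eq_mul]
  refine (contDiff_symGram (contDiffOn_met _) f g).add ((contDiffOn_par _).mul ?_)
  exact contDiffOn_mul_entry (contDiffOn_mul_entry (contDiffOn_endo _)
    (contDiffOn_inv_entry (contDiff_symGram (contDiffOn_bg _)) fun D hD => hD))
    (contDiff_symGram (contDiffOn_met _)) f g

theorem contDiffOn_invGram (f g : Monomials d r) :
    ContDiffOn ℝ ∞ (fun D : LocalData d r => D.invGram f g) (good d r) := by
  simp only [invGram, Matrix.transpose_apply]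
  exact contDiffOn_inv_entry (fun a b => (contDiffOn_gram a b).mono fun D hD => hD.1)
    (fun D hD => hD.2.isUnit_det.ne_zero) g f

theorem isOpen_good : IsOpen (good d r) := by
  have h0 : IsOpen {D : LocalData d r | (symGram d D.bg).det ≠ 0} := by
    have : ContDiffOn ℝ ∞ (fun D : LocalData d r => (symGram d D.bg).det) Set.univ :=
      contDiffOn_det (contDiff_symGram (contDiffOn_bg _))
    exact isOpen_ne.preimage (contDiffOn_univ.1 this).continuous
  have hc : ContinuousOn (fun D : LocalData d r => D.gram) {D | (symGram d D.bg).det ≠ 0} :=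
    continuousOn_pi.2 fun f => continuousOn_pi.2 fun g => (contDiffOn_gram f g).continuousOn
  exact hc.isOpen_inter_preimage h0 isOpen_accretive

theorem gram_of_par_zero {D : LocalData d r} (h : D.par = 0) : D.gram = symGram d D.met := by
  simp [gram, h]

/-- The twisted metric is uniformly positive when `k` is large. -/
theorem exists_compact {Z : Type*} [TopologicalSpace Z] {K : Set Z} (hK : IsCompact K)
    {A₀ : Z → Matrix (Fin r) (Fin r) ℂ} (hA₀ : ContinuousOn A₀ K)
    (hherm : ∀ y ∈ K, (A₀ y).IsHermitian) (hacc : ∀ y ∈ K, Accretive (A₀ y)) (B : ℝ) {l : ℝ}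
    (hl : 0 < l) :
    ∃ ε : ℝ, 0 < ε ∧ ∃ 𝒟 : Set (LocalData d r), IsCompact 𝒟 ∧ 𝒟 ⊆ good d r ∧
      ∀ y ∈ K, ∀ (A : Matrix (Fin r) (Fin r) ℂ) (Ψ : Matrix (Monomials d r) (Monomials d r) ℂ)
        (t : ℝ), 0 ≤ t → t ≤ ε → A.IsHermitian →
        (∀ a, l * (pairing (A₀ y) a a).re ≤ (pairing A a a).re) → (∀ i j, ‖A i j‖ ≤ B) →
        (∀ f g, ‖Ψ f g‖ ≤ B) → mk (A₀ y) A Ψ t ∈ 𝒟 := by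
  let parIdx : DataIdx d r := .inr (.inr (.inr ()))
  have hbgc : Continuous fun D : LocalData d r => D.bg :=
    continuous_pi fun i => continuous_pi fun j => continuous_apply _
  have hmetc : Continuous fun D : LocalData d r => D.met :=
    continuous_pi fun i => continuous_pi fun j => continuous_apply _
  have hpar : Continuous fun D : LocalData d r => D.par := continuous_apply _
  have himg : IsCompact (A₀ '' K) := hK.image_of_continuousOn hA₀
  obtain ⟨B₀, hB₀⟩ : ∃ B₀ : ℝ, ∀ y ∈ K, ∀ i j, ‖A₀ y i j‖ ≤ B₀ := by
    have : ∀ i j, ∃ C, ∀ y ∈ K, ‖A₀ y i j‖ ≤ C := fun i j => hK.exists_bound_of_continuousOn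
      ((continuous_apply_apply i j).comp_continuousOn hA₀)
    choose C hC using this
    refine ⟨∑ i, ∑ j, |C i j|, fun y hy i j => (hC i j y hy).trans ((le_abs_self _).trans ?_)⟩
    exact (Finset.single_le_sum (f := fun j => |C i j|) (fun _ _ => abs_nonneg _)
      (Finset.mem_univ j)).trans (Finset.single_le_sum (f := fun i => ∑ j, |C i j|)
      (fun _ _ => Finset.sum_nonneg fun _ _ => abs_nonneg _) (Finset.mem_univ i))
  -- The data with t = 0: closed and bounded, and good because the twisted metric is then Sym^d of a
  -- metric bounded below by l times the background. The inner `max B 0` keeps the bound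
  -- non-negative for the component t = 0.
  let 𝒟₀ : Set (LocalData d r) := {D | D.bg ∈ A₀ '' K ∧ D.met.IsHermitian ∧
    (∀ a, l * (pairing D.bg a a).re ≤ (pairing D.met a a).re) ∧ D.par = 0 ∧
    ∀ i, ‖D i‖ ≤ max B₀ (max B 0)}
  have hclosed : IsClosed 𝒟₀ := by
    have c1 : IsClosed {D : LocalData d r | D.met.IsHermitian} :=
      isClosed_eq hmetc.matrix_conjTranspose hmetc
    have c2 : IsClosed {D : LocalData d r |
        ∀ a, l * (pairing D.bg a a).re ≤ (pairing D.met a a).re} := by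
      simp only [Set.ofPred_forall]
      refine isClosed_iInter fun a => isClosed_le ?_ ?_
      · exact continuous_const.mul (continuousOn_univ.1
          (continuousOn_re_pairing hbgc.continuousOn continuousOn_const))
      · exact continuousOn_univ.1 (continuousOn_re_pairing hmetc.continuousOn continuousOn_const)
    have c3 : IsClosed {D : LocalData d r | ∀ i, ‖D i‖ ≤ max B₀ (max B 0)} := by
      simp only [Set.ofPred_forall]
      exact isClosed_iInter fun i => isClosed_le (continuous_apply i).norm continuous_const
    exact (himg.isClosed.preimage hbgc).inter (c1.inter (c2.inter
      ((isClosed_eq hpar continuous_const).inter c3)))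
  have hcomp : IsCompact 𝒟₀ := by
    refine Metric.isCompact_of_isClosed_isBounded hclosed
      ((Metric.isBounded_closedBall (x := (0 : LocalData d r)) (r := max B₀ (max B 0))).subset ?_)
    intro D hD
    rw [mem_closedBall_zero_iff]
    exact (pi_norm_le_iff_of_nonneg (by simp)).2 hD.2.2.2.2
  have hgood : 𝒟₀ ⊆ good d r := by
    rintro D ⟨⟨y, hy, hyD⟩, h2, h3, h4, -⟩
    refine ⟨?_, ?_⟩
    · rw [← hyD]
      exact (accretive_symGram (hherm y hy) (hacc y hy)).isUnit_det.ne_zero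
    · rw [gram_of_par_zero h4]
      refine accretive_symGram h2 fun a ha => lt_of_lt_of_le ?_ (h3 a)
      rw [← hyD]
      exact mul_pos hl (hacc y hy a ha)
  let shift : ℝ × LocalData d r → LocalData d r := fun q => q.2 + Pi.single parIdx (q.1 : ℂ)
  have hshift : Continuous shift := by
    refine continuous_snd.add (continuous_pi fun i => ?_)
    have : (fun q : ℝ × LocalData d r => (Pi.single parIdx (q.1 : ℂ) : LocalData d r) i) =
        fun q => if i = parIdx then (q.1 : ℂ) else 0 := by
      ext q; rw [Pi.single_apply]
    rw [this]
    split_ifs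
    · exact Complex.continuous_ofReal.comp continuous_fst
    · exact continuous_const
  -- Tube lemma: the good set is open and contains the compact set at t = 0, hence also all its
  -- translates by small t.
  have htube : ∀ᶠ t : ℝ in nhds 0, ∀ D ∈ 𝒟₀, shift (t, D) ∈ good d r := by
    refine hcomp.eventually_forall_of_forall_eventually fun D hD => ?_
    refine hshift.continuousAt.eventually (isOpen_good.mem_nhds ?_)
    simpa [shift] using hgood hD
  obtain ⟨ε, hε, hball⟩ := Metric.eventually_nhds_iff.1 htube
  -- Halving ε gives a closed interval of parameters inside the open ball, so that the image is
  -- compact.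
  refine ⟨ε / 2, by positivity, shift '' (Set.Icc 0 (ε / 2) ×ˢ 𝒟₀),
    (isCompact_Icc.prod hcomp).image hshift, ?_, ?_⟩
  · rintro _ ⟨⟨t, D⟩, ⟨ht, hD⟩, rfl⟩
    refine hball ?_ D hD
    rw [Real.dist_eq, sub_zero, abs_of_nonneg ht.1]
    linarith [ht.2]
  · intro y hy A Ψ t ht0 ht1 hA hAl hAB hΨB
    refine ⟨(t, mk (A₀ y) A Ψ 0), ⟨⟨ht0, ht1⟩, ⟨y, hy, rfl⟩, hA, hAl, rfl, ?_⟩, ?_⟩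
    · rintro (⟨i, j⟩ | ⟨i, j⟩ | ⟨f, g⟩ | _)
      · exact (hB₀ y hy i j).trans (le_max_left _ _)
      · exact (hAB i j).trans ((le_max_left _ _).trans (le_max_right _ _))
      · exact (hΨB f g).trans ((le_max_left _ _).trans (le_max_right _ _))
      · change ‖(0 : ℂ)‖ ≤ _
        simp
    · have hne : ∀ (D : LocalData d r) i, i ≠ parIdx → shift (t, D) i = D i := fun D i hi => by
        change D i + (Pi.single parIdx (t : ℂ) : LocalData d r) i = D i
        rw [Pi.single_eq_of_ne hi, add_zero]
      ext i
      rcases i with i | i | i | u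
      · exact hne _ _ Sum.inl_ne_inr
      · exact hne _ _ fun h => Sum.inl_ne_inr (Sum.inr.inj h)
      · exact hne _ _ fun h => Sum.inl_ne_inr (Sum.inr.inj (Sum.inr.inj h))
      · change 0 + (Pi.single parIdx (t : ℂ) : LocalData d r) parIdx = t
        rw [Pi.single_eq_same, zero_add]

end LocalData

end Data

/-! ### The estimate in a single chart -/

section LocalBound

variable {m n d : ℕ}

/-- The compact set of the jets occurring for bounded data. -/
theorem exists_compact_jets {𝒟 : Set (LocalData d (n + 1))} (h𝒟 : IsCompact 𝒟)
    (hgood : 𝒟 ⊆ LocalData.good d (n + 1)) (B : ℝ) {c : ℝ} (hc : 0 < c) :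
    ∃ 𝒥 : Set (Jet m d (n + 1)), IsCompact 𝒥 ∧ 𝒥 ⊆ goodJets m d (n + 1) ∧
      ∀ J : Jet m d (n + 1), ‖J‖ ≤ B → c ≤ ‖(Matrix.of J.kah).det‖ →
        (∃ D ∈ 𝒟, J.val = fun f g => D.invGram f g) → J ∈ 𝒥 := by
  let I : Set (Monomials d (n + 1) → Monomials d (n + 1) → ℂ) :=
    (fun D : LocalData d (n + 1) => fun f g => D.invGram f g) '' 𝒟
  have hI : IsCompact I := h𝒟.image_of_continuousOn (continuousOn_pi.2 fun f =>
    continuousOn_pi.2 fun g => (LocalData.contDiffOn_invGram f g).continuousOn.mono hgood)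
  have hval : Continuous fun J : Jet m d (n + 1) => J.val :=
    continuous_pi fun f => continuous_pi fun g => continuous_apply _
  have hdet : Continuous fun J : Jet m d (n + 1) => (Matrix.of J.kah).det :=
    Continuous.matrix_det (continuous_pi fun a => continuous_pi fun b => continuous_apply _)
  -- Boundedness alone would not keep `normVal` away from 0. The value component is therefore
  -- required to come from the compact set 𝒟, and the Kähler determinant to have modulus at least c.
  refine ⟨{J | J.val ∈ I} ∩ {J | c ≤ ‖(Matrix.of J.kah).det‖} ∩ Metric.closedBall 0 B, ?_, ?_, ?_⟩
  · exact (isCompact_closedBall _ _).inter_left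
      ((hI.isClosed.preimage hval).inter (isClosed_le continuous_const hdet.norm))
  · rintro J ⟨⟨⟨D, hD, hDJ⟩, h2⟩, -⟩
    refine ⟨fun h0 => ?_, fun v hv => ?_⟩
    · have : c ≤ 0 := by simpa [h0] using h2
      linarith
    · rw [← hDJ]
      exact normVal_inv_ne_zero (hgood hD).2 hv
  · rintro J hJ h2 ⟨D, hD, hDJ⟩
    exact ⟨⟨⟨D, hD, hDJ.symm⟩, h2⟩, by simpa using hJ⟩

/-- The local estimate: the derivatives of the fibre integral are bounded in terms of those of the
data. -/
theorem exists_local_bound {K : Set (Fin m → ℂ)} (hK : IsCompact K)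
    {A₀ : (Fin m → ℂ) → Matrix (Fin (n + 1)) (Fin (n + 1)) ℂ}
    (hA₀ : ∀ y ∈ K, ∀ i j, ContDiffAt ℝ ∞ (fun z => A₀ z i j) y)
    (hherm : ∀ y ∈ K, (A₀ y).IsHermitian) (hacc : ∀ y ∈ K, Accretive (A₀ y)) (p : ℕ) {B l c : ℝ}
    (hB : 0 ≤ B) (hl : 0 < l) (hc : 0 < c) :
    ∃ (ε C : ℝ), 0 < ε ∧ 0 ≤ C ∧ ∀ (A : (Fin m → ℂ) → Matrix (Fin (n + 1)) (Fin (n + 1)) ℂ)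
      (Ψ : (Fin m → ℂ) → Matrix (Monomials d (n + 1)) (Monomials d (n + 1)) ℂ)
      (N : (Fin m → ℂ) → Matrix (Fin m) (Fin m) ℂ) (t : ℝ) (y : Fin m → ℂ),
      0 ≤ t → t ≤ ε → y ∈ K →
      (∀ i j, ContDiffAt ℝ ∞ (fun z => A z i j) y) → (∀ f g, ContDiffAt ℝ ∞ (fun z => Ψ z f g) y) →
      (∀ a b, ContDiffAt ℝ ∞ (fun z => N z a b) y) →
      (∀ i ≤ p + 2, ∀ a b, ‖iteratedFDeriv ℝ i (fun z => A z a b) y‖ ≤ B) →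
      (∀ i ≤ p + 2, ∀ f g, ‖iteratedFDeriv ℝ i (fun z => Ψ z f g) y‖ ≤ B) →
      (∀ i ≤ p, ∀ a b, ‖iteratedFDeriv ℝ i (fun z => N z a b) y‖ ≤ B) →
      (A y).IsHermitian → (∀ a, l * (pairing (A₀ y) a a).re ≤ (pairing (A y) a a).re) →
      c ≤ ‖(N y).det‖ →
      LocalData.mk (A₀ y) (A y) (Ψ y) t ∈ LocalData.good d (n + 1) ∧
      ∀ f g, ∀ i ≤ p, ‖iteratedFDeriv ℝ i (fun z => jetIntegral f g
        (jetOf (fun z => (LocalData.mk (A₀ z) (A z) (Ψ z) t).invGram) N t z)) y‖ ≤ C := by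
  have hcont : ContinuousOn A₀ K := continuousOn_pi.2 fun i => continuousOn_pi.2 fun j y hy =>
    (hA₀ y hy i j).continuousAt.continuousWithinAt
  obtain ⟨ε, hε, 𝒟, h𝒟, hgood, hmem⟩ := LocalData.exists_compact (d := d) hK hcont hherm hacc B hl
  obtain ⟨B₀, hB₀⟩ : ∃ B₀ : ℝ, ∀ y ∈ K, ∀ s ≤ p + 2, ∀ i j,
      ‖iteratedFDeriv ℝ s (fun z => A₀ z i j) y‖ ≤ B₀ := by
    have : ∀ (s : ℕ) i j, ∃ C, ∀ y ∈ K, ‖iteratedFDeriv ℝ s (fun z => A₀ z i j) y‖ ≤ C :=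
      fun s i j => hK.exists_bound_of_continuousOn fun y hy =>
        ((hA₀ y hy i j).iteratedFDeriv_right (m := 0) (i := s)
          (by exact_mod_cast le_top)).continuousAt.continuousWithinAt
    choose C hC using this
    refine ⟨∑ s ∈ Finset.range (p + 3), ∑ i, ∑ j, |C s i j|, fun y hy s hs i j =>
      (hC s i j y hy).trans ((le_abs_self _).trans ?_)⟩
    refine (Finset.single_le_sum (f := fun j => |C s i j|) (fun _ _ => abs_nonneg _)
      (Finset.mem_univ j)).trans ?_
    refine (Finset.single_le_sum (f := fun i => ∑ j, |C s i j|)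
      (fun _ _ => Finset.sum_nonneg fun _ _ => abs_nonneg _) (Finset.mem_univ i)).trans ?_
    exact Finset.single_le_sum (f := fun s => ∑ i, ∑ j, |C s i j|)
      (fun _ _ => Finset.sum_nonneg fun _ _ => Finset.sum_nonneg fun _ _ => abs_nonneg _)
      (Finset.mem_range.2 (by omega))
  set B₁ := |B₀| + B + ε + 1
  have hB₁ : 0 ≤ B₁ := by positivity
  -- Two applications of the chain rule: from the data to Q at order p + 2, then from the jet to the
  -- integral at order p. Forming the jet in between costs two derivatives.
  have hq := fun f g : Monomials d (n + 1) => exists_bound_iteratedFDeriv_comp (V := Fin m → ℂ)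
    LocalData.isOpen_good (LocalData.contDiffOn_invGram f g) h𝒟 hgood (p + 2) B₁
  choose Bq hBq0 hBq using hq
  set B₂ := (∑ f, ∑ g, Bq f g) + B
  have hB₂ : 0 ≤ B₂ := add_nonneg (Finset.sum_nonneg fun f _ => Finset.sum_nonneg fun g _ =>
    hBq0 f g) hB
  have hBq2 : ∀ f g, Bq f g ≤ B₂ := fun f g => by
    have h1 := (Finset.single_le_sum (f := fun g => Bq f g) (fun g _ => hBq0 f g)
      (Finset.mem_univ g)).trans (Finset.single_le_sum (f := fun f => ∑ g, Bq f g)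
      (fun f _ => Finset.sum_nonneg fun g _ => hBq0 f g) (Finset.mem_univ f))
    simp only [B₂]; linarith
  obtain ⟨BJ, hBJ, hJ⟩ := exists_bound_jetOf m d (n + 1) p B₂ hB₂
  obtain ⟨𝒥, h𝒥, h𝒥good, h𝒥mem⟩ := exists_compact_jets (m := m) h𝒟 hgood BJ hc
  have hI := fun f g : Monomials d (n + 1) => exists_bound_iteratedFDeriv_comp (V := Fin m → ℂ)
    isOpen_goodJets (contDiffOn_jetIntegral (m := m) f g) h𝒥 h𝒥good p BJ
  choose BI hBI0 hBI using hI
  -- The bound t ≤ ε gives positivity of the twisted metric, and t ≤ 1 is required for the bound on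
  -- jets.
  refine ⟨min ε 1, ∑ f, ∑ g, BI f g, lt_min hε one_pos, Finset.sum_nonneg fun f _ =>
    Finset.sum_nonneg fun g _ => hBI0 f g, ?_⟩
  intro A Ψ N t y ht0 ht1 hy hA hΨ hN hAB hΨB hNB hAh hAl hdet
  have htε : t ≤ ε := ht1.trans (min_le_left _ _)
  have ht1' : t ≤ 1 := ht1.trans (min_le_right _ _)
  have hm : LocalData.mk (A₀ y) (A y) (Ψ y) t ∈ 𝒟 := hmem y hy (A y) (Ψ y) t ht0 htε hAh hAl
    (fun i j => by simpa using hAB 0 (by omega) i j) (fun f g => by simpa using hΨB 0 (by omega) f g)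
  refine ⟨hgood hm, fun f g i hi => ?_⟩
  have hDs : ContDiffAt ℝ ∞ (fun z => LocalData.mk (A₀ z) (A z) (Ψ z) t) y := by
    refine contDiffAt_pi.2 ?_
    rintro (⟨i, j⟩ | ⟨i, j⟩ | ⟨f, g⟩ | _)
    · exact hA₀ y hy i j
    · exact hA i j
    · exact hΨ f g
    · exact contDiffAt_const
  have hDB : ∀ i ≤ p + 2, ‖iteratedFDeriv ℝ i (fun z => LocalData.mk (A₀ z) (A z) (Ψ z) t) y‖ ≤
      B₁ := by
    intro i hi
    refine norm_iteratedFDeriv_pi_le hB₁ (hDs.of_le (by exact_mod_cast le_top)) ?_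
    have := abs_nonneg B₀
    rintro (⟨a, b⟩ | ⟨a, b⟩ | ⟨f, g⟩ | _)
    · refine (hB₀ y hy i hi a b).trans ((le_abs_self _).trans ?_)
      simp only [B₁]; linarith
    · refine (hAB i hi a b).trans ?_
      simp only [B₁]; linarith
    · refine (hΨB i hi f g).trans ?_
      simp only [B₁]; linarith
    · change ‖iteratedFDeriv ℝ i (fun _ => (t : ℂ)) y‖ ≤ _
      rcases Nat.eq_zero_or_pos i with rfl | h0
      · simp only [norm_iteratedFDeriv_zero, Complex.norm_real, Real.norm_of_nonneg ht0]
        simp only [B₁]; linarith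
      · rw [iteratedFDeriv_const_of_ne (by omega)]
        simpa using hB₁
  have hQs : ∀ f g, ContDiffAt ℝ ∞
      (fun z => (LocalData.mk (A₀ z) (A z) (Ψ z) t).invGram f g) y := fun f g =>
    ContDiffAt.comp (g := fun D : LocalData d (n + 1) => D.invGram f g) y
      ((LocalData.contDiffOn_invGram f g).contDiffAt
        (LocalData.isOpen_good.mem_nhds (hgood hm))) hDs
  have hQB : ∀ i ≤ p + 2, ∀ f g, ‖iteratedFDeriv ℝ i
      (fun z => (LocalData.mk (A₀ z) (A z) (Ψ z) t).invGram f g) y‖ ≤ B₂ := fun i hi f g =>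
    (hBq f g _ y hDs hm hDB i hi).trans (hBq2 f g)
  have htn : ‖(t : ℂ)‖ ≤ 1 := by
    rw [Complex.norm_real, Real.norm_of_nonneg ht0]; exact ht1'
  have hBB : B ≤ B₂ := le_add_of_nonneg_left (Finset.sum_nonneg fun f _ =>
    Finset.sum_nonneg fun g _ => hBq0 f g)
  have hJB := hJ (fun z => (LocalData.mk (A₀ z) (A z) (Ψ z) t).invGram) N t y htn hQs hN hQB
    fun i hi a b => (hNB i hi a b).trans hBB
  have hJs := contDiffAt_jetOf (t : ℂ) hQs hN
  have hJm := h𝒥mem (jetOf (fun z => (LocalData.mk (A₀ z) (A z) (Ψ z) t).invGram) N t y)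
    (by simpa using hJB 0 (Nat.zero_le _)) hdet ⟨_, hm, rfl⟩
  refine (hBI f g _ y hJs hJm hJB i hi).trans ?_
  exact (Finset.single_le_sum (f := fun g => BI f g) (fun g _ => hBI0 f g)
      (Finset.mem_univ g)).trans (Finset.single_le_sum (f := fun f => ∑ g, BI f g)
      (fun f _ => Finset.sum_nonneg fun g _ => hBI0 f g) (Finset.mem_univ f))

end LocalBound

/-! ### Change of frame on the symmetric power -/

section SymChange

variable {V : Type*} [AddCommGroup V] [Module ℂ V] {d r : ℕ}

/-- The monomial with given factors. -/
def sortMon (F : Fin d → Fin r) : Monomials d r := ⟨F ∘ Tuple.sort F, Tuple.monotone_sort F⟩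

/-- The matrix on monomials induced by a matrix. -/
def symMat (d : ℕ) {r : ℕ} (g : Matrix (Fin r) (Fin r) ℂ) :
    Matrix (Monomials d r) (Monomials d r) ℂ :=
  Matrix.of fun f h => ∑ F : Fin d → Fin r, if sortMon F = h then ∏ i, g (f.1 i) (F i) else 0

theorem tprod_sortMon (b : Fin r → V) (F : Fin d → Fin r) :
    SymmetricPower.tprod ℂ (fun i => b ((sortMon F).1 i)) =
      SymmetricPower.tprod ℂ fun i => b (F i) :=
  SymmetricPower.tprod_equiv (Tuple.sort F) fun i => b (F i)

/-- Expanding the product gives a sum over all index maps F; symmetry identifies the terms of F and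
of its sorted version. -/
theorem tprod_change {b b' : Fin r → V} {g : Matrix (Fin r) (Fin r) ℂ}
    (hg : ∀ i, b' i = ∑ j, g i j • b j) (f : Monomials d r) :
    (SymmetricPower.tprod ℂ fun i => b' (f.1 i) : Sym[ℂ]^d V) =
      ∑ h, symMat d g f h • SymmetricPower.tprod ℂ fun i => b (h.1 i) := by
  have h1 : (SymmetricPower.tprod ℂ fun i => b' (f.1 i) : Sym[ℂ]^d V) =
      ∑ F : Fin d → Fin r, (∏ i, g (f.1 i) (F i)) • SymmetricPower.tprod ℂ fun i => b (F i) := by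
    simp only [hg]
    rw [MultilinearMap.map_sum]
    exact Finset.sum_congr rfl fun F _ => MultilinearMap.map_smul_univ _ _ _
  rw [h1]
  simp only [symMat, Matrix.of_apply, Finset.sum_smul, ite_smul, zero_smul]
  rw [Finset.sum_comm]
  refine Finset.sum_congr rfl fun F _ => ?_
  rw [Finset.sum_ite_eq, if_pos (Finset.mem_univ _), tprod_sortMon]

end SymChange

/-! ### Holomorphic families of frames -/

section Frames

variable {m : ℕ} {X : Type*} [TopologicalSpace X] [ChartedSpace (Fin m → ℂ) X]
  {V : X → Type*} {ι : Type*} [Fintype ι] [DecidableEq ι] [∀ x, AddCommGroup (V x)]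
  [∀ x, Module ℂ (V x)]

/-- The domain of the frame labelled by `x₀`, as a subset of `X`. -/
def Frames.nbhd (fr : Frames m X V ι) (x₀ : X) : Set X :=
  {x | x ∈ (chartAt (Fin m → ℂ) x₀).source ∧ chartAt (Fin m → ℂ) x₀ x ∈ fr.dom x₀}

/-- The change of coordinates. -/
def coordChange (x₀ x₀' : X) (y : Fin m → ℂ) : Fin m → ℂ :=
  chartAt (Fin m → ℂ) x₀ ((chartAt (Fin m → ℂ) x₀').symm y)

/-- The part of the chart labelled by `x₀'` where also the frame labelled by `x₀` is defined. -/
def Frames.overlap (fr : Frames m X V ι) (x₀ x₀' : X) : Set (Fin m → ℂ) :=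
  fr.dom x₀' ∩ (chartAt (Fin m → ℂ) x₀').symm ⁻¹' fr.nbhd x₀

/-- Frames that depend holomorphically on the point. -/
structure Frames.IsHolo (fr : Frames m X V ι) : Prop where
  isOpen_dom : ∀ x₀, IsOpen (fr.dom x₀)
  dom_subset : ∀ x₀, fr.dom x₀ ⊆ (chartAt (Fin m → ℂ) x₀).target
  mem_dom : ∀ x₀, chartAt (Fin m → ℂ) x₀ x₀ ∈ fr.dom x₀
  basis : ∀ x₀, ∀ x ∈ fr.nbhd x₀, ∃ b : Module.Basis ι ℂ (V x), ∀ i, b i = fr.vec x₀ x i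
  change : ∀ x₀ x₀', ∃ g : X → Matrix ι ι ℂ,
    (∀ i j, DifferentiableOn ℂ (fun y => g ((chartAt (Fin m → ℂ) x₀').symm y) i j)
      (fr.overlap x₀ x₀')) ∧
    ∀ x ∈ fr.nbhd x₀ ∩ fr.nbhd x₀', ∀ i, fr.vec x₀' x i = ∑ j, g x i j • fr.vec x₀ x j

theorem isUnit_det_of_change {W : Type*} [AddCommGroup W] [Module ℂ W] (b b' : Module.Basis ι ℂ W)
    {g : Matrix ι ι ℂ} (hg : ∀ i, b' i = ∑ j, g i j • b j) : IsUnit g.det := by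
  have h : g = (b.toMatrix b').transpose := by
    ext i j
    rw [Matrix.transpose_apply, Module.Basis.toMatrix_apply, hg]
    simp [Finsupp.single_apply]
  rw [h, Matrix.det_transpose]
  have := b.invertibleToMatrix b'
  exact Matrix.isUnit_det_of_invertible _

namespace Frames.IsHolo

variable {fr : Frames m X V ι}

theorem symm_mem_nbhd (hfr : fr.IsHolo) {x₀ : X} {y : Fin m → ℂ} (hy : y ∈ fr.dom x₀) :
    (chartAt (Fin m → ℂ) x₀).symm y ∈ fr.nbhd x₀ := by
  have ht := hfr.dom_subset x₀ hy
  refine ⟨(chartAt (Fin m → ℂ) x₀).map_target ht, ?_⟩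
  rwa [(chartAt (Fin m → ℂ) x₀).right_inv ht]

theorem mem_nbhd_self (hfr : fr.IsHolo) (x₀ : X) : x₀ ∈ fr.nbhd x₀ := ⟨mem_chart_source _ x₀, hfr.mem_dom x₀⟩

theorem isOpen_nbhd (hfr : fr.IsHolo) (x₀ : X) : IsOpen (fr.nbhd x₀) :=
  (chartAt (Fin m → ℂ) x₀).isOpen_inter_preimage (hfr.isOpen_dom x₀)

theorem isOpen_overlap (hfr : fr.IsHolo) (x₀ x₀' : X) : IsOpen (fr.overlap x₀ x₀') := by
  have h := (chartAt (Fin m → ℂ) x₀').isOpen_inter_preimage_symm (hfr.isOpen_nbhd x₀)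
  have h2 : fr.overlap x₀ x₀' = fr.dom x₀' ∩ ((chartAt (Fin m → ℂ) x₀').target ∩
      (chartAt (Fin m → ℂ) x₀').symm ⁻¹' fr.nbhd x₀) := by
    ext y
    exact ⟨fun h => ⟨h.1, hfr.dom_subset _ h.1, h.2⟩, fun h => ⟨h.1, h.2.2⟩⟩
  rw [h2]
  exact (hfr.isOpen_dom x₀').inter h

theorem symm_coordChange {x₀ x₀' : X} {y : Fin m → ℂ} (hy : y ∈ fr.overlap x₀ x₀') :
    (chartAt (Fin m → ℂ) x₀).symm (coordChange x₀ x₀' y) = (chartAt (Fin m → ℂ) x₀').symm y :=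
  (chartAt (Fin m → ℂ) x₀).left_inv hy.2.1

theorem mapsTo_coordChange (x₀ x₀' : X) :
    Set.MapsTo (coordChange x₀ x₀') (fr.overlap x₀ x₀') (fr.dom x₀) := fun _ hy => hy.2.2

end Frames.IsHolo

theorem comps_eq_of_change {fr : Frames m X V ι} (T : ∀ x, V x →ₗ[ℂ] V x →ₛₗ[starRingEnd ℂ] ℂ)
    {x₀ x₀' : X} {y : Fin m → ℂ} (hy : y ∈ fr.overlap x₀ x₀') {g : Matrix ι ι ℂ}
    (hg : ∀ i, fr.vec x₀' ((chartAt (Fin m → ℂ) x₀').symm y) i =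
      ∑ j, g i j • fr.vec x₀ ((chartAt (Fin m → ℂ) x₀').symm y) j) :
    comps fr (fun x s t => T x s t) x₀' y =
      g * comps fr (fun x s t => T x s t) x₀ (coordChange x₀ x₀' y) * g.conjTranspose := by
  ext i j
  have h1 : ∀ a b, comps fr (fun x s t => T x s t) x₀ (coordChange x₀ x₀' y) a b =
      T ((chartAt (Fin m → ℂ) x₀').symm y) (fr.vec x₀ ((chartAt (Fin m → ℂ) x₀').symm y) a)
        (fr.vec x₀ ((chartAt (Fin m → ℂ) x₀').symm y) b) := by
    intro a b
    simp only [comps, Matrix.of_apply]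
    rw [Frames.IsHolo.symm_coordChange hy]
  simp only [Matrix.mul_apply, h1, Matrix.conjTranspose_apply, Finset.sum_mul]
  simp only [comps, Matrix.of_apply, hg, map_sum, LinearMap.sum_apply, map_smulₛₗ,
    LinearMap.smul_apply, smul_eq_mul, Finset.mul_sum, RCLike.star_def, RingHom.id_apply]
  refine Finset.sum_congr rfl fun b _ => Finset.sum_congr rfl fun a _ => by ring

end Frames

/-! ### Frames of E, of Sym^d E and of the tangent bundle -/

section BundleFrames

variable {m r d : ℕ} {X : Type*} [TopologicalSpace X] [ChartedSpace (Fin m → ℂ) X]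
  {E : X → Type*} [∀ x, AddCommGroup (E x)] [∀ x, Module ℂ (E x)]
  [∀ x, TopologicalSpace (E x)] [TopologicalSpace (TotalSpace (Fin r → ℂ) E)]
  [FiberBundle (Fin r → ℂ) E] [VectorBundle ℂ (Fin r → ℂ) E]

theorem mem_nbhd_bundleFrames {x₀ x : X} : x ∈ (bundleFrames E m r).nbhd x₀ ↔
    x ∈ (chartAt (Fin m → ℂ) x₀).source ∧ x ∈ (trivializationAt (Fin r → ℂ) E x₀).baseSet := by
  constructor
  · rintro ⟨h1, h2⟩
    have h3 := h2.2
    rw [Set.mem_preimage, (chartAt (Fin m → ℂ) x₀).left_inv h1] at h3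
    exact ⟨h1, h3⟩
  · rintro ⟨h1, h2⟩
    refine ⟨h1, (chartAt (Fin m → ℂ) x₀).map_source h1, ?_⟩
    rwa [Set.mem_preimage, (chartAt (Fin m → ℂ) x₀).left_inv h1]

/-- The basis of the fibre given by the frame. -/
def frameBasis {x₀ x : X} (hx : x ∈ (trivializationAt (Fin r → ℂ) E x₀).baseSet) :
    Module.Basis (Fin r) ℂ (E x) :=
  (trivializationAt (Fin r → ℂ) E x₀).basisAt (Pi.basisFun ℂ (Fin r)) hx

theorem frameBasis_apply {x₀ x : X} (hx : x ∈ (trivializationAt (Fin r → ℂ) E x₀).baseSet)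
    (i : Fin r) : frameBasis hx i = (bundleFrames E m r).vec x₀ x i :=
  ((trivializationAt (Fin r → ℂ) E x₀).localFrame_apply_of_mem_baseSet _ hx).symm

theorem frameBasis_repr {x₀ x : X} (hx : x ∈ (trivializationAt (Fin r → ℂ) E x₀).baseSet)
    (s : E x) (i : Fin r) : (frameBasis hx).repr s i =
      (trivializationAt (Fin r → ℂ) E x₀).linearMapAt ℂ x s i := by
  rw [frameBasis, Trivialization.basisAt, Module.Basis.map_repr, LinearEquiv.trans_apply,
    Pi.basisFun_repr, LinearEquiv.symm_symm, Trivialization.linearMapAt_apply, if_pos hx]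
  rfl

theorem vec_change {x₀ x₀' x : X} (hx : x ∈ (trivializationAt (Fin r → ℂ) E x₀).baseSet)
    (hx' : x ∈ (trivializationAt (Fin r → ℂ) E x₀').baseSet) (i : Fin r) :
    (bundleFrames E m r).vec x₀' x i = ∑ j, (trivializationAt (Fin r → ℂ) E x₀').coordChangeL ℂ
      (trivializationAt (Fin r → ℂ) E x₀) x (Pi.single i 1) j • (bundleFrames E m r).vec x₀ x j := by
  rw [← frameBasis_apply (m := m) hx']
  simp only [← frameBasis_apply (m := m) hx]
  rw [← (frameBasis hx).sum_repr (frameBasis hx' i)]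
  refine Finset.sum_congr rfl fun j _ => ?_
  congr 1
  rw [frameBasis_repr, Trivialization.linearMapAt_apply, if_pos hx,
    Trivialization.coordChangeL_apply _ _ ⟨hx', hx⟩]
  have : frameBasis hx' i = (trivializationAt (Fin r → ℂ) E x₀').symm x (Pi.single i 1) := by
    rw [frameBasis, Trivialization.basisAt, Module.Basis.map_apply, Pi.basisFun_apply]
    rfl
  rw [this]

variable [IsManifold 𝓘(ℂ, Fin m → ℂ) ω X]

theorem contDiffOn_coordChange (x₀ x₀' : X) : ContDiffOn ℂ ω (coordChange x₀ x₀')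
    ((chartAt (Fin m → ℂ) x₀').target ∩
      (chartAt (Fin m → ℂ) x₀').symm ⁻¹' (chartAt (Fin m → ℂ) x₀).source) := by
  have h1 : ContMDiffOn 𝓘(ℂ, Fin m → ℂ) 𝓘(ℂ, Fin m → ℂ) ω (chartAt (Fin m → ℂ) x₀)
    (chartAt (Fin m → ℂ) x₀).source := contMDiffOn_chart
  have h2 : ContMDiffOn 𝓘(ℂ, Fin m → ℂ) 𝓘(ℂ, Fin m → ℂ) ω (chartAt (Fin m → ℂ) x₀').symm
    (chartAt (Fin m → ℂ) x₀').target := contMDiffOn_chart_symm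
  exact contMDiffOn_iff_contDiffOn.1 (h1.comp (h2.mono Set.inter_subset_left)
    Set.inter_subset_right)

theorem isHolo_bundleFrames [ContMDiffVectorBundle ω (Fin r → ℂ) E 𝓘(ℂ, Fin m → ℂ)] :
    (bundleFrames E m r).IsHolo where
  isOpen_dom x₀ := (chartAt (Fin m → ℂ) x₀).isOpen_inter_preimage_symm
    (trivializationAt (Fin r → ℂ) E x₀).open_baseSet
  dom_subset x₀ := Set.inter_subset_left
  mem_dom x₀ := (mem_nbhd_bundleFrames.2 ⟨mem_chart_source _ x₀,
    FiberBundle.mem_baseSet_trivializationAt' x₀⟩).2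
  basis x₀ x hx := ⟨frameBasis (mem_nbhd_bundleFrames.1 hx).2, fun i => frameBasis_apply _ i⟩
  change x₀ x₀' := by
    refine ⟨fun x => Matrix.of fun i j => (trivializationAt (Fin r → ℂ) E x₀').coordChangeL ℂ
      (trivializationAt (Fin r → ℂ) E x₀) x (Pi.single i 1) j, fun i j => ?_, fun x hx i => ?_⟩
    · have h1 := contMDiffOn_coordChangeL (n := ω) (IB := 𝓘(ℂ, Fin m → ℂ)) (𝕜 := ℂ)
        (trivializationAt (Fin r → ℂ) E x₀') (trivializationAt (Fin r → ℂ) E x₀)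
      have h2 : ContMDiffOn 𝓘(ℂ, Fin m → ℂ) 𝓘(ℂ, Fin m → ℂ) ω (chartAt (Fin m → ℂ) x₀').symm
        (chartAt (Fin m → ℂ) x₀').target := contMDiffOn_chart_symm
      have h3 := contMDiffOn_iff_contDiffOn.1 (h1.comp
        (t := (trivializationAt (Fin r → ℂ) E x₀').baseSet ∩
          (trivializationAt (Fin r → ℂ) E x₀).baseSet)
        (h2.mono (show (bundleFrames E m r).overlap x₀ x₀' ⊆ _ from fun y hy => hy.1.1))
        fun y hy => ⟨hy.1.2, (mem_nbhd_bundleFrames.1 hy.2).2⟩)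
      have h4 := (h3.differentiableOn (by simp)).clm_apply
        (differentiableOn_const (Pi.single i 1 : Fin r → ℂ))
      exact differentiableOn_pi.1 h4 j
    · exact vec_change (mem_nbhd_bundleFrames.1 hx.1).2 (mem_nbhd_bundleFrames.1 hx.2).2 i

theorem isHolo_symFrames [ContMDiffVectorBundle ω (Fin r → ℂ) E 𝓘(ℂ, Fin m → ℂ)] :
    (symFrames E m r d).IsHolo where
  isOpen_dom := isHolo_bundleFrames.isOpen_dom
  dom_subset := isHolo_bundleFrames.dom_subset
  mem_dom := isHolo_bundleFrames.mem_dom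
  basis x₀ x hx := by
    obtain ⟨b, hb⟩ := isHolo_bundleFrames.basis x₀ x hx
    exact ⟨symBasis d b, fun f => by simp only [symBasis_apply, hb]; rfl⟩
  change x₀ x₀' := by
    obtain ⟨g, hg, hgc⟩ := (isHolo_bundleFrames (E := E) (m := m) (r := r)).change x₀ x₀'
    -- The entries of the induced transition matrix are sums of products of entries of g, hence
    -- holomorphic.
    refine ⟨fun x => symMat d (g x), fun f h => ?_, fun x hx f => tprod_change (hgc x hx) f⟩
    simp only [symMat, Matrix.of_apply]
    refine DifferentiableOn.fun_sum fun F _ => ?_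
    split_ifs
    · exact fun y hy => (HasFDerivWithinAt.finsetProd fun i _ =>
        (hg (f.1 i) (F i) y hy).hasFDerivWithinAt).differentiableWithinAt
    · exact differentiableOn_const _

/-- The frames of the holomorphic tangent bundle. -/
abbrev tangentFrames (m : ℕ) (X : Type*) [TopologicalSpace X] [ChartedSpace (Fin m → ℂ) X]
    [IsManifold 𝓘(ℂ, Fin m → ℂ) ω X] :
    Frames m X (fun x : X => TangentSpace 𝓘(ℂ, Fin m → ℂ) x) (Fin m) :=
  bundleFrames (fun x : X => TangentSpace 𝓘(ℂ, Fin m → ℂ) x) m m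

theorem isHolo_tangentFrames : (tangentFrames m X).IsHolo :=
  haveI : IsManifold 𝓘(ℂ, Fin m → ℂ) (ω + 1) X := by simpa
  haveI : ContMDiffVectorBundle ω (Fin m → ℂ) (fun x : X => TangentSpace 𝓘(ℂ, Fin m → ℂ) x)
    𝓘(ℂ, Fin m → ℂ) := TangentBundle.contMDiffVectorBundle
  isHolo_bundleFrames

theorem mem_nbhd_tangentFrames {x₀ x : X} : x ∈ (tangentFrames m X).nbhd x₀ ↔
    x ∈ (chartAt (Fin m → ℂ) x₀).source :=
  mem_nbhd_bundleFrames.trans ⟨fun h => h.1, fun h => ⟨h, h⟩⟩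

theorem dom_tangentFrames (x₀ : X) :
    (tangentFrames m X).dom x₀ = (chartAt (Fin m → ℂ) x₀).target :=
  Set.inter_eq_left.2 fun _ hy => (chartAt (Fin m → ℂ) x₀).map_target hy

/-- The transition matrix of the tangent frames is the holomorphic Jacobian of the coordinate
change. Kähler matrices thus transform in the way that `iterCov_transform` demands of N. -/
theorem tangent_vec_change {x₀ x₀' x : X} (hx : x ∈ (chartAt (Fin m → ℂ) x₀).source)
    (hx' : x ∈ (chartAt (Fin m → ℂ) x₀').source) (i : Fin m) :
    (tangentFrames m X).vec x₀' x i =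
      ∑ j, holoJac (coordChange x₀ x₀') (chartAt (Fin m → ℂ) x₀' x) i j •
        (tangentFrames m X).vec x₀ x j := by
  rw [vec_change (x₀ := x₀) (E := fun x : X => TangentSpace 𝓘(ℂ, Fin m → ℂ) x) hx hx']
  refine Finset.sum_congr rfl fun j _ => ?_
  congr 1
  have h1 := Trivialization.coordChangeL_apply (R := ℂ)
    (trivializationAt (Fin m → ℂ) (fun x : X => TangentSpace 𝓘(ℂ, Fin m → ℂ) x) x₀')
    (trivializationAt (Fin m → ℂ) (fun x : X => TangentSpace 𝓘(ℂ, Fin m → ℂ) x) x₀)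
    ⟨hx', hx⟩ (Pi.single i 1)
  rw [h1]
  have h2 : (trivializationAt (Fin m → ℂ) (fun x : X => TangentSpace 𝓘(ℂ, Fin m → ℂ) x) x₀').symm x
      (Pi.single i 1) = tangentCoordChange 𝓘(ℂ, Fin m → ℂ) x₀' x x (Pi.single i (1 : ℂ)) :=
    (Trivialization.symmL_apply (R := ℂ) _ hx' _).symm.trans (congrArg (fun L => L (Pi.single i (1 : ℂ)))
      (TangentBundle.symmL_trivializationAt_eq_core (I := 𝓘(ℂ, Fin m → ℂ)) hx'))
  rw [h2]
  have h3 : (trivializationAt (Fin m → ℂ) (fun x : X => TangentSpace 𝓘(ℂ, Fin m → ℂ) x) x₀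
      ⟨x, tangentCoordChange 𝓘(ℂ, Fin m → ℂ) x₀' x x (Pi.single i (1 : ℂ))⟩).2 =
      tangentCoordChange 𝓘(ℂ, Fin m → ℂ) x x₀ x
        (tangentCoordChange 𝓘(ℂ, Fin m → ℂ) x₀' x x (Pi.single i (1 : ℂ))) := rfl
  rw [h3, tangentCoordChange_comp ⟨⟨by simpa using hx', by simp⟩, by simpa using hx⟩,
    tangentCoordChange_def, holoJac, Matrix.of_apply]
  simp only [modelWithCornersSelf_coe, Set.range_id, fderivWithin_univ]
  rfl

end BundleFrames

/-! ### Components of forms, and covariant derivatives in different frames -/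

section FrameForms

variable {m : ℕ} {X : Type*} [TopologicalSpace X] [ChartedSpace (Fin m → ℂ) X]
  {V : X → Type*} {ι : Type*} [Fintype ι] [DecidableEq ι] [∀ x, AddCommGroup (V x)]
  [∀ x, Module ℂ (V x)] {fr : Frames m X V ι} {T : ∀ x, V x →ₗ[ℂ] V x →ₛₗ[starRingEnd ℂ] ℂ}

theorem pairing_sum {W : Type*} [AddCommGroup W] [Module ℂ W]
    (f : W →ₗ[ℂ] W →ₛₗ[starRingEnd ℂ] ℂ) (e : ι → W) (a b : ι → ℂ) :
    pairing (Matrix.of fun i j => f (e i) (e j)) a b = f (∑ i, a i • e i) (∑ i, b i • e i) := by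
  simp only [pairing, Matrix.of_apply, map_sum, LinearMap.sum_apply, map_smulₛₗ,
    LinearMap.smul_apply, smul_eq_mul, RingHom.id_apply, Finset.mul_sum]
  rw [Finset.sum_comm]
  exact Finset.sum_congr rfl fun i _ => Finset.sum_congr rfl fun j _ => by ring

theorem pairing_comps (x₀ : X) (y : Fin m → ℂ) (a b : ι → ℂ) :
    pairing (comps fr (fun x s t => T x s t) x₀ y) a b =
      T _ (∑ i, a i • fr.vec x₀ ((chartAt (Fin m → ℂ) x₀).symm y) i)
        (∑ i, b i • fr.vec x₀ ((chartAt (Fin m → ℂ) x₀).symm y) i) :=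
  pairing_sum (T ((chartAt (Fin m → ℂ) x₀).symm y)) _ a b

theorem isHermitian_comps {x₀ : X} {y : Fin m → ℂ}
    (hT : IsHermInner (T ((chartAt (Fin m → ℂ) x₀).symm y))) :
    (comps fr (fun x s t => T x s t) x₀ y).IsHermitian := by
  ext i j
  simp only [Matrix.conjTranspose_apply, comps, Matrix.of_apply, RCLike.star_def]
  exact (hT.symm _ _).symm

theorem Frames.IsHolo.accretive_comps (hfr : fr.IsHolo) {x₀ : X} {y : Fin m → ℂ}
    (hy : y ∈ fr.dom x₀) (hT : IsHermInner (T ((chartAt (Fin m → ℂ) x₀).symm y))) :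
    Accretive (comps fr (fun x s t => T x s t) x₀ y) := by
  intro a ha
  obtain ⟨b, hb⟩ := hfr.basis x₀ _ (hfr.symm_mem_nbhd hy)
  rw [pairing_comps]
  refine hT.pos _ fun h0 => ha ?_
  simp only [← hb] at h0
  ext i
  simpa [Finsupp.single_apply] using congrArg (fun s => b.repr s i) h0

theorem Frames.IsHolo.isHermInner_of_accretive (hfr : fr.IsHolo) {x₀ : X} {y : Fin m → ℂ}
    (hy : y ∈ fr.dom x₀) (hsymm : ∀ s t, T ((chartAt (Fin m → ℂ) x₀).symm y) s t =
      conj (T ((chartAt (Fin m → ℂ) x₀).symm y) t s))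
    (hT : Accretive (comps fr (fun x s t => T x s t) x₀ y)) :
    IsHermInner (T ((chartAt (Fin m → ℂ) x₀).symm y)) := by
  refine ⟨hsymm, fun s hs => ?_⟩
  obtain ⟨b, hb⟩ := hfr.basis x₀ _ (hfr.symm_mem_nbhd hy)
  have h := hT (fun i => b.repr s i) fun h0 => hs (by
    rw [← b.sum_repr s]
    exact Finset.sum_eq_zero fun i _ => by rw [congrFun h0 i]; simp)
  rw [pairing_comps] at h
  simp only [← hb, b.sum_repr] at h
  exact h

theorem smoothMat_chernForm {κ : Type*} [Fintype κ] [DecidableEq κ] {U : Set (κ → ℂ)}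
    (hU : IsOpen U) {H : (κ → ℂ) → Matrix ι ι ℂ} (hH : SmoothMat H U)
    (hdet : ∀ y ∈ U, (H y).det ≠ 0) (v : κ → ℂ) : SmoothMat (fun y => chernForm H y v) U := by
  refine contDiffOn_mul_entry (fun a b => ?_) (contDiffOn_inv_entry hH hdet)
  simp only [Matrix.of_apply]
  exact fun y hy => (contDiffAt_del (by exact (hH a b).contDiffAt (hU.mem_nhds hy))
    v).contDiffWithinAt

theorem pairing_mul_mul_conjTranspose (M g : Matrix ι ι ℂ) (a b : ι → ℂ) :
    pairing (g * M * g.conjTranspose) a b = pairing M (Matrix.vecMul a g) (Matrix.vecMul b g) := by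
  rw [pairing_eq_vecMul, pairing_eq_vecMul, ← Matrix.vecMul_vecMul, ← Matrix.vecMul_vecMul]
  generalize Matrix.vecMul (Matrix.vecMul a g) M = c
  simp only [Matrix.vecMul, dotProduct, Matrix.conjTranspose_apply, Finset.sum_mul, map_sum,
    map_mul, Finset.mul_sum, RCLike.star_def]
  rw [Finset.sum_comm]
  exact Finset.sum_congr rfl fun i _ => Finset.sum_congr rfl fun j _ => by ring

variable [IsManifold 𝓘(ℂ, Fin m → ℂ) ω X]

theorem KahlerForm.isHermInner (κ : KahlerForm m X) (x : X) : IsHermInner (κ.form x) :=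
  ⟨κ.conj_symm x, κ.pos x⟩

theorem KahlerForm.smoothMat (κ : KahlerForm m X) (x₀ : X) :
    SmoothMat (κ.matrix x₀) ((tangentFrames m X).dom x₀) := κ.smooth x₀

theorem KahlerForm.accretive (κ : KahlerForm m X) {x₀ : X} {y : Fin m → ℂ}
    (hy : y ∈ (tangentFrames m X).dom x₀) : Accretive (κ.matrix x₀ y) :=
  isHolo_tangentFrames.accretive_comps hy (κ.isHermInner _)

theorem KahlerForm.matrix_change (κ : KahlerForm m X) {x₀ x₀' : X} {y : Fin m → ℂ}
    (hy : y ∈ (tangentFrames m X).overlap x₀ x₀') :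
    κ.matrix x₀' y = holoJac (coordChange x₀ x₀') y * κ.matrix x₀ (coordChange x₀ x₀' y) *
      (holoJac (coordChange x₀ x₀') y).conjTranspose := by
  refine comps_eq_of_change κ.form hy fun i => ?_
  have h1 := isHolo_tangentFrames.symm_mem_nbhd hy.1
  have h2 := tangent_vec_change (mem_nbhd_tangentFrames.1 hy.2) (mem_nbhd_tangentFrames.1 h1) i
  rwa [(chartAt (Fin m → ℂ) x₀').right_inv (isHolo_tangentFrames.dom_subset _ hy.1)] at h2

theorem isUnit_det_holoJac_coordChange {x₀ x₀' : X} {y : Fin m → ℂ}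
    (hy : y ∈ (tangentFrames m X).overlap x₀ x₀') :
    IsUnit (holoJac (coordChange x₀ x₀') y).det := by
  have h1 := isHolo_tangentFrames.symm_mem_nbhd hy.1
  obtain ⟨b, hb⟩ := isHolo_tangentFrames.basis x₀ _ hy.2
  obtain ⟨b', hb'⟩ := isHolo_tangentFrames.basis x₀' _ h1
  refine isUnit_det_of_change b b' fun i => ?_
  have h2 := tangent_vec_change (mem_nbhd_tangentFrames.1 hy.2) (mem_nbhd_tangentFrames.1 h1) i
  rw [(chartAt (Fin m → ℂ) x₀').right_inv (isHolo_tangentFrames.dom_subset _ hy.1)] at h2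
  simp only [hb, hb', h2]

theorem Frames.IsHolo.overlap_subset (hfr : fr.IsHolo) (x₀ x₀' : X) :
    fr.overlap x₀ x₀' ⊆ (tangentFrames m X).overlap x₀ x₀' := fun y hy => by
  refine ⟨?_, mem_nbhd_tangentFrames.2 hy.2.1⟩
  rw [dom_tangentFrames]
  exact hfr.dom_subset _ hy.1

theorem Frames.IsHolo.dom_subset_tangent (hfr : fr.IsHolo) (x₀ : X) :
    fr.dom x₀ ⊆ (tangentFrames m X).dom x₀ := by
  rw [dom_tangentFrames]; exact hfr.dom_subset x₀

/-- The covariant derivatives in different charts and frames. -/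
theorem Frames.IsHolo.pairing_iterCov_change (hfr : fr.IsHolo) (ν : KahlerForm m X)
    {H : ∀ x, V x →ₗ[ℂ] V x →ₛₗ[starRingEnd ℂ] ℂ} (hH : ∀ x, IsHermInner (H x))
    (hHs : IsSmoothForm fr fun x s t => H x s t) (hTs : IsSmoothForm fr fun x s t => T x s t)
    {x₀ x₀' : X} {y : Fin m → ℂ} (hy : y ∈ fr.overlap x₀ x₀') :
    ∃ (g : Matrix ι ι ℂ) (G : Matrix (Fin m) (Fin m) ℂ),
      (∀ a b, pairing (ν.matrix x₀' y) a b = pairing (ν.matrix x₀ (coordChange x₀ x₀' y))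
        (Matrix.vecMul a G) (Matrix.vecMul b G)) ∧
      (∀ a b, pairing (comps fr (fun x s t => H x s t) x₀' y) a b =
        pairing (comps fr (fun x s t => H x s t) x₀ (coordChange x₀ x₀' y))
          (Matrix.vecMul a g) (Matrix.vecMul b g)) ∧
      ∀ j v a b, pairing (iterCov (ν.matrix x₀') (comps fr (fun x s t => H x s t) x₀')
        (comps fr (fun x s t => T x s t) x₀') j y v) a b =
      pairing (iterCov (ν.matrix x₀) (comps fr (fun x s t => H x s t) x₀)
        (comps fr (fun x s t => T x s t) x₀) j (coordChange x₀ x₀' y)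
          (fun i => Matrix.vecMul (v i) G)) (Matrix.vecMul a g) (Matrix.vecMul b g) := by
  obtain ⟨g, hg, hgc⟩ := hfr.change x₀ x₀'
  have hmem : ∀ z ∈ fr.overlap x₀ x₀', (chartAt (Fin m → ℂ) x₀').symm z ∈
      fr.nbhd x₀ ∩ fr.nbhd x₀' := fun z hz => ⟨hz.2, hfr.symm_mem_nbhd hz.1⟩
  have hHdet : ∀ z ∈ fr.dom x₀, IsUnit (comps fr (fun x s t => H x s t) x₀ z).det := fun z hz =>
    (hfr.accretive_comps hz (hH _)).isUnit_det
  have hNdet : ∀ z ∈ fr.dom x₀, IsUnit (ν.matrix x₀ z).det := fun z hz =>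
    (ν.accretive (hfr.dom_subset_tangent x₀ hz)).isUnit_det
  have hNs : SmoothMat (ν.matrix x₀) (fr.dom x₀) := fun a b =>
    (ν.smoothMat x₀ a b).mono (hfr.dom_subset_tangent x₀)
  have hcH : ∀ z ∈ fr.overlap x₀ x₀', _ := fun z hz =>
    comps_eq_of_change H hz (hgc _ (hmem z hz))
  have hcN : ∀ z ∈ fr.overlap x₀ x₀', _ := fun z hz =>
    ν.matrix_change (hfr.overlap_subset x₀ x₀' hz)
  have hφ : ContDiffOn ℂ 2 (coordChange x₀ x₀') (fr.overlap x₀ x₀') :=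
    ((contDiffOn_coordChange x₀ x₀').of_le le_top).mono fun z hz =>
      ⟨hfr.dom_subset _ hz.1, hz.2.1⟩
  have key := fun j => iterCov_transform (hfr.isOpen_dom x₀) (hfr.isOpen_overlap x₀ x₀')
    (Frames.IsHolo.mapsTo_coordChange x₀ x₀') hφ hg (fun z hz => by
      obtain ⟨b, hb⟩ := hfr.basis x₀ _ (hmem z hz).1
      obtain ⟨b', hb'⟩ := hfr.basis x₀' _ (hmem z hz).2
      refine isUnit_det_of_change b b' fun i => ?_
      simp only [hb, hb']
      exact hgc _ (hmem z hz) i)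
    (fun z hz => isUnit_det_holoJac_coordChange (hfr.overlap_subset x₀ x₀' hz)) hNs (hHs x₀)
    hNdet hHdet (smoothMat_chernForm (hfr.isOpen_dom x₀) hNs fun z hz => (hNdet z hz).ne_zero)
    (smoothMat_chernForm (hfr.isOpen_dom x₀) (hHs x₀) fun z hz => (hHdet z hz).ne_zero)
    (hTs x₀) hcN hcH (fun z hz => comps_eq_of_change T hz (hgc _ (hmem z hz))) j y hy
  refine ⟨g ((chartAt (Fin m → ℂ) x₀').symm y), holoJac (coordChange x₀ x₀') y, fun a b => ?_,
    fun a b => ?_, fun j v a b => ?_⟩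
  · rw [hcN y hy, pairing_mul_mul_conjTranspose]
  · rw [hcH y hy, pairing_mul_mul_conjTranspose]
  · rw [key, pairing_mul_mul_conjTranspose]

end FrameForms

/-! ### The twisted metric in terms of local data -/

section Twisted

variable {m n d : ℕ} {X : Type*} [TopologicalSpace X] [ChartedSpace (Fin m → ℂ) X]
  [IsManifold 𝓘(ℂ, Fin m → ℂ) ω X]
  {E : X → Type*} [∀ x, AddCommGroup (E x)] [∀ x, Module ℂ (E x)]
  [∀ x, TopologicalSpace (E x)] [TopologicalSpace (TotalSpace (Fin (n + 1) → ℂ) E)]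
  [FiberBundle (Fin (n + 1) → ℂ) E] [VectorBundle ℂ (Fin (n + 1) → ℂ) E]
  [ContMDiffVectorBundle ω (Fin (n + 1) → ℂ) E 𝓘(ℂ, Fin m → ℂ)]

theorem HermitianMetric.isHermInner (h : HermitianMetric E m (n + 1)) (x : X) :
    IsHermInner (h.form x) := ⟨h.conj_symm x, h.pos x⟩

theorem HermitianMetric.isHermInner_symForm (h : HermitianMetric E m (n + 1)) (x : X) :
    IsHermInner (symForm (d := d) (h.form x)) := by
  have : FiniteDimensional ℂ (E x) := Module.Basis.finiteDimensional_of_finite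
    (frameBasis (FiberBundle.mem_baseSet_trivializationAt' (F := Fin (n + 1) → ℂ) x))
  exact PushMetric.isHermInner_symForm (h.isHermInner x)

/-- The matrix of a hermitian metric in the chart labelled by `x₀`. -/
def HermitianMetric.matrix (h : HermitianMetric E m (n + 1)) (x₀ : X) (y : Fin m → ℂ) :
    Matrix (Fin (n + 1)) (Fin (n + 1)) ℂ :=
  comps (bundleFrames E m (n + 1)) (fun x s t => h.form x s t) x₀ y

/-- The form `Sym^d h (Φ ·, ·)`. -/
def endForm (h : HermitianMetric E m (n + 1)) (Φ : ∀ x, Module.End ℂ (Sym[ℂ]^d (E x))) (x : X) :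
    Sym[ℂ]^d (E x) →ₗ[ℂ] Sym[ℂ]^d (E x) →ₛₗ[starRingEnd ℂ] ℂ := symForm (h.form x) ∘ₗ Φ x

/-- The form `Sym^d h (I + k⁻¹ Φ)`. -/
def twistedForm (h : HermitianMetric E m (n + 1)) (Φ : ∀ x, Module.End ℂ (Sym[ℂ]^d (E x)))
    (k : ℕ) (x : X) : Sym[ℂ]^d (E x) →ₗ[ℂ] Sym[ℂ]^d (E x) →ₛₗ[starRingEnd ℂ] ℂ :=
  endForm h (fun x => 1 + (k : ℂ)⁻¹ • Φ x) x

theorem comps_symMetric (h : HermitianMetric E m (n + 1)) (x₀ : X) (y : Fin m → ℂ) :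
    comps (symFrames E m (n + 1) d) (symMetric d h) x₀ y = symGram d (h.matrix x₀ y) := by
  ext f g
  exact symForm_monomials _ _ f g

theorem isSmoothForm_symMetric (h : HermitianMetric E m (n + 1)) :
    IsSmoothForm (symFrames E m (n + 1) d) (symMetric d h) := fun x₀ f g => by
  simp only [comps_symMetric]
  exact LocalData.contDiff_symGram (h.smooth x₀) f g

theorem exists_endMatrix (Φ : ∀ x, Module.End ℂ (Sym[ℂ]^d (E x))) {x₀ : X}
    {y : Fin m → ℂ} (hy : y ∈ (symFrames E m (n + 1) d).dom x₀) :
    ∃ A : Matrix (Monomials d (n + 1)) (Monomials d (n + 1)) ℂ, ∀ f,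
      Φ _ ((symFrames E m (n + 1) d).vec x₀ ((chartAt (Fin m → ℂ) x₀).symm y) f) =
        ∑ g, A f g • (symFrames E m (n + 1) d).vec x₀ ((chartAt (Fin m → ℂ) x₀).symm y) g := by
  obtain ⟨b, hb⟩ := isHolo_symFrames.basis x₀ _ (isHolo_symFrames.symm_mem_nbhd hy)
  refine ⟨Matrix.of fun f g => b.repr (Φ _ (b f)) g, fun f => ?_⟩
  simp only [← hb, Matrix.of_apply]
  exact (b.sum_repr _).symm

theorem comps_symMetricEnd (h : HermitianMetric E m (n + 1))
    {Φ : ∀ x, Module.End ℂ (Sym[ℂ]^d (E x))} {x₀ : X} {y : Fin m → ℂ}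
    {A : Matrix (Monomials d (n + 1)) (Monomials d (n + 1)) ℂ} (hA : ∀ f,
      Φ _ ((symFrames E m (n + 1) d).vec x₀ ((chartAt (Fin m → ℂ) x₀).symm y) f) =
        ∑ g, A f g • (symFrames E m (n + 1) d).vec x₀ ((chartAt (Fin m → ℂ) x₀).symm y) g) :
    comps (symFrames E m (n + 1) d) (symMetricEnd h Φ) x₀ y = A * symGram d (h.matrix x₀ y) := by
  rw [← comps_symMetric]
  ext f g
  simp only [comps, symMetricEnd, symMetric, Matrix.of_apply, Matrix.mul_apply, hA, map_sum,
    LinearMap.sum_apply, map_smulₛₗ, LinearMap.smul_apply, smul_eq_mul, RingHom.id_apply]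

theorem isSmoothForm_symMetricEnd (h : HermitianMetric E m (n + 1))
    {Φ : ∀ x, Module.End ℂ (Sym[ℂ]^d (E x))} (hΦ : IsSmoothEnd (symFrames E m (n + 1) d) Φ) :
    IsSmoothForm (symFrames E m (n + 1) d) (symMetricEnd h Φ) := fun x₀ f g => by
  obtain ⟨A, hA, hA'⟩ := hΦ x₀
  have h1 := contDiffOn_mul_entry (M := fun y => Matrix.of fun f g => A f g y) hA
    (fun f g => LocalData.contDiff_symGram (d := d) (h.smooth x₀) f g) f g
  refine h1.congr fun y hy => ?_
  rw [comps_symMetricEnd h (A := Matrix.of fun f g => A f g y) (hA' y hy)]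
  rfl

/-- The local data of the twisted metric. -/
def localData (h₀ h : HermitianMetric E m (n + 1)) (Φ : ∀ x, Module.End ℂ (Sym[ℂ]^d (E x)))
    (t : ℝ) (x₀ : X) (y : Fin m → ℂ) : LocalData d (n + 1) :=
  LocalData.mk (h₀.matrix x₀ y) (h.matrix x₀ y)
    (comps (symFrames E m (n + 1) d) (symMetricEnd h₀ Φ) x₀ y) t

variable (h₀ h : HermitianMetric E m (n + 1)) {Φ : ∀ x, Module.End ℂ (Sym[ℂ]^d (E x))} (k : ℕ)
  {x₀ : X} {y : Fin m → ℂ}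

theorem HermitianMetric.accretive_matrix (hy : y ∈ (bundleFrames E m (n + 1)).dom x₀) :
    Accretive (h.matrix x₀ y) :=
  isHolo_bundleFrames.accretive_comps hy (h.isHermInner _)

theorem HermitianMetric.isHermitian_matrix (x₀ : X) (y : Fin m → ℂ) :
    (h.matrix x₀ y).IsHermitian := isHermitian_comps (h.isHermInner _)

theorem det_symGram_ne_zero (hy : y ∈ (bundleFrames E m (n + 1)).dom x₀) :
    (symGram d (h.matrix x₀ y)).det ≠ 0 :=
  (accretive_symGram (h.isHermitian_matrix x₀ y) (h.accretive_matrix hy)).isUnit_det.ne_zero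

/-- The endomorphism enters through the form Ψ = Sym^d h₀ (Φ ·, ·), since the hypothesis controls
the derivatives of this form. The matrix of Φ is recovered as Ψ (Sym^d h₀)⁻¹, which explains the
shape of `LocalData.gram`. -/
theorem comps_twistedMetric (hy : y ∈ (symFrames E m (n + 1) d).dom x₀) :
    comps (symFrames E m (n + 1) d) (fun x s t => twistedForm h Φ k x s t) x₀ y =
      (localData h₀ h Φ (k : ℝ)⁻¹ x₀ y).gram := by
  obtain ⟨A, hA⟩ := exists_endMatrix Φ hy
  have h1 := comps_symMetricEnd (Φ := fun x => 1 + (k : ℂ)⁻¹ • Φ x) h (A := 1 + (k : ℂ)⁻¹ • A)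
    (x₀ := x₀) (y := y) fun f => by
      simp only [LinearMap.add_apply, Module.End.one_apply, LinearMap.smul_apply, hA,
        Matrix.add_apply, Matrix.smul_apply, add_smul, Finset.sum_add_distrib, Matrix.one_apply,
        ite_smul, one_smul, zero_smul, Finset.sum_ite_eq, Finset.mem_univ, if_true, smul_eq_mul,
        mul_smul, Finset.smul_sum]
  refine h1.trans ?_
  have h2 : (localData h₀ h Φ (k : ℝ)⁻¹ x₀ y).gram = symGram d (h.matrix x₀ y) +
      (((k : ℝ)⁻¹ : ℝ) : ℂ) • (comps (symFrames E m (n + 1) d) (symMetricEnd h₀ Φ) x₀ y *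
        (symGram d (h₀.matrix x₀ y))⁻¹ * symGram d (h.matrix x₀ y)) := rfl
  rw [h2, comps_symMetricEnd h₀ hA, Matrix.mul_nonsing_inv_cancel_right _ _
    (isUnit_iff_ne_zero.2 (det_symGram_ne_zero h₀ hy)), add_mul, one_mul, Matrix.smul_mul]
  push_cast
  rfl

theorem localData_mem_good (hy : y ∈ (symFrames E m (n + 1) d).dom x₀)
    (hpos : IsHermInner (twistedForm h Φ k ((chartAt (Fin m → ℂ) x₀).symm y))) :
    localData h₀ h Φ (k : ℝ)⁻¹ x₀ y ∈ LocalData.good d (n + 1) := by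
  refine ⟨det_symGram_ne_zero h₀ hy, ?_⟩
  rw [← comps_twistedMetric h₀ h k hy]
  exact isHolo_symFrames.accretive_comps hy hpos

theorem twistedForm_symm (hΦ : ∀ x s t, symMetric d h x (Φ x s) t = symMetric d h x s (Φ x t)) (x : X)
    (s t : Sym[ℂ]^d (E x)) : twistedForm h Φ k x s t = conj (twistedForm h Φ k x t s) := by
  have hs := (h.isHermInner_symForm (d := d) x).symm
  have h1 : symForm (h.form x) (Φ x s) t = symForm (h.form x) s (Φ x t) := hΦ x s t
  have h2 : ∀ s t, twistedForm h Φ k x s t =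
      symForm (h.form x) s t + (k : ℂ)⁻¹ * symForm (h.form x) (Φ x s) t := fun s t => by
    simp [twistedForm, endForm]
  rw [h2, h2, h1, hs s t, hs s (Φ x t)]
  simp

/-- The form is hermitian because Φ is symmetric for Sym^d h and k⁻¹ is real; it is positive because
its Gram matrix is accretive. This is how positivity of I + k⁻¹Φ is deduced instead of assumed. -/
theorem isHermInner_twistedForm (hy : y ∈ (symFrames E m (n + 1) d).dom x₀)
    (hΦ : ∀ x s t, symMetric d h x (Φ x s) t = symMetric d h x s (Φ x t))
    (hgood : localData h₀ h Φ (k : ℝ)⁻¹ x₀ y ∈ LocalData.good d (n + 1)) :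
    IsHermInner (twistedForm h Φ k ((chartAt (Fin m → ℂ) x₀).symm y)) := by
  refine isHolo_symFrames.isHermInner_of_accretive hy (twistedForm_symm h k hΦ _) ?_
  rw [comps_twistedMetric h₀ h k hy]
  exact hgood.2

theorem contDiffOn_localData (hΦ : IsSmoothEnd (symFrames E m (n + 1) d) Φ) (t : ℝ) (x₀ : X) :
    ContDiffOn ℝ ∞ (localData h₀ h Φ t x₀) ((symFrames E m (n + 1) d).dom x₀) := by
  refine contDiffOn_pi.2 ?_
  rintro (⟨i, j⟩ | ⟨i, j⟩ | ⟨f, g⟩ | _)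
  · exact h₀.smooth x₀ i j
  · exact h.smooth x₀ i j
  · exact isSmoothForm_symMetricEnd h₀ hΦ x₀ f g
  · exact contDiffOn_const

/-- The element `∑ v_i e_i^*` of `E_x^*`. -/
def homPoint (n : ℕ) (E : X → Type*) [∀ x, AddCommGroup (E x)] [∀ x, Module ℂ (E x)]
    [∀ x, TopologicalSpace (E x)] [TopologicalSpace (TotalSpace (Fin (n + 1) → ℂ) E)]
    [FiberBundle (Fin (n + 1) → ℂ) E] [VectorBundle ℂ (Fin (n + 1) → ℂ) E]
    (x₀ x : X) (v : Fin (n + 1) → ℂ) : Module.Dual ℂ (E x) :=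
  ∑ i, v i • (LinearMap.proj i ∘ₗ (trivializationAt (Fin (n + 1) → ℂ) E x₀).linearMapAt ℂ x)

theorem homPoint_frameBasis {x : X} (hx : x ∈ (trivializationAt (Fin (n + 1) → ℂ) E x₀).baseSet)
    (v : Fin (n + 1) → ℂ) (j : Fin (n + 1)) : homPoint n E x₀ x v (frameBasis hx j) = v j := by
  have h : ∀ i, (trivializationAt (Fin (n + 1) → ℂ) E x₀).linearMapAt ℂ x (frameBasis hx j) i =
      if j = i then 1 else 0 := fun i => by
    rw [← frameBasis_repr hx, Module.Basis.repr_self, Finsupp.single_apply]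
  simp [homPoint, h]

theorem powDual_homPoint {x : X} (hx : x ∈ (trivializationAt (Fin (n + 1) → ℂ) E x₀).baseSet)
    (v : Fin (n + 1) → ℂ) (f : Monomials d (n + 1)) :
    powDual d (homPoint n E x₀ x v) (symBasis d (frameBasis hx) f) = mon f v := by
  rw [powDual_symBasis]
  simp only [homPoint_frameBasis]
  rfl

/-- In the monomial basis the functional v^d has the components `mon f v`, so the dual norm becomes
the expression in Q = G⁻ᵀ for which the jets were designed. -/
theorem dualNormSq_twistedForm (hy : y ∈ (symFrames E m (n + 1) d).dom x₀)
    (hpos : IsHermInner (twistedForm h Φ k ((chartAt (Fin m → ℂ) x₀).symm y)))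
    (v : Fin (n + 1) → ℂ) :
    (dualNormSq (twistedMetric h Φ k ((chartAt (Fin m → ℂ) x₀).symm y))
      (powDual d (homPoint n E x₀ ((chartAt (Fin m → ℂ) x₀).symm y) v)) : ℂ) =
      normFun (fun z => (localData h₀ h Φ (k : ℝ)⁻¹ x₀ z).invGram) (Sum.elim y v) := by
  have hb := (mem_nbhd_bundleFrames.1 (isHolo_bundleFrames.symm_mem_nbhd hy)).2
  have h1 := hpos.dualNormSq_eq_gram (symBasis d (frameBasis hb))
    (G := (localData h₀ h Φ (k : ℝ)⁻¹ x₀ y).gram) (fun f g => by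
      rw [← comps_twistedMetric h₀ h k hy]
      simp only [symBasis_apply, frameBasis_apply (m := m)]
      rfl) (localData_mem_good h₀ h k hy hpos).2.isUnit_det
    (powDual d (homPoint n E x₀ ((chartAt (Fin m → ℂ) x₀).symm y) v))
  refine h1.trans ?_
  simp only [powDual_homPoint hb]
  rfl

end Twisted

/-! ### Homogeneity of the integrand on the cone -/

section Homogeneous

variable {m n d : ℕ}

theorem jetIntegrand_eq (f g : Monomials d (n + 1)) (J : Jet m d (n + 1)) (v : Fin (n + 1) → ℂ) :
    jetIntegrand f g J v = mon f v * conj (mon g v) / normVal J.val v *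
    ((jetMat J v).det / (Matrix.of J.kah).det) := rfl

variable {Q : (Fin m → ℂ) → Matrix (Monomials d (n + 1)) (Monomials d (n + 1)) ℂ}
  {K : (Fin m → ℂ) → Matrix (Fin m) (Fin m) ℂ} {t k : ℂ} {y : Fin m → ℂ}
  {N : (Fin m ⊕ Fin (n + 1) → ℂ) → ℝ}

theorem contDiffAt_of_normFun (hQ : ∀ f g, ContDiffAt ℝ 2 (fun z => Q z f g) y)
    (hN : ∀ v : Fin (n + 1) → ℂ, (fun w => (N w : ℂ)) =ᶠ[nhds (Sum.elim y v)] normFun Q)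
    (v : Fin (n + 1) → ℂ) : ContDiffAt ℝ 2 N (Sum.elim y v) := by
  have h := (contDiffAt_normFun (N := 2) hQ v).congr_of_eventuallyEq (hN v)
  have h2 := Complex.reCLM.contDiff.contDiffAt.comp _ h
  exact h2

/-- The volume density, up to a constant, in terms of jets, together with its homogeneity. -/
theorem jetMat_homogeneous (hd : d ≠ 0) (hQ : ∀ f g, ContDiffAt ℝ 2 (fun z => Q z f g) y)
    (htk : t * k = 1)
    (hhom : ∀ (y : Fin m → ℂ) (v : Fin (n + 1) → ℂ) (c : ℂ),
      N (Sum.elim y (c • v)) = (‖c‖ ^ 2) ^ d * N (Sum.elim y v))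
    (hN : ∀ v : Fin (n + 1) → ℂ, (fun w => (N w : ℂ)) =ᶠ[nhds (Sum.elim y v)] normFun Q)
    {ξ : Fin n → ℂ} (hN0 : N (Sum.elim y (Fin.cons 1 ξ)) ≠ 0) {c : ℂ} (hc : c ≠ 0) :
    ((‖c‖ : ℂ) ^ 2) ^ (n + 1) * (jetMat (jetOf Q K t y) (c • Fin.cons 1 ξ)).det =
      (d : ℂ) ^ 2 * (t ^ m * (complexHessian (fun w => Real.log (N (affineSlice w))) (Sum.elim y ξ) +
        Matrix.fromBlocks (k • K y) 0 0 0).det) := by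
  have hs := contDiffAt_of_normFun hQ hN
  have h := det_cHess_homogeneous hhom hc (hs _) (hs _) hN0 hd (k • K y)
  rw [det_jetMat hQ K htk, ← (hN _).self_of_nhds, ← cHess_congr (hN _), mul_left_comm, h]
  ring

/-- The determinant scales by |c|^{-2(n+1)}, as one sees by comparing `jetMat_homogeneous` for c and
for 1. The factors |c|^{2d} of the monomials and of N cancel. -/
theorem jetIntegrand_homogeneous (hd : d ≠ 0) (hQ : ∀ f g, ContDiffAt ℝ 2 (fun z => Q z f g) y)
    (htk : t * k = 1)
    (hhom : ∀ (y : Fin m → ℂ) (v : Fin (n + 1) → ℂ) (c : ℂ),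
      N (Sum.elim y (c • v)) = (‖c‖ ^ 2) ^ d * N (Sum.elim y v))
    (hN : ∀ v : Fin (n + 1) → ℂ, (fun w => (N w : ℂ)) =ᶠ[nhds (Sum.elim y v)] normFun Q)
    (ξ : Fin n → ℂ) (hN0 : N (Sum.elim y (Fin.cons 1 ξ)) ≠ 0) {c : ℂ} (hc : c ≠ 0)
    (f g : Monomials d (n + 1)) :
    ((‖c‖ : ℂ) ^ 2) ^ (n + 1) * jetIntegrand f g (jetOf Q K t y) (c • Fin.cons 1 ξ) =
      jetIntegrand f g (jetOf Q K t y) (Fin.cons 1 ξ) := by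
  have h1 := jetMat_homogeneous (K := K) hd hQ htk hhom hN hN0 hc
  have h2 := jetMat_homogeneous (K := K) hd hQ htk hhom hN hN0 one_ne_zero
  simp only [norm_one, Complex.ofReal_one, one_pow, one_mul, one_smul] at h2
  rw [← h2] at h1
  have hcn : ((‖c‖ : ℂ) ^ 2) ^ d ≠ 0 := pow_ne_zero _ (pow_ne_zero _ (by simpa using hc))
  have hn : c ^ d * conj c ^ d = ((‖c‖ : ℂ) ^ 2) ^ d := by
    rw [← mul_pow, Complex.mul_conj, Complex.normSq_eq_norm_sq]; push_cast; rfl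
  rw [jetIntegrand_eq, jetIntegrand_eq, ← h1, mon_smul, mon_smul, normVal_smul, map_mul, map_pow]
  have : c ^ d * mon f (Fin.cons 1 ξ : Fin (n + 1) → ℂ) *
      (conj c ^ d * conj (mon g (Fin.cons 1 ξ : Fin (n + 1) → ℂ))) = ((‖c‖ : ℂ) ^ 2) ^ d *
      (mon f (Fin.cons 1 ξ : Fin (n + 1) → ℂ) * conj (mon g (Fin.cons 1 ξ : Fin (n + 1) → ℂ))) := by
    rw [← hn]; ring
  rw [this, mul_div_mul_left _ _ hcn]
  ring

end Homogeneous

/-! ### Nondegeneracy on the fibres -/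

section FibreDensity

variable {m n : ℕ}

theorem cHess_const_mul {κ : Type*} [Fintype κ] [DecidableEq κ] {u : (κ → ℂ) → ℂ} {w : κ → ℂ}
    (hu : ContDiffAt ℝ 2 u w) (c : ℂ) : cHess (fun z => c * u z) w = c • cHess u w := by
  ext a b
  have h := cHess_mul_holo_conj (B := fun _ => c) (C := fun _ => 1) hu contDiffAt_const
    contDiffAt_const a b
  simp only [fderiv_fun_const, Pi.zero_apply, zero_apply, map_zero, mul_zero, add_zero,
    map_one, mul_one] at h
  rw [Matrix.smul_apply, smul_eq_mul, ← mul_comm, ← h]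
  congr 1
  ext z
  ring

theorem cHess_hermitian {κ ι : Type*} [Fintype κ] [DecidableEq κ] [Fintype ι]
    (A : Matrix ι ι ℂ) (e : ι → κ) (w : κ → ℂ) (a b : κ) :
    cHess (fun z => ∑ i, ∑ j, A i j * z (e i) * conj (z (e j))) w a b =
      ∑ i, ∑ j, A i j * (Pi.single a 1 : κ → ℂ) (e i) * conj ((Pi.single b 1 : κ → ℂ) (e j)) := by
  have hz : ∀ c, ContDiffAt ℂ 2 (fun z : κ → ℂ => z c) w := fun c =>
    (contDiff_apply ℂ ℂ c).contDiffAt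
  have hterm : ∀ i j, ContDiffAt ℝ 2 (fun z : κ → ℂ => A i j * z (e i) * conj (z (e j))) w :=
    fun i j => (contDiffAt_const.mul ((hz _).restrict_scalars ℝ)).mul
      (Complex.conjCLE.contDiff.contDiffAt.comp _ ((hz _).restrict_scalars ℝ))
  rw [cHess_sum _ fun i _ => ContDiffAt.sum fun j _ => hterm i j, Matrix.sum_apply]
  refine Finset.sum_congr rfl fun i _ => ?_
  rw [cHess_sum _ fun j _ => hterm i j, Matrix.sum_apply]
  refine Finset.sum_congr rfl fun j _ => ?_
  rw [cHess_mul_holo_conj contDiffAt_const (hz _) (hz _), fderiv_proj, fderiv_proj]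
  have h0 : ∀ v, delBar (fun _ : κ → ℂ => A i j) w v = 0 := fun v => by simp [delBar]
  have h1 : ∀ v, del (fun _ : κ → ℂ => A i j) w v = 0 := fun v => by simp [del]
  have h2 : cHess (fun _ : κ → ℂ => A i j) w a b = 0 := by simp [cHess, delBar, del]
  rw [h0, h1, h2]
  ring

theorem det_of_isEmpty {ι κ : Type*} [Fintype ι] [DecidableEq ι] [IsEmpty ι] [Fintype κ]
    [DecidableEq κ] (M : Matrix (ι ⊕ κ) (ι ⊕ κ) ℂ) : M.det = M.toBlocks₂₂.det := by
  conv_lhs => rw [← Matrix.fromBlocks_toBlocks M]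
  rw [show M.toBlocks₁₂ = 0 from Subsingleton.elim _ _, Matrix.det_fromBlocks_zero₁₂,
    Matrix.det_isEmpty, one_mul]

/-- Nondegeneracy of the Fubini–Study form. -/
theorem det_complexHessian_fubiniStudy {A : Matrix (Fin (n + 1)) (Fin (n + 1)) ℂ} (hA : A.det ≠ 0)
    {q : (Fin (n + 1) → ℂ) → ℝ}
    (hq : ∀ v, (q v : ℂ) = ∑ i, ∑ j, A i j * v i * conj (v j)) {ξ : Fin n → ℂ}
    (h0 : q (Fin.cons 1 ξ) ≠ 0) :
    (complexHessian (fun w : Fin 0 ⊕ Fin n → ℂ => Real.log (q (Fin.cons 1 (w ∘ Sum.inr))))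
      (Sum.elim Fin.elim0 ξ)).det ≠ 0 := by
  set N : (Fin 0 ⊕ Fin (n + 1) → ℂ) → ℝ := fun w => q (w ∘ Sum.inr)
  have hNc : (fun w => (N w : ℂ)) = fun w : Fin 0 ⊕ Fin (n + 1) → ℂ =>
      ∑ i, ∑ j, A i j * w (Sum.inr i) * conj (w (Sum.inr j)) := funext fun w => hq _
  have hs : ContDiff ℝ 2 N := by
    have h1 : ContDiff ℝ 2 (fun w => (N w : ℂ)) := by
      rw [hNc]
      have hz : ∀ c, ContDiff ℝ 2 (fun z : Fin 0 ⊕ Fin (n + 1) → ℂ => z c) := fun c =>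
        contDiff_apply ℝ ℂ c
      exact ContDiff.sum fun i _ => ContDiff.sum fun j _ => (contDiff_const.mul (hz _)).mul
        (Complex.conjCLE.contDiff.comp (hz _))
    exact Complex.reCLM.contDiff.comp h1
  have hhom : ∀ (y : Fin 0 → ℂ) (v : Fin (n + 1) → ℂ) (c : ℂ),
      N (Sum.elim y (c • v)) = (‖c‖ ^ 2) ^ 1 * N (Sum.elim y v) := by
    intro y v c
    have h1 : ((q (c • v) : ℝ) : ℂ) = ((‖c‖ ^ 2 * q v : ℝ) : ℂ) := by
      push_cast
      rw [hq, hq, Finset.mul_sum]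
      refine Finset.sum_congr rfl fun i _ => ?_
      rw [Finset.mul_sum]
      refine Finset.sum_congr rfl fun j _ => ?_
      have : (‖c‖ : ℂ) ^ 2 = c * conj c := by
        rw [Complex.mul_conj, Complex.normSq_eq_norm_sq]; push_cast; rfl
      rw [this, Pi.smul_apply, Pi.smul_apply, smul_eq_mul, smul_eq_mul, map_mul]
      ring
    rw [pow_one]
    exact_mod_cast h1
  -- The case m = 0, d = 1, K = 0: on the cone the Hessian of the quadratic function N is the
  -- constant matrix A.
  have h := det_cHess_homogeneous hhom (y := Fin.elim0) (ξ := ξ) (one_ne_zero (α := ℂ))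
    hs.contDiffAt hs.contDiffAt h0 one_ne_zero 0
  simp only [norm_one, Complex.ofReal_one, one_pow, one_mul, one_smul, Nat.cast_one,
    Matrix.fromBlocks_zero, add_zero] at h
  have hcomp : (fun w : Fin 0 ⊕ Fin n → ℂ => Real.log (q (Fin.cons 1 (w ∘ Sum.inr)))) =
      fun w => Real.log (N (affineSlice w)) := rfl
  rw [hcomp, ← h, Matrix.det_smul, det_of_isEmpty]
  refine mul_ne_zero (pow_ne_zero _ (inv_ne_zero (by exact_mod_cast h0))) ?_
  have h22 : (cHess (fun w => (N w : ℂ)) (Sum.elim Fin.elim0 (Fin.cons 1 ξ))).toBlocks₂₂ = A := by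
    ext a b
    rw [hNc]
    refine (cHess_hermitian A Sum.inr _ (Sum.inr a) (Sum.inr b)).trans ?_
    simp [Pi.single_apply]
  rw [h22]
  exact hA

/-- The chain rule along the holomorphic inclusion ξ ↦ (y, ξ) of a fibre reduces the fibre density
to the situation of an empty base. -/
theorem toBlocks₂₂_complexHessian {u : (Fin m ⊕ Fin n → ℂ) → ℝ} {y : Fin m → ℂ} {ξ : Fin n → ℂ}
    (hu : ContDiffAt ℝ 2 u (Sum.elim y ξ)) :
    (complexHessian u (Sum.elim y ξ)).toBlocks₂₂.det =
      (complexHessian (fun w : Fin 0 ⊕ Fin n → ℂ => u (Sum.elim y (w ∘ Sum.inr)))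
        (Sum.elim Fin.elim0 ξ)).det := by
  set Ψ : (Fin 0 ⊕ Fin n → ℂ) → Fin m ⊕ Fin n → ℂ := fun w => Sum.elim y (w ∘ Sum.inr) with hΨ
  have hΨs : ContDiff ℂ 2 Ψ := by
    refine contDiff_pi.2 ?_
    rintro (a | a)
    · exact contDiff_const
    · exact contDiff_apply ℂ ℂ _
  have huc : ContDiffAt ℝ 2 (fun w => (u w : ℂ)) (Ψ (Sum.elim Fin.elim0 ξ)) :=
    Complex.ofRealCLM.contDiff.contDiffAt.comp _ hu
  have h := cHess_comp huc hΨs.contDiffAt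
  rw [complexHessian_eq, complexHessian_eq, h, det_of_isEmpty]
  congr 1
  have hJ : ∀ b c, holoJac Ψ (Sum.elim Fin.elim0 ξ) (Sum.inr b) c =
      if c = Sum.inr b then 1 else 0 := by
    intro b c
    rw [holoJac_apply (hΨs.differentiable (by simp) _)]
    rcases c with c | c
    · simp [hΨ]
    · simp only [hΨ, Sum.elim_inr, Function.comp_apply, fderiv_proj]
      simp [Pi.single_apply]
  ext a b
  simp only [Matrix.toBlocks₂₂, Matrix.of_apply, Matrix.mul_apply, Matrix.conjTranspose_apply, hJ]
  simp
  rfl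

end FibreDensity

/-! ### Scaling of dual norms, and powers -/

section DualNorm

variable {V : Type*} [AddCommGroup V] [Module ℂ V]

theorem dualNormSq_smul (H : V → V → ℂ) (c : ℂ) (f : Module.Dual ℂ V) :
    dualNormSq H (c • f) = ‖c‖ ^ 2 * dualNormSq H f := by
  unfold dualNormSq
  rw [← smul_eq_mul, ← Real.sSup_smul_of_nonneg (by positivity)]
  congr 1
  ext q
  constructor
  · rintro ⟨s, hs, rfl⟩
    exact ⟨‖f s‖ ^ 2, ⟨s, hs, rfl⟩, by simp [mul_pow]⟩
  · rintro ⟨_, ⟨s, hs, rfl⟩, rfl⟩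
    exact ⟨s, hs, by simp [mul_pow]⟩

theorem powDual_smul (d : ℕ) (c : ℂ) (v : Module.Dual ℂ V) :
    powDual d (c • v) = c ^ d • powDual d v := by
  refine LinearMap.ext_on (SymmetricPower.span_tprod_eq_top ℂ (Fin d) V) ?_
  rintro _ ⟨w, rfl⟩
  rw [LinearMap.smul_apply, powDual_tprod, powDual_tprod]
  simp [Finset.prod_mul_distrib]

theorem IsHermInner.exists_riesz [FiniteDimensional ℂ V] {h : V →ₗ[ℂ] V →ₛₗ[starRingEnd ℂ] ℂ}
    (hh : IsHermInner h) (f : Module.Dual ℂ V) : ∃ t, ∀ s, f s = h s t := by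
  obtain ⟨b, hb⟩ := hh.exists_orthonormal_basis
  refine ⟨∑ i, conj (f (b i)) • b i, fun s => ?_⟩
  have : f = h.flip (∑ i, conj (f (b i)) • b i) := by
    refine b.ext fun j => ?_
    simp [hb, LinearMap.flip_apply]
  exact LinearMap.congr_fun this s

theorem dualNormSq_symForm_eq_pow [FiniteDimensional ℂ V] {d : ℕ}
    {h : V →ₗ[ℂ] V →ₛₗ[starRingEnd ℂ] ℂ} (hh : IsHermInner h) (v : Module.Dual ℂ V) :
    dualNormSq (fun s t => symForm (d := d) h s t) (powDual d v) =
      dualNormSq (fun s t => h s t) v ^ d := by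
  obtain ⟨t, ht⟩ := hh.exists_riesz v
  rw [dualNormSq_symForm hh ht, hh.dualNormSq_eq ht]

end DualNorm

/-! ### The norm function on the cone and the fibre density -/

section PushIntegrand

variable {m n d : ℕ} {X : Type*} [TopologicalSpace X] [ChartedSpace (Fin m → ℂ) X]
  [IsManifold 𝓘(ℂ, Fin m → ℂ) ω X]
  {E : X → Type*} [∀ x, AddCommGroup (E x)] [∀ x, Module ℂ (E x)]
  [∀ x, TopologicalSpace (E x)] [TopologicalSpace (TotalSpace (Fin (n + 1) → ℂ) E)]
  [FiberBundle (Fin (n + 1) → ℂ) E] [VectorBundle ℂ (Fin (n + 1) → ℂ) E]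
  [ContMDiffVectorBundle ω (Fin (n + 1) → ℂ) E 𝓘(ℂ, Fin m → ℂ)]

theorem homPoint_smul (x₀ x : X) (c : ℂ) (v : Fin (n + 1) → ℂ) :
    homPoint n E x₀ x (c • v) = c • homPoint n E x₀ x v := by
  simp only [homPoint, Finset.smul_sum, smul_smul, Pi.smul_apply, smul_eq_mul]

/-- The function `|v^d|²` of the twisted metric, in the coordinates `(y, v)`. -/
def normReal (h : HermitianMetric E m (n + 1)) (Φ : ∀ x, Module.End ℂ (Sym[ℂ]^d (E x))) (k : ℕ)
    (x₀ : X) (w : Fin m ⊕ Fin (n + 1) → ℂ) : ℝ :=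
  dualNormSq (twistedMetric h Φ k ((chartAt (Fin m → ℂ) x₀).symm (w ∘ Sum.inl)))
    (powDual d (homPoint n E x₀ ((chartAt (Fin m → ℂ) x₀).symm (w ∘ Sum.inl)) (w ∘ Sum.inr)))

variable (h₀ h : HermitianMetric E m (n + 1)) {Φ : ∀ x, Module.End ℂ (Sym[ℂ]^d (E x))} {k : ℕ}
  {x₀ : X} {y : Fin m → ℂ}

/-- Scaling a functional scales the supremum defining its dual norm, even without positivity. Hence
homogeneity holds at all y, as `det_cHess_homogeneous` asks, and not only in the domain of the
frame. -/
theorem normReal_homogeneous (Φ : ∀ x, Module.End ℂ (Sym[ℂ]^d (E x))) (k : ℕ) (x₀ : X)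
    (y : Fin m → ℂ) (v : Fin (n + 1) → ℂ) (c : ℂ) :
    normReal h Φ k x₀ (Sum.elim y (c • v)) = (‖c‖ ^ 2) ^ d * normReal h Φ k x₀ (Sum.elim y v) := by
  change dualNormSq (twistedMetric h Φ k ((chartAt (Fin m → ℂ) x₀).symm y))
    (powDual d (homPoint n E x₀ ((chartAt (Fin m → ℂ) x₀).symm y) (c • v))) = _ * dualNormSq
    (twistedMetric h Φ k ((chartAt (Fin m → ℂ) x₀).symm y))
    (powDual d (homPoint n E x₀ ((chartAt (Fin m → ℂ) x₀).symm y) v))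
  rw [homPoint_smul, powDual_smul, dualNormSq_smul, norm_pow]
  ring

theorem normReal_eventuallyEq (hy : y ∈ (symFrames E m (n + 1) d).dom x₀)
    (hpos : ∀ x, IsHermInner (twistedForm h Φ k x)) (v : Fin (n + 1) → ℂ) :
    (fun w => (normReal h Φ k x₀ w : ℂ)) =ᶠ[nhds (Sum.elim y v)]
      normFun (fun z => (localData h₀ h Φ (k : ℝ)⁻¹ x₀ z).invGram) := by
  have hc : ContinuousAt (fun w : Fin m ⊕ Fin (n + 1) → ℂ => w ∘ Sum.inl) (Sum.elim y v) :=
    (baseProj m (n + 1)).continuous.continuousAt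
  filter_upwards [hc.preimage_mem_nhds ((isHolo_symFrames.isOpen_dom x₀).mem_nhds hy)] with w hw
  have := dualNormSq_twistedForm h₀ h k hw (hpos _) (w ∘ Sum.inr)
  rw [Sum.elim_comp_inl_inr] at this
  exact this

theorem contDiffAt_invGram (hΦ : IsSmoothEnd (symFrames E m (n + 1) d) Φ)
    (hy : y ∈ (symFrames E m (n + 1) d).dom x₀)
    (hpos : ∀ x, IsHermInner (twistedForm h Φ k x)) (f g : Monomials d (n + 1)) :
    ContDiffAt ℝ ∞ (fun z => (localData h₀ h Φ (k : ℝ)⁻¹ x₀ z).invGram f g) y :=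
  ContDiffAt.comp (g := fun D : LocalData d (n + 1) => D.invGram f g) y
    ((LocalData.contDiffOn_invGram f g).contDiffAt
      (LocalData.isOpen_good.mem_nhds (localData_mem_good h₀ h k hy (hpos _))))
    ((contDiffOn_localData h₀ h hΦ _ x₀).contDiffAt ((isHolo_symFrames.isOpen_dom x₀).mem_nhds hy))

theorem normReal_ne_zero (hy : y ∈ (symFrames E m (n + 1) d).dom x₀)
    (hpos : ∀ x, IsHermInner (twistedForm h Φ k x)) {v : Fin (n + 1) → ℂ} (hv : v ≠ 0) :
    normReal h Φ k x₀ (Sum.elim y v) ≠ 0 := by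
  -- The background metric only serves to parametrise the data; where no uniformity is at stake, h
  -- itself takes its place.
  have h1 := (normReal_eventuallyEq h h hy hpos v).self_of_nhds
  have h2 := normVal_inv_ne_zero (localData_mem_good h h k hy (hpos _)).2 hv
  intro h3
  simp only [h3, Complex.ofReal_zero] at h1
  exact h2 h1.symm

theorem contDiffAt_normReal (hΦ : IsSmoothEnd (symFrames E m (n + 1) d) Φ)
    (hy : y ∈ (symFrames E m (n + 1) d).dom x₀)
    (hpos : ∀ x, IsHermInner (twistedForm h Φ k x)) (v : Fin (n + 1) → ℂ) :
    ContDiffAt ℝ 2 (normReal h Φ k x₀) (Sum.elim y v) :=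
  contDiffAt_of_normFun (fun f g => (contDiffAt_invGram h h hΦ hy hpos f g).of_le
    (by norm_cast)) (normReal_eventuallyEq h h hy hpos) v

theorem cons_one_ne_zero (ξ : Fin n → ℂ) : (Fin.cons 1 ξ : Fin (n + 1) → ℂ) ≠ 0 := fun h => by
  simpa using congrFun h 0

theorem isSmoothEnd_zero : IsSmoothEnd (symFrames E m (n + 1) d) fun _ => 0 := fun _ =>
  ⟨fun _ _ _ => 0, fun _ _ => contDiffOn_const, fun _ _ _ => by simp⟩

/-- On a fibre log |v^d|² = d log |v|², so this density is d^n times that of a Fubini–Study form,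
which is nondegenerate. It is needed because the density is both a divisor and a factor of the
integrand. -/
theorem fibreDensity_ne_zero (hd : d ≠ 0) (hy : y ∈ (symFrames E m (n + 1) d).dom x₀)
    (ξ : Fin n → ℂ) : fibreDensity d h x₀ (Sum.elim y ξ) ≠ 0 := by
  set x := (chartAt (Fin m → ℂ) x₀).symm y
  have hb := (mem_nbhd_bundleFrames.1 (isHolo_bundleFrames.symm_mem_nbhd hy)).2
  have hfin : FiniteDimensional ℂ (E x) := Module.Basis.finiteDimensional_of_finite (frameBasis hb)
  -- Sym^d h is the twisted metric with Φ = 0 and k = 1, so that the results on twisted metrics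
  -- apply to it.
  have htw : twistedMetric h (fun x => (0 : Module.End ℂ (Sym[ℂ]^d (E x)))) 1 = symMetric d h := by
    funext x s t
    simp [twistedMetric, symMetricEnd]
  have hpos : ∀ x, IsHermInner (twistedForm h (fun x => (0 : Module.End ℂ (Sym[ℂ]^d (E x)))) 1 x) :=
    fun x => by
      have : twistedForm h (fun x => (0 : Module.End ℂ (Sym[ℂ]^d (E x)))) 1 x =
          symForm (h.form x) := by
        refine LinearMap.ext fun s => LinearMap.ext fun t => ?_
        exact congrFun (congrFun (congrFun htw x) s) t
      rw [this]
      exact h.isHermInner_symForm x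
  set N := normReal h (fun x => (0 : Module.End ℂ (Sym[ℂ]^d (E x)))) 1 x₀ with hN
  set q : (Fin (n + 1) → ℂ) → ℝ := fun v =>
    dualNormSq (fun s t => h.form x s t) (homPoint n E x₀ x v) with hq
  have hNq : ∀ v, N (Sum.elim y v) = q v ^ d := fun v => by
    refine Eq.trans ?_ (dualNormSq_symForm_eq_pow (h.isHermInner x) (homPoint n E x₀ x v))
    change dualNormSq (twistedMetric h _ 1 x) _ = _
    rw [htw]
    rfl
  have hN0 : ∀ ξ : Fin n → ℂ, N (Sum.elim y (Fin.cons 1 ξ)) ≠ 0 := fun ξ =>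
    normReal_ne_zero h hy hpos (cons_one_ne_zero ξ)
  have hAu := (h.accretive_matrix hy).isUnit_det
  have hgram : ∀ v, (q v : ℂ) = ∑ i, ∑ j, (h.matrix x₀ y)⁻¹.transpose i j * v i * conj (v j) := by
    intro v
    have := (h.isHermInner x).dualNormSq_eq_gram (frameBasis hb) (G := h.matrix x₀ y)
      (fun i j => by simp only [frameBasis_apply (m := m)]; rfl) hAu (homPoint n E x₀ x v)
    simpa only [homPoint_frameBasis] using this
  have hq0 : q (Fin.cons 1 ξ) ≠ 0 := fun h0 => hN0 ξ (by rw [hNq, h0, zero_pow hd])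
  have hdetA : (h.matrix x₀ y)⁻¹.transpose.det ≠ 0 := by
    rw [Matrix.det_transpose]
    exact (Matrix.isUnit_nonsing_inv_det _ hAu).ne_zero
  have hfs := det_complexHessian_fubiniStudy hdetA hgram hq0
  have hslice : ContDiff ℝ 2 (affineSlice (m := m) (n := n)) := by
    refine contDiff_pi.2 ?_
    rintro (a | a)
    · exact contDiff_apply ℝ ℂ _
    · refine Fin.cases ?_ (fun i => ?_) a
      · exact contDiff_const
      · exact contDiff_apply ℝ ℂ (Sum.inr i : Fin m ⊕ Fin n)
  have hu : ContDiffAt ℝ 2 (fun w => Real.log (N (affineSlice w))) (Sum.elim y ξ) :=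
    ((contDiffAt_normReal h isSmoothEnd_zero hy hpos (Fin.cons 1 ξ)).comp (Sum.elim y ξ)
      (f := affineSlice) hslice.contDiffAt).log (hN0 ξ)
  have h1 : fibreDensity d h x₀ (Sum.elim y ξ) =
      (complexHessian (fun w => Real.log (N (affineSlice w))) (Sum.elim y ξ)).toBlocks₂₂.det := by
    rw [fibreDensity, ← htw]
    rfl
  have h2 : (fun w : Fin 0 ⊕ Fin n → ℂ => Real.log (N (affineSlice (Sum.elim y (w ∘ Sum.inr))))) =
      fun w => d * Real.log (q (Fin.cons 1 (w ∘ Sum.inr))) := by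
    funext w
    change Real.log (N (Sum.elim y (Fin.cons 1 (w ∘ Sum.inr)))) = _
    rw [hNq, Real.log_pow]
  have hqs : ContDiffAt ℝ 2 (fun w : Fin 0 ⊕ Fin n → ℂ =>
      (Real.log (q (Fin.cons 1 (w ∘ Sum.inr))) : ℂ)) (Sum.elim Fin.elim0 ξ) := by
    have hqd : ContDiff ℝ 2 q := by
      have h3 : ContDiff ℝ 2 (fun v => (q v : ℂ)) := by
        simp only [hgram]
        exact ContDiff.sum fun i _ => ContDiff.sum fun j _ => (contDiff_const.mul
          (contDiff_apply ℝ ℂ i)).mul (Complex.conjCLE.contDiff.comp (contDiff_apply ℝ ℂ j))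
      exact Complex.reCLM.contDiff.comp h3
    have hcons : ContDiff ℝ 2 (fun w : Fin 0 ⊕ Fin n → ℂ =>
        (Fin.cons 1 (w ∘ Sum.inr) : Fin (n + 1) → ℂ)) := by
      refine contDiff_pi.2 fun a => ?_
      refine Fin.cases ?_ (fun i => ?_) a
      · exact contDiff_const
      · exact contDiff_apply ℝ ℂ (Sum.inr i : Fin 0 ⊕ Fin n)
    exact Complex.ofRealCLM.contDiff.contDiffAt.comp _ ((hqd.comp hcons).contDiffAt.log hq0)
  rw [h1, toBlocks₂₂_complexHessian hu, h2, complexHessian_eq]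
  have h3 : (fun w : Fin 0 ⊕ Fin n → ℂ =>
      ((d * Real.log (q (Fin.cons 1 (w ∘ Sum.inr))) : ℝ) : ℂ)) =
      fun w => (d : ℂ) * (Real.log (q (Fin.cons 1 (w ∘ Sum.inr))) : ℂ) := by
    funext w; push_cast; rfl
  rw [h3, cHess_const_mul hqs, Matrix.det_smul]
  exact mul_ne_zero (pow_ne_zero _ (by exact_mod_cast hd)) hfs

end PushIntegrand

/-! ### The push-forward integrand as a homogeneous function -/

section HomIntegrand

variable {m n d : ℕ} {X : Type*} [TopologicalSpace X] [ChartedSpace (Fin m → ℂ) X]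
  [IsManifold 𝓘(ℂ, Fin m → ℂ) ω X]
  {E : X → Type*} [∀ x, AddCommGroup (E x)] [∀ x, Module ℂ (E x)]
  [∀ x, TopologicalSpace (E x)] [TopologicalSpace (TotalSpace (Fin (n + 1) → ℂ) E)]
  [FiberBundle (Fin (n + 1) → ℂ) E] [VectorBundle ℂ (Fin (n + 1) → ℂ) E]
  [ContMDiffVectorBundle ω (Fin (n + 1) → ℂ) E 𝓘(ℂ, Fin m → ℂ)]

/-- The integrand of the push-forward as a homogeneous function on `E_x^*`. -/
def homIntegrand (κ : KahlerForm m X) (h : HermitianMetric E m (n + 1))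
    (Φ : ∀ x, Module.End ℂ (Sym[ℂ]^d (E x))) (k : ℕ) (x₀ x : X) (s t : Sym[ℂ]^d (E x))
    (v : Fin (n + 1) → ℂ) : ℂ :=
  powDual d (homPoint n E x₀ x v) s * conj (powDual d (homPoint n E x₀ x v) t) /
      dualNormSq (twistedMetric h Φ k x) (powDual d (homPoint n E x₀ x v)) *
    ((k : ℂ)⁻¹ ^ m * (((normReal h Φ k x₀ (Sum.elim (chartAt (Fin m → ℂ) x₀ x) v) : ℂ))⁻¹ •
      cHess (fun w => (normReal h Φ k x₀ w : ℂ)) (Sum.elim (chartAt (Fin m → ℂ) x₀ x) v) +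
      Matrix.fromBlocks ((k : ℂ) • κ.matrix x₀ (chartAt (Fin m → ℂ) x₀ x)) 0 0 0).det /
    (κ.matrix x₀ (chartAt (Fin m → ℂ) x₀ x)).det)

/-- The jet of the twisted metric and the Kähler form. -/
def metricJet (κ : KahlerForm m X) (h₀ h : HermitianMetric E m (n + 1))
    (Φ : ∀ x, Module.End ℂ (Sym[ℂ]^d (E x))) (k : ℕ) (x₀ : X) (y : Fin m → ℂ) :
    Jet m d (n + 1) :=
  jetOf (fun z => (localData h₀ h Φ (k : ℝ)⁻¹ x₀ z).invGram) (κ.matrix x₀) ((k : ℝ)⁻¹ : ℝ) y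

variable (κ : KahlerForm m X) (h₀ h : HermitianMetric E m (n + 1))
  {Φ : ∀ x, Module.End ℂ (Sym[ℂ]^d (E x))} {k : ℕ} {x₀ : X} {y : Fin m → ℂ}

theorem metricJet_mem (hy : y ∈ (symFrames E m (n + 1) d).dom x₀)
    (hpos : ∀ x, IsHermInner (twistedForm h Φ k x)) :
    metricJet κ h₀ h Φ k x₀ y ∈ goodJets m d (n + 1) :=
  ⟨(κ.accretive (isHolo_symFrames.dom_subset_tangent x₀ hy)).isUnit_det.ne_zero, fun _ hv =>
    normVal_inv_ne_zero (localData_mem_good h₀ h k hy (hpos _)).2 hv⟩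

theorem contDiffAt_metricJet (hΦ : IsSmoothEnd (symFrames E m (n + 1) d) Φ)
    (hy : y ∈ (symFrames E m (n + 1) d).dom x₀)
    (hpos : ∀ x, IsHermInner (twistedForm h Φ k x)) :
    ContDiffAt ℝ ∞ (metricJet κ h₀ h Φ k x₀) y :=
  contDiffAt_jetOf _ (contDiffAt_invGram h₀ h hΦ hy hpos) fun a b =>
    (κ.smoothMat x₀ a b).contDiffAt ((isHolo_tangentFrames.isOpen_dom x₀).mem_nhds
      (isHolo_symFrames.dom_subset_tangent x₀ hy))

/-- The vectors s and t are expanded in monomials. Since only the jet at y then occurs, continuity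
and homogeneity are inherited from the jet integrands. -/
theorem homIntegrand_eq_sum (hk : k ≠ 0) (hΦ : IsSmoothEnd (symFrames E m (n + 1) d) Φ)
    (hy : y ∈ (symFrames E m (n + 1) d).dom x₀) (hpos : ∀ x, IsHermInner (twistedForm h Φ k x))
    (s t : Sym[ℂ]^d (E ((chartAt (Fin m → ℂ) x₀).symm y))) :
    ∃ a b : Monomials d (n + 1) → ℂ,
      (∀ v, homIntegrand κ h Φ k x₀ _ s t v =
        ∑ f, ∑ g, a f * conj (b g) * jetIntegrand f g (metricJet κ h₀ h Φ k x₀ y) v) ∧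
      ∑ f, a f • (symFrames E m (n + 1) d).vec x₀ _ f = s ∧
      ∑ f, b f • (symFrames E m (n + 1) d).vec x₀ _ f = t := by
  have hb := (mem_nbhd_bundleFrames.1 (isHolo_bundleFrames.symm_mem_nbhd hy)).2
  set B := symBasis d (frameBasis hb) with hB
  have hvec : ∀ f, B f = (symFrames E m (n + 1) d).vec x₀ _ f := fun f => by
    simp only [hB, symBasis_apply, frameBasis_apply (m := m)]; rfl
  have hyt := isHolo_symFrames.dom_subset x₀ hy
  refine ⟨fun f => B.repr s f, fun f => B.repr t f, fun v => ?_, ?_, ?_⟩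
  · have hpow : ∀ s : Sym[ℂ]^d (E ((chartAt (Fin m → ℂ) x₀).symm y)),
        powDual d (homPoint n E x₀ _ v) s = ∑ f, B.repr s f * mon f v := fun s => by
      conv_lhs => rw [← B.sum_repr s]
      simp only [map_sum, map_smul, smul_eq_mul, hB, powDual_homPoint hb]
    have htk : ((((k : ℝ)⁻¹ : ℝ) : ℂ)) * (k : ℂ) = 1 := by
      push_cast
      exact inv_mul_cancel₀ (by exact_mod_cast hk)
    have hdet := det_jetMat (fun f g => (contDiffAt_invGram h₀ h hΦ hy hpos f g).of_le
      (by norm_cast)) (κ.matrix x₀) htk v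
    have hev := normReal_eventuallyEq h₀ h hy hpos v
    rw [← cHess_congr hev, ← hev.self_of_nhds] at hdet
    have hnorm := dualNormSq_twistedForm h₀ h k hy (hpos _) v
    unfold homIntegrand
    rw [(chartAt (Fin m → ℂ) x₀).right_inv hyt, hnorm, hpow, hpow]
    simp only [jetIntegrand_eq]
    rw [show (jetMat (metricJet κ h₀ h Φ k x₀ y) v).det = _ from hdet]
    have h1 : normVal (metricJet κ h₀ h Φ k x₀ y).val v =
      normFun (fun z => (localData h₀ h Φ (k : ℝ)⁻¹ x₀ z).invGram) (Sum.elim y v) := rfl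
    have h2 : Matrix.of (metricJet κ h₀ h Φ k x₀ y).kah = κ.matrix x₀ y := rfl
    rw [h1, h2, map_sum, Finset.sum_mul_sum, Finset.sum_div, Finset.sum_mul]
    refine Finset.sum_congr rfl fun f _ => ?_
    rw [Finset.sum_div, Finset.sum_mul]
    refine Finset.sum_congr rfl fun g _ => ?_
    push_cast
    rw [map_mul]
    ring
  · simp only [← hvec, B.sum_repr]
  · simp only [← hvec, B.sum_repr]

/-- The fibre density cancels, and `det_cHess_homogeneous` with c = 1 passes from affine to
homogeneous coordinates at the cost of d². The factor 2^n comes from the normalisation i dξ ∧ dξ̄.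
-/
theorem pushIntegrand_eq (hd : d ≠ 0) (hk : k ≠ 0) (hΦ : IsSmoothEnd (symFrames E m (n + 1) d) Φ)
    (hy : y ∈ (symFrames E m (n + 1) d).dom x₀) (hpos : ∀ x, IsHermInner (twistedForm h Φ k x))
    (s t : Sym[ℂ]^d (E ((chartAt (Fin m → ℂ) x₀).symm y))) (ξ : Fin n → ℂ) :
    pushIntegrand κ h Φ k x₀ _ s t ξ =
      2 ^ n / (d : ℂ) ^ 2 * homIntegrand κ h Φ k x₀ _ s t (Fin.cons 1 ξ) := by
  have hyt := isHolo_symFrames.dom_subset x₀ hy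
  have hs := contDiffAt_normReal h hΦ hy hpos
  have hN0 := normReal_ne_zero h hy hpos (cons_one_ne_zero ξ)
  have hkey := det_cHess_homogeneous (normReal_homogeneous h Φ k x₀) (one_ne_zero (α := ℂ))
    (hs _) (hs _) hN0 hd ((k : ℂ) • κ.matrix x₀ y)
  simp only [norm_one, Complex.ofReal_one, one_pow, one_mul, one_smul] at hkey
  have hdK : densityK κ h Φ k x₀ (Sum.elim y ξ) = ((k : ℂ) ^ m)⁻¹ *
      (complexHessian (fun w => Real.log (normReal h Φ k x₀ (affineSlice w))) (Sum.elim y ξ) +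
        Matrix.fromBlocks ((k : ℂ) • κ.matrix x₀ y) 0 0 0).det := by
    have : (Matrix.fromBlocks ((k : ℂ) • κ.matrix x₀ y) 0 0 0 :
        Matrix (Fin m ⊕ Fin n) (Fin m ⊕ Fin n) ℂ) =
        (k : ℂ) • Matrix.fromBlocks (κ.matrix x₀ y) 0 0 0 := by
      rw [Matrix.fromBlocks_smul, smul_zero, smul_zero, smul_zero]
    rw [this]
    rfl
  have hfd := fibreDensity_ne_zero h hd hy ξ
  have hdet := (κ.accretive (isHolo_symFrames.dom_subset_tangent x₀ hy)).isUnit_det.ne_zero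
  have hd0 : (d : ℂ) ≠ 0 := by exact_mod_cast hd
  have hG : densityG d κ h x₀ (Sum.elim y ξ) =
    fibreDensity d h x₀ (Sum.elim y ξ) * (κ.matrix x₀ y).det := rfl
  unfold pushIntegrand homIntegrand
  rw [(chartAt (Fin m → ℂ) x₀).right_inv hyt, hdK, hG, hkey]
  have hP : affinePoint n E x₀ ((chartAt (Fin m → ℂ) x₀).symm y) ξ =
    homPoint n E x₀ ((chartAt (Fin m → ℂ) x₀).symm y) (Fin.cons 1 ξ) := rfl
  rw [hP, inv_pow]
  generalize (complexHessian (fun w => Real.log (normReal h Φ k x₀ (affineSlice w)))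
    (Sum.elim y ξ) + Matrix.fromBlocks ((k : ℂ) • κ.matrix x₀ y) 0 0 0).det = D
  field_simp

theorem continuousOn_homIntegrand (hk : k ≠ 0) (hΦ : IsSmoothEnd (symFrames E m (n + 1) d) Φ)
    (hy : y ∈ (symFrames E m (n + 1) d).dom x₀) (hpos : ∀ x, IsHermInner (twistedForm h Φ k x))
    (s t : Sym[ℂ]^d (E ((chartAt (Fin m → ℂ) x₀).symm y))) :
    ContinuousOn (homIntegrand κ h Φ k x₀ _ s t) {0}ᶜ := by
  obtain ⟨a, b, hab, -⟩ := homIntegrand_eq_sum κ h h hk hΦ hy hpos s t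
  rw [funext hab]
  refine continuousOn_finsetSum _ fun f _ => continuousOn_finsetSum _ fun g _ =>
    continuousOn_const.mul ?_
  exact (contDiffOn_jetIntegrand f g).continuousOn.comp (f := fun v =>
    (metricJet κ h h Φ k x₀ y, v)) (by fun_prop) fun v hv => ⟨metricJet_mem κ h h hy hpos, hv⟩

theorem homIntegrand_homogeneous (hd : d ≠ 0) (hk : k ≠ 0)
    (hΦ : IsSmoothEnd (symFrames E m (n + 1) d) Φ)
    (hy : y ∈ (symFrames E m (n + 1) d).dom x₀) (hpos : ∀ x, IsHermInner (twistedForm h Φ k x))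
    (s t : Sym[ℂ]^d (E ((chartAt (Fin m → ℂ) x₀).symm y))) {c : ℂ} (hc : c ≠ 0) (ξ : Fin n → ℂ) :
    ((‖c‖ : ℂ) ^ 2) ^ (n + 1) * homIntegrand κ h Φ k x₀ _ s t (c • Fin.cons 1 ξ) =
      homIntegrand κ h Φ k x₀ _ s t (Fin.cons 1 ξ) := by
  obtain ⟨a, b, hab, -⟩ := homIntegrand_eq_sum κ h h hk hΦ hy hpos s t
  have htk : ((((k : ℝ)⁻¹ : ℝ) : ℂ)) * (k : ℂ) = 1 := by
    push_cast
    exact inv_mul_cancel₀ (by exact_mod_cast hk)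
  rw [hab, hab, Finset.mul_sum]
  refine Finset.sum_congr rfl fun f _ => ?_
  rw [Finset.mul_sum]
  refine Finset.sum_congr rfl fun g _ => ?_
  rw [mul_left_comm]
  congr 1
  exact jetIntegrand_homogeneous hd (fun f g => (contDiffAt_invGram h h hΦ hy hpos f g).of_le
    (by norm_cast)) htk (normReal_homogeneous h Φ k x₀) (normReal_eventuallyEq h h hy hpos) ξ
    (normReal_ne_zero h hy hpos (cons_one_ne_zero ξ)) hc f g

/-- The push-forward as an integral over a spherical shell in `E_x^*`. -/
theorem integral_pushIntegrand (hd : d ≠ 0) (hk : k ≠ 0)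
    (hΦ : IsSmoothEnd (symFrames E m (n + 1) d) Φ) {x : X}
    (hx : x ∈ (symFrames E m (n + 1) d).nbhd x₀) (hpos : ∀ x, IsHermInner (twistedForm h Φ k x))
    (s t : Sym[ℂ]^d (E x)) {ν : (Fin (n + 1) → ℂ) → ℝ} (hν : IsNormSqLike ν) :
    Integrable (pushIntegrand κ h Φ k x₀ x s t) ∧
      radialConst * ∫ ξ, pushIntegrand κ h Φ k x₀ x s t ξ =
        2 ^ n / (d : ℂ) ^ 2 * ∫ v, (radialBump (ν v) : ℂ) * homIntegrand κ h Φ k x₀ x s t v := by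
  obtain ⟨y, hy, rfl⟩ : ∃ y ∈ (symFrames E m (n + 1) d).dom x₀,
      (chartAt (Fin m → ℂ) x₀).symm y = x :=
    ⟨_, hx.2, (chartAt (Fin m → ℂ) x₀).left_inv hx.1⟩
  have h1 := integral_affine_eq hν (continuousOn_homIntegrand κ h hk hΦ hy hpos s t)
    fun c hc ξ => homIntegrand_homogeneous κ h hd hk hΦ hy hpos s t hc ξ
  have h2 : pushIntegrand κ h Φ k x₀ _ s t = fun ξ : Fin n → ℂ =>
      2 ^ n / (d : ℂ) ^ 2 * homIntegrand κ h Φ k x₀ _ s t (Fin.cons 1 ξ) :=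
    funext fun ξ => pushIntegrand_eq κ h hd hk hΦ hy hpos s t ξ
  rw [h2, h1.2, integral_const_mul]
  exact ⟨h1.1.const_mul _, by ring⟩

end HomIntegrand

/-! ### The volume density under fibrewise linear maps -/

section FrameChange

variable {m n d : ℕ}

/-- The map `(y, v) ↦ (φ y, G y v)`. -/
def fibreMap (φ : (Fin m → ℂ) → Fin m → ℂ) (G : (Fin m → ℂ) → Matrix (Fin n) (Fin n) ℂ)
    (w : Fin m ⊕ Fin n → ℂ) : Fin m ⊕ Fin n → ℂ :=
  Sum.elim (φ (w ∘ Sum.inl)) ((G (w ∘ Sum.inl)).mulVec (w ∘ Sum.inr))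

theorem contDiffAt_fibreMap {φ : (Fin m → ℂ) → Fin m → ℂ}
    {G : (Fin m → ℂ) → Matrix (Fin n) (Fin n) ℂ} {y : Fin m → ℂ} (hφ : ContDiffAt ℂ 2 φ y)
    (hG : ∀ i j, ContDiffAt ℂ 2 (fun z => G z i j) y) (v : Fin n → ℂ) :
    ContDiffAt ℂ 2 (fibreMap φ G) (Sum.elim y v) := by
  have hb : ContDiffAt ℂ 2 (fun w : Fin m ⊕ Fin n → ℂ => w ∘ Sum.inl) (Sum.elim y v) :=
    (baseProj m n).contDiff.contDiffAt
  refine contDiffAt_pi.2 ?_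
  rintro (a | i)
  · exact (contDiffAt_pi.1 hφ a).comp (Sum.elim y v) hb
  · change ContDiffAt ℂ 2 (fun w : Fin m ⊕ Fin n → ℂ => ∑ j, G (w ∘ Sum.inl) i j * w (Sum.inr j)) _
    refine ContDiffAt.sum (𝕜 := ℂ) fun j _ => ContDiffAt.mul (𝕜 := ℂ) (𝔸 := ℂ)
      (f := fun w : Fin m ⊕ Fin n → ℂ => G (w ∘ Sum.inl) i j) (g := fun w => w (Sum.inr j)) ?_ ?_
    · exact ContDiffAt.comp (g := fun z => G z i j) (f := fun w => w ∘ Sum.inl) (Sum.elim y v)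
        (hG i j) hb
    · exact (ContinuousLinearMap.proj (R := ℂ) (φ := fun _ => ℂ)
        (Sum.inr j : Fin m ⊕ Fin n)).contDiff.contDiffAt

/-- The Jacobian is block triangular. The block B, formed by the base derivatives of G, affects
neither its determinant nor the transformation of the base block K. -/
theorem holoJac_fibreMap {φ : (Fin m → ℂ) → Fin m → ℂ}
    {G : (Fin m → ℂ) → Matrix (Fin n) (Fin n) ℂ} {y : Fin m → ℂ} (hφ : ContDiffAt ℂ 2 φ y)
    (hG : ∀ i j, ContDiffAt ℂ 2 (fun z => G z i j) y) (v : Fin n → ℂ) :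
    ∃ B, holoJac (fibreMap φ G) (Sum.elim y v) =
      Matrix.fromBlocks (holoJac φ y) B 0 (G y).transpose := by
  have hdiff : DifferentiableAt ℂ (fibreMap φ G) (Sum.elim y v) :=
    (contDiffAt_fibreMap hφ hG v).differentiableAt (by simp)
  have hφd : DifferentiableAt ℂ φ y := hφ.differentiableAt (by simp)
  have hb : HasFDerivAt (fun w : Fin m ⊕ Fin n → ℂ => w ∘ Sum.inl) (baseProj m n) (Sum.elim y v) :=
    (baseProj m n).hasFDerivAt
  have h1 : ∀ b c, holoJac (fibreMap φ G) (Sum.elim y v) b (Sum.inl c) =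
      fderiv ℂ (fun z => φ z c) y (baseProj m n (Pi.single b 1)) := by
    intro b c
    rw [holoJac_apply hdiff]
    have hc : DifferentiableAt ℂ (fun z => φ z c) y := differentiableAt_pi.1 hφd c
    have := (HasFDerivAt.comp (g := fun z => φ z c) (f := fun w => w ∘ Sum.inl) (Sum.elim y v)
      hc.hasFDerivAt hb).fderiv
    exact DFunLike.congr_fun this _
  have h2 : ∀ b c, holoJac (fibreMap φ G) (Sum.elim y v) (Sum.inr b) (Sum.inr c) = G y c b := by
    intro b c
    rw [holoJac_apply hdiff]
    have hterm : ∀ j, HasFDerivAt (fun w : Fin m ⊕ Fin n → ℂ => G (w ∘ Sum.inl) c j * w (Sum.inr j))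
        (G y c j • ContinuousLinearMap.proj (R := ℂ) (φ := fun _ => ℂ) (Sum.inr j : Fin m ⊕ Fin n) +
          v j • (fderiv ℂ (fun z => G z c j) y ∘L baseProj m n)) (Sum.elim y v) := fun j =>
      HasFDerivAt.mul (HasFDerivAt.comp (g := fun z => G z c j) (f := fun w => w ∘ Sum.inl)
        (Sum.elim y v) ((hG c j).differentiableAt (by simp)).hasFDerivAt hb)
        (ContinuousLinearMap.proj (R := ℂ) (φ := fun _ => ℂ)
          (Sum.inr j : Fin m ⊕ Fin n)).hasFDerivAt
    have hs : HasFDerivAt (fun w => fibreMap φ G w (Sum.inr c)) _ (Sum.elim y v) :=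
      HasFDerivAt.fun_sum (u := Finset.univ) fun j _ => hterm j
    rw [hs.fderiv]
    simp [baseProj_single_inr, Pi.single_apply]
  refine ⟨(holoJac (fibreMap φ G) (Sum.elim y v)).toBlocks₁₂, ?_⟩
  ext (a | a) (b | b)
  · rw [h1, Matrix.fromBlocks_apply₁₁, baseProj_single_inl, holoJac_apply hφd]
  · rfl
  · rw [h1, Matrix.fromBlocks_apply₂₁, baseProj_single_inr]
    simp
  · rw [h2, Matrix.fromBlocks_apply₂₂, Matrix.transpose_apply]

/-- Transformation of the volume density under a change of chart and frame. -/
theorem det_cHess_fibreMap {φ : (Fin m → ℂ) → Fin m → ℂ}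
    {G : (Fin m → ℂ) → Matrix (Fin n) (Fin n) ℂ} {y : Fin m → ℂ} (hφ : ContDiffAt ℂ 2 φ y)
    (hG : ∀ i j, ContDiffAt ℂ 2 (fun z => G z i j) y) {v : Fin n → ℂ}
    {N N' : (Fin m ⊕ Fin n → ℂ) → ℂ} (hN' : ContDiffAt ℝ 2 N' (fibreMap φ G (Sum.elim y v)))
    (hN : N =ᶠ[nhds (Sum.elim y v)] fun w => N' (fibreMap φ G w))
    {K K' : Matrix (Fin m) (Fin m) ℂ}
    (hK : K = holoJac φ y * K' * (holoJac φ y).conjTranspose) (c k : ℂ) :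
    (c • cHess N (Sum.elim y v) + Matrix.fromBlocks (k • K) 0 0 0).det =
      (((‖(holoJac φ y).det‖ : ℂ) ^ 2) * ((‖(G y).det‖ : ℂ) ^ 2)) *
      (c • cHess N' (fibreMap φ G (Sum.elim y v)) + Matrix.fromBlocks (k • K') 0 0 0).det := by
  obtain ⟨B, hB⟩ := holoJac_fibreMap hφ hG v
  have h1 := cHess_comp hN' (contDiffAt_fibreMap hφ hG v)
  rw [← cHess_congr hN] at h1
  have h2 : c • cHess N (Sum.elim y v) + Matrix.fromBlocks (k • K) 0 0 0 =
      holoJac (fibreMap φ G) (Sum.elim y v) *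
      (c • cHess N' (fibreMap φ G (Sum.elim y v)) + Matrix.fromBlocks (k • K') 0 0 0) *
      (holoJac (fibreMap φ G) (Sum.elim y v)).conjTranspose := by
    rw [mul_add, add_mul, Matrix.mul_smul, Matrix.smul_mul, h1]
    congr 1
    rw [hB, Matrix.fromBlocks_conjTranspose, Matrix.fromBlocks_multiply, Matrix.fromBlocks_multiply,
      hK]
    simp
  have hsq : ∀ z : ℂ, (‖z‖ : ℂ) ^ 2 = z * conj z := fun z => by
    rw [Complex.mul_conj, Complex.normSq_eq_norm_sq]; push_cast; rfl
  rw [h2, Matrix.det_mul, Matrix.det_mul, Matrix.det_conjTranspose, hB,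
    Matrix.det_fromBlocks_zero₂₁, Matrix.det_transpose, hsq, hsq, RCLike.star_def, map_mul]
  ring

end FrameChange

/-! ### Independence of the chart and of the frame -/

section Invariance

variable {m n d : ℕ} {X : Type*} [TopologicalSpace X] [ChartedSpace (Fin m → ℂ) X]
  [IsManifold 𝓘(ℂ, Fin m → ℂ) ω X]
  {E : X → Type*} [∀ x, AddCommGroup (E x)] [∀ x, Module ℂ (E x)]
  [∀ x, TopologicalSpace (E x)] [TopologicalSpace (TotalSpace (Fin (n + 1) → ℂ) E)]
  [FiberBundle (Fin (n + 1) → ℂ) E] [VectorBundle ℂ (Fin (n + 1) → ℂ) E]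
  [ContMDiffVectorBundle ω (Fin (n + 1) → ℂ) E 𝓘(ℂ, Fin m → ℂ)]
  (κ : KahlerForm m X) (h : HermitianMetric E m (n + 1))
  {Φ : ∀ x, Module.End ℂ (Sym[ℂ]^d (E x))} {k : ℕ} {x₀ x₀' x : X}

/-- The transition matrix of the frames. -/
def transMat (n : ℕ) (E : X → Type*) [∀ x, AddCommGroup (E x)] [∀ x, Module ℂ (E x)]
    [∀ x, TopologicalSpace (E x)] [TopologicalSpace (TotalSpace (Fin (n + 1) → ℂ) E)]
    [FiberBundle (Fin (n + 1) → ℂ) E] [VectorBundle ℂ (Fin (n + 1) → ℂ) E]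
    (x₀ x₀' x : X) : Matrix (Fin (n + 1)) (Fin (n + 1)) ℂ :=
  Matrix.of fun i j => (trivializationAt (Fin (n + 1) → ℂ) E x₀').coordChangeL ℂ
    (trivializationAt (Fin (n + 1) → ℂ) E x₀) x (Pi.single i 1) j

theorem frameBasis_change (hx : x ∈ (bundleFrames E m (n + 1)).nbhd x₀)
    (hx' : x ∈ (bundleFrames E m (n + 1)).nbhd x₀') (i : Fin (n + 1)) :
    frameBasis (mem_nbhd_bundleFrames.1 hx').2 i =
      ∑ j, transMat n E x₀ x₀' x i j • frameBasis (mem_nbhd_bundleFrames.1 hx).2 j := by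
  simp only [frameBasis_apply (m := m)]
  exact vec_change (mem_nbhd_bundleFrames.1 hx).2 (mem_nbhd_bundleFrames.1 hx').2 i

/-- The entries of v are the values of the functional on the frame vectors, so they transform by the
same matrix as the frame. -/
theorem homPoint_change (hx : x ∈ (bundleFrames E m (n + 1)).nbhd x₀)
    (hx' : x ∈ (bundleFrames E m (n + 1)).nbhd x₀') (v : Fin (n + 1) → ℂ) :
    homPoint n E x₀' x ((transMat n E x₀ x₀' x).mulVec v) = homPoint n E x₀ x v := by
  refine (frameBasis (mem_nbhd_bundleFrames.1 hx').2).ext fun i => ?_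
  rw [homPoint_frameBasis, frameBasis_change hx hx', map_sum]
  simp only [map_smul, homPoint_frameBasis, smul_eq_mul]
  rfl

theorem contDiffAt_transMat (hx : x ∈ (bundleFrames E m (n + 1)).nbhd x₀)
    (hx' : x ∈ (bundleFrames E m (n + 1)).nbhd x₀') (i j : Fin (n + 1)) :
    ContDiffAt ℂ 2 (fun z => transMat n E x₀ x₀' ((chartAt (Fin m → ℂ) x₀).symm z) i j)
      (chartAt (Fin m → ℂ) x₀ x) := by
  have h1 := contMDiffOn_coordChangeL (n := ω) (IB := 𝓘(ℂ, Fin m → ℂ)) (𝕜 := ℂ)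
    (trivializationAt (Fin (n + 1) → ℂ) E x₀') (trivializationAt (Fin (n + 1) → ℂ) E x₀)
  have h2 : ContMDiffOn 𝓘(ℂ, Fin m → ℂ) 𝓘(ℂ, Fin m → ℂ) ω (chartAt (Fin m → ℂ) x₀).symm
    (chartAt (Fin m → ℂ) x₀).target := contMDiffOn_chart_symm
  have h3 := contMDiffOn_iff_contDiffOn.1 (h1.comp
    (t := (trivializationAt (Fin (n + 1) → ℂ) E x₀').baseSet ∩
      (trivializationAt (Fin (n + 1) → ℂ) E x₀).baseSet)
    (h2.mono (show (bundleFrames E m (n + 1)).overlap x₀' x₀ ⊆ _ from fun y hy => hy.1.1))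
    fun y hy => ⟨(mem_nbhd_bundleFrames.1 hy.2).2, hy.1.2⟩)
  have h4 := (h3.clm_apply (contDiffOn_const (c := (Pi.single i 1 : Fin (n + 1) → ℂ)))).contDiffAt
    ((isHolo_bundleFrames.isOpen_overlap x₀' x₀).mem_nhds (x := chartAt (Fin m → ℂ) x₀ x)
      ⟨hx.2, by rwa [Set.mem_preimage, (chartAt (Fin m → ℂ) x₀).left_inv hx.1]⟩)
  exact (contDiffAt_pi.1 h4 j).of_le le_top

theorem isUnit_det_transMat (hx : x ∈ (bundleFrames E m (n + 1)).nbhd x₀)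
    (hx' : x ∈ (bundleFrames E m (n + 1)).nbhd x₀') :
    IsUnit (transMat n E x₀ x₀' x).det :=
  isUnit_det_of_change _ _ (frameBasis_change hx hx')

/-- The homogeneous integrand in different charts and frames. -/
theorem homIntegrand_change (hΦ : IsSmoothEnd (symFrames E m (n + 1) d) Φ)
    (hx : x ∈ (symFrames E m (n + 1) d).nbhd x₀) (hx' : x ∈ (symFrames E m (n + 1) d).nbhd x₀')
    (hpos : ∀ x, IsHermInner (twistedForm h Φ k x)) (s t : Sym[ℂ]^d (E x)) (v : Fin (n + 1) → ℂ) :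
    homIntegrand κ h Φ k x₀ x s t v = (‖(transMat n E x₀ x₀' x).det‖ : ℂ) ^ 2 *
      homIntegrand κ h Φ k x₀' x s t ((transMat n E x₀ x₀' x).mulVec v) := by
  set y := chartAt (Fin m → ℂ) x₀ x with hy
  set φ : (Fin m → ℂ) → Fin m → ℂ := coordChange x₀' x₀ with hφ
  set G := fun z => transMat n E x₀ x₀' ((chartAt (Fin m → ℂ) x₀).symm z) with hG
  have hsymm : (chartAt (Fin m → ℂ) x₀).symm y = x := (chartAt (Fin m → ℂ) x₀).left_inv hx.1
  have hov : y ∈ (symFrames E m (n + 1) d).overlap x₀' x₀ :=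
    ⟨hx.2, by rwa [Set.mem_preimage, hsymm]⟩
  have hφy : φ y = chartAt (Fin m → ℂ) x₀' x := by rw [hφ, coordChange, hsymm]
  have hGy : G y = transMat n E x₀ x₀' x := by rw [hG]; simp only [hsymm]
  have hΨ : fibreMap φ G (Sum.elim y v) =
      Sum.elim (chartAt (Fin m → ℂ) x₀' x) ((transMat n E x₀ x₀' x).mulVec v) := by
    rw [← hφy, ← hGy]; rfl
  have hφs : ContDiffAt ℂ 2 φ y := ((contDiffOn_coordChange x₀' x₀).contDiffAt
    (((chartAt (Fin m → ℂ) x₀).isOpen_inter_preimage_symm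
      (chartAt (Fin m → ℂ) x₀').open_source).mem_nhds
        ⟨isHolo_symFrames.dom_subset _ hx.2, hov.2.1⟩)).of_le le_top
  have hGs : ∀ i j, ContDiffAt ℂ 2 (fun z => G z i j) y := contDiffAt_transMat hx hx'
  have hev : (fun w => (normReal h Φ k x₀ w : ℂ)) =ᶠ[nhds (Sum.elim y v)]
      fun w => (normReal h Φ k x₀' (fibreMap φ G w) : ℂ) := by
    have hc : ContinuousAt (fun w : Fin m ⊕ Fin (n + 1) → ℂ => w ∘ Sum.inl) (Sum.elim y v) :=
      (baseProj m (n + 1)).continuous.continuousAt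
    filter_upwards [hc.preimage_mem_nhds
      ((isHolo_symFrames.isOpen_overlap x₀' x₀).mem_nhds hov)] with w hw
    have h1 : (chartAt (Fin m → ℂ) x₀').symm (φ (w ∘ Sum.inl)) =
      (chartAt (Fin m → ℂ) x₀).symm (w ∘ Sum.inl) := Frames.IsHolo.symm_coordChange hw
    congr 1
    change dualNormSq (twistedMetric h Φ k ((chartAt (Fin m → ℂ) x₀).symm (w ∘ Sum.inl)))
      (powDual d (homPoint n E x₀ ((chartAt (Fin m → ℂ) x₀).symm (w ∘ Sum.inl)) (w ∘ Sum.inr))) =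
      dualNormSq (twistedMetric h Φ k ((chartAt (Fin m → ℂ) x₀').symm (φ (w ∘ Sum.inl))))
      (powDual d (homPoint n E x₀' ((chartAt (Fin m → ℂ) x₀').symm (φ (w ∘ Sum.inl)))
        ((transMat n E x₀ x₀' ((chartAt (Fin m → ℂ) x₀).symm (w ∘ Sum.inl))).mulVec (w ∘ Sum.inr))))
    rw [h1, homPoint_change (isHolo_bundleFrames.symm_mem_nbhd hw.1) hw.2]
  have hN's : ContDiffAt ℝ 2 (fun w => (normReal h Φ k x₀' w : ℂ))
      (fibreMap φ G (Sum.elim y v)) := by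
    rw [hΨ]
    exact Complex.ofRealCLM.contDiff.contDiffAt.comp _ (contDiffAt_normReal h hΦ hx'.2 hpos _)
  have hK : κ.matrix x₀ y = holoJac φ y * κ.matrix x₀' (φ y) * (holoJac φ y).conjTranspose :=
    κ.matrix_change (isHolo_symFrames.overlap_subset x₀' x₀ hov)
  have hdet := det_cHess_fibreMap hφs hGs hN's hev hK
    (((normReal h Φ k x₀ (Sum.elim y v) : ℂ))⁻¹) (k : ℂ)
  have hn : (normReal h Φ k x₀ (Sum.elim y v) : ℂ) = normReal h Φ k x₀'
      (Sum.elim (chartAt (Fin m → ℂ) x₀' x) ((transMat n E x₀ x₀' x).mulVec v)) := by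
    rw [← hΨ]; exact hev.self_of_nhds
  have hJ : ((‖(holoJac φ y).det‖ : ℂ) ^ 2) ≠ 0 := by
    have := (isUnit_det_holoJac_coordChange
      (isHolo_symFrames.overlap_subset x₀' x₀ hov)).ne_zero
    exact pow_ne_zero _ (by simpa using this)
  have hKdet : (κ.matrix x₀ y).det =
      (‖(holoJac φ y).det‖ : ℂ) ^ 2 * (κ.matrix x₀' (chartAt (Fin m → ℂ) x₀' x)).det := by
    rw [hK, hφy, Matrix.det_mul, Matrix.det_mul, Matrix.det_conjTranspose, RCLike.star_def]
    have : (‖(holoJac φ y).det‖ : ℂ) ^ 2 = (holoJac φ y).det * conj (holoJac φ y).det := by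
      rw [Complex.mul_conj, Complex.normSq_eq_norm_sq]; push_cast; rfl
    rw [this]; ring
  unfold homIntegrand
  -- The squared modulus J of the base Jacobian occurs in the volume form and in the determinant of
  -- the Kähler matrix, and cancels. The fibre factor T remains and becomes the Jacobian of v ↦ gv
  -- under the integral.
  have hcancel : ∀ A K J T D M : ℂ, J ≠ 0 →
      A * (K * (J * T * D) / (J * M)) = T * (A * (K * D / M)) := fun A K J T D M hJ => by
    rw [show K * (J * T * D) = J * (K * (T * D)) by ring, mul_div_mul_left _ _ hJ]
    ring
  rw [homPoint_change hx hx', hdet, hKdet, hΨ, hφy, hGy, hn, hcancel _ _ _ _ _ _ hJ]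

/-- The integrands on the cone differ by |det g|², the real Jacobian of v ↦ gv. Any exhaustion ν may
be used in `integral_pushIntegrand`; taking the standard one in one frame and its pullback by g in
the other makes the cut-offs match. The lemma is indispensable because `pushMetric` uses at x the
frame labelled by x, while derivatives are computed in one fixed frame. -/
theorem integral_pushIntegrand_change (hd : d ≠ 0) (hk : k ≠ 0)
    (hΦ : IsSmoothEnd (symFrames E m (n + 1) d) Φ)
    (hx : x ∈ (symFrames E m (n + 1) d).nbhd x₀) (hx' : x ∈ (symFrames E m (n + 1) d).nbhd x₀')
    (hpos : ∀ x, IsHermInner (twistedForm h Φ k x)) (s t : Sym[ℂ]^d (E x)) :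
    ∫ ξ, pushIntegrand κ h Φ k x₀ x s t ξ = ∫ ξ, pushIntegrand κ h Φ k x₀' x s t ξ := by
  have hdet := (isUnit_det_transMat hx hx').ne_zero
  set g := transMat n E x₀ x₀' x with hg
  have hν := isNormSqLike_stdNormSq (n := n)
  have hνg : IsNormSqLike fun v : Fin (n + 1) → ℂ => stdNormSq (g.mulVec v) :=
    ⟨hν.cont.comp (by fun_prop), fun v hv => hν.pos _ fun h0 => hv
      (Matrix.eq_zero_of_mulVec_eq_zero hdet h0), fun c v => by rw [Matrix.mulVec_smul, hν.hom]⟩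
  have h1 := (integral_pushIntegrand κ h hd hk hΦ hx hpos s t hνg).2
  have h2 := (integral_pushIntegrand κ h hd hk hΦ hx' hpos s t hν).2
  have h3 := integral_comp_complexLinear (Matrix.toLin' g) (by rwa [LinearMap.det_toLin'])
    (fun v => (radialBump (stdNormSq v) : ℂ) * homIntegrand κ h Φ k x₀' x s t v)
  refine mul_left_cancel₀ radialConst_ne_zero ?_
  rw [h1, h2, ← h3, LinearMap.det_toLin']
  simp only [← integral_const_mul]
  congr 1
  funext v
  simp only [Matrix.toLin'_apply]
  rw [homIntegrand_change κ h hΦ hx hx' hpos s t v]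
  push_cast
  ring

end Invariance

/-! ### The push-forward metric as a smooth field of forms -/

section PushMetricForm

variable {m n d : ℕ} {X : Type*} [TopologicalSpace X] [ChartedSpace (Fin m → ℂ) X]
  [IsManifold 𝓘(ℂ, Fin m → ℂ) ω X]
  {E : X → Type*} [∀ x, AddCommGroup (E x)] [∀ x, Module ℂ (E x)]
  [∀ x, TopologicalSpace (E x)] [TopologicalSpace (TotalSpace (Fin (n + 1) → ℂ) E)]
  [FiberBundle (Fin (n + 1) → ℂ) E] [VectorBundle ℂ (Fin (n + 1) → ℂ) E]
  [ContMDiffVectorBundle ω (Fin (n + 1) → ℂ) E 𝓘(ℂ, Fin m → ℂ)]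
  (κ : KahlerForm m X) (h₀ h : HermitianMetric E m (n + 1))
  {Φ : ∀ x, Module.End ℂ (Sym[ℂ]^d (E x))} {k : ℕ}

theorem integrable_pushIntegrand (hd : d ≠ 0) (hk : k ≠ 0)
    (hΦ : IsSmoothEnd (symFrames E m (n + 1) d) Φ) (hpos : ∀ x, IsHermInner (twistedForm h Φ k x))
    (x : X) (s t : Sym[ℂ]^d (E x)) : Integrable (pushIntegrand κ h Φ k x x s t) :=
  (integral_pushIntegrand κ h hd hk hΦ (isHolo_symFrames.mem_nbhd_self x) hpos s t
    isNormSqLike_stdNormSq).1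

/-- Additivity of the integral rests on integrability. The bundled form is what the lemmas on change
of frame accept. -/
theorem exists_pushForm (hd : d ≠ 0) (hk : k ≠ 0)
    (hΦ : IsSmoothEnd (symFrames E m (n + 1) d) Φ)
    (hpos : ∀ x, IsHermInner (twistedForm h Φ k x)) :
    ∃ T : ∀ x, Sym[ℂ]^d (E x) →ₗ[ℂ] Sym[ℂ]^d (E x) →ₛₗ[starRingEnd ℂ] ℂ,
      (fun x s t => T x s t) = pushMetric κ h Φ k := by
  have hint := integrable_pushIntegrand κ h hd hk hΦ hpos
  refine ⟨fun x => LinearMap.mk₂'ₛₗ (RingHom.id ℂ) (starRingEnd ℂ) (pushMetric κ h Φ k x)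
    (fun s s' t => ?_) (fun c s t => ?_) (fun s t t' => ?_) (fun c s t => ?_), rfl⟩
  · rw [pushMetric, pushMetric, pushMetric, ← mul_add, ← integral_add (hint x s t) (hint x s' t)]
    congr 2
    funext ξ
    simp only [pushIntegrand, map_add]
    ring
  · rw [pushMetric, pushMetric, RingHom.id_apply, smul_eq_mul, mul_left_comm, ← integral_const_mul c]
    congr 2
    funext ξ
    simp only [pushIntegrand, map_smul, smul_eq_mul]
    ring
  · rw [pushMetric, pushMetric, pushMetric, ← mul_add, ← integral_add (hint x s t) (hint x s t')]
    congr 2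
    funext ξ
    simp only [pushIntegrand, map_add]
    ring
  · rw [pushMetric, pushMetric, smul_eq_mul, mul_left_comm, ← integral_const_mul (conj c)]
    congr 2
    funext ξ
    simp only [pushIntegrand, map_smul, smul_eq_mul, map_mul]
    ring

/-- The constant relating the push-forward and the integral over the spherical shell. -/
def pushConst (n d : ℕ) : ℂ :=
  (fibreConst n d : ℂ)⁻¹ * (radialConst⁻¹ * (2 ^ n / (d : ℂ) ^ 2))

/-- The components of the push-forward metric. -/
theorem comps_pushMetric (hd : d ≠ 0) (hk : k ≠ 0)
    (hΦ : IsSmoothEnd (symFrames E m (n + 1) d) Φ) (hpos : ∀ x, IsHermInner (twistedForm h Φ k x))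
    {x₀ : X} {y : Fin m → ℂ} (hy : y ∈ (symFrames E m (n + 1) d).dom x₀)
    (f g : Monomials d (n + 1)) :
    comps (symFrames E m (n + 1) d) (pushMetric κ h Φ k) x₀ y f g =
      pushConst n d * jetIntegral f g (metricJet κ h₀ h Φ k x₀ y) := by
  have hx := isHolo_symFrames.symm_mem_nbhd hy
  set x := (chartAt (Fin m → ℂ) x₀).symm y with hxdef
  set s := (symFrames E m (n + 1) d).vec x₀ x f with hs
  set t := (symFrames E m (n + 1) d).vec x₀ x g with ht
  obtain ⟨a, b, hab, ha, hb⟩ := homIntegrand_eq_sum κ h₀ h hk hΦ hy hpos s t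
  obtain ⟨B, hB⟩ := isHolo_symFrames.basis x₀ x hx
  have hcoef : ∀ (a : Monomials d (n + 1) → ℂ) (f : Monomials d (n + 1)),
      ∑ f, a f • (symFrames E m (n + 1) d).vec x₀ x f = (symFrames E m (n + 1) d).vec x₀ x f →
      a = Pi.single f 1 := by
    intro a f hf
    simp only [← hB] at hf
    ext e
    have := congrArg (fun s => B.repr s e) hf
    simpa [Finsupp.single_apply, Pi.single_apply, eq_comm] using this
  have ha' := hcoef a f ha
  have hb' := hcoef b g hb
  have hhom : ∀ v, homIntegrand κ h Φ k x₀ x s t v =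
      jetIntegrand f g (metricJet κ h₀ h Φ k x₀ y) v := fun v => by
    rw [hab v, ha', hb', Finset.sum_eq_single f, Finset.sum_eq_single g]
    · simp
    · intro e _ he; simp [he]
    · simp
    · intro e _ he; simp [he]
    · simp
  have h1 := (integral_pushIntegrand κ h hd hk hΦ hx hpos s t isNormSqLike_stdNormSq).2
  -- From the frame labelled by the moving point x to the fixed frame labelled by x₀.
  have h2 := integral_pushIntegrand_change κ h hd hk hΦ (isHolo_symFrames.mem_nbhd_self x) hx hpos
    s t
  simp only [hhom] at h1
  change (fibreConst n d : ℂ)⁻¹ * ∫ ξ, pushIntegrand κ h Φ k x x s t ξ = _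
  rw [h2, pushConst, jetIntegral, mul_assoc, mul_assoc, ← h1,
    inv_mul_cancel_left₀ radialConst_ne_zero]

theorem isSmoothForm_pushMetric (hd : d ≠ 0) (hk : k ≠ 0)
    (hΦ : IsSmoothEnd (symFrames E m (n + 1) d) Φ)
    (hpos : ∀ x, IsHermInner (twistedForm h Φ k x)) :
    IsSmoothForm (symFrames E m (n + 1) d) (pushMetric κ h Φ k) := fun x₀ f g => by
  have h1 : ContDiffOn ℝ ∞ (fun y => pushConst n d * jetIntegral f g (metricJet κ h h Φ k x₀ y))
      ((symFrames E m (n + 1) d).dom x₀) := fun y hy =>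
    (contDiffAt_const.mul (ContDiffAt.comp y ((contDiffOn_jetIntegral f g).contDiffAt
      (isOpen_goodJets.mem_nhds (metricJet_mem κ h h hy hpos)))
      (contDiffAt_metricJet κ h h hΦ hy hpos))).contDiffWithinAt
  exact h1.congr fun y hy => comps_pushMetric κ h h hd hk hΦ hpos hy f g

end PushMetricForm

/-! ### The volume ratio in an arbitrary chart -/

section VolumeRatio

variable {m : ℕ} {X : Type*} [TopologicalSpace X] [ChartedSpace (Fin m → ℂ) X]
  [IsManifold 𝓘(ℂ, Fin m → ℂ) ω X]

/-- Both determinants are multiplied by the squared modulus of the same Jacobian determinant. -/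
theorem volRatio_eq (κ ν : KahlerForm m X) {x₀ : X} {y : Fin m → ℂ}
    (hy : y ∈ (tangentFrames m X).dom x₀) :
    volRatio κ ν ((chartAt (Fin m → ℂ) x₀).symm y) =
      ‖(κ.matrix x₀ y).det‖ / ‖(ν.matrix x₀ y).det‖ := by
  set x := (chartAt (Fin m → ℂ) x₀).symm y with hx
  have hov : y ∈ (tangentFrames m X).overlap x x₀ := ⟨hy, isHolo_tangentFrames.mem_nbhd_self x⟩
  have hJ := norm_ne_zero_iff.2 (isUnit_det_holoJac_coordChange hov).ne_zero
  have hc : coordChange x x₀ y = chartAt (Fin m → ℂ) x x := rfl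
  have hsq : ∀ κ : KahlerForm m X, ‖(κ.matrix x₀ y).det‖ = ‖(holoJac (coordChange x x₀) y).det‖ ^ 2 *
      ‖(κ.matrix x (chartAt (Fin m → ℂ) x x)).det‖ := fun κ => by
    rw [κ.matrix_change hov, hc, Matrix.det_mul, Matrix.det_mul, Matrix.det_conjTranspose, norm_mul,
      norm_mul, norm_star]
    ring
  rw [volRatio, hsq κ, hsq ν, mul_div_mul_left _ _ (pow_ne_zero _ hJ)]

end VolumeRatio

/-! ### Comparison of covariant and ordinary bounds on compact sets -/

section Comparison

variable {ι κ : Type*} [Fintype ι] [DecidableEq ι] [Fintype κ] [DecidableEq κ]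

/-- The bound is written S² so that u/S has length at most 1, and S ≥ 1 so that S^j ≤ S^p for j ≤ p.
-/
theorem exists_pairing_le {Z σ : Type*} [TopologicalSpace Z] [Finite σ] {K : Set Z}
    (hK : IsCompact K) {G : Z → Matrix ι ι ℂ} (hG : ContinuousOn G K) (u : σ → ι → ℂ) :
    ∃ S : ℝ, 1 ≤ S ∧ ∀ z ∈ K, ∀ s, (pairing (G z) (u s) (u s)).re ≤ S ^ 2 := by
  have := Fintype.ofFinite σ
  have h1 : ∀ s, ∃ C : ℝ, ∀ z ∈ K, ‖(pairing (G z) (u s) (u s)).re‖ ≤ C := fun s =>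
    hK.exists_bound_of_continuousOn (continuousOn_re_pairing hG continuousOn_const)
  choose C hC using h1
  have h0 : 0 ≤ ∑ s, |C s| := Finset.sum_nonneg fun _ _ => abs_nonneg _
  refine ⟨1 + ∑ s, |C s|, by linarith, fun z hz s => ?_⟩
  have h2 : |C s| ≤ ∑ s, |C s| :=
    Finset.single_le_sum (f := fun s => |C s|) (fun _ _ => abs_nonneg _) (Finset.mem_univ s)
  have h3 := (le_abs_self _).trans (hC s z hz)
  have h4 := le_abs_self (C s)
  nlinarith

theorem pairing_inv_smul_le (G : Matrix ι ι ℂ) (u : ι → ℂ) {S : ℝ} (hS : 0 < S)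
    (h : (pairing G u u).re ≤ S ^ 2) :
    (pairing G (((S⁻¹ : ℝ) : ℂ) • u) (((S⁻¹ : ℝ) : ℂ) • u)).re ≤ 1 := by
  rw [pairing_smul_self, inv_pow, inv_mul_le_iff₀ (by positivity), mul_one]
  exact h

theorem pairing_single (M : Matrix ι ι ℂ) (a b : ι) :
    pairing M (Pi.single a 1) (Pi.single b 1) = M a b := by
  simp [pairing, Pi.single_apply]

theorem norm_pairing_le (M : Matrix ι ι ℂ) {a b : ι → ℂ} {R L : ℝ} (ha : ‖a‖ ≤ R) (hb : ‖b‖ ≤ R)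
    (hM : ∀ i j, ‖M i j‖ ≤ L) : ‖pairing M a b‖ ≤ (Fintype.card ι : ℝ) ^ 2 * (R * L * R) := by
  have h1 : ∀ i j, ‖a i * M i j * conj (b j)‖ ≤ R * L * R := fun i j => by
    rw [norm_mul, norm_mul, RCLike.norm_conj]
    have hai := (norm_le_pi_norm a i).trans ha
    have hbj := (norm_le_pi_norm b j).trans hb
    have hL := (norm_nonneg _).trans (hM i j)
    have hR := (norm_nonneg _).trans ha
    exact mul_le_mul (mul_le_mul hai (hM i j) (norm_nonneg _) hR) hbj (norm_nonneg _)
      (mul_nonneg hR hL)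
  calc ‖pairing M a b‖ ≤ ∑ i, ∑ j, ‖a i * M i j * conj (b j)‖ :=
        (norm_sum_le _ _).trans (Finset.sum_le_sum fun i _ => norm_sum_le _ _)
    _ ≤ ∑ _i : ι, ∑ _j : ι, R * L * R :=
        Finset.sum_le_sum fun i _ => Finset.sum_le_sum fun j _ => h1 i j
    _ = _ := by simp [sq, mul_assoc]

theorem SmoothMat.continuousOn {T : (κ → ℂ) → Matrix ι ι ℂ} {U : Set (κ → ℂ)}
    (hT : SmoothMat T U) : ContinuousOn T U :=
  continuousOn_pi.2 fun a => continuousOn_pi.2 fun b => (hT a b).continuousOn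

variable {N : (κ → ℂ) → Matrix κ κ ℂ} {H : (κ → ℂ) → Matrix ι ι ℂ} {U K : Set (κ → ℂ)}

/-- Bounds of the covariant derivatives imply bounds of the derivatives. -/
theorem exists_iteratedFDeriv_bound (hU : IsOpen U) (hNs : SmoothMat N U) (hHs : SmoothMat H U)
    (hN : ∀ y ∈ U, Accretive (N y)) (hH : ∀ y ∈ U, Accretive (H y)) (hK : IsCompact K)
    (hKU : K ⊆ U) (p : ℕ) :
    ∃ C : ℝ, 0 ≤ C ∧ ∀ T, SmoothMat T U → ∀ y ∈ K, ∀ L : ℝ, 0 ≤ L →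
      (∀ j ≤ p, ∀ v : Fin j → κ → ℂ, (∀ i, (pairing (N y) (v i) (v i)).re ≤ 1) →
        ∀ a, (pairing (H y) a a).re ≤ 1 → ∀ b, (pairing (H y) b b).re ≤ 1 →
          ‖pairing (iterCov N H T j y v) a b‖ ≤ L) →
      ∀ i ≤ p, ∀ a b, ‖iteratedFDeriv ℝ i (fun z => T z a b) y‖ ≤ C * L := by
  have hNc := smoothMat_chernForm hU hNs fun y hy => (hN y hy).isUnit_det.ne_zero
  have hHc := smoothMat_chernForm hU hHs fun y hy => (hH y hy).isUnit_det.ne_zero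
  obtain ⟨C, hC0, hC⟩ := iteratedFDeriv_bound hU hNc hHc hK hKU p
  obtain ⟨S, hS1, hS⟩ := exists_pairing_le hK (hNs.continuousOn.mono hKU)
    (realBasis : κ × Bool → κ → ℂ)
  obtain ⟨R, hR1, hR⟩ := exists_pairing_le hK (hHs.continuousOn.mono hKU)
    (fun i : ι => (Pi.single i 1 : ι → ℂ))
  have hS0 : 0 < S := by linarith
  have hR0 : 0 < R := by linarith
  -- Covariant bounds concern unit arguments. Rescaling the basis vectors costs a factor S for each
  -- of at most p tangent slots and a factor R for each of the two bundle slots.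
  refine ⟨C * (S ^ p * R ^ 2), by positivity, fun T hT y hy L hL hb i hi a b => ?_⟩
  rw [mul_assoc]
  refine hC T hT y hy (S ^ p * R ^ 2 * L) (by positivity) (fun j hj r a b => ?_) i hi a b
  have hml := (iterCov_structure hU hNc hHc j).2 T hT y (hKU hy)
  have h1 := hb j hj (fun i => ((S⁻¹ : ℝ) : ℂ) • realBasis (r i))
    (fun i => pairing_inv_smul_le _ _ hS0 (hS y hy (r i)))
    (((R⁻¹ : ℝ) : ℂ) • Pi.single a 1) (pairing_inv_smul_le _ _ hR0 (hR y hy a))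
    (((R⁻¹ : ℝ) : ℂ) • Pi.single b 1) (pairing_inv_smul_le _ _ hR0 (hR y hy b))
  have h2 := (hml.toMultilinearMap a b).map_smul_univ (fun _ => S⁻¹) fun i => realBasis (r i)
  have h3 : iterCov N H T j y (fun i => ((S⁻¹ : ℝ) : ℂ) • realBasis (r i)) a b =
      ((S⁻¹ ^ j : ℝ) : ℂ) * iterCov N H T j y (fun i => realBasis (r i)) a b := by
    simp only [Finset.prod_const, Finset.card_univ, Fintype.card_fin] at h2
    rw [← Complex.real_smul]
    exact h2
  rw [pairing_smul, pairing_single, h3, norm_mul, norm_mul, norm_mul, RCLike.norm_conj,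
    Complex.norm_real, Complex.norm_real, Real.norm_of_nonneg (by positivity),
    Real.norm_of_nonneg (by positivity)] at h1
  set A := ‖iterCov N H T j y (fun i => realBasis (r i)) a b‖
  have h4 : A ≤ S ^ j * R ^ 2 * L := by
    calc A = S ^ j * R ^ 2 * (R⁻¹ * R⁻¹ * (S⁻¹ ^ j * A)) := by
          rw [inv_pow]; field_simp
      _ ≤ _ := mul_le_mul_of_nonneg_left h1 (by positivity)
  refine h4.trans ?_
  gcongr

/-- Bounds of the derivatives imply bounds of the covariant derivatives. -/
theorem exists_pairing_iterCov_bound (hU : IsOpen U) (hNs : SmoothMat N U) (hHs : SmoothMat H U)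
    (hN : ∀ y ∈ U, Accretive (N y)) (hH : ∀ y ∈ U, Accretive (H y)) (hK : IsCompact K)
    (hKU : K ⊆ U) (p : ℕ) :
    ∃ C : ℝ, 0 ≤ C ∧ ∀ T, SmoothMat T U → ∀ y ∈ K, ∀ L : ℝ, 0 ≤ L →
      (∀ i ≤ p, ∀ a b, ‖iteratedFDeriv ℝ i (fun z => T z a b) y‖ ≤ L) →
      ∀ j ≤ p, ∀ v : Fin j → κ → ℂ, (∀ i, (pairing (N y) (v i) (v i)).re ≤ 1) →
        ∀ a, (pairing (H y) a a).re ≤ 1 → ∀ b, (pairing (H y) b b).re ≤ 1 →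
          ‖pairing (iterCov N H T j y v) a b‖ ≤ C * L := by
  have hNc := smoothMat_chernForm hU hNs fun y hy => (hN y hy).isUnit_det.ne_zero
  have hHc := smoothMat_chernForm hU hHs fun y hy => (hH y hy).isUnit_det.ne_zero
  obtain ⟨C, hC0, hC⟩ := iterCov_bound hU hNc hHc hK hKU p
  obtain ⟨S, hS0, hS⟩ := exists_norm_le_of_accretive hK (hNs.continuousOn.mono hKU)
    fun y hy => hN y (hKU hy)
  obtain ⟨R, hR0, hR⟩ := exists_norm_le_of_accretive hK (hHs.continuousOn.mono hKU)
    fun y hy => hH y (hKU hy)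
  -- Conversely, unit arguments have coordinates of size at most S and R, by positivity of the
  -- background metrics over the compact set.
  refine ⟨(Fintype.card ι : ℝ) ^ 2 * (R * (C * (1 + S) ^ p) * R), by positivity,
    fun T hT y hy L hL hb j hj v hv a ha b hb' => ?_⟩
  have h1 : ∀ e f, ‖iterCov N H T j y v e f‖ ≤ C * L * (1 + S) ^ p := fun e f => by
    refine (hC T hT y hy L hL hb j hj v e f).trans ?_
    refine mul_le_mul_of_nonneg_left ?_ (by positivity)
    calc ∏ i, ‖v i‖ ≤ ∏ _i : Fin j, (1 + S) := Finset.prod_le_prod (fun _ _ => norm_nonneg _)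
          fun i _ => (hS y hy _ (hv i)).trans (by linarith)
      _ = (1 + S) ^ j := by simp
      _ ≤ (1 + S) ^ p := pow_le_pow_right₀ (by linarith) hj
  refine (norm_pairing_le _ (hR y hy a ha) (hR y hy b hb') h1).trans (le_of_eq ?_)
  ring

end Comparison

/-! ### The uniform estimate over X -/

section Estimate

variable {m n d : ℕ} {X : Type*} [TopologicalSpace X] [ChartedSpace (Fin m → ℂ) X]
  [IsManifold 𝓘(ℂ, Fin m → ℂ) ω X]

section CpNorm

variable {V : X → Type*} {ι : Type*} [Fintype ι] [DecidableEq ι]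

/-- The bound `C` for the covariant derivatives up to order `p`, in the chart and the frame labelled
by `x₀`, at the point with coordinates `y`. -/
def CovBound (fr : Frames m X V ι) (ν : KahlerForm m X) (H T : ∀ x, V x → V x → ℂ) (p : ℕ) (C : ℝ)
    (x₀ : X) (y : Fin m → ℂ) : Prop :=
  ∀ j ≤ p, ∀ v : Fin j → Fin m → ℂ, (∀ i, (pairing (ν.matrix x₀ y) (v i) (v i)).re ≤ 1) →
    ∀ a, (pairing (comps fr H x₀ y) a a).re ≤ 1 → ∀ b, (pairing (comps fr H x₀ y) b b).re ≤ 1 →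
      ‖pairing (iterCov (ν.matrix x₀) (comps fr H x₀) (comps fr T x₀) j y v) a b‖ ≤ C

theorem cpNorm_le_iff (fr : Frames m X V ι) (ν : KahlerForm m X) (H T : ∀ x, V x → V x → ℂ) (p : ℕ)
    {C : ℝ} (hC : 0 ≤ C) : cpNorm fr ν H p T ≤ ENNReal.ofReal C ↔
      ∀ x₀, ∀ y ∈ fr.dom x₀, CovBound fr ν H T p C x₀ y := by
  simp only [cpNorm, iSup_le_iff, ENNReal.ofReal_le_ofReal_iff hC]
  exact ⟨fun h x₀ y hy j hj v hv a ha b hb => h j hj x₀ y hy v hv a ha b hb,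
    fun h j hj x₀ y hy v hv a ha b hb => h x₀ y hy j hj v hv a ha b hb⟩

theorem CovBound.mono {fr : Frames m X V ι} {ν : KahlerForm m X} {H T : ∀ x, V x → V x → ℂ} {p : ℕ}
    {C C' : ℝ} {x₀ : X} {y : Fin m → ℂ} (h : CovBound fr ν H T p C x₀ y) (hC : C ≤ C') :
    CovBound fr ν H T p C' x₀ y := fun j hj v hv a ha b hb => (h j hj v hv a ha b hb).trans hC

/-- Arguments of length at most 1 correspond to such arguments under the change of frame, because
the background metrics transform in the same way. Hence C is unchanged. -/
theorem CovBound.change [∀ x, AddCommGroup (V x)] [∀ x, Module ℂ (V x)] {fr : Frames m X V ι}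
    (hfr : fr.IsHolo) {ν : KahlerForm m X} {H T : ∀ x, V x →ₗ[ℂ] V x →ₛₗ[starRingEnd ℂ] ℂ}
    (hH : ∀ x, IsHermInner (H x)) (hHs : IsSmoothForm fr fun x s t => H x s t)
    (hTs : IsSmoothForm fr fun x s t => T x s t) {p : ℕ} {C : ℝ} {x₀ x₀' : X} {y : Fin m → ℂ}
    (hy : y ∈ fr.overlap x₀ x₀') (h : CovBound fr ν (fun x s t => H x s t) (fun x s t => T x s t) p C
      x₀ (coordChange x₀ x₀' y)) :
    CovBound fr ν (fun x s t => H x s t) (fun x s t => T x s t) p C x₀' y := by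
  obtain ⟨g, G, h1, h2, h3⟩ := hfr.pairing_iterCov_change ν hH hHs hTs hy
  intro j hj v hv a ha b hb
  rw [h3]
  refine h j hj _ (fun i => ?_) _ ?_ _ ?_
  · rw [← h1]; exact hv i
  · rw [← h2]; exact ha
  · rw [← h2]; exact hb

end CpNorm

variable {E : X → Type*} [∀ x, AddCommGroup (E x)] [∀ x, Module ℂ (E x)]
  [∀ x, TopologicalSpace (E x)] [TopologicalSpace (TotalSpace (Fin (n + 1) → ℂ) E)]
  [FiberBundle (Fin (n + 1) → ℂ) E] [VectorBundle ℂ (Fin (n + 1) → ℂ) E]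
  [ContMDiffVectorBundle ω (Fin (n + 1) → ℂ) E 𝓘(ℂ, Fin m → ℂ)]

/-- The hypotheses on the Kähler form, the metric and the endomorphism. -/
structure Admissible (ν₀ : KahlerForm m X) (h₀ : HermitianMetric E m (n + 1)) (l l' : ℝ) (p : ℕ)
    (κ : KahlerForm m X) (h : HermitianMetric E m (n + 1))
    (Φ : ∀ x, Module.End ℂ (Sym[ℂ]^d (E x))) : Prop where
  smooth : IsSmoothEnd (symFrames E m (n + 1) d) Φ
  symm : ∀ x s t, symMetric d h x (Φ x s) t = symMetric d h x s (Φ x t)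
  kahler : ∀ x₀, ∀ y ∈ (tangentFrames m X).dom x₀, CovBound (tangentFrames m X) ν₀
    (fun x s t => ν₀.form x s t) (fun x s t => κ.form x s t) p l x₀ y
  metric : ∀ x₀, ∀ y ∈ (bundleFrames E m (n + 1)).dom x₀, CovBound (bundleFrames E m (n + 1)) ν₀
    (fun x s t => h₀.form x s t) (fun x s t => h.form x s t) (p + 2) l x₀ y
  endo : ∀ x₀, ∀ y ∈ (symFrames E m (n + 1) d).dom x₀, CovBound (symFrames E m (n + 1) d) ν₀
    (symMetric d h₀) (symMetricEnd h₀ Φ) (p + 2) l x₀ y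
  lower : ∀ x s, l' * (h₀.form x s s).re ≤ (h.form x s s).re
  volume : ∀ x, l' ≤ volRatio κ ν₀ x

/-- A bound for the push-forward metrics of all admissible data over a subset `S` of `X`. -/
def PushBound (ν₀ : KahlerForm m X) (h₀ : HermitianMetric E m (n + 1)) (d : ℕ) (l l' : ℝ) (p : ℕ)
    (C : ℝ) (k₀ : ℕ) (S : Set X) : Prop :=
  ∀ (κ : KahlerForm m X) (h : HermitianMetric E m (n + 1))
    (Φ : ∀ x, Module.End ℂ (Sym[ℂ]^d (E x))), Admissible ν₀ h₀ l l' p κ h Φ → ∀ k : ℕ, k₀ ≤ k →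
    (∀ x ∈ S, IsHermInner (twistedForm h Φ k x)) ∧
    ((∀ x, IsHermInner (twistedForm h Φ k x)) → ∀ x₀, ∀ y ∈ (symFrames E m (n + 1) d).dom x₀,
      (chartAt (Fin m → ℂ) x₀).symm y ∈ S → CovBound (symFrames E m (n + 1) d) ν₀
        (symMetric d h₀) (pushMetric κ h Φ k) p C x₀ y)

theorem exists_det_lower_bound (ν : KahlerForm m X) {x₁ : X} {K : Set (Fin m → ℂ)}
    (hK : IsCompact K) (hKU : K ⊆ (tangentFrames m X).dom x₁) :
    ∃ c : ℝ, 0 < c ∧ ∀ y ∈ K, c ≤ ‖(ν.matrix x₁ y).det‖ := by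
  have hcont : ContinuousOn (fun y => ‖(ν.matrix x₁ y).det‖) K :=
    ((contDiffOn_det (ν.smoothMat x₁)).continuousOn.mono hKU).norm
  rcases K.eq_empty_or_nonempty with rfl | hne
  · exact ⟨1, one_pos, by simp⟩
  obtain ⟨z, hz, hmin⟩ := hK.exists_isMinOn hne hcont
  exact ⟨_, norm_pos_iff.2 (ν.accretive (hKU hz)).isUnit_det.ne_zero, fun y hy => hmin hy⟩

/-- The local estimate. -/
theorem exists_pushBound_nhds (hd : d ≠ 0) (ν₀ : KahlerForm m X) (h₀ : HermitianMetric E m (n + 1))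
    {l l' : ℝ} (hl : 0 < l) (hl' : 0 < l') (p : ℕ) (x₁ : X) :
    ∃ V ∈ nhds x₁, ∃ (C : ℝ) (k₀ : ℕ), 0 ≤ C ∧ k₀ ≠ 0 ∧ PushBound ν₀ h₀ d l l' p C k₀ V := by
  set fr := symFrames E m (n + 1) d with hfrdef
  have hfr : fr.IsHolo := isHolo_symFrames
  set U := fr.dom x₁ with hUdef
  have hU : IsOpen U := hfr.isOpen_dom x₁
  have hUt : U ⊆ (tangentFrames m X).dom x₁ := hfr.dom_subset_tangent x₁
  obtain ⟨K, hK, hxK, hKU⟩ := exists_compact_subset hU (hfr.mem_dom x₁)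
  have hKt := hKU.trans hUt
  have hNs : SmoothMat (ν₀.matrix x₁) U := fun a b => (ν₀.smoothMat x₁ a b).mono hUt
  have hNa : ∀ y ∈ U, Accretive (ν₀.matrix x₁ y) := fun y hy => ν₀.accretive (hUt hy)
  have hSs : SmoothMat (comps fr (symMetric d h₀) x₁) U := isSmoothForm_symMetric h₀ x₁
  have hSa : ∀ y ∈ U, Accretive (comps fr (symMetric d h₀) x₁ y) := fun y hy => by
    rw [comps_symMetric]
    exact accretive_symGram (h₀.isHermitian_matrix x₁ y) (h₀.accretive_matrix hy)
  obtain ⟨C₁, hC₁, hB₁⟩ := exists_iteratedFDeriv_bound hU hNs hNs hNa hNa hK hKU p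
  obtain ⟨C₂, hC₂, hB₂⟩ := exists_iteratedFDeriv_bound hU hNs (h₀.smooth x₁) hNa
    (fun y hy => h₀.accretive_matrix hy) hK hKU (p + 2)
  obtain ⟨C₃, hC₃, hB₃⟩ := exists_iteratedFDeriv_bound hU hNs hSs hNa hSa hK hKU (p + 2)
  obtain ⟨C₄, hC₄, hB₄⟩ := exists_pairing_iterCov_bound hU hNs hSs hNa hSa hK hKU p
  obtain ⟨c, hc, hdet⟩ := exists_det_lower_bound ν₀ hK hKt
  set B := C₁ * l + C₂ * l + C₃ * l with hB
  have hB0 : 0 ≤ B := by positivity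
  have hle₁ : C₁ * l ≤ B := by have := mul_nonneg hC₂ hl.le; have := mul_nonneg hC₃ hl.le; linarith
  have hle₂ : C₂ * l ≤ B := by have := mul_nonneg hC₁ hl.le; have := mul_nonneg hC₃ hl.le; linarith
  have hle₃ : C₃ * l ≤ B := by have := mul_nonneg hC₁ hl.le; have := mul_nonneg hC₂ hl.le; linarith
  -- The determinant of the matrix of ω has modulus at least l' c, as that of ν₀ has modulus at
  -- least c on K and the volume ratio is at least l'.
  obtain ⟨ε, C₅, hε, hC₅, hB₅⟩ := exists_local_bound (d := d) hK (A₀ := h₀.matrix x₁)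
    (fun y hy i j => (h₀.smooth x₁ i j).contDiffAt (hU.mem_nhds (hKU hy)))
    (fun y _ => h₀.isHermitian_matrix x₁ y) (fun y hy => h₀.accretive_matrix (hKU hy)) p hB0 hl'
    (mul_pos hl' hc)
  obtain ⟨k₁, hk₁⟩ := exists_nat_gt ε⁻¹
  have hV : (chartAt (Fin m → ℂ) x₁).source ∩ chartAt (Fin m → ℂ) x₁ ⁻¹' interior K ∈ nhds x₁ :=
    ((chartAt (Fin m → ℂ) x₁).isOpen_inter_preimage isOpen_interior).mem_nhds
      ⟨mem_chart_source _ x₁, hxK⟩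
  -- C₅ bounds the derivatives of the jet integral, `pushConst` normalises, and C₄ passes to
  -- covariant derivatives. The successor of k₁ excludes k = 0.
  refine ⟨_, hV, C₄ * (‖pushConst n d‖ * C₅), k₁ + 1, by positivity, by simp, ?_⟩
  intro κ h Φ hadm k hk
  have hk0 : k ≠ 0 := by omega
  have hkpos : (0 : ℝ) < k := by exact_mod_cast Nat.pos_of_ne_zero hk0
  have hkε : ((k : ℝ))⁻¹ ≤ ε := by
    have h1 : (k₁ : ℝ) ≤ k := by exact_mod_cast (by omega : k₁ ≤ k)
    exact inv_le_of_inv_le₀ hε (by linarith)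
  have key := fun y (hy : y ∈ K) => hB₅ (h.matrix x₁)
    (comps fr (symMetricEnd h₀ Φ) x₁) (κ.matrix x₁) (k : ℝ)⁻¹ y (by positivity) hkε hy
    (fun i j => (h.smooth x₁ i j).contDiffAt (hU.mem_nhds (hKU hy)))
    (fun f g => (isSmoothForm_symMetricEnd h₀ hadm.smooth x₁ f g).contDiffAt
      (hU.mem_nhds (hKU hy)))
    (fun a b => (κ.smoothMat x₁ a b).contDiffAt
      ((isHolo_tangentFrames.isOpen_dom x₁).mem_nhds (hKt hy)))
    (fun i hi a b => (hB₂ _ (h.smooth x₁) y hy l hl.le (hadm.metric x₁ y (hKU hy)) i hi a b).trans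
      hle₂)
    (fun i hi f g => (hB₃ _ (isSmoothForm_symMetricEnd h₀ hadm.smooth x₁) y hy l hl.le
      (hadm.endo x₁ y (hKU hy)) i hi f g).trans hle₃)
    (fun i hi a b => (hB₁ _ (fun a b => (κ.smoothMat x₁ a b).mono hUt) y hy l hl.le
      (hadm.kahler x₁ y (hKt hy)) i hi a b).trans hle₁)
    (h.isHermitian_matrix x₁ y)
    (fun a => by
      have h1 := hadm.lower ((chartAt (Fin m → ℂ) x₁).symm y)
        (∑ i, a i • (bundleFrames E m (n + 1)).vec x₁ ((chartAt (Fin m → ℂ) x₁).symm y) i)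
      rwa [← pairing_comps (fr := bundleFrames E m (n + 1)) (T := h.form),
        ← pairing_comps (fr := bundleFrames E m (n + 1)) (T := h₀.form)] at h1)
    (by
      have h1 := hadm.volume ((chartAt (Fin m → ℂ) x₁).symm y)
      have h2 := hdet y hy
      rw [volRatio_eq κ ν₀ (hKt hy), le_div_iff₀ (hc.trans_le h2)] at h1
      exact (mul_le_mul_of_nonneg_left h2 hl'.le).trans h1)
  have hmemK : ∀ x ∈ (chartAt (Fin m → ℂ) x₁).source ∩ chartAt (Fin m → ℂ) x₁ ⁻¹' interior K,
      chartAt (Fin m → ℂ) x₁ x ∈ K := fun x hx => interior_subset hx.2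
  constructor
  · intro x hx
    have h1 := isHermInner_twistedForm h₀ h k (hKU (hmemK x hx)) hadm.symm (key _ (hmemK x hx)).1
    rwa [(chartAt (Fin m → ℂ) x₁).left_inv hx.1] at h1
  · intro hpos x₀ y hy hyV
    obtain ⟨T, hT⟩ := exists_pushForm κ h hd hk0 hadm.smooth hpos
    have hTs := isSmoothForm_pushMetric κ h hd hk0 hadm.smooth hpos
    have hov : y ∈ fr.overlap x₁ x₀ := ⟨hy, hyV.1, hKU (hmemK _ hyV)⟩
    have hyK : coordChange x₁ x₀ y ∈ K := hmemK _ hyV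
    -- The estimate is made in the frame labelled by x₁, where the constants are under control.
    -- Tensoriality then carries it to every other frame over the same point, with the same
    -- constant.
    have hloc : CovBound fr ν₀ (symMetric d h₀) (pushMetric κ h Φ k) p
        (C₄ * (‖pushConst n d‖ * C₅)) x₁ (coordChange x₁ x₀ y) := by
      refine hB₄ _ (hTs x₁) _ hyK _ (by positivity) fun i hi f g => ?_
      have hev : (fun z => comps fr (pushMetric κ h Φ k) x₁ z f g) =ᶠ[nhds (coordChange x₁ x₀ y)]
          fun z => pushConst n d • jetIntegral f g (metricJet κ h₀ h Φ k x₁ z) := by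
        filter_upwards [hU.mem_nhds (hKU hyK)] with z hz
        exact comps_pushMetric κ h₀ h hd hk0 hadm.smooth hpos hz f g
      have hs : ContDiffAt ℝ ∞ (fun z => jetIntegral f g (metricJet κ h₀ h Φ k x₁ z))
          (coordChange x₁ x₀ y) :=
        ContDiffAt.comp (g := jetIntegral f g) _ ((contDiffOn_jetIntegral f g).contDiffAt
          (isOpen_goodJets.mem_nhds (metricJet_mem κ h₀ h (hKU hyK) hpos)))
          (contDiffAt_metricJet κ h₀ h hadm.smooth (hKU hyK) hpos)
      rw [(Filter.EventuallyEq.iteratedFDeriv ℝ hev i).self_of_nhds, iteratedFDeriv_const_smul_apply'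
        (hs.of_le (by exact_mod_cast le_top)), norm_smul]
      exact mul_le_mul_of_nonneg_left ((key _ hyK).2 f g i hi) (norm_nonneg _)
    rw [← hT] at hloc hTs ⊢
    exact CovBound.change hfr (H := fun x => symForm (h₀.form x)) h₀.isHermInner_symForm
      (isSmoothForm_symMetric h₀) hTs hov hloc

theorem PushBound.union {ν₀ : KahlerForm m X} {h₀ : HermitianMetric E m (n + 1)} {l l' : ℝ} {p : ℕ}
    {C C' : ℝ} {k₀ k₀' : ℕ} {S S' : Set X} (hS : PushBound ν₀ h₀ d l l' p C k₀ S)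
    (hS' : PushBound ν₀ h₀ d l l' p C' k₀' S') :
    PushBound ν₀ h₀ d l l' p (max C C') (max k₀ k₀') (S ∪ S') := by
  intro κ h Φ hadm k hk
  have h1 := hS κ h Φ hadm k ((le_max_left _ _).trans hk)
  have h2 := hS' κ h Φ hadm k ((le_max_right _ _).trans hk)
  exact ⟨fun x hx => hx.elim (h1.1 x) (h2.1 x), fun hpos x₀ y hy hyS => hyS.elim
    (fun hyS => (h1.2 hpos x₀ y hy hyS).mono (le_max_left _ _))
    fun hyS => (h2.2 hpos x₀ y hy hyS).mono (le_max_right _ _)⟩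

/-- Compactness induction over subsets of X. Positivity of the twisted metric is proved only over S,
while the estimate may assume it everywhere; in this form both assertions are stable under unions,
and for S = X the first supplies the assumption of the second. -/
theorem exists_pushBound [CompactSpace X] (hd : d ≠ 0) (ν₀ : KahlerForm m X)
    (h₀ : HermitianMetric E m (n + 1)) {l l' : ℝ} (hl : 0 < l) (hl' : 0 < l') (p : ℕ) :
    ∃ (C : ℝ) (k₀ : ℕ), 0 ≤ C ∧ k₀ ≠ 0 ∧ PushBound ν₀ h₀ d l l' p C k₀ Set.univ := by
  refine isCompact_univ.induction_on (p := fun S => ∃ (C : ℝ) (k₀ : ℕ), 0 ≤ C ∧ k₀ ≠ 0 ∧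
    PushBound ν₀ h₀ d l l' p C k₀ S) ?_ ?_ ?_ ?_
  · exact ⟨0, 1, le_rfl, one_ne_zero, fun κ h Φ _ k _ => by simp⟩
  · rintro S S' hSS' ⟨C, k₀, hC, hk₀, h⟩
    exact ⟨C, k₀, hC, hk₀, fun κ g Φ hadm k hk => ⟨fun x hx => (h κ g Φ hadm k hk).1 x (hSS' hx),
      fun hpos x₀ y hy hyS => (h κ g Φ hadm k hk).2 hpos x₀ y hy (hSS' hyS)⟩⟩
  · rintro S S' ⟨C, k₀, hC, hk₀, h⟩ ⟨C', k₀', hC', _, h'⟩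
    exact ⟨_, _, le_max_of_le_left hC, (lt_max_of_lt_left (Nat.pos_of_ne_zero hk₀)).ne', h.union h'⟩
  · intro x _
    obtain ⟨V, hV, h⟩ := exists_pushBound_nhds hd ν₀ h₀ hl hl' p x
    exact ⟨V, mem_nhdsWithin_of_mem_nhds hV, h⟩

end Estimate

end PushMetric

end

/-! ### The theorem -/

theorem theorem3p7 {m n d : ℕ} (hd : 0 < d)
    {X : Type*} [TopologicalSpace X] [T2Space X] [CompactSpace X]
    [ChartedSpace (Fin m → ℂ) X] [IsManifold 𝓘(ℂ, Fin m → ℂ) ω X]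
    {E : X → Type*} [∀ x, AddCommGroup (E x)] [∀ x, Module ℂ (E x)]
    [∀ x, TopologicalSpace (E x)] [TopologicalSpace (TotalSpace (Fin (n + 1) → ℂ) E)]
    [FiberBundle (Fin (n + 1) → ℂ) E] [VectorBundle ℂ (Fin (n + 1) → ℂ) E]
    [ContMDiffVectorBundle ω (Fin (n + 1) → ℂ) E 𝓘(ℂ, Fin m → ℂ)]
    (ν₀ : KahlerForm m X) (h₀ : HermitianMetric E m (n + 1))
    (l l' : ℝ) (hl : 0 < l) (hl' : 0 < l') (p : ℕ) (hp : 0 < p) :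
    ∃ C : ℝ, 0 < C ∧ ∃ k₀ : ℕ,
      ∀ (κ : KahlerForm m X) (h : HermitianMetric E m (n + 1))
        (Φ : ∀ x, Module.End ℂ (Sym[ℂ]^d (E x))),
      IsSmoothEnd (symFrames E m (n + 1) d) Φ →
      (∀ x s t, symMetric d h x (Φ x s) t = symMetric d h x s (Φ x t)) →
      cpNorm (bundleFrames (fun x : X => TangentSpace 𝓘(ℂ, Fin m → ℂ) x) m m) ν₀
        (fun x s t => ν₀.form x s t) p (fun x s t => κ.form x s t) ≤ ENNReal.ofReal l →
      cpNorm (bundleFrames E m (n + 1)) ν₀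
        (fun x s t => h₀.form x s t) (p + 2) (fun x s t => h.form x s t) ≤ ENNReal.ofReal l →
      -- `Sym^d h₀` is parallel, so `Φ` and `Sym^d h₀ (Φ ·, ·)` have the same `C^{p+2}` norm
      cpNorm (symFrames E m (n + 1) d) ν₀
        (symMetric d h₀) (p + 2) (symMetricEnd h₀ Φ) ≤ ENNReal.ofReal l →
      (∀ x s, l' * (h₀.form x s s).re ≤ (h.form x s s).re) →
      (∀ x, l' ≤ volRatio κ ν₀ x) →
      ∀ k : ℕ, k₀ ≤ k →
        (∀ x s t, Integrable (pushIntegrand κ h Φ k x x s t)) ∧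
        IsSmoothForm (symFrames E m (n + 1) d) (pushMetric κ h Φ k) ∧
        cpNorm (symFrames E m (n + 1) d) ν₀
          (symMetric d h₀) p (pushMetric κ h Φ k) ≤ ENNReal.ofReal C := by
  obtain ⟨C, k₀, hC, hk₀, hbound⟩ := exists_pushBound hd.ne' ν₀ h₀ hl hl' p
  -- C is only known to be non-negative, and the constant sought is positive.
  refine ⟨C + 1, by linarith, k₀, fun κ h Φ hΦ hsymm hκ hh hΦb hlow hvol k hk => ?_⟩
  rw [cpNorm_le_iff _ _ _ _ _ hl.le] at hκ hh hΦb
  have hb := hbound κ h Φ ⟨hΦ, hsymm, hκ, hh, hΦb, hlow, hvol⟩ k hk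
  -- For k ≥ k₀ the twisted metric is positive over all of X; convergence, smoothness and the
  -- estimate all depend on this.
  have hpos := fun x => hb.1 x (Set.mem_univ x)
  have hk0 : k ≠ 0 := by omega
  refine ⟨integrable_pushIntegrand κ h hd.ne' hk0 hΦ hpos,
    isSmoothForm_pushMetric κ h hd.ne' hk0 hΦ hpos, ?_⟩
  rw [cpNorm_le_iff _ _ _ _ _ (by linarith)]
  exact fun x₀ y hy => (hb.2 hpos x₀ y hy (Set.mem_univ _)).mono (by linarith)
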